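/- Let $V$ be a finite-dimensional complex symplectic vector space, let $\mathcal O_V$ be the Poisson algebra of formal power series on $V$ at $0$, and for $v\in V$ let $v^*\in V^*\subseteq\mathcal O_V$ be the linear function with $\{v^*,f\}=\partial_v f$. A symplectic automorphism is a $\mathbb C$-algebra automorphism of $\mathcal O_V$ preserving the Poisson bracket; it acts on operators $\mathcal O_V^{\otimes n}\to\mathcal O_V$ by conjugation. Let $\operatorname{Inv}_n(V)$ be the space of (constant-coefficient) polydifferential operators $\mathcal O_V^{\otimes n}\to\mathcal O_V$ that are invariant under all symplectic automorphisms, graded by the total order of differentiation: $\operatorname{Inv}_n(V)=\bigoplus_N \operatorname{Inv}_n(V)_N$. The group $S_{n+1}$ acts on constant-coefficient operators $P$ of degree $n$ by viewing $P$ as the distribution $\int P(f_1,\dots,f_n)f_{n+1}$ and permuting the $n+1$ functions, i.e. by permuting $\partial^{(1)},\dots,\partial^{(n+1)}$, where $\partial^{(n+1)}=-\sum_{i\le n}\partial^{(i)}$. For $0\ne v\in V$ let $\operatorname{Inv}_{k}(V)^v$ be the space of constant-coefficient polydifferential operators of degree $k$ invariant under all symplectic automorphisms $\alpha$ with $\alpha(v^*)=v^*$,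 and let $\operatorname{Inv}_{k,\ell}(V)^v$ (weight $\ell$, $\ell\ge 0$) be the subspace of those $\psi$ with $\alpha\cdot\psi=c^\ell\psi$ for all symplectic automorphisms $\alpha$ and $c\in\mathbb C$ with $\alpha(v^*)=c\,v^*$. Let $\operatorname{Inv}_{k,\ell}(V)^v_r$ be its part of order $r$. The height of an irreducible representation of $S_{N}$ is the number of cells below the top row of its Young diagram; the height $\le h$ part of a representation is the sum of its irreducible subrepresentations of height $\le h$. Proposition. Let $n\ge k\ge 0$. There are linear maps $$\iota_{k,\ell,n}=\iota^{V,v}_{k,\ell,n}:\operatorname{Inv}_{k,\ell}(V)^v\to\operatorname{Inv}_n(V)\qquad(0\neq v\in V,\ \ell\ge 0,\ k+\ell\le n),$$ natural with respect to symplectic isomorphisms of pairs $(V,v)$ (that is, Poisson isomorphisms $\mathcal O_V\to\mathcal O_{V'}$ sending $v^*$ to $v'^*$), such that: (a) for each $\ell$ with $k+\ell\le n$, $\operatorname{Inv}_{k,\ell}(V)^v$ is stable under $S_{k+1}$ and $\iota_{k,\ell,n}$ is injective and $S_{k+1}$-linear, where $S_{k+1}\subseteq S_{n-k}\times S_{k+1}\subseteq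 S_{n+1}$ permutes the last $k$ inputs and the output; (b) restriction to $(v^*)^{\otimes\ell}\otimes 1^{\otimes(n-k-\ell)}\otimes\mathcal O_V^{\otimes k}$ is a left inverse of $\iota_{k,\ell,n}$: $\ \iota_{k,\ell,n}(\psi)\bigl((v^*)^{\otimes\ell}\otimes 1^{\otimes(n-k-\ell)}\otimes g_1\otimes\cdots\otimes g_k\bigr)=\psi(g_1\otimes\cdots\otimes g_k)$; (c) for every $v\ne0$ and every $N\ge 0$, the $S_{n+1}$-linear span of the images $\iota_{k,\ell,n}\bigl(\operatorname{Inv}_{k,\ell}(V)^v_r\bigr)$, taken over all $\ell,r\ge 0$ with $k+\ell\le n$ and $r+\ell=N$, is exactly the height $\le k+1$ part of $\operatorname{Inv}_n(V)_{N}$. -/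

import Mathlib

universe u w

/-- A complex symplectic vector space, written in a linear coordinate system: the underlying
vector space is `V = (idx → ℂ)`, for a finite index set `idx` of coordinates, and `form` is an
arbitrary nondegenerate alternating bilinear form on it. -/
structure SymplecticSpace : Type (u + 1) where
  idx : Type u
  [fintypeIdx : Fintype idx]
  [decEqIdx : DecidableEq idx]
  form : LinearMap.BilinForm ℂ (idx → ℂ)
  alt : form.IsAlt
  nondeg : form.Nondegenerate

attribute [instance] SymplecticSpace.fintypeIdx SymplecticSpace.decEqIdx

namespace SymplecticSpace

/-! ### Functions, Poisson bracket, symplectic isomorphisms -/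

/-- The vectors of `V`. -/
abbrev Vec (V : SymplecticSpace.{u}) : Type u := V.idx → ℂ

/-- `𝒪_V`: formal power series (at the origin) in the linear coordinates on `V`. -/
abbrev Fun (V : SymplecticSpace.{u}) : Type u := MvPowerSeries V.idx ℂ

/-- The Poisson bracket on `𝒪_V` attached to the symplectic form. -/
noncomputable def poisson (V : SymplecticSpace.{u}) (f g : V.Fun) : V.Fun :=
  ∑ a : V.idx, ∑ b : V.idx, (LinearMap.BilinForm.toMatrix' V.form)⁻¹ a b •
    (MvPowerSeries.pderiv ℂ a f * MvPowerSeries.pderiv ℂ b g)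

/-- The linear function `v^* ∈ V^* ⊆ 𝒪_V` corresponding to `v ∈ V`, namely `x ↦ ω(v, x)`. It is
normalised by `{v^*, f} = ∂_v f`, see `poisson_dual`. -/
noncomputable def dual (V : SymplecticSpace.{u}) (v : V.Vec) : V.Fun :=
  ∑ b : V.idx, V.form v (Pi.single b 1) • (MvPowerSeries.X b : V.Fun)

/-- Formal symplectic isomorphisms, given by what they do to functions: `ℂ`-algebra isomorphisms
of the rings of formal power series that preserve the Poisson brackets. (Such an algebra
isomorphism preserves the maximal ideals, so it is a formal change of variables.) -/
def IsSymplectic {V W : SymplecticSpace.{u}} (α : V.Fun ≃ₐ[ℂ] W.Fun) : Prop :=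
  ∀ f g : V.Fun, α (V.poisson f g) = W.poisson (α f) (α g)

/-! ### Constant coefficient polydifferential operators -/

/-- The space of constant coefficient polydifferential operators of degree `n` on `V`, given by
their symbols: the variable `(i, a)` stands for `∂/∂x_a` acting on the `i`-th input. -/
abbrev Symb (V : SymplecticSpace.{u}) (n : ℕ) : Type u := MvPolynomial (Fin n × V.idx) ℂ

/-- The iterated partial derivative `∂^m = ∏_a (∂/∂x_a)^{m a}` on `𝒪_V`. -/
noncomputable def iterDeriv (V : SymplecticSpace.{u}) (m : V.idx →₀ ℕ) (f : V.Fun) : V.Fun :=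
  fun d => ((∏ a : V.idx, (d a + m a).descFactorial (m a) : ℕ) : ℂ) *
    MvPowerSeries.coeff (d + m) f

/-- The polydifferential operator `𝒪_V^{⊗ n} → 𝒪_V` with a given symbol, as a function of its
inputs `f_1, …, f_n`. The monomial with exponent `m` goes to
`f_1 ⊗ ⋯ ⊗ f_n ↦ ∂^{m_1} f_1 ⋯ ∂^{m_n} f_n`. -/
noncomputable def act (V : SymplecticSpace.{u}) (n : ℕ) :
    V.Symb n →ₗ[ℂ] ((Fin n → V.Fun) → V.Fun) :=
  (MvPolynomial.basisMonomials (Fin n × V.idx) ℂ).constr ℂ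
    (fun m f => ∏ i : Fin n, V.iterDeriv (m.curry i) (f i))

/-- `Inv_n(V)`: polydifferential operators of degree `n` that are invariant under all symplectic
automorphisms. (Invariant operators with power series coefficients automatically have constant
coefficients, and the operators in a given homogeneous order have them in any case.) -/
noncomputable def inv (V : SymplecticSpace.{u}) (n : ℕ) : Submodule ℂ (V.Symb n) where
  carrier := {p | ∀ α : V.Fun ≃ₐ[ℂ] V.Fun, IsSymplectic α →
    ∀ f : Fin n → V.Fun, α (V.act n p f) = V.act n p (fun i => α (f i))}
  add_mem' := by
    intro p q hp hq α hα f
    simp only [map_add, Pi.add_apply, hp α hα f, hq α hα f]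
  zero_mem' := by
    intro α hα f
    simp
  smul_mem' := by
    intro c p hp α hα f
    simp only [map_smul, Pi.smul_apply, hp α hα f]

/-- `Inv_k(V)^v`: constant coefficient polydifferential operators of degree `k` that are invariant
under the symplectic automorphisms fixing `v` (equivalently, fixing the linear function `v^*`). -/
noncomputable def invFix (V : SymplecticSpace.{u}) (k : ℕ) (v : V.Vec) :
    Submodule ℂ (V.Symb k) where
  carrier := {p | ∀ α : V.Fun ≃ₐ[ℂ] V.Fun, IsSymplectic α → α (V.dual v) = V.dual v →
    ∀ f : Fin k → V.Fun, α (V.act k p f) = V.act k p (fun i => α (f i))}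
  add_mem' := by
    intro p q hp hq α hα hv f
    simp only [map_add, Pi.add_apply, hp α hα hv f, hq α hα hv f]
  zero_mem' := by
    intro α hα hv f
    simp
  smul_mem' := by
    intro c p hp α hα hv f
    simp only [map_smul, Pi.smul_apply, hp α hα hv f]

/-- `Inv_{k,ℓ}(V)^v`, the weight `ℓ` part of `Inv_k(V)^v`: every symplectic automorphism `α` with
`α v = c v` sends `ψ` to `α ∘ ψ ∘ (α⁻¹)^{⊗ k} = c ^ ℓ ψ`. -/
noncomputable def invWeight (V : SymplecticSpace.{u}) (k l : ℕ) (v : V.Vec) :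
    Submodule ℂ (V.Symb k) where
  carrier := {p | p ∈ V.invFix k v ∧
    ∀ α : V.Fun ≃ₐ[ℂ] V.Fun, IsSymplectic α → ∀ c : ℂ, α (V.dual v) = c • V.dual v →
      ∀ f : Fin k → V.Fun, α (V.act k p (fun i => α.symm (f i))) = c ^ l • V.act k p f}
  add_mem' := by
    rintro p q ⟨hp0, hp⟩ ⟨hq0, hq⟩
    refine ⟨add_mem hp0 hq0, ?_⟩
    intro α hα c hv f
    simp only [map_add, Pi.add_apply, hp α hα c hv f, hq α hα c hv f, smul_add]
  zero_mem' := by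
    refine ⟨zero_mem _, ?_⟩
    intro α hα c hv f
    simp
  smul_mem' := by
    rintro a p ⟨hp0, hp⟩
    refine ⟨Submodule.smul_mem _ _ hp0, ?_⟩
    intro α hα c hv f
    simp only [map_smul, Pi.smul_apply, hp α hα c hv f]
    exact smul_comm _ _ _

/-- The operators that are homogeneous of order `r`. -/
noncomputable abbrev ofOrder (V : SymplecticSpace.{u}) (n r : ℕ) : Submodule ℂ (V.Symb n) :=
  MvPolynomial.homogeneousSubmodule (Fin n × V.idx) ℂ r

/-- `α` carries the operator with symbol `p` on `V` to the operator with symbol `q` on `W`, that is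
`q = α ∘ p ∘ (α⁻¹)^{⊗ n}`. -/
def Carries {V W : SymplecticSpace.{u}} {n : ℕ} (α : V.Fun ≃ₐ[ℂ] W.Fun)
    (p : V.Symb n) (q : W.Symb n) : Prop :=
  ∀ f : Fin n → V.Fun, α (V.act n p f) = W.act n q (fun i => α (f i))

/-! ### The action of `S_{n+1}` -/

/-- The derivative `∂/∂x_a` acting on the `j`-th of the `n + 1` functions `f_1, …, f_n, f_{n+1}`,
when an operator `P` is viewed as the distribution `∫ P(f_1, …, f_n) f_{n+1}`. The last function
belongs to the output and integration by parts turns its derivative into minus the sum of the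
derivatives of all the inputs. -/
noncomputable def slot (V : SymplecticSpace.{u}) (n : ℕ) (j : Fin (n + 1)) (a : V.idx) :
    V.Symb n :=
  Fin.lastCases (motive := fun _ => V.Symb n)
    (-∑ i : Fin n, MvPolynomial.X (i, a)) (fun i => MvPolynomial.X (i, a)) j

theorem sum_slot (V : SymplecticSpace.{u}) (n : ℕ) (a : V.idx) :
    ∑ j : Fin (n + 1), V.slot n j a = 0 := by
  rw [Fin.sum_univ_castSucc]
  simp [slot]

/-- A permutation `s` of the `n + 1` functions acts on operators of degree `n` by
`(s · P)(f_1, …, f_n) "paired with" f_{n+1} = P(f_{s 1}, …, f_{s n}) "paired with" f_{s (n+1)}`. -/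
noncomputable def permHom (V : SymplecticSpace.{u}) (n : ℕ) (s : Equiv.Perm (Fin (n + 1))) :
    V.Symb n →ₐ[ℂ] V.Symb n :=
  MvPolynomial.aeval (fun ia : Fin n × V.idx => V.slot n (s ia.1.castSucc) ia.2)

theorem permHom_slot (V : SymplecticSpace.{u}) (n : ℕ) (s : Equiv.Perm (Fin (n + 1)))
    (j : Fin (n + 1)) (a : V.idx) : V.permHom n s (V.slot n j a) = V.slot n (s j) a := by
  induction j using Fin.lastCases with
  | cast i => simp [permHom, slot]
  | last =>
    have h : ∑ i : Fin (n + 1), V.slot n (s i) a = 0 := by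
      rw [Equiv.sum_comp s (fun i => V.slot n i a)]
      exact V.sum_slot n a
    rw [Fin.sum_univ_castSucc] at h
    have h2 : V.slot n (Fin.last n) a = -∑ i : Fin n, MvPolynomial.X (i, a) := by simp [slot]
    rw [h2, map_neg, map_sum]
    simp only [permHom, MvPolynomial.aeval_X]
    exact neg_eq_of_add_eq_zero_right h

/-- The representation of `S_{n+1}` on polydifferential operators of degree `n`. -/
noncomputable def perm (V : SymplecticSpace.{u}) (n : ℕ) :
    Representation ℂ (Equiv.Perm (Fin (n + 1))) (V.Symb n) where
  toFun s := (V.permHom n s).toLinearMap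
  map_one' := by
    have h : V.permHom n 1 = AlgHom.id ℂ (V.Symb n) := by
      apply MvPolynomial.algHom_ext
      rintro ⟨i, a⟩
      simp [permHom, slot]
    rw [h]
    rfl
  map_mul' s t := by
    have h : V.permHom n (s * t) = (V.permHom n s).comp (V.permHom n t) := by
      apply MvPolynomial.algHom_ext
      rintro ⟨i, a⟩
      simp only [AlgHom.comp_apply]
      have h1 : V.permHom n t (MvPolynomial.X (i, a)) = V.slot n (t i.castSucc) a := by
        simp [permHom]
      rw [h1, permHom_slot]
      simp [permHom]
    rw [h]
    rfl

/-- The inclusion `S_{k+1} ⊆ S_{n-k} × S_{k+1} ⊆ S_{n+1}`: permutations of the last `k` inputs and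
the output. -/
def tailEmb {k n : ℕ} (h : k ≤ n) : Fin (k + 1) ↪ Fin (n + 1) where
  toFun j := ⟨(n - k) + j.1, by have := j.2; omega⟩
  inj' i j hij := by
    have := congrArg Fin.val hij
    apply Fin.ext
    simpa using this

/-- See `tailEmb`. -/
def tailPerm {k n : ℕ} (h : k ≤ n) (s : Equiv.Perm (Fin (k + 1))) : Equiv.Perm (Fin (n + 1)) :=
  s.viaFintypeEmbedding (tailEmb h)

/-- The inputs `(v^*)^{⊗ ℓ} ⊗ 1^{⊗ (n-k-ℓ)} ⊗ g_1 ⊗ ⋯ ⊗ g_k` (for `k + ℓ ≤ n`). -/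
noncomputable def plug (V : SymplecticSpace.{u}) {k n : ℕ} (h : k ≤ n) (l : ℕ) (v : V.Vec)
    (g : Fin k → V.Fun) : Fin n → V.Fun := fun i =>
  if i.1 < l then V.dual v
  else if hi : i.1 < n - k then 1
  else g ⟨i.1 - (n - k), by have := i.2; omega⟩

end SymplecticSpace

/-! ### Irreducible representations of symmetric groups and their heights -/

/-- The Young symmetrizer `∑_{p ∈ Row(T)} ∑_{q ∈ Col(T)} sgn(q) p q` of a tableau `T` (a numbering
of the cells of a Young diagram). -/
noncomputable def youngSymmetrizer {N : ℕ} {μ : YoungDiagram} (T : ↥μ.cells ≃ Fin N) :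
    MonoidAlgebra ℂ (Equiv.Perm (Fin N)) := by
  classical
  exact
    ∑ p ∈ (Finset.univ : Finset (Equiv.Perm (Fin N))).filter
        (fun p => ∀ x, (T.symm (p x)).1.1 = (T.symm x).1.1),
      ∑ q ∈ (Finset.univ : Finset (Equiv.Perm (Fin N))).filter
        (fun q => ∀ x, (T.symm (q x)).1.2 = (T.symm x).1.2),
        MonoidAlgebra.single (p * q) (((Equiv.Perm.sign q : ℤˣ) : ℤ) : ℂ)

/-- The Specht module of a tableau, the left ideal of `ℂ[S_N]` generated by its Young symmetrizer.
It is the irreducible representation of `S_N` associated with the Young diagram. -/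
noncomputable def spechtModule {N : ℕ} {μ : YoungDiagram} (T : ↥μ.cells ≃ Fin N) :
    Submodule (MonoidAlgebra ℂ (Equiv.Perm (Fin N))) (MonoidAlgebra ℂ (Equiv.Perm (Fin N))) :=
  Submodule.span _ {youngSymmetrizer T}

/-- The number of cells of a Young diagram below its top row. -/
def YoungDiagram.height (μ : YoungDiagram) : ℕ := (μ.cells.filter (fun c => 0 < c.1)).card

/-- `W` is an irreducible subrepresentation of `ρ` with associated Young diagram `μ`. -/
def IsSubrepOfShape {N : ℕ} {E : Type w} [AddCommGroup E] [Module ℂ E]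
    (ρ : Representation ℂ (Equiv.Perm (Fin N)) E) (W : Submodule ℂ E) (μ : YoungDiagram) : Prop :=
  ∃ (hW : ∀ s, ∀ x ∈ W, ρ s x ∈ W) (T : ↥μ.cells ≃ Fin N)
    (e : W ≃ₗ[ℂ] ↥((spechtModule T).restrictScalars ℂ)),
    ∀ (s : Equiv.Perm (Fin N)) (x : W),
      (e ⟨ρ s x, hW s x x.2⟩ : MonoidAlgebra ℂ (Equiv.Perm (Fin N))) =
        MonoidAlgebra.single s 1 * (e x : MonoidAlgebra ℂ (Equiv.Perm (Fin N)))

/-- The height `≤ h` part of a subspace `M` of a representation of `S_N`: the span of all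
irreducible subrepresentations of height `≤ h` that lie in `M`. -/
def heightPart {N : ℕ} {E : Type w} [AddCommGroup E] [Module ℂ E]
    (ρ : Representation ℂ (Equiv.Perm (Fin N)) E) (M : Submodule ℂ E) (h : ℕ) : Submodule ℂ E :=
  sSup {W | W ≤ M ∧ ∃ μ : YoungDiagram, μ.height ≤ h ∧ IsSubrepOfShape ρ W μ}

/-- The `G`-linear span of a set of vectors of a representation of `G`. -/
def groupSpan {G : Type*} [Group G] {E : Type w} [AddCommGroup E] [Module ℂ E]
    (ρ : Representation ℂ G E) (S : Set E) : Submodule ℂ E :=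
  Submodule.span ℂ {y | ∃ s : G, ∃ x ∈ S, y = ρ s x}

/-! ### Consistency of the conventions -/

namespace SymplecticSpace

theorem iterDeriv_zero (V : SymplecticSpace.{u}) (f : V.Fun) : V.iterDeriv 0 f = f := by
  ext d
  simp [iterDeriv, MvPowerSeries.coeff_apply]

theorem iterDeriv_add_single (V : SymplecticSpace.{u}) (m : V.idx →₀ ℕ) (a : V.idx)
    (f : V.Fun) : V.iterDeriv (m + Finsupp.single a 1) f =
      MvPowerSeries.pderiv ℂ a (V.iterDeriv m f) := by
  ext d
  rw [MvPowerSeries.coeff_pderiv]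
  simp only [iterDeriv, MvPowerSeries.coeff_apply]
  have hprod : (∏ b : V.idx, (d b + (m + (Finsupp.single a 1 : V.idx →₀ ℕ)) b).descFactorial
      ((m + (Finsupp.single a 1 : V.idx →₀ ℕ)) b)) =
      (∏ b : V.idx, ((d + (Finsupp.single a 1 : V.idx →₀ ℕ)) b + m b).descFactorial (m b)) * (d a + 1) := by
    rw [← Finset.mul_prod_erase _ _ (Finset.mem_univ a),
      ← Finset.mul_prod_erase _ (fun b => ((d + (Finsupp.single a 1 : V.idx →₀ ℕ)) b + m b).descFactorial (m b))
        (Finset.mem_univ a)]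
    have h1 : ∀ b ∈ (Finset.univ : Finset V.idx).erase a,
        (d b + (m + (Finsupp.single a 1 : V.idx →₀ ℕ)) b).descFactorial ((m + (Finsupp.single a 1 : V.idx →₀ ℕ)) b) =
        ((d + (Finsupp.single a 1 : V.idx →₀ ℕ)) b + m b).descFactorial (m b) := by
      intro b hb
      have hb' : a ≠ b := (Finset.ne_of_mem_erase hb).symm
      simp [Finsupp.single_eq_of_ne' hb']
    rw [Finset.prod_congr rfl h1]
    have h2 : (d a + (m + (Finsupp.single a 1 : V.idx →₀ ℕ)) a).descFactorial ((m + (Finsupp.single a 1 : V.idx →₀ ℕ)) a) =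
        (d a + 1) * ((d + (Finsupp.single a 1 : V.idx →₀ ℕ)) a + m a).descFactorial (m a) := by
      simp only [Finsupp.add_apply, Finsupp.single_eq_same, Nat.descFactorial_succ]
      congr 1
      · omega
      · congr 1
        omega
    rw [h2]
    ring
  rw [hprod]
  have he : d + (m + (Finsupp.single a 1 : V.idx →₀ ℕ)) = d + Finsupp.single a 1 + m := by abel
  rw [he]
  push_cast
  ring

theorem act_monomial (V : SymplecticSpace.{u}) (n : ℕ) (m : Fin n × V.idx →₀ ℕ)
    (f : Fin n → V.Fun) : V.act n (MvPolynomial.monomial m 1) f =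
      ∏ i : Fin n, V.iterDeriv (m.curry i) (f i) := by
  have h := (MvPolynomial.basisMonomials (Fin n × V.idx) ℂ).constr_basis ℂ
    (fun m (f : Fin n → V.Fun) => ∏ i : Fin n, V.iterDeriv (m.curry i) (f i)) m
  rw [MvPolynomial.coe_basisMonomials] at h
  exact congrFun h f

theorem poisson_dual (V : SymplecticSpace.{u}) (v : V.Vec) (f : V.Fun) :
    V.poisson (V.dual v) f = ∑ a : V.idx, v a • MvPowerSeries.pderiv ℂ a f := by
  set M := LinearMap.BilinForm.toMatrix' V.form with hM
  have hdet : IsUnit M.det := by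
    rw [isUnit_iff_ne_zero]
    exact LinearMap.BilinForm.nondegenerate_toMatrix'_iff.mpr V.nondeg |>.det_ne_zero
  have hrow : ∀ b, V.form v (Pi.single b 1) = (Matrix.vecMul v M) b := by
    intro b
    have hv : v = ∑ a, v a • (Pi.single a (1 : ℂ) : V.Vec) := by
      ext c
      simp [Finset.sum_apply, Pi.single_apply]
    conv_lhs => rw [hv]
    simp [Matrix.vecMul, dotProduct, hM, LinearMap.BilinForm.toMatrix'_apply]
  have hd : ∀ a, MvPowerSeries.pderiv ℂ a (V.dual v) =
      (Matrix.vecMul v M) a • (1 : V.Fun) := by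
    intro a
    simp only [dual, map_sum, hrow, Derivation.map_smul]
    rw [Finset.sum_eq_single a]
    · simp [MvPowerSeries.pderiv_X_self]
    · intro b _ hb
      rw [MvPowerSeries.pderiv_X_of_ne]
      · simp
      · exact hb
    · simp
  have hv : Matrix.vecMul (Matrix.vecMul v M) M⁻¹ = v := by
    rw [Matrix.vecMul_vecMul, Matrix.mul_nonsing_inv _ hdet, Matrix.vecMul_one]
  simp only [poisson, hd, ← hM]
  rw [Finset.sum_comm]
  apply Finset.sum_congr rfl
  intro b _
  conv_rhs => rw [← hv]
  rw [Matrix.vecMul, dotProduct, Finset.sum_smul]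
  apply Finset.sum_congr rfl
  intro a _
  rw [smul_mul_assoc, one_mul, smul_smul, mul_comm]

end SymplecticSpace

/-!
A constant coefficient operator `P` acts on exponentials `e^ν` through the values of its symbol
(`act_expo`), and exponentials span a dense subspace of the power series. All of the argument
therefore takes place on the level of the polynomial functions `symbEval P ν` of covectors `ν i`,
one for each input.

*Invariance.* Being invariant under the symplectic automorphisms that fix `v^*` means two things
(`mem_invFix_iff`): invariance under the linear ones, and commutation with the brackets with all
`e^lam` for `lam` orthogonal to `v^*`, that is, the vanishing of the variation `symbVar`. To get the
brackets, differentiate along the shears `x ↦ x + t λ(x)^d λ^♯` (`lieInv_of_commutesWith_shear`).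
Conversely, the leading term of an automorphism with trivial linear part is Hamiltonian, by the
formal Poincaré lemma, and can be removed by shears (`commutesWith_of_unipotent`).

*Restriction.* Putting multiples of `v^*` into the first `n - k` inputs of an invariant operator, and
taking the square-free coefficients, gives its restrictions `symbRestr`, which are operators in the
last `k` inputs. The coefficient of a product of `l` parameters has weight `l`.

*Uniqueness.* An invariant operator that is symmetric in the first `n - k` inputs is determined by
its restrictions (`eq_zero_of_symbRestr`): the vanishing of the variation allows to replace the
multiples of `v^*` by arbitrary covectors, one after the other.

*Existence.* Let `ψ` have weight `l`. The variation of `ψ` along `lam` is divisible by the linear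
form `{v^*, lam}`, and the quotient is an operator with one more input (`IsNext`), again invariant
under the stabilizer of `v^*`, of weight `l - 1`. After `l` steps the weight is `0`. The next operator
has weight `-1`, so it vanishes by an argument about `SL₂` (`eq_zero_of_weight`); hence the operator
of weight `0` is invariant under all symplectic automorphisms. Its coefficient along `(v^*)^{⊗ l}` is
`l! ψ`, because each step contributes the weight as a factor (`exists_invariant`). Symmetrizing over
the first `n - k` inputs yields the symmetric extension `symmExt` of `ψ`.

Uniqueness makes the symmetric extension linear and natural. Permutations of the last `k` inputs
and the output need not preserve its restrictions of order `> l` in `v^*`, but they do commute with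
the lowest restriction (`symbRestr_tailPerm`). So the average `equivExt` of the symmetric
extension over `S_{k+1}` is equivariant and still restricts to `ψ` in the lowest order. This gives
injectivity and the left inverse, since plugging in `(v^*)^{⊗ l} ⊗ 1^{⊗ (n-k-l)}` reads off the
lowest restriction (`act_plug`).

*Span of the images.* Subtracting the extension of the lowest restriction, step by step, shows that
the invariant operators that are symmetric in the first `n - k` inputs are sums of equivariant
extensions (`mem_span_equivExt`). Hence the images span the subrepresentation generated by the
`S_{n-k}`-invariants. That this is the part of height `≤ k + 1` is a general fact on representations
of `S_{n+1}` (`heightPart_eq_groupSpan`). It rests on the classical theory of Young symmetrizers: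
they generate simple left ideals, they are orthogonal for different shapes, and their translates span
the group algebra (`one_mem_span_youngSymmetrizer`), by counting conjugacy classes.
-/

/-! ### The adic filtration on formal power series -/

open MvPowerSeries in
/-- The `M`-th power of the maximal ideal: the power series without terms of degree `< M`. -/
def fil (σ : Type*) (M : ℕ) : Ideal (MvPowerSeries σ ℂ) where
  carrier := {f | ∀ d : σ →₀ ℕ, d.degree < M → coeff d f = 0}
  add_mem' := by
    intro f g hf hg d hd
    simp [hf d hd, hg d hd]
  zero_mem' := by
    intro d _
    simp
  smul_mem' := by
    classical
    intro f g hg d hd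
    rw [smul_eq_mul, coeff_mul]
    refine Finset.sum_eq_zero fun x hx => ?_
    have h := Finset.HasAntidiagonal.mem_antidiagonal.mp hx
    rw [hg x.2 ?_, mul_zero]
    refine lt_of_le_of_lt ?_ hd
    rw [← h, map_add]
    omega

section Fil

open MvPowerSeries

variable {σ τ : Type*}

theorem fil_anti {M N : ℕ} (h : M ≤ N) {f : MvPowerSeries σ ℂ} (hf : f ∈ fil σ N) :
    f ∈ fil σ M := fun d hd => hf d (lt_of_lt_of_le hd h)

theorem mem_fil_zero (f : MvPowerSeries σ ℂ) : f ∈ fil σ 0 := fun d hd => by omega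

theorem mul_mem_fil {M N : ℕ} {f g : MvPowerSeries σ ℂ} (hf : f ∈ fil σ M) (hg : g ∈ fil σ N) :
    f * g ∈ fil σ (M + N) := by
  classical
  intro d hd
  rw [coeff_mul]
  refine Finset.sum_eq_zero fun x hx => ?_
  have h := congrArg Finsupp.degree (Finset.HasAntidiagonal.mem_antidiagonal.mp hx)
  rw [map_add] at h
  by_cases h1 : x.1.degree < M
  · rw [hf _ h1, zero_mul]
  · rw [hg _ (by omega), mul_zero]

theorem pow_mem_fil {M : ℕ} {f : MvPowerSeries σ ℂ} (hf : f ∈ fil σ M) (n : ℕ) :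
    f ^ n ∈ fil σ (n * M) := by
  induction n with
  | zero => simpa using mem_fil_zero _
  | succ n ih =>
    rw [pow_succ, Nat.succ_mul]
    exact mul_mem_fil ih hf

theorem smul_mem_fil {M : ℕ} {f : MvPowerSeries σ ℂ} (c : ℂ) (hf : f ∈ fil σ M) :
    c • f ∈ fil σ M := fun d hd => by simp [hf d hd]

theorem X_mem_fil (a : σ) : (X a : MvPowerSeries σ ℂ) ∈ fil σ 1 := by
  classical
  intro d hd
  have : d = 0 := (Finsupp.degree_eq_zero_iff d).mp (by omega)
  subst this
  simp

theorem eq_of_forall_sub_mem_fil {f g : MvPowerSeries σ ℂ} (h : ∀ M, f - g ∈ fil σ M) :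
    f = g := by
  ext d
  have := h (d.degree + 1) d (Nat.lt_succ_self _)
  rwa [map_sub, sub_eq_zero] at this

theorem eq_zero_of_forall_mem_fil {f : MvPowerSeries σ ℂ} (h : ∀ M, f ∈ fil σ M) : f = 0 :=
  eq_of_forall_sub_mem_fil fun M => by simpa using h M

/-- For `M = 0` the truncated subtraction is harmless, since `fil σ 0` is everything. -/
theorem pderiv_mem_fil {M : ℕ} {f : MvPowerSeries σ ℂ} (a : σ) (hf : f ∈ fil σ M) :
    pderiv ℂ a f ∈ fil σ (M - 1) := by
  intro d hd
  rw [coeff_pderiv, hf _ (by rw [map_add]; simp; omega), zero_mul]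

theorem mem_fil_one {f : MvPowerSeries σ ℂ} : f ∈ fil σ 1 ↔ constantCoeff f = 0 := by
  constructor
  · intro h
    rw [← coeff_zero_eq_constantCoeff_apply]
    exact h 0 (by simp)
  · intro h d hd
    have : d = 0 := (Finsupp.degree_eq_zero_iff d).mp (by omega)
    subst this
    simpa using h

/-- A power series without terms of degree `≤ M` is a combination of the coordinates with
coefficients without terms of degree `< M`. -/
theorem exists_eq_sum_X_mul [Fintype σ] {M : ℕ} {f : MvPowerSeries σ ℂ}
    (hf : f ∈ fil σ (M + 1)) :
    ∃ g : σ → MvPowerSeries σ ℂ, (∀ a, g a ∈ fil σ M) ∧ f = ∑ a, X a * g a := by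
  classical
  obtain he | ⟨⟨a₀⟩⟩ := isEmpty_or_nonempty σ
  · refine ⟨fun _ => 0, fun _ => zero_mem _, ?_⟩
    ext d
    simpa [Subsingleton.elim d 0] using hf 0 (by simp)
  have hex : ∀ d : σ →₀ ℕ, ∃ a, d ≠ 0 → d a ≠ 0 := fun d => by
    by_cases hd : d = 0
    · exact ⟨a₀, fun h => absurd hd h⟩
    · obtain ⟨a, ha⟩ := Finsupp.ne_iff.mp hd
      exact ⟨a, fun _ => ha⟩
  -- `s d` is a variable dividing the monomial with exponent `d`; each monomial of `f` is divided by
  -- the variable chosen for it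
  choose s hs using hex
  obtain ⟨g, hg⟩ : ∃ g : σ → MvPowerSeries σ ℂ, ∀ a e, coeff e (g a) =
      if s (e + Finsupp.single a 1) = a then coeff (e + Finsupp.single a 1) f else 0 :=
    ⟨fun a e => if s (e + Finsupp.single a 1) = a then coeff (e + Finsupp.single a 1) f else 0,
      fun a e => rfl⟩
  refine ⟨g, ?_, ?_⟩
  · intro a d hd
    rw [hg]
    split_ifs
    · exact hf _ (by rw [map_add]; simp; omega)
    · rfl
  · ext d
    rw [map_sum]
    by_cases hd : d = 0
    · subst hd
      rw [hf 0 (by simp), Finset.sum_eq_zero]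
      intro a _
      simp
    · have key : ∀ a, coeff d (X a * g a) = if s d = a then coeff d f else 0 := by
        intro a
        change coeff d (monomial (Finsupp.single a 1) 1 * g a) = _
        rw [coeff_monomial_mul]
        by_cases ha : d a = 0
        · have : s d ≠ a := fun h => hs d hd (h ▸ ha)
          rw [if_neg this, if_neg]
          intro h
          have := h a
          simp [ha] at this
        · have hle : Finsupp.single a 1 ≤ d := by
            rw [Finsupp.single_le_iff]
            omega
          rw [if_pos hle, one_mul, hg, tsub_add_cancel_of_le hle]
      rw [Finset.sum_congr rfl fun a _ => key a]
      simp

/-- Algebra homomorphisms between rings of formal power series are continuous. -/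
theorem algHom_mem_fil [Fintype σ] (φ : MvPowerSeries σ ℂ →ₐ[ℂ] MvPowerSeries τ ℂ) {M : ℕ}
    {f : MvPowerSeries σ ℂ} (hf : f ∈ fil σ M) : φ f ∈ fil τ M := by
  have h1 : ∀ f ∈ fil σ 1, φ f ∈ fil τ 1 := by
    intro f hf
    rw [mem_fil_one] at hf ⊢
    by_contra hc
    set c := constantCoeff (φ f) with hcdef
    -- `f - c` is a unit, its image is not
    have hu : IsUnit (f - algebraMap ℂ _ c) := by
      rw [isUnit_iff_constantCoeff, map_sub, hf, zero_sub, MvPowerSeries.algebraMap_apply, constantCoeff_C]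
      simpa using hc
    have hu2 := hu.map φ
    rw [map_sub, AlgHom.commutes, isUnit_iff_constantCoeff, map_sub, MvPowerSeries.algebraMap_apply,
      constantCoeff_C] at hu2
    simp [hcdef] at hu2
  induction M generalizing f with
  | zero => exact mem_fil_zero _
  | succ M ih =>
    obtain ⟨g, hg, rfl⟩ := exists_eq_sum_X_mul hf
    rw [map_sum]
    refine Submodule.sum_mem _ fun a _ => ?_
    rw [map_mul, add_comm]
    exact mul_mem_fil (h1 _ (X_mem_fil a)) (ih (hg a))

/-- The finite set of exponents of degree `< M`. -/
def expBelow (σ : Type*) [Fintype σ] [DecidableEq σ] (M : ℕ) : Finset (σ →₀ ℕ) :=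
  (Finset.range M).biUnion fun n => Finset.univ.finsuppAntidiag n

theorem mem_expBelow [Fintype σ] [DecidableEq σ] {M : ℕ} {d : σ →₀ ℕ} :
    d ∈ expBelow σ M ↔ d.degree < M := by
  simp only [expBelow, Finset.mem_biUnion, Finset.mem_range, Finset.mem_finsuppAntidiag,
    Finset.subset_univ, and_true, Finsupp.degree_eq_sum]
  exact ⟨fun ⟨n, hn, h⟩ => h ▸ hn, fun h => ⟨_, h, rfl⟩⟩

/-- Polynomials are dense. -/
theorem sub_sum_monomial_mem_fil [Fintype σ] [DecidableEq σ] (M : ℕ) (f : MvPowerSeries σ ℂ) :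
    f - ∑ d ∈ expBelow σ M, coeff d f • monomial d (1 : ℂ) ∈ fil σ M := by
  intro d hd
  rw [map_sub, map_sum, Finset.sum_eq_single d]
  · simp
  · intro e _ he
    rw [map_smul, coeff_monomial, if_neg (Ne.symm he), smul_zero]
  · intro h
    exact absurd (mem_expBelow.mpr hd) h

/-- Closedness in the adic topology. -/
def IsAdicClosed (S : Submodule ℂ (MvPowerSeries σ ℂ)) : Prop :=
  ∀ f, (∀ M, ∃ g ∈ S, f - g ∈ fil σ M) → f ∈ S

theorem isAdicClosed_ker (T : MvPowerSeries σ ℂ →ₗ[ℂ] MvPowerSeries τ ℂ)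
    (hT : ∀ M, ∃ K, ∀ f ∈ fil σ K, T f ∈ fil τ M) : IsAdicClosed (LinearMap.ker T) := by
  intro f hf
  rw [LinearMap.mem_ker]
  refine eq_zero_of_forall_mem_fil fun M => ?_
  obtain ⟨K, hK⟩ := hT M
  obtain ⟨g, hg, hfg⟩ := hf K
  have := hK _ hfg
  rwa [map_sub, LinearMap.mem_ker.mp hg, sub_zero] at this

end Fil

/-! ### Exponentials of linear functions -/

section Exponential

open MvPowerSeries

variable {σ : Type*}

/-- The linear function with coefficients `ν`. -/
noncomputable def lin [Fintype σ] (ν : σ → ℂ) : MvPowerSeries σ ℂ := ∑ a, ν a • X a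

/-- The exponential `e^ν` of the linear function with coefficients `ν`. -/
noncomputable def expo [Fintype σ] (ν : σ → ℂ) : MvPowerSeries σ ℂ :=
  fun d => ∏ a, ν a ^ d a / (d a).factorial

variable [Fintype σ]

theorem coeff_expo (ν : σ → ℂ) (d : σ →₀ ℕ) :
    coeff d (expo ν) = ∏ a, ν a ^ d a / (d a).factorial := rfl

theorem lin_mem_fil (ν : σ → ℂ) : lin ν ∈ fil σ 1 :=
  Submodule.sum_mem _ fun a _ => smul_mem_fil _ (X_mem_fil a)

theorem pderiv_lin (ν : σ → ℂ) (a : σ) : pderiv ℂ a (lin ν) = C (ν a) := by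
  classical
  simp only [lin, map_sum, Derivation.map_smul, pderiv_X]
  rw [Finset.sum_eq_single a]
  · simp [smul_eq_C_mul]
  · intro b _ hb
    simp [hb]
  · simp

@[simp]
theorem constantCoeff_expo (ν : σ → ℂ) : constantCoeff (expo ν) = 1 := by
  rw [← coeff_zero_eq_constantCoeff_apply, coeff_expo]
  simp

theorem pderiv_expo (ν : σ → ℂ) (a : σ) : pderiv ℂ a (expo ν) = ν a • expo ν := by
  classical
  ext d
  rw [coeff_pderiv, map_smul, coeff_expo, coeff_expo, ← Finset.mul_prod_erase _ _ (Finset.mem_univ a),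
    ← Finset.mul_prod_erase _ (fun b => ν b ^ d b / ((d b).factorial : ℂ)) (Finset.mem_univ a)]
  have h1 : ∀ b ∈ (Finset.univ : Finset σ).erase a,
      ν b ^ (d + Finsupp.single a 1 : σ →₀ ℕ) b /
        (((d + Finsupp.single a 1 : σ →₀ ℕ) b).factorial : ℂ) =
      ν b ^ d b / ((d b).factorial : ℂ) := by
    intro b hb
    have hb' : a ≠ b := (Finset.ne_of_mem_erase hb).symm
    simp [Finsupp.single_eq_of_ne' hb']
  rw [Finset.prod_congr rfl h1]
  have h2 : ((d a).factorial : ℂ) ≠ 0 := Nat.cast_ne_zero.mpr (Nat.factorial_ne_zero _)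
  have h3 : ((d a : ℂ) + 1) ≠ 0 := Nat.cast_add_one_ne_zero _
  simp only [Finsupp.add_apply, Finsupp.single_eq_same, Nat.factorial_succ, pow_succ, smul_eq_mul]
  push_cast
  field_simp

theorem expo_zero : expo (0 : σ → ℂ) = 1 := by
  refine pderiv.ext (fun a => ?_) (by simp)
  rw [pderiv_expo, Derivation.map_one_eq_zero]
  simp

/-- The solutions of the linear first order system satisfied by `e^ν` are its multiples. -/
theorem eq_smul_expo {f : MvPowerSeries σ ℂ} {ν : σ → ℂ}
    (h : ∀ a, pderiv ℂ a f = ν a • f) : f = constantCoeff f • expo ν := by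
  rw [← sub_eq_zero]
  have h1 : ∀ a, pderiv ℂ a (f - constantCoeff f • expo ν) =
      ν a • (f - constantCoeff f • expo ν) := by
    intro a
    rw [map_sub, h, Derivation.map_smul, pderiv_expo, smul_sub, smul_comm]
  have h2 : constantCoeff (f - constantCoeff f • expo ν) = 0 := by simp
  generalize f - constantCoeff f • expo ν = g at h1 h2
  ext d
  rw [map_zero]
  induction hn : d.degree generalizing d with
  | zero =>
    have : d = 0 := (Finsupp.degree_eq_zero_iff d).mp hn
    subst this
    simpa using h2
  | succ n ih =>
    have hd : d ≠ 0 := by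
      rintro rfl
      simp at hn
    obtain ⟨a, ha⟩ := Finsupp.ne_iff.mp hd
    have hle : Finsupp.single a 1 ≤ d := by
      rw [Finsupp.single_le_iff]
      have : d a ≠ 0 := ha
      omega
    obtain ⟨e, rfl⟩ := exists_add_of_le hle
    rw [add_comm] at *
    have he := congrArg (coeff e) (h1 a)
    rw [coeff_pderiv, map_smul, ih e (by rw [map_add] at hn; simp at hn; omega), smul_zero] at he
    have h3 : ((e a : ℂ) + 1) ≠ 0 := Nat.cast_add_one_ne_zero _
    exact (mul_eq_zero.mp he).resolve_right h3

theorem expo_mul_expo (μ ν : σ → ℂ) : expo μ * expo ν = expo (μ + ν) := by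
  rw [eq_smul_expo (f := expo μ * expo ν) (ν := μ + ν)]
  · simp
  · intro a
    rw [Derivation.leibniz, pderiv_expo, pderiv_expo, Pi.add_apply, add_smul]
    simp only [smul_eq_mul, mul_smul_comm]
    rw [mul_comm (expo ν), add_comm]

theorem prod_expo {ι : Type*} (s : Finset ι) (ν : ι → σ → ℂ) :
    ∏ i ∈ s, expo (ν i) = expo (∑ i ∈ s, ν i) := by
  classical
  induction s using Finset.induction_on with
  | empty => simp [expo_zero]
  | insert i s hi ih => rw [Finset.prod_insert hi, Finset.sum_insert hi, ih, expo_mul_expo]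

theorem pderiv_lin_pow (ν : σ → ℂ) (a : σ) (N : ℕ) :
    pderiv ℂ a (((N + 1).factorial : ℂ)⁻¹ • lin ν ^ (N + 1)) =
      ν a • ((N.factorial : ℂ)⁻¹ • lin ν ^ N) := by
  rw [Derivation.map_smul, Derivation.leibniz_pow, pderiv_lin, Nat.factorial_succ]
  have h2 : (N.factorial : ℂ) ≠ 0 := Nat.cast_ne_zero.mpr (Nat.factorial_ne_zero _)
  have h3 : ((N : ℂ) + 1) ≠ 0 := Nat.cast_add_one_ne_zero _
  rw [Nat.add_sub_cancel, smul_eq_mul, mul_comm (lin ν ^ N), ← smul_eq_C_mul,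
    ← Nat.cast_smul_eq_nsmul ℂ, smul_smul, smul_smul, smul_smul]
  congr 1
  push_cast
  field_simp

/-- The homogeneous component of degree `N` of `e^ν` is `ν^N / N!`. -/
theorem coeff_inv_factorial_smul_lin_pow (ν : σ → ℂ) (N : ℕ) (d : σ →₀ ℕ) :
    coeff d ((N.factorial : ℂ)⁻¹ • lin ν ^ N) = if d.degree = N then coeff d (expo ν) else 0 := by
  induction N generalizing d with
  | zero =>
    by_cases hd : d = 0
    · subst hd
      simp
    · have : d.degree ≠ 0 := fun h => hd ((Finsupp.degree_eq_zero_iff d).mp h)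
      classical
      simp [this, coeff_one, hd]
  | succ N ih =>
    by_cases hd : d = 0
    · subst hd
      simp [lin]
    · obtain ⟨a, ha⟩ := Finsupp.ne_iff.mp hd
      have hle : Finsupp.single a 1 ≤ d := by
        rw [Finsupp.single_le_iff]
        have : d a ≠ 0 := ha
        omega
      obtain ⟨e, rfl⟩ := exists_add_of_le hle
      rw [add_comm] at *
      have he := congrArg (coeff e) (pderiv_lin_pow ν a N)
      have he2 := congrArg (coeff e) (pderiv_expo ν a)
      have h3 : ((e a : ℂ) + 1) ≠ 0 := Nat.cast_add_one_ne_zero _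
      rw [coeff_pderiv, map_smul (coeff e), ih] at he
      rw [coeff_pderiv, map_smul] at he2
      have hdeg : (e + Finsupp.single a 1).degree = e.degree + 1 := by
        rw [map_add]
        simp
      rw [hdeg]
      apply mul_right_cancel₀ h3
      rw [he]
      by_cases h4 : e.degree = N
      · rw [if_pos h4, if_pos (by omega), he2]
      · rw [if_neg h4, if_neg (by omega)]
        simp

theorem expo_sub_sum_mem_fil (ν : σ → ℂ) (M : ℕ) :
    expo ν - ∑ N ∈ Finset.range M, (N.factorial : ℂ)⁻¹ • lin ν ^ N ∈ fil σ M := by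
  intro d hd
  rw [map_sub, map_sum, Finset.sum_eq_single d.degree]
  · rw [coeff_inv_factorial_smul_lin_pow, if_pos rfl, sub_self]
  · intro N _ hN
    rw [coeff_inv_factorial_smul_lin_pow, if_neg (Ne.symm hN)]
  · intro h
    exact absurd (Finset.mem_range.mpr hd) h

end Exponential
/-! ### Divisibility by linear forms -/

section LinearForm

open MvPolynomial

variable {σ : Type*}

theorem eval_aeval {τ : Type*} (x : τ → ℂ) (g : σ → MvPolynomial τ ℂ) (F : MvPolynomial σ ℂ) :
    eval x (aeval g F) = eval (fun a => eval x (g a)) F := by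
  have h := comp_aeval_apply (aeval x : MvPolynomial τ ℂ →ₐ[ℂ] ℂ) F (f := g)
  exact h

variable [Fintype σ]

/-- A polynomial that vanishes on a hyperplane is divisible by the linear form defining it. -/
theorem linearForm_dvd_of_eval_eq_zero {c : σ → ℂ} (hc : c ≠ 0) {F : MvPolynomial σ ℂ}
    (hF : ∀ x : σ → ℂ, ∑ a, c a * x a = 0 → eval x F = 0) :
    (∑ a, C (c a) * X a) ∣ F := by
  classical
  obtain ⟨b, hb⟩ := Function.ne_iff.mp hc
  have hb : c b ≠ 0 := hb
  set ℓ : MvPolynomial σ ℂ := ∑ a, C (c a) * X a with hℓ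
  -- projection to the hyperplane along the coordinate axis `b`
  set g : σ → MvPolynomial σ ℂ := fun a => X a - C ((Pi.single b 1 : σ → ℂ) a) * (C (c b)⁻¹ * ℓ)
    with hg
  have h0 : aeval g F = 0 := by
    refine MvPolynomial.funext fun x => ?_
    rw [eval_aeval, map_zero]
    apply hF
    have h1 : ∀ a, c a * eval x (g a) =
        c a * x a - (Pi.single b 1 : σ → ℂ) a * (c a * ((c b)⁻¹ * eval x ℓ)) := by
      intro a
      simp [hg]
      ring
    rw [Finset.sum_congr rfl fun a _ => h1 a, Finset.sum_sub_distrib,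
      Finset.sum_eq_single (a := b) (f := fun a => (Pi.single b 1 : σ → ℂ) a *
        (c a * ((c b)⁻¹ * eval x ℓ)))]
    · have : eval x ℓ = ∑ a, c a * x a := by simp [hℓ]
      rw [this, Pi.single_eq_same, one_mul, mul_inv_cancel_left₀ hb, sub_self]
    · intro a _ ha
      simp [ha]
    · simp
  -- modulo `ℓ` the projection is the identity, so `F` is congruent to its value on the hyperplane
  have h1 : (Ideal.Quotient.mkₐ ℂ (Ideal.span {ℓ})).comp (aeval g) =
      Ideal.Quotient.mkₐ ℂ (Ideal.span {ℓ}) := by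
    apply algHom_ext
    intro a
    rw [AlgHom.comp_apply, aeval_X, Ideal.Quotient.mkₐ_eq_mk, Ideal.Quotient.eq,
      Ideal.mem_span_singleton]
    refine ⟨-(C ((Pi.single b 1 : σ → ℂ) a) * C (c b)⁻¹), ?_⟩
    rw [hg]
    ring
  have h2 := DFunLike.congr_fun h1 F
  rw [AlgHom.comp_apply, h0, map_zero, Ideal.Quotient.mkₐ_eq_mk, eq_comm,
    Ideal.Quotient.eq_zero_iff_mem, Ideal.mem_span_singleton] at h2
  exact h2

end LinearForm

/-! ### Density of exponentials -/

section Density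

open MvPowerSeries

variable {σ τ : Type*} [Fintype σ]

/-- The pairing of polynomials with power series in which a polynomial acts as a differential
operator, followed by evaluation at the origin. -/
noncomputable def diffPairing (h : MvPowerSeries σ ℂ) : MvPolynomial σ ℂ →ₗ[ℂ] ℂ :=
  (MvPolynomial.basisMonomials σ ℂ).constr ℂ
    (fun d => ((∏ a, (d a).factorial : ℕ) : ℂ) * coeff d h)

theorem diffPairing_monomial (h : MvPowerSeries σ ℂ) (d : σ →₀ ℕ) (c : ℂ) :
    diffPairing h (MvPolynomial.monomial d c) =
      c * (((∏ a, (d a).factorial : ℕ) : ℂ) * coeff d h) := by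
  have h1 := (MvPolynomial.basisMonomials σ ℂ).constr_basis ℂ
    (fun d => ((∏ a, (d a).factorial : ℕ) : ℂ) * coeff d h) d
  rw [MvPolynomial.coe_basisMonomials] at h1
  have h2 : MvPolynomial.monomial d c = c • MvPolynomial.monomial d (1 : ℂ) := by
    rw [MvPolynomial.smul_monomial, smul_eq_mul, mul_one]
  rw [h2, map_smul, smul_eq_mul, diffPairing, h1]

theorem diffPairing_X_mul (h : MvPowerSeries σ ℂ) (a : σ) (F : MvPolynomial σ ℂ) :
    diffPairing h (MvPolynomial.X a * F) = diffPairing (pderiv ℂ a h) F := by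
  classical
  induction F using MvPolynomial.induction_on' with
  | add p q hp hq => rw [mul_add, map_add, map_add, hp, hq]
  | monomial d c =>
    rw [MvPolynomial.X, MvPolynomial.monomial_mul, one_mul, diffPairing_monomial,
      diffPairing_monomial, coeff_pderiv, add_comm (Finsupp.single a 1)]
    have h1 : ∏ b, ((d + Finsupp.single a 1 : σ →₀ ℕ) b).factorial =
        (∏ b, (d b).factorial) * (d a + 1) := by
      rw [← Finset.mul_prod_erase _ _ (Finset.mem_univ a),
        ← Finset.mul_prod_erase _ (fun b => (d b).factorial) (Finset.mem_univ a)]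
      rw [Finset.prod_congr rfl (g := fun b => (d b).factorial)]
      · simp only [Finsupp.add_apply, Finsupp.single_eq_same, Nat.factorial_succ]
        ring
      · intro b hb
        have hb' : a ≠ b := (Finset.ne_of_mem_erase hb).symm
        simp [Finsupp.single_eq_of_ne' hb']
    rw [h1]
    push_cast
    ring

theorem diffPairing_sum_X_mul (h : MvPowerSeries σ ℂ) (v : σ → ℂ) (F : MvPolynomial σ ℂ) :
    diffPairing h ((∑ a, MvPolynomial.C (v a) * MvPolynomial.X a) * F) =
      diffPairing (∑ a, v a • pderiv ℂ a h) F := by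
  have hsum : ∀ s : Finset σ, diffPairing (∑ a ∈ s, v a • pderiv ℂ a h) F =
      ∑ a ∈ s, v a * diffPairing (pderiv ℂ a h) F := by
    intro s
    induction F using MvPolynomial.induction_on' with
    | add p q hp hq => simp only [map_add, hp, hq, mul_add, Finset.sum_add_distrib]
    | monomial d c =>
      simp only [diffPairing_monomial, map_sum, map_smul, smul_eq_mul, Finset.mul_sum]
      exact Finset.sum_congr rfl fun a _ => by ring
  rw [hsum, Finset.sum_mul, map_sum]
  refine Finset.sum_congr rfl fun a _ => ?_
  rw [mul_assoc, ← MvPolynomial.smul_eq_C_mul, map_smul, diffPairing_X_mul, smul_eq_mul]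

/-- A function that is constant in the direction `v` is approximated by combinations of the
exponentials `e^ν` with `ν(v) = 0`. The reason is that a continuous functional killing these
exponentials has a symbol divisible by the linear form `v`, so it factors through the derivative
in the direction `v`. -/
theorem mem_span_expo_sup_fil (v : σ → ℂ) {h : MvPowerSeries σ ℂ}
    (hh : ∑ a, v a • pderiv ℂ a h = 0) (M : ℕ) :
    h ∈ Submodule.span ℂ {f | ∃ ν : σ → ℂ, ∑ a, v a * ν a = 0 ∧ f = expo ν} ⊔
      (fil σ M).restrictScalars ℂ := by
  classical
  by_contra hn
  obtain ⟨L, hL, hle⟩ := Submodule.exists_le_ker_of_notMem hn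
  rw [sup_le_iff] at hle
  have hexp : ∀ f, L f = ∑ d ∈ expBelow σ M, coeff d f * L (monomial d 1) := by
    intro f
    have h1 : L (f - ∑ d ∈ expBelow σ M, coeff d f • monomial d (1 : ℂ)) = 0 :=
      hle.2 (sub_sum_monomial_mem_fil M f)
    rw [map_sub, sub_eq_zero] at h1
    rw [h1, map_sum]
    simp
  -- the symbol of the functional `L`: its value at `ν` is `L (e^ν)`
  set l : MvPolynomial σ ℂ := ∑ d ∈ expBelow σ M,
    MvPolynomial.monomial d (L (monomial d 1) / ((∏ a, (d a).factorial : ℕ) : ℂ)) with hl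
  have heval : ∀ ν : σ → ℂ, MvPolynomial.eval ν l = L (expo ν) := by
    intro ν
    rw [hl, map_sum, hexp]
    refine Finset.sum_congr rfl fun d _ => ?_
    rw [MvPolynomial.eval_monomial, coeff_expo, Finset.prod_div_distrib,
      Finsupp.prod_fintype _ _ (by simp)]
    push_cast
    ring
  have hLl : L h = diffPairing h l := by
    rw [hexp, hl, map_sum]
    refine Finset.sum_congr rfl fun d _ => ?_
    rw [diffPairing_monomial]
    have : ((∏ a, (d a).factorial : ℕ) : ℂ) ≠ 0 :=
      Nat.cast_ne_zero.mpr (Finset.prod_ne_zero_iff.mpr fun a _ => Nat.factorial_ne_zero _)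
    field_simp
  have hvan : ∀ ν : σ → ℂ, ∑ a, v a * ν a = 0 → MvPolynomial.eval ν l = 0 := fun ν hν => by
    rw [heval]
    exact hle.1 (Submodule.subset_span ⟨ν, hν, rfl⟩)
  apply hL
  rw [hLl]
  by_cases hv : v = 0
  · have : l = 0 := MvPolynomial.funext fun ν => by rw [hvan ν (by simp [hv]), map_zero]
    rw [this, map_zero]
  · obtain ⟨l', hl'⟩ := linearForm_dvd_of_eval_eq_zero hv hvan
    rw [hl', diffPairing_sum_X_mul, hh]
    have h0 : (fun d : σ →₀ ℕ => ((∏ a, (d a).factorial : ℕ) : ℂ) *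
        coeff d (0 : MvPowerSeries σ ℂ)) = 0 := by
      ext d
      simp
    rw [diffPairing, h0, map_zero, LinearMap.zero_apply]

/-- The exponentials span a dense subspace. -/
theorem eq_top_of_expo_mem {S : Submodule ℂ (MvPowerSeries σ ℂ)} (hS : IsAdicClosed S)
    (h : ∀ ν, expo ν ∈ S) : S = ⊤ := by
  rw [eq_top_iff]
  intro f _
  refine hS f fun M => ?_
  have h1 := mem_span_expo_sup_fil (0 : σ → ℂ) (h := f) (by simp) M
  obtain ⟨g, hg, r, hr, rfl⟩ := Submodule.mem_sup.mp h1
  refine ⟨g, ?_, by simpa using hr⟩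
  refine Submodule.span_le.mpr ?_ hg
  rintro _ ⟨ν, -, rfl⟩
  exact h ν

/-- The powers of linear functions span a dense subspace. -/
theorem eq_top_of_lin_pow_mem {S : Submodule ℂ (MvPowerSeries σ ℂ)} (hS : IsAdicClosed S)
    (h : ∀ ν N, lin ν ^ N ∈ S) : S = ⊤ :=
  eq_top_of_expo_mem hS fun ν => hS _ fun M =>
    ⟨_, Submodule.sum_mem _ fun N _ => Submodule.smul_mem _ _ (h ν N), expo_sub_sum_mem_fil ν M⟩

/-- A subalgebra that is closed and contains the coordinates is everything. -/
theorem subalgebra_eq_top {S : Subalgebra ℂ (MvPowerSeries σ ℂ)}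
    (hS : IsAdicClosed (Subalgebra.toSubmodule S)) (h : ∀ a, X a ∈ S) : S = ⊤ := by
  apply Subalgebra.toSubmodule_injective
  rw [Algebra.top_toSubmodule]
  refine eq_top_of_lin_pow_mem hS fun ν N => ?_
  rw [Subalgebra.mem_toSubmodule]
  exact pow_mem (sum_mem fun a _ => S.smul_mem (h a) _) N

/-- Algebra homomorphisms are automatically continuous, so they are determined by the images of the
coordinates. -/
theorem algHom_ext_X {φ ψ : MvPowerSeries σ ℂ →ₐ[ℂ] MvPowerSeries τ ℂ}
    (h : ∀ a, φ (X a) = ψ (X a)) : φ = ψ := by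
  have h1 : AlgHom.equalizer φ ψ = ⊤ := by
    refine subalgebra_eq_top ?_ h
    intro f hf
    refine eq_of_forall_sub_mem_fil fun M => ?_
    obtain ⟨g, hg, hfg⟩ := hf M
    have hg' : φ g = ψ g := hg
    have e : φ f - ψ f = φ (f - g) - ψ (f - g) := by
      rw [map_sub, map_sub, hg']
      ring
    rw [e]
    exact sub_mem (algHom_mem_fil φ hfg) (algHom_mem_fil ψ hfg)
  ext1 f
  have : f ∈ AlgHom.equalizer φ ψ := h1 ▸ Algebra.mem_top
  exact this

/-- A derivation along an algebra homomorphism that kills the coordinates is zero. -/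
theorem eq_zero_of_leibniz (φ : MvPowerSeries σ ℂ →ₐ[ℂ] MvPowerSeries τ ℂ)
    (T : MvPowerSeries σ ℂ →ₗ[ℂ] MvPowerSeries τ ℂ)
    (hT : ∀ f g, T (f * g) = φ f * T g + φ g * T f) (h : ∀ a, T (X a) = 0) : T = 0 := by
  have hcont : ∀ M f, f ∈ fil σ (M + 1) → T f ∈ fil τ M := by
    intro M
    induction M with
    | zero => exact fun f _ => mem_fil_zero _
    | succ M ih =>
      intro f hf
      obtain ⟨g, hg, rfl⟩ := exists_eq_sum_X_mul hf
      rw [map_sum]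
      refine Submodule.sum_mem _ fun a _ => ?_
      rw [hT, h, mul_zero, add_zero, add_comm M]
      exact mul_mem_fil (algHom_mem_fil φ (X_mem_fil a)) (ih _ (hg a))
  have h1 : T 1 = 0 := by
    have := hT 1 1
    simpa using this
  have hpow : ∀ ν N, T (lin ν ^ N) = 0 := by
    intro ν N
    induction N with
    | zero => simpa using h1
    | succ N ih =>
      rw [pow_succ, hT, ih, mul_zero, add_zero, lin, map_sum]
      simp [h]
  have := eq_top_of_lin_pow_mem (isAdicClosed_ker T fun M => ⟨M + 1, hcont M⟩)
    (fun ν N => LinearMap.mem_ker.mpr (hpow ν N))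
  exact LinearMap.ker_eq_top.mp this

end Density
/-! ### Symbols and their values -/

section Symbols

variable {S I : Type*}

/-- The value of a symbol at a family of covectors, one for each input. -/
noncomputable def symbEval (P : MvPolynomial (S × I) ℂ) (ν : S → I → ℂ) : ℂ :=
  MvPolynomial.eval (fun x => ν x.1 x.2) P

@[simp]
theorem symbEval_zero (ν : S → I → ℂ) : symbEval (0 : MvPolynomial (S × I) ℂ) ν = 0 := map_zero _

@[simp]
theorem symbEval_add (P Q : MvPolynomial (S × I) ℂ) (ν : S → I → ℂ) :
    symbEval (P + Q) ν = symbEval P ν + symbEval Q ν := map_add _ _ _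

@[simp]
theorem symbEval_sub (P Q : MvPolynomial (S × I) ℂ) (ν : S → I → ℂ) :
    symbEval (P - Q) ν = symbEval P ν - symbEval Q ν := map_sub _ _ _

@[simp]
theorem symbEval_mul (P Q : MvPolynomial (S × I) ℂ) (ν : S → I → ℂ) :
    symbEval (P * Q) ν = symbEval P ν * symbEval Q ν := map_mul _ _ _

@[simp]
theorem symbEval_smul (c : ℂ) (P : MvPolynomial (S × I) ℂ) (ν : S → I → ℂ) :
    symbEval (c • P) ν = c * symbEval P ν := by
  simp [symbEval]

@[simp]
theorem symbEval_C (c : ℂ) (ν : S → I → ℂ) :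
    symbEval (MvPolynomial.C c : MvPolynomial (S × I) ℂ) ν = c := by
  simp [symbEval]

@[simp]
theorem symbEval_X (x : S × I) (ν : S → I → ℂ) :
    symbEval (MvPolynomial.X x : MvPolynomial (S × I) ℂ) ν = ν x.1 x.2 := by
  simp [symbEval]

theorem symbEval_sum {T : Type*} (s : Finset T) (P : T → MvPolynomial (S × I) ℂ)
    (ν : S → I → ℂ) : symbEval (∑ t ∈ s, P t) ν = ∑ t ∈ s, symbEval (P t) ν := map_sum _ _ _

theorem symbEval_aeval {T J : Type*} (g : S × J → MvPolynomial (T × I) ℂ)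
    (P : MvPolynomial (S × J) ℂ) (ν : T → I → ℂ) :
    symbEval (MvPolynomial.aeval g P) ν = symbEval P (fun i a => symbEval (g (i, a)) ν) :=
  eval_aeval _ _ _

theorem symb_ext {P Q : MvPolynomial (S × I) ℂ} (h : ∀ ν, symbEval P ν = symbEval Q ν) :
    P = Q :=
  MvPolynomial.funext fun x => h fun i a => x (i, a)

/-- The first order variation of a symbol under the Hamiltonian vector field of the exponential
`e^lam`: it measures to what extent the operator commutes with the bracket with `e^lam`. -/
noncomputable def symbVar [Fintype S] [DecidableEq S] (B : LinearMap.BilinForm ℂ (I → ℂ))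
    (P : MvPolynomial (S × I) ℂ) (lam : I → ℂ) (ν : S → I → ℂ) : ℂ :=
  ∑ i, B lam (ν i) * (symbEval P (Function.update ν i (ν i + lam)) - symbEval P ν)

end Symbols

/-! ### Continuous multilinear maps -/

section MultilinearDensity

open MvPowerSeries

variable {σ τ S : Type*} [Fintype σ] [Fintype S] [DecidableEq S]

/-- Continuity of a multilinear map in the adic topologies. -/
def IsAdicCont (T : MultilinearMap ℂ (fun _ : S => MvPowerSeries σ ℂ) (MvPowerSeries τ ℂ)) : Prop :=
  ∀ M, ∃ K, ∀ f i, f i ∈ fil σ K → T f ∈ fil τ M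

/-- By density, a continuous multilinear map that vanishes on exponentials is zero: the inputs are
freed from being exponentials one at a time. -/
theorem multilinear_eq_zero_of_expo
    {T : MultilinearMap ℂ (fun _ : S => MvPowerSeries σ ℂ) (MvPowerSeries τ ℂ)}
    (hT : IsAdicCont T) (h : ∀ ν : S → σ → ℂ, T (fun i => expo (ν i)) = 0)
    (f : S → MvPowerSeries σ ℂ) : T f = 0 := by
  have key : ∀ (s : Finset S) (f : S → MvPowerSeries σ ℂ),
      (∀ i, i ∉ s → ∃ ν, f i = expo ν) → T f = 0 := by
    intro s
    induction s using Finset.induction_on with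
    | empty =>
      intro f hf
      choose ν hν using fun i => hf i (by simp)
      rw [show f = fun i => expo (ν i) from funext hν]
      exact h ν
    | insert i s hi ih =>
      intro f hf
      have h1 : LinearMap.ker (T.toLinearMap f i) = ⊤ := by
        refine eq_top_of_expo_mem (isAdicClosed_ker _ fun M => ?_) fun ν => ?_
        · obtain ⟨K, hK⟩ := hT M
          refine ⟨K, fun g hg => ?_⟩
          rw [MultilinearMap.toLinearMap_apply]
          exact hK _ i (by simpa using hg)
        · rw [LinearMap.mem_ker, MultilinearMap.toLinearMap_apply]
          refine ih _ fun j hj => ?_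
          by_cases hji : j = i
          · subst hji
            exact ⟨ν, by simp⟩
          · rw [Function.update_of_ne hji]
            exact hf j (by simp [hji, hj])
      have h2 : f i ∈ LinearMap.ker (T.toLinearMap f i) := h1 ▸ Submodule.mem_top
      rw [LinearMap.mem_ker, MultilinearMap.toLinearMap_apply, Function.update_eq_self] at h2
      exact h2
  exact key Finset.univ f (by simp)

/-- The commutator `D ∘ T - ∑ᵢ T ∘ Dᵢ` of a multilinear map with a linear operator. -/
noncomputable def multilinearCommutator (D : MvPowerSeries σ ℂ →ₗ[ℂ] MvPowerSeries σ ℂ)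
    (T : MultilinearMap ℂ (fun _ : S => MvPowerSeries σ ℂ) (MvPowerSeries σ ℂ)) :
    MultilinearMap ℂ (fun _ : S => MvPowerSeries σ ℂ) (MvPowerSeries σ ℂ) :=
  D.compMultilinearMap T - ∑ i, T.compLinearMap (Function.update (fun _ => LinearMap.id) i D)

omit [Fintype σ] in
theorem multilinearCommutator_apply (D : MvPowerSeries σ ℂ →ₗ[ℂ] MvPowerSeries σ ℂ)
    (T : MultilinearMap ℂ (fun _ : S => MvPowerSeries σ ℂ) (MvPowerSeries σ ℂ))
    (f : S → MvPowerSeries σ ℂ) :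
    multilinearCommutator D T f = D (T f) - ∑ i, T (Function.update f i (D (f i))) := by
  simp only [multilinearCommutator, sub_apply, sum_apply,
    LinearMap.compMultilinearMap_apply, MultilinearMap.compLinearMap_apply]
  congr 1
  refine Finset.sum_congr rfl fun i _ => congrArg T ?_
  ext1 j
  by_cases hj : j = i
  · subst hj
    simp
  · simp [hj]

omit [Fintype σ] in
theorem isAdicCont_multilinearCommutator {D : MvPowerSeries σ ℂ →ₗ[ℂ] MvPowerSeries σ ℂ}
    {T : MultilinearMap ℂ (fun _ : S => MvPowerSeries σ ℂ) (MvPowerSeries σ ℂ)}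
    (hD : ∀ M, ∀ f ∈ fil σ (M + 1), D f ∈ fil σ M) (hT : IsAdicCont T) :
    IsAdicCont (multilinearCommutator D T) := by
  intro M
  obtain ⟨K₁, h₁⟩ := hT (M + 1)
  obtain ⟨K₂, h₂⟩ := hT M
  refine ⟨K₁ + K₂ + 1, fun f i hf => ?_⟩
  rw [multilinearCommutator_apply]
  refine sub_mem (hD _ _ (h₁ f i (fil_anti (by omega) hf))) (Submodule.sum_mem _ fun j _ => ?_)
  refine h₂ _ i ?_
  by_cases hj : i = j
  · subst hj
    rw [Function.update_self]
    exact hD _ _ (fil_anti (by omega) hf)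
  · rw [Function.update_of_ne hj]
    exact fil_anti (by omega) hf

end MultilinearDensity

namespace SymplecticSpace

open MvPowerSeries

/-! ### The Poisson bracket -/

/-- The bivector of the Poisson bracket, as a bilinear form on covectors. -/
noncomputable def biv (V : SymplecticSpace.{u}) : LinearMap.BilinForm ℂ V.Vec :=
  Matrix.toBilin' (LinearMap.BilinForm.toMatrix' V.form)⁻¹

theorem biv_apply (V : SymplecticSpace.{u}) (μ ν : V.Vec) :
    V.biv μ ν = ∑ a, ∑ b, μ a * (LinearMap.BilinForm.toMatrix' V.form)⁻¹ a b * ν b := by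
  rw [biv, Matrix.toBilin'_apply]

/-- The covector `v^*`, as the tuple of its coefficients. -/
noncomputable def codual (V : SymplecticSpace.{u}) (v : V.Vec) : V.Vec :=
  fun b => V.form v (Pi.single b 1)

theorem dual_eq_lin (V : SymplecticSpace.{u}) (v : V.Vec) : V.dual v = lin (V.codual v) := rfl

theorem isUnit_det (V : SymplecticSpace.{u}) :
    IsUnit (LinearMap.BilinForm.toMatrix' V.form).det := by
  rw [isUnit_iff_ne_zero]
  exact LinearMap.BilinForm.nondegenerate_toMatrix'_iff.mpr V.nondeg |>.det_ne_zero

theorem codual_eq_vecMul (V : SymplecticSpace.{u}) (v : V.Vec) :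
    V.codual v = Matrix.vecMul v (LinearMap.BilinForm.toMatrix' V.form) := by
  ext b
  have hv : v = ∑ a, v a • (Pi.single a (1 : ℂ) : V.Vec) := by
    ext c
    simp [Finset.sum_apply, Pi.single_apply]
  conv_lhs => rw [codual, hv]
  simp [Matrix.vecMul, dotProduct, LinearMap.BilinForm.toMatrix'_apply]

theorem biv_codual (V : SymplecticSpace.{u}) (v ν : V.Vec) :
    V.biv (V.codual v) ν = ∑ a, v a * ν a := by
  have h : V.biv (V.codual v) ν = dotProduct (Matrix.vecMul (V.codual v)
      (LinearMap.BilinForm.toMatrix' V.form)⁻¹) ν := by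
    rw [biv_apply, dotProduct, Finset.sum_comm]
    refine Finset.sum_congr rfl fun b _ => ?_
    rw [Matrix.vecMul, dotProduct, Finset.sum_mul]
  rw [h, codual_eq_vecMul, Matrix.vecMul_vecMul, Matrix.mul_nonsing_inv _ V.isUnit_det,
    Matrix.vecMul_one]
  rfl

theorem exists_codual_eq (V : SymplecticSpace.{u}) (μ : V.Vec) : ∃ v, V.codual v = μ := by
  refine ⟨Matrix.vecMul μ (LinearMap.BilinForm.toMatrix' V.form)⁻¹, ?_⟩
  rw [codual_eq_vecMul, Matrix.vecMul_vecMul, Matrix.nonsing_inv_mul _ V.isUnit_det,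
    Matrix.vecMul_one]

theorem codual_injective (V : SymplecticSpace.{u}) {v w : V.Vec}
    (h : V.codual v = V.codual w) : v = w := by
  ext a
  have := V.biv_codual v (Pi.single a 1)
  rw [h, biv_codual] at this
  simpa [Pi.single_apply] using this.symm

theorem codual_ne_zero (V : SymplecticSpace.{u}) {v : V.Vec} (hv : v ≠ 0) : V.codual v ≠ 0 := by
  intro h
  apply hv
  apply V.codual_injective
  rw [h]
  ext b
  simp [codual]

theorem codual_zero (V : SymplecticSpace.{u}) : V.codual 0 = 0 := by
  ext b
  simp [codual]

theorem biv_isAlt (V : SymplecticSpace.{u}) : V.biv.IsAlt := by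
  intro μ
  obtain ⟨v, rfl⟩ := V.exists_codual_eq μ
  rw [biv_codual]
  have hv : v = ∑ a, v a • (Pi.single a (1 : ℂ) : V.Vec) := by
    ext c
    simp [Finset.sum_apply, Pi.single_apply]
  have h : V.form v (∑ a, v a • (Pi.single a (1 : ℂ) : V.Vec)) = 0 := by
    rw [← hv]
    exact V.alt v
  rw [map_sum] at h
  simp only [map_smul, smul_eq_mul] at h
  exact h

theorem biv_neg (V : SymplecticSpace.{u}) (μ ν : V.Vec) : V.biv μ ν = -V.biv ν μ :=
  (V.biv_isAlt.neg_eq ν μ).symm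

theorem exists_biv_ne_zero (V : SymplecticSpace.{u}) {μ : V.Vec} (h : μ ≠ 0) :
    ∃ ν, V.biv μ ν ≠ 0 := by
  obtain ⟨v, rfl⟩ := V.exists_codual_eq μ
  have hv : v ≠ 0 := by
    rintro rfl
    exact h V.codual_zero
  obtain ⟨a, ha⟩ := Function.ne_iff.mp hv
  refine ⟨Pi.single a 1, ?_⟩
  rw [biv_codual]
  simpa [Pi.single_apply] using ha

/-- The Hamiltonian vector field of a function. -/
noncomputable def ham (V : SymplecticSpace.{u}) (f : V.Fun) : Derivation ℂ V.Fun V.Fun :=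
  ∑ a, ∑ b, ((LinearMap.BilinForm.toMatrix' V.form)⁻¹ a b • pderiv ℂ a f) • pderiv ℂ b

theorem ham_apply (V : SymplecticSpace.{u}) (f g : V.Fun) : V.ham f g = V.poisson f g := by
  have h : ∀ {T : Type u} (s : Finset T) (D : T → Derivation ℂ V.Fun V.Fun),
      (∑ t ∈ s, D t) g = ∑ t ∈ s, D t g := by
    intro T s D
    rw [← Derivation.coeFnAddMonoidHom_apply, map_sum, Finset.sum_apply]
    rfl
  simp only [ham, poisson, h]
  refine Finset.sum_congr rfl fun a _ => Finset.sum_congr rfl fun b _ => ?_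
  rw [Derivation.smul_apply, smul_eq_mul, smul_mul_assoc]

/-- The bracket with a function, as a linear map. -/
noncomputable def poissonL (V : SymplecticSpace.{u}) (x : V.Fun) : V.Fun →ₗ[ℂ] V.Fun where
  toFun := V.poisson x
  map_add' f g := by simp only [← ham_apply, map_add]
  map_smul' c f := by simp only [← ham_apply, Derivation.map_smul, RingHom.id_apply]

theorem poisson_comm (V : SymplecticSpace.{u}) (f g : V.Fun) :
    V.poisson f g = -V.poisson g f := by
  rw [poisson, poisson, ← Finset.sum_neg_distrib, Finset.sum_comm]
  refine Finset.sum_congr rfl fun b _ => ?_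
  rw [← Finset.sum_neg_distrib]
  refine Finset.sum_congr rfl fun a _ => ?_
  have h := V.biv_neg (Pi.single a 1) (Pi.single b 1)
  rw [biv, Matrix.toBilin'_single, Matrix.toBilin'_single] at h
  rw [h, mul_comm, neg_smul]

theorem poisson_mem_fil (V : SymplecticSpace.{u}) (f : V.Fun) {M : ℕ} {g : V.Fun}
    (hg : g ∈ fil V.idx (M + 1)) : V.poisson f g ∈ fil V.idx M := by
  refine Submodule.sum_mem _ fun a _ => Submodule.sum_mem _ fun b _ => smul_mem_fil _ ?_
  exact Ideal.mul_mem_left _ _ (pderiv_mem_fil b hg)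

theorem poisson_mem_fil_add (V : SymplecticSpace.{u}) {M N : ℕ} {f g : V.Fun}
    (hf : f ∈ fil V.idx (M + 1)) (hg : g ∈ fil V.idx (N + 1)) :
    V.poisson f g ∈ fil V.idx (M + N) := by
  refine Submodule.sum_mem _ fun a _ => Submodule.sum_mem _ fun b _ => smul_mem_fil _ ?_
  exact mul_mem_fil (pderiv_mem_fil a hf) (pderiv_mem_fil b hg)

theorem poisson_expo (V : SymplecticSpace.{u}) (μ ν : V.Vec) :
    V.poisson (expo μ) (expo ν) = V.biv μ ν • expo (μ + ν) := by
  simp only [poisson, pderiv_expo, biv_apply, Finset.sum_smul, ← expo_mul_expo]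
  refine Finset.sum_congr rfl fun a _ => Finset.sum_congr rfl fun b _ => ?_
  rw [smul_mul_smul_comm, smul_smul]
  congr 1
  ring

theorem poisson_lin (V : SymplecticSpace.{u}) (μ ν : V.Vec) :
    V.poisson (lin μ) (lin ν) = C (V.biv μ ν) := by
  simp only [poisson, pderiv_lin, biv_apply, map_sum, ← map_mul, smul_eq_C_mul]
  refine Finset.sum_congr rfl fun a _ => Finset.sum_congr rfl fun b _ => ?_
  congr 1
  ring

theorem poisson_lin_expo (V : SymplecticSpace.{u}) (μ ν : V.Vec) :
    V.poisson (lin μ) (expo ν) = V.biv μ ν • expo ν := by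
  simp only [poisson, pderiv_lin, pderiv_expo, biv_apply, Finset.sum_smul, ← smul_eq_C_mul,
    smul_smul]
  refine Finset.sum_congr rfl fun a _ => Finset.sum_congr rfl fun b _ => ?_
  congr 1
  ring

/-! ### Polydifferential operators -/

/-- The iterated derivative as a linear map. -/
noncomputable def iterDerivL (V : SymplecticSpace.{u}) (m : V.idx →₀ ℕ) : V.Fun →ₗ[ℂ] V.Fun where
  toFun := V.iterDeriv m
  map_add' f g := by
    ext d
    simp only [iterDeriv, coeff_apply, map_add]
    exact mul_add _ _ _
  map_smul' c f := by
    ext d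
    simp only [iterDeriv, coeff_apply, map_smul, smul_eq_mul, RingHom.id_apply]
    exact mul_left_comm _ _ _

theorem iterDeriv_mem_fil (V : SymplecticSpace.{u}) (m : V.idx →₀ ℕ) {M : ℕ} {f : V.Fun}
    (hf : f ∈ fil V.idx (M + m.degree)) : V.iterDeriv m f ∈ fil V.idx M := by
  intro d hd
  rw [coeff_apply, iterDeriv, hf _ (by rw [map_add]; omega), mul_zero]

theorem iterDeriv_expo (V : SymplecticSpace.{u}) (m : V.idx →₀ ℕ) (ν : V.Vec) :
    V.iterDeriv m (expo ν) = (∏ a, ν a ^ m a) • expo ν := by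
  induction hn : m.degree generalizing m with
  | zero =>
    rw [(Finsupp.degree_eq_zero_iff m).mp hn, iterDeriv_zero]
    simp
  | succ n ih =>
    have hm : m ≠ 0 := by
      rintro rfl
      simp at hn
    obtain ⟨a, ha⟩ := Finsupp.ne_iff.mp hm
    have hle : Finsupp.single a 1 ≤ m := by
      rw [Finsupp.single_le_iff]
      have : m a ≠ 0 := ha
      omega
    obtain ⟨e, rfl⟩ := exists_add_of_le hle
    rw [add_comm] at *
    rw [iterDeriv_add_single, ih e (by rw [map_add] at hn; simp at hn; omega),
      Derivation.map_smul, pderiv_expo, smul_smul]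
    congr 1
    simp only [Finsupp.add_apply, pow_add, Finset.prod_mul_distrib]
    congr 1
    rw [Finset.prod_eq_single a]
    · simp
    · intro b _ hb
      simp [Finsupp.single_eq_of_ne hb]
    · simp

/-- A polydifferential operator as a multilinear map. -/
noncomputable def actM (V : SymplecticSpace.{u}) (n : ℕ) (P : V.Symb n) :
    MultilinearMap ℂ (fun _ : Fin n => V.Fun) V.Fun :=
  (MvPolynomial.basisMonomials (Fin n × V.idx) ℂ).constr ℂ
    (fun m => (MultilinearMap.mkPiAlgebra ℂ (Fin n) V.Fun).compLinearMap
      (fun i => V.iterDerivL (m.curry i))) P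

/-- Induction over symbols, from monomials with coefficient `1`. -/
theorem act_induction {V : SymplecticSpace.{u}} {n : ℕ} {motive : V.Symb n → Prop}
    (P : V.Symb n) (monomial : ∀ m, motive (MvPolynomial.monomial m 1))
    (add : ∀ P Q, motive P → motive Q → motive (P + Q))
    (smul : ∀ (c : ℂ) P, motive P → motive (c • P)) : motive P := by
  induction P using MvPolynomial.induction_on' with
  | add p q hp hq => exact add p q hp hq
  | monomial m c =>
    have : MvPolynomial.monomial m c = c • MvPolynomial.monomial m (1 : ℂ) := by
      rw [MvPolynomial.smul_monomial, smul_eq_mul, mul_one]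
    rw [this]
    exact smul c _ (monomial m)

theorem actM_apply (V : SymplecticSpace.{u}) (n : ℕ) (P : V.Symb n) (f : Fin n → V.Fun) :
    V.actM n P f = V.act n P f := by
  induction P using act_induction with
  | add P Q hP hQ => rw [map_add, Pi.add_apply, ← hP, ← hQ, actM, map_add]; rfl
  | smul c P hP => rw [map_smul, Pi.smul_apply, ← hP, actM, map_smul]; rfl
  | monomial m =>
    rw [act_monomial, actM]
    have h := (MvPolynomial.basisMonomials (Fin n × V.idx) ℂ).constr_basis ℂ
      (fun m => (MultilinearMap.mkPiAlgebra ℂ (Fin n) V.Fun).compLinearMap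
      (fun i => V.iterDerivL (m.curry i))) m
    rw [MvPolynomial.coe_basisMonomials] at h
    rw [h, MultilinearMap.compLinearMap_apply, MultilinearMap.mkPiAlgebra_apply]
    rfl

/-- An operator lowers the vanishing order at the origin by a bounded amount. -/
theorem act_mem_fil (V : SymplecticSpace.{u}) (n : ℕ) (P : V.Symb n) :
    ∃ D, ∀ M f i, f i ∈ fil V.idx (M + D) → V.act n P f ∈ fil V.idx M := by
  induction P using act_induction with
  | add P Q hP hQ =>
    obtain ⟨D₁, h₁⟩ := hP
    obtain ⟨D₂, h₂⟩ := hQ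
    refine ⟨D₁ + D₂, fun M f i hf => ?_⟩
    rw [map_add, Pi.add_apply]
    exact add_mem (h₁ M f i (fil_anti (by omega) hf)) (h₂ M f i (fil_anti (by omega) hf))
  | smul c P hP =>
    obtain ⟨D, h⟩ := hP
    refine ⟨D, fun M f i hf => ?_⟩
    rw [map_smul, Pi.smul_apply]
    exact smul_mem_fil _ (h M f i hf)
  | monomial m =>
    refine ⟨∑ i, (m.curry i).degree, fun M f i hf => ?_⟩
    rw [act_monomial, ← Finset.mul_prod_erase _ _ (Finset.mem_univ i)]
    refine Ideal.mul_mem_right _ _ (V.iterDeriv_mem_fil _ (fil_anti ?_ hf))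
    have := Finset.single_le_sum (f := fun i => (m.curry i).degree) (fun _ _ => Nat.zero_le _)
      (Finset.mem_univ i)
    omega

theorem isAdicCont_actM (V : SymplecticSpace.{u}) (n : ℕ) (P : V.Symb n) :
    IsAdicCont (V.actM n P) := by
  obtain ⟨D, h⟩ := V.act_mem_fil n P
  refine fun M => ⟨M + D, fun f i hf => ?_⟩
  rw [actM_apply]
  exact h M f i hf

/-- On exponentials an operator acts through the values of its symbol. -/
theorem act_expo (V : SymplecticSpace.{u}) (n : ℕ) (P : V.Symb n) (ν : Fin n → V.Vec) :
    V.act n P (fun i => expo (ν i)) = symbEval P ν • expo (∑ i, ν i) := by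
  induction P using act_induction with
  | add P Q hP hQ => rw [map_add, Pi.add_apply, hP, hQ, symbEval_add, add_smul]
  | smul c P hP => rw [map_smul, Pi.smul_apply, hP, symbEval_smul, smul_smul]
  | monomial m =>
    rw [act_monomial, ← prod_expo]
    simp only [iterDeriv_expo, Finset.prod_smul]
    congr 1
    rw [symbEval, MvPolynomial.eval_monomial, one_mul, Finsupp.prod_fintype _ _ (by simp),
      Fintype.prod_prod_type]
    rfl

theorem expo_ne_zero {σ : Type*} [Fintype σ] (ν : σ → ℂ) : expo ν ≠ 0 := by
  intro h
  have := constantCoeff_expo ν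
  rw [h, map_zero] at this
  exact zero_ne_one this

theorem smul_expo_inj {σ : Type*} [Fintype σ] {c d : ℂ} {ν : σ → ℂ} :
    c • expo ν = d • expo ν ↔ c = d :=
  (smul_left_injective ℂ (expo_ne_zero ν)).eq_iff

/-- The operator `P` commutes with the Hamiltonian vector field of `x`. -/
def LieInv (V : SymplecticSpace.{u}) (n : ℕ) (P : V.Symb n) (x : V.Fun) : Prop :=
  ∀ f : Fin n → V.Fun,
    V.poisson x (V.act n P f) = ∑ i, V.act n P (Function.update f i (V.poisson x (f i)))

/-- Commutation with a Hamiltonian vector field has to be checked on exponentials only. -/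
theorem lieInv_iff_expo (V : SymplecticSpace.{u}) (n : ℕ) (P : V.Symb n) (x : V.Fun) :
    V.LieInv n P x ↔ ∀ ν : Fin n → V.Vec, V.poisson x (V.act n P fun i => expo (ν i)) =
      ∑ i, V.act n P (Function.update (fun i => expo (ν i)) i (V.poisson x (expo (ν i)))) := by
  refine ⟨fun h ν => h _, fun h f => ?_⟩
  have h1 := multilinear_eq_zero_of_expo (T := multilinearCommutator (V.poissonL x)
    (V.actM n P)) (isAdicCont_multilinearCommutator (fun M f hf =>
      V.poisson_mem_fil x hf) (V.isAdicCont_actM n P)) (fun ν => by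
      rw [multilinearCommutator_apply]
      simp only [poissonL, LinearMap.coe_mk, AddHom.coe_mk, actM_apply]
      rw [h, sub_self]) f
  rw [multilinearCommutator_apply, sub_eq_zero] at h1
  simpa only [poissonL, LinearMap.coe_mk, AddHom.coe_mk, actM_apply] using h1

/-- Commutation with the bracket with `e^lam`, in terms of the values of the symbol. -/
theorem lieInv_expo_iff (V : SymplecticSpace.{u}) (n : ℕ) (P : V.Symb n) (lam : V.Vec) :
    V.LieInv n P (expo lam) ↔ ∀ ν, symbVar V.biv P lam ν = 0 := by
  rw [lieInv_iff_expo]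
  refine forall_congr' fun ν => ?_
  have h1 : ∀ i, V.act n P (Function.update (fun i => expo (ν i)) i
      (V.poisson (expo lam) (expo (ν i)))) =
      (V.biv lam (ν i) * symbEval P (Function.update ν i (ν i + lam))) •
        expo (lam + ∑ j, ν j) := by
    intro i
    rw [poisson_expo, ← actM_apply, MultilinearMap.map_update_smul, actM_apply]
    have : Function.update (fun i => expo (ν i)) i (expo (lam + ν i)) =
        fun j => expo (Function.update ν i (ν i + lam) j) := by
      ext1 j
      by_cases hj : j = i
      · subst hj
        simp [add_comm]
      · simp [hj]
    rw [this, act_expo, smul_smul, Finset.sum_update_of_mem (Finset.mem_univ i)]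
    congr 2
    rw [← Finset.add_sum_erase _ _ (Finset.mem_univ i), Finset.sdiff_singleton_eq_erase]
    abel
  rw [Finset.sum_congr rfl fun i _ => h1 i, ← Finset.sum_smul, act_expo]
  have h2 : V.poisson (expo lam) (symbEval P ν • expo (∑ i, ν i)) =
      ((∑ i, V.biv lam (ν i)) * symbEval P ν) • expo (lam + ∑ i, ν i) := by
    rw [← ham_apply, Derivation.map_smul, ham_apply, poisson_expo, smul_smul, map_sum, mul_comm]
  rw [h2, smul_expo_inj, symbVar]
  simp only [mul_sub, Finset.sum_sub_distrib, ← Finset.sum_mul]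
  rw [sub_eq_zero, eq_comm]

end SymplecticSpace
namespace SymplecticSpace

open MvPowerSeries

/-! ### Symplectic isomorphisms of rings of formal power series -/

theorem X_eq_lin {σ : Type*} [Fintype σ] [DecidableEq σ] (a : σ) :
    (X a : MvPowerSeries σ ℂ) = lin (Pi.single a 1) := by
  rw [lin, Finset.sum_eq_single a]
  · simp
  · intro b _ hb
    simp [hb]
  · simp

theorem lin_add {σ : Type*} [Fintype σ] (μ ν : σ → ℂ) : lin (μ + ν) = lin μ + lin ν := by
  simp [lin, add_smul, Finset.sum_add_distrib]

theorem lin_smul {σ : Type*} [Fintype σ] (c : ℂ) (ν : σ → ℂ) : lin (c • ν) = c • lin ν := by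
  simp [lin, mul_smul, Finset.smul_sum]

theorem poisson_mul_right (V : SymplecticSpace.{u}) (f g h : V.Fun) :
    V.poisson f (g * h) = g * V.poisson f h + h * V.poisson f g := by
  rw [← ham_apply, Derivation.leibniz, ham_apply, ham_apply, smul_eq_mul, smul_eq_mul]

theorem poisson_mul_left (V : SymplecticSpace.{u}) (f g h : V.Fun) :
    V.poisson (f * g) h = f * V.poisson g h + g * V.poisson f h := by
  rw [poisson_comm, poisson_mul_right, V.poisson_comm g, V.poisson_comm f]
  ring

theorem poisson_add_right (V : SymplecticSpace.{u}) (f g h : V.Fun) :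
    V.poisson f (g + h) = V.poisson f g + V.poisson f h := (V.poissonL f).map_add g h

theorem poisson_sub_right (V : SymplecticSpace.{u}) (f g h : V.Fun) :
    V.poisson f (g - h) = V.poisson f g - V.poisson f h := (V.poissonL f).map_sub g h

theorem poisson_smul_right (V : SymplecticSpace.{u}) (f g : V.Fun) (c : ℂ) :
    V.poisson f (c • g) = c • V.poisson f g := (V.poissonL f).map_smul c g

theorem poisson_add_left (V : SymplecticSpace.{u}) (f g h : V.Fun) :
    V.poisson (f + g) h = V.poisson f h + V.poisson g h := by
  rw [poisson_comm, poisson_add_right, V.poisson_comm f, V.poisson_comm g]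
  ring

theorem poisson_smul_left (V : SymplecticSpace.{u}) (f g : V.Fun) (c : ℂ) :
    V.poisson (c • f) g = c • V.poisson f g := by
  rw [poisson_comm, poisson_smul_right, V.poisson_comm f, smul_neg]

theorem poisson_C_right (V : SymplecticSpace.{u}) (f : V.Fun) (c : ℂ) :
    V.poisson f (C c) = 0 := by
  rw [← ham_apply]
  exact (V.ham f).map_algebraMap c

theorem poisson_C_left (V : SymplecticSpace.{u}) (f : V.Fun) (c : ℂ) :
    V.poisson (C c) f = 0 := by
  rw [poisson_comm, poisson_C_right, neg_zero]

theorem poisson_lin_pow_left (V : SymplecticSpace.{u}) (lam : V.Vec) (d : ℕ) (f : V.Fun) :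
    V.poisson (lin lam ^ (d + 1)) f = ((d : ℂ) + 1) • (lin lam ^ d * V.poisson (lin lam) f) := by
  induction d with
  | zero => simp
  | succ d ih =>
    rw [pow_succ, poisson_mul_left, ih, Nat.cast_add, Nat.cast_one]
    simp only [smul_eq_C_mul, map_add, map_one]
    ring

/-- Compatibility with the brackets has to be checked on coordinates only. -/
theorem isSymplectic_of_X {V W : SymplecticSpace.{u}} {α : V.Fun ≃ₐ[ℂ] W.Fun}
    (h : ∀ a b, α (V.poisson (X a) (X b)) = W.poisson (α (X a)) (α (X b))) :
    IsSymplectic α := by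
  let T : V.Fun → V.Fun →ₗ[ℂ] W.Fun := fun f =>
    α.toLinearMap ∘ₗ V.poissonL f - W.poissonL (α f) ∘ₗ α.toLinearMap
  have hT : ∀ f g, T f g = α (V.poisson f g) - W.poisson (α f) (α g) := fun f g => rfl
  -- the defect of compatibility is a derivation along `α` in each argument
  have hleib : ∀ f g h, T f (g * h) = α g * T f h + α h * T f g := by
    intro f g h
    simp only [hT, poisson_mul_right, map_mul, map_add]
    ring
  have hcomm : ∀ f g, T f g = - T g f := by
    intro f g
    rw [hT, hT, V.poisson_comm, W.poisson_comm, map_neg]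
    ring
  have h1 : ∀ a, T (X a) = 0 := fun a =>
    eq_zero_of_leibniz α.toAlgHom _ (hleib _) fun b => by rw [hT, h, sub_self]
  have h2 : ∀ f, T f = 0 := fun f =>
    eq_zero_of_leibniz α.toAlgHom _ (hleib _) fun b => by rw [hcomm, h1]; simp
  intro f g
  have := hT f g
  rwa [h2, LinearMap.zero_apply, eq_comm, sub_eq_zero] at this

theorem IsSymplectic.symm {V W : SymplecticSpace.{u}} {α : V.Fun ≃ₐ[ℂ] W.Fun}
    (h : IsSymplectic α) : IsSymplectic α.symm := by
  intro f g
  apply α.injective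
  rw [h, α.apply_symm_apply, α.apply_symm_apply, α.apply_symm_apply]

theorem IsSymplectic.trans {U V W : SymplecticSpace.{u}} {α : U.Fun ≃ₐ[ℂ] V.Fun}
    {β : V.Fun ≃ₐ[ℂ] W.Fun} (h : IsSymplectic α) (h' : IsSymplectic β) :
    IsSymplectic (α.trans β) := fun f g => by
  rw [AlgEquiv.trans_apply, h, h']
  rfl

theorem exists_algHom_X {σ τ : Type*} [Fintype σ] (a : σ → MvPowerSeries τ ℂ)
    (ha : ∀ i, a i ∈ fil τ 1) :
    ∃ φ : MvPowerSeries σ ℂ →ₐ[ℂ] MvPowerSeries τ ℂ, ∀ i, φ (X i) = a i := by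
  have hs : HasSubst a := hasSubst_of_constantCoeff_zero fun i => mem_fil_one.mp (ha i)
  exact ⟨substAlgHom hs, fun i => substAlgHom_X hs i⟩

/-- A symplectic change of variables, given by the images `a ν` of the linear functions `ν` under it
and `b ν` under its inverse. -/
theorem exists_isSymplectic {V W : SymplecticSpace.{u}} (a : V.Vec →ₗ[ℂ] W.Fun)
    (b : W.Vec →ₗ[ℂ] V.Fun) (ha : ∀ ν, a ν ∈ fil W.idx 1) (hb : ∀ ν, b ν ∈ fil V.idx 1)
    (hab : ∀ φ : V.Fun →ₐ[ℂ] W.Fun, (∀ ν, φ (lin ν) = a ν) → ∀ ν, φ (b ν) = lin ν)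
    (hba : ∀ φ : W.Fun →ₐ[ℂ] V.Fun, (∀ ν, φ (lin ν) = b ν) → ∀ ν, φ (a ν) = lin ν)
    (hbr : ∀ μ ν, W.poisson (a μ) (a ν) = C (V.biv μ ν)) :
    ∃ α : V.Fun ≃ₐ[ℂ] W.Fun, IsSymplectic α ∧ (∀ ν, α (lin ν) = a ν) ∧
      ∀ ν, α.symm (lin ν) = b ν := by
  have hlin : ∀ {V W : SymplecticSpace.{u}} (a : V.Vec →ₗ[ℂ] W.Fun) (φ : V.Fun →ₐ[ℂ] W.Fun),
      (∀ i, φ (X i) = a (Pi.single i 1)) → ∀ ν, φ (lin ν) = a ν := by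
    intro V W a φ h ν
    have hν : ν = ∑ i, ν i • (Pi.single i (1 : ℂ) : V.Vec) := by
      ext c
      simp [Finset.sum_apply, Pi.single_apply]
    conv_rhs => rw [hν]
    simp only [lin, map_sum, map_smul, h]
  obtain ⟨φ, hφ⟩ := exists_algHom_X (fun i => a (Pi.single i 1)) fun i => ha _
  obtain ⟨ψ, hψ⟩ := exists_algHom_X (fun i => b (Pi.single i 1)) fun i => hb _
  have hφ' := hlin a φ hφ
  have hψ' := hlin b ψ hψ
  let α : V.Fun ≃ₐ[ℂ] W.Fun := AlgEquiv.ofAlgHom φ ψ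
    (algHom_ext_X fun i => by
      rw [AlgHom.comp_apply, AlgHom.id_apply, X_eq_lin, hψ', hab φ hφ'])
    (algHom_ext_X fun i => by
      rw [AlgHom.comp_apply, AlgHom.id_apply, X_eq_lin, hφ', hba ψ hψ'])
  have hα : ∀ f, α f = φ f := fun f => rfl
  refine ⟨α, isSymplectic_of_X fun i j => ?_, fun ν => hφ' ν, fun ν => hψ' ν⟩
  rw [X_eq_lin, X_eq_lin, poisson_lin, hα, hα, hα, hφ', hφ', hbr]
  exact φ.commutes _

/-- Linear symplectic isomorphisms act on functions. -/
theorem exists_linear_isSymplectic {V W : SymplecticSpace.{u}} (A : V.Vec ≃ₗ[ℂ] W.Vec)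
    (hA : ∀ μ ν, W.biv (A μ) (A ν) = V.biv μ ν) :
    ∃ α : V.Fun ≃ₐ[ℂ] W.Fun, IsSymplectic α ∧ ∀ ν, α (lin ν) = lin (A ν) := by
  let linL : ∀ V : SymplecticSpace.{u}, V.Vec →ₗ[ℂ] V.Fun := fun V =>
    { toFun := lin, map_add' := lin_add, map_smul' := fun c ν => lin_smul c ν }
  obtain ⟨α, h1, h2, -⟩ := exists_isSymplectic (V := V) (W := W) (linL W ∘ₗ A.toLinearMap)
    (linL V ∘ₗ A.symm.toLinearMap) (fun ν => lin_mem_fil _) (fun ν => lin_mem_fil _)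
    (fun φ hφ ν => by
      have := hφ (A.symm ν)
      simpa [linL] using this)
    (fun φ hφ ν => by
      have := hφ (A ν)
      simpa [linL] using this)
    (fun μ ν => by
      have := W.poisson_lin (A μ) (A ν)
      rw [hA] at this
      exact this)
  exact ⟨α, h1, h2⟩

/-- The shears `x ↦ x + t λ(x)^d λ^♯`, the flows of the Hamiltonians `λ^{d+1} / (d+1)`. -/
theorem exists_shear (V : SymplecticSpace.{u}) (lam : V.Vec) {d : ℕ} (hd : 1 ≤ d) (t : ℂ) :
    ∃ α : V.Fun ≃ₐ[ℂ] V.Fun, IsSymplectic α ∧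
      (∀ ν, α (lin ν) = lin ν + (t * V.biv lam ν) • lin lam ^ d) ∧
      ∀ ν, α.symm (lin ν) = lin ν + (-t * V.biv lam ν) • lin lam ^ d := by
  let a : ℂ → V.Vec →ₗ[ℂ] V.Fun := fun t =>
    { toFun := fun ν => lin ν + (t * V.biv lam ν) • lin lam ^ d
      map_add' := fun μ ν => by
        rw [lin_add, map_add, mul_add, add_smul]
        abel
      map_smul' := fun c ν => by
        rw [lin_smul, map_smul, smul_eq_mul, mul_left_comm, mul_smul, RingHom.id_apply, smul_add] }
  have ha : ∀ t ν, a t ν = lin ν + (t * V.biv lam ν) • lin lam ^ d := fun t ν => rfl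
  have hfil : ∀ t ν, a t ν ∈ fil V.idx 1 := fun t ν =>
    add_mem (lin_mem_fil _) (smul_mem_fil _ (fil_anti (by omega) (pow_mem_fil (lin_mem_fil lam) d)))
  have hinv : ∀ t, ∀ φ : V.Fun →ₐ[ℂ] V.Fun, (∀ ν, φ (lin ν) = a t ν) →
      ∀ ν, φ (a (-t) ν) = lin ν := by
    intro t φ hφ ν
    have hlam : φ (lin lam) = lin lam := by
      rw [hφ, ha, V.biv_isAlt lam, mul_zero, zero_smul, add_zero]
    rw [ha, map_add, map_smul, map_pow, hlam, hφ, ha, add_assoc, ← add_smul]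
    simp
  refine exists_isSymplectic (a t) (a (-t)) (hfil t) (hfil (-t)) (hinv t)
    (fun φ hφ ν => by simpa using hinv (-t) φ hφ ν) fun μ ν => ?_
  obtain ⟨e, rfl⟩ : ∃ e, d = e + 1 := ⟨d - 1, by omega⟩
  rw [ha, ha, poisson_add_left, poisson_add_right, poisson_add_right, poisson_lin,
    poisson_smul_left, poisson_smul_right, poisson_smul_left, poisson_smul_right,
    V.poisson_comm (lin μ), poisson_lin_pow_left, poisson_lin_pow_left, poisson_lin_pow_left,
    V.poisson_comm (lin lam) (lin lam ^ (e + 1)), poisson_lin_pow_left, poisson_lin, poisson_lin,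
    poisson_lin, V.biv_isAlt lam]
  simp only [map_zero, mul_zero, smul_zero, neg_zero, add_zero]
  rw [mul_comm _ (C (V.biv lam μ)), mul_comm _ (C (V.biv lam ν)), ← smul_eq_C_mul,
    ← smul_eq_C_mul, smul_neg, smul_smul, smul_smul, smul_smul, smul_smul, add_assoc]
  have : t * V.biv lam μ * ((e + 1) * V.biv lam ν) = t * V.biv lam ν * ((e + 1) * V.biv lam μ) := by
    ring
  rw [← mul_assoc _ _ (V.biv lam ν), ← mul_assoc _ _ (V.biv lam μ)] at this
  simp only [mul_assoc] at this ⊢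
  rw [this, neg_add_cancel, add_zero]

/-- Truncated exponential series are multiplicative up to high order. -/
theorem sum_pow_add_sub_mem_fil {σ : Type*} {f g : MvPowerSeries σ ℂ} (hf : f ∈ fil σ 1)
    (hg : g ∈ fil σ 1) (J : ℕ) :
    ∑ N ∈ Finset.range J, (N.factorial : ℂ)⁻¹ • (f + g) ^ N -
      (∑ N ∈ Finset.range J, (N.factorial : ℂ)⁻¹ • f ^ N) *
        ∑ N ∈ Finset.range J, (N.factorial : ℂ)⁻¹ • g ^ N ∈ fil σ J := by
  classical
  have h1 : ∀ N, (N.factorial : ℂ)⁻¹ • (f + g) ^ N = ∑ x ∈ Finset.HasAntidiagonal.antidiagonal N,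
      ((x.1.factorial : ℂ)⁻¹ • f ^ x.1) * ((x.2.factorial : ℂ)⁻¹ • g ^ x.2) := by
    intro N
    rw [(Commute.all f g).add_pow', Finset.smul_sum]
    refine Finset.sum_congr rfl fun x hx => ?_
    have hx := Finset.HasAntidiagonal.mem_antidiagonal.mp hx
    rw [smul_mul_smul_comm, ← Nat.cast_smul_eq_nsmul ℂ, smul_smul]
    congr 1
    rw [← hx, Nat.cast_add_choose]
    have h2 := Nat.cast_ne_zero (R := ℂ).mpr (Nat.factorial_ne_zero (x.1 + x.2))
    field_simp
  -- the terms of the product of the truncated series with `x.1 + x.2 ≥ J` are in `fil σ J`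
  have h2 : ∑ N ∈ Finset.range J, (N.factorial : ℂ)⁻¹ • (f + g) ^ N =
      ∑ x ∈ (Finset.range J ×ˢ Finset.range J).filter (fun x => x.1 + x.2 < J),
        ((x.1.factorial : ℂ)⁻¹ • f ^ x.1) * ((x.2.factorial : ℂ)⁻¹ • g ^ x.2) := by
    rw [Finset.sum_congr rfl fun N _ => h1 N, ← Finset.sum_fiberwise_of_maps_to
      (s := (Finset.range J ×ˢ Finset.range J).filter (fun x => x.1 + x.2 < J))
      (t := Finset.range J) (g := fun x => x.1 + x.2) (fun x hx => by simp at hx ⊢; omega)]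
    refine Finset.sum_congr rfl fun N hN => Finset.sum_congr ?_ fun _ _ => rfl
    ext x
    have hN := Finset.mem_range.mp hN
    simp only [Finset.HasAntidiagonal.mem_antidiagonal, Finset.mem_filter, Finset.mem_product,
      Finset.mem_range]
    omega
  rw [h2, Finset.sum_mul_sum, ← Finset.sum_product', ← Finset.sum_filter_add_sum_filter_not
    (Finset.range J ×ˢ Finset.range J) (fun x => x.1 + x.2 < J), sub_add_cancel_left]
  refine neg_mem (Submodule.sum_mem _ fun x hx => ?_)
  have hx := (Finset.mem_filter.mp hx).2
  refine fil_anti (M := J) (N := x.1 * 1 + x.2 * 1) (by omega) ?_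
  exact mul_mem_fil (smul_mem_fil _ (pow_mem_fil hf _)) (smul_mem_fil _ (pow_mem_fil hg _))

/-- An algebra homomorphism maps `e^ν` to the exponential of the image of `ν`. -/
theorem map_expo_sub_mem_fil {σ τ : Type*} [Fintype σ]
    (φ : MvPowerSeries σ ℂ →ₐ[ℂ] MvPowerSeries τ ℂ) (ν : σ → ℂ) (J : ℕ) :
    φ (expo ν) - ∑ N ∈ Finset.range J, (N.factorial : ℂ)⁻¹ • φ (lin ν) ^ N ∈ fil τ J := by
  have := algHom_mem_fil φ (expo_sub_sum_mem_fil ν J)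
  simpa [map_sub, map_sum, map_smul, map_pow] using this

theorem map_expo_of_map_lin {σ τ : Type*} [Fintype σ] [Fintype τ]
    (φ : MvPowerSeries σ ℂ →ₐ[ℂ] MvPowerSeries τ ℂ) {ν : σ → ℂ} {μ : τ → ℂ}
    (h : φ (lin ν) = lin μ) : φ (expo ν) = expo μ :=
  eq_of_forall_sub_mem_fil fun M => by
    have h1 := map_expo_sub_mem_fil φ ν M
    rw [h] at h1
    have := sub_mem h1 (expo_sub_sum_mem_fil μ M)
    simpa using this

end SymplecticSpace
/-! ### The Leibniz rule and exponentials of vector fields -/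

section Leibniz

open MvPowerSeries

variable {σ S : Type*} [Fintype S] [DecidableEq S]

/-- The divided powers `D^j / j!` of an operator. -/
noncomputable def divPow (D : MvPowerSeries σ ℂ →ₗ[ℂ] MvPowerSeries σ ℂ) (j : ℕ) :
    MvPowerSeries σ ℂ →ₗ[ℂ] MvPowerSeries σ ℂ := (j.factorial : ℂ)⁻¹ • D ^ j

theorem divPow_zero (D : MvPowerSeries σ ℂ →ₗ[ℂ] MvPowerSeries σ ℂ) (f : MvPowerSeries σ ℂ) :
    divPow D 0 f = f := by
  simp [divPow]

theorem succ_smul_divPow_succ (D : MvPowerSeries σ ℂ →ₗ[ℂ] MvPowerSeries σ ℂ) (j : ℕ)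
    (f : MvPowerSeries σ ℂ) : ((j : ℂ) + 1) • divPow D (j + 1) f = D (divPow D j f) := by
  simp only [divPow, LinearMap.smul_apply, map_smul, smul_smul, pow_succ', Module.End.mul_apply,
    Nat.factorial_succ]
  congr 1
  have h2 : (j.factorial : ℂ) ≠ 0 := Nat.cast_ne_zero.mpr (Nat.factorial_ne_zero _)
  have h3 : ((j : ℂ) + 1) ≠ 0 := Nat.cast_add_one_ne_zero _
  push_cast
  field_simp

/-- Euler's identity for the sum of `F` over the multi-indices `r` of total degree `j + 1`: the weight
`∑ i, r i` of each term is `j + 1`. -/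
theorem sum_piAntidiag_shift {E : Type*} [AddCommGroup E] [Module ℂ E] (F : (S → ℕ) → E) (j : ℕ) :
    ∑ r ∈ Finset.piAntidiag Finset.univ j, ∑ i, ((r i : ℂ) + 1) • F (r + Pi.single i 1) =
      ((j : ℂ) + 1) • ∑ r ∈ Finset.piAntidiag Finset.univ (j + 1), F r := by
  have h1 : ((j : ℂ) + 1) • ∑ r ∈ Finset.piAntidiag (Finset.univ : Finset S) (j + 1), F r =
      ∑ r ∈ Finset.piAntidiag (Finset.univ : Finset S) (j + 1), ∑ i, (r i : ℂ) • F r := by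
    rw [Finset.smul_sum]
    refine Finset.sum_congr rfl fun r hr => ?_
    rw [← Finset.sum_smul, ← Nat.cast_sum, (Finset.mem_piAntidiag.mp hr).1]
    push_cast
    rfl
  rw [h1, Finset.sum_comm, Finset.sum_comm (s := Finset.piAntidiag Finset.univ (j + 1))]
  refine Finset.sum_congr rfl fun i _ => ?_
  rw [← Finset.sum_filter_add_sum_filter_not (Finset.piAntidiag Finset.univ (j + 1))
    (fun r => r i = 0), Finset.sum_eq_zero (s := Finset.filter (fun r => r i = 0) _) (f := fun r => (r i : ℂ) • F r),
    zero_add]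
  · refine Finset.sum_nbij' (fun r => r + Pi.single i 1) (fun r => r - Pi.single i 1) ?_ ?_ ?_ ?_ ?_
    · intro r hr
      simp only [Finset.mem_piAntidiag, Finset.mem_filter, Finset.mem_univ, implies_true,
        and_true] at hr ⊢
      refine ⟨?_, by simp⟩
      rw [← hr, Finset.sum_congr rfl fun k _ => Pi.add_apply r _ k, Finset.sum_add_distrib]
      simp
    · intro r hr
      simp only [Finset.mem_piAntidiag, Finset.mem_filter, Finset.mem_univ, implies_true,
        and_true] at hr ⊢
      have h2 : r = (r - Pi.single i 1) + Pi.single i 1 := by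
        ext k
        by_cases hk : k = i
        · subst hk
          simp
          omega
        · simp [hk]
      have h3 : ∑ k, ((r - Pi.single i 1 : S → ℕ) k + (Pi.single i 1 : S → ℕ) k) = j + 1 := by
        rw [← hr.1]
        exact Finset.sum_congr rfl fun k _ => (congrFun h2 k).symm
      rw [Finset.sum_add_distrib] at h3
      simpa using h3
    · intro r _
      ext k
      simp
    · intro r hr
      have := (Finset.mem_filter.mp hr).2
      ext k
      by_cases hk : k = i
      · subst hk
        simp
        omega
      · simp [hk]
    · intro r _
      simp
  · intro r hr
    rw [(Finset.mem_filter.mp hr).2]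
    simp

/-- The general Leibniz rule for the divided powers of an operator commuting with a multilinear
map. -/
theorem divPow_multilinear {D : MvPowerSeries σ ℂ →ₗ[ℂ] MvPowerSeries σ ℂ}
    {T : MultilinearMap ℂ (fun _ : S => MvPowerSeries σ ℂ) (MvPowerSeries σ ℂ)}
    (h : ∀ f, D (T f) = ∑ i, T (Function.update f i (D (f i)))) (j : ℕ)
    (f : S → MvPowerSeries σ ℂ) :
    divPow D j (T f) = ∑ r ∈ Finset.piAntidiag Finset.univ j, T fun i => divPow D (r i) (f i) := by
  induction j with
  | zero =>
    rw [divPow_zero]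
    simp [divPow_zero]
  | succ j ih =>
    have h3 : ((j : ℂ) + 1) ≠ 0 := Nat.cast_add_one_ne_zero _
    apply smul_right_injective _ h3
    simp only
    rw [succ_smul_divPow_succ, ih, ← sum_piAntidiag_shift, map_sum]
    refine Finset.sum_congr rfl fun r _ => ?_
    rw [h]
    refine Finset.sum_congr rfl fun i _ => ?_
    rw [← succ_smul_divPow_succ, T.map_update_smul]
    congr 2
    ext1 k
    by_cases hk : k = i
    · subst hk
      simp
    · simp [hk]

/-- Changing the inputs of a continuous multilinear map by high order terms, one at a time. -/
theorem multilinear_sub_mem_fil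
    {T : MultilinearMap ℂ (fun _ : S => MvPowerSeries σ ℂ) (MvPowerSeries σ ℂ)} {K M : ℕ}
    (hT : ∀ f i, f i ∈ fil σ K → T f ∈ fil σ M) {g h : S → MvPowerSeries σ ℂ}
    (hgh : ∀ i, g i - h i ∈ fil σ K) : T g - T h ∈ fil σ M := by
  have key : ∀ s : Finset S, T (s.piecewise g h) - T h ∈ fil σ M := by
    intro s
    induction s using Finset.induction_on with
    | empty => simp
    | insert i s hi ih =>
      have e : T ((insert i s).piecewise g h) - T (s.piecewise g h) =
          T (Function.update (s.piecewise g h) i (g i - h i)) := by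
        rw [T.map_update_sub, Finset.piecewise_insert]
        congr 2
        have : h i = s.piecewise g h i := by simp [hi]
        rw [this, Function.update_eq_self]
      have h1 : T ((insert i s).piecewise g h) - T (s.piecewise g h) ∈ fil σ M := by
        rw [e]
        refine hT _ i ?_
        rw [Function.update_self]
        exact hgh i
      have := add_mem h1 ih
      rwa [sub_add_sub_cancel] at this
  simpa using key Finset.univ

/-- Comparison of the exponential of an operator, applied to the output of a multilinear map or to
all its inputs. The map `α` stands for `exp (t D)`; only its values at the inputs and at the output
are used, up to terms of high order. The difference is a polynomial in `t` whose coefficients measure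
the failure of the Leibniz rule for the divided powers of `D`. -/
theorem exp_multilinear_sub_mem_fil {D : MvPowerSeries σ ℂ →ₗ[ℂ] MvPowerSeries σ ℂ}
    {T : MultilinearMap ℂ (fun _ : S => MvPowerSeries σ ℂ) (MvPowerSeries σ ℂ)} {D₀ : ℕ}
    (hT : ∀ M f i, f i ∈ fil σ (M + D₀) → T f ∈ fil σ M)
    {f : S → MvPowerSeries σ ℂ} (hf : ∀ i j, divPow D j (f i) ∈ fil σ j) (M : ℕ) :
    ∃ J₀, ∀ J, J₀ ≤ J → ∀ (t : ℂ) (α : MvPowerSeries σ ℂ → MvPowerSeries σ ℂ),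
      (∀ i, α (f i) - ∑ j ∈ Finset.range J, t ^ j • divPow D j (f i) ∈ fil σ J) →
      (α (T f) - ∑ j ∈ Finset.range J, t ^ j • divPow D j (T f) ∈ fil σ J) →
      (α (T f) - T (fun i => α (f i))) - ∑ j ∈ Finset.range J, t ^ j • (divPow D j (T f) -
        ∑ r ∈ Finset.piAntidiag Finset.univ j, T fun i => divPow D (r i) (f i)) ∈ fil σ M := by
  classical
  -- if `∑ i, r i ≥ J`, some `r i` is at least `M + D₀`, so the corresponding term is in `fil σ M`
  refine ⟨Fintype.card S * (M + D₀) + M + D₀ + 1, fun J hJ t α h1 h2 => ?_⟩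
  have h3 : T (fun i => α (f i)) - T (fun i => ∑ j ∈ Finset.range J, t ^ j • divPow D j (f i)) ∈
      fil σ M :=
    multilinear_sub_mem_fil (hT M) fun i => fil_anti (by omega) (h1 i)
  have h4 : T (fun i => ∑ j ∈ Finset.range J, t ^ j • divPow D j (f i)) =
      ∑ r ∈ Fintype.piFinset fun _ : S => Finset.range J,
        t ^ (∑ i, r i) • T fun i => divPow D (r i) (f i) := by
    rw [T.map_sum_finset]
    refine Finset.sum_congr rfl fun r _ => ?_
    rw [T.map_smul_univ (fun i => t ^ r i), Finset.prod_pow_eq_pow_sum]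
  have h5 : ∑ j ∈ Finset.range J, t ^ j •
      ∑ r ∈ Finset.piAntidiag Finset.univ j, T (fun i => divPow D (r i) (f i)) =
      ∑ r ∈ (Fintype.piFinset fun _ : S => Finset.range J).filter (fun r => ∑ i, r i < J),
        t ^ (∑ i, r i) • T fun i => divPow D (r i) (f i) := by
    rw [← Finset.sum_fiberwise_of_maps_to (t := Finset.range J)
      (s := (Fintype.piFinset fun _ : S => Finset.range J).filter (fun r => ∑ i, r i < J))
      (g := fun r : S → ℕ => ∑ i, r i) (fun r hr => Finset.mem_range.mpr (Finset.mem_filter.mp hr).2)]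
    refine Finset.sum_congr rfl fun j hj => ?_
    rw [Finset.smul_sum]
    refine Finset.sum_congr ?_ fun r hr => ?_
    · ext r
      have hj := Finset.mem_range.mp hj
      simp only [Finset.mem_piAntidiag, Finset.mem_filter, Fintype.mem_piFinset, Finset.mem_range,
        Finset.mem_univ, implies_true, and_true]
      constructor
      · intro h
        have h : ∑ i, r i = j := h
        refine ⟨⟨fun i => ?_, by omega⟩, h⟩
        have : r i ≤ ∑ i, r i :=
          Finset.single_le_sum (f := r) (fun _ _ => Nat.zero_le _) (Finset.mem_univ i)
        omega
      · exact fun h => h.2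
    · rw [(Finset.mem_filter.mp hr).2]
  have h6 : ∑ r ∈ Fintype.piFinset (fun _ : S => Finset.range J),
        t ^ (∑ i, r i) • T (fun i => divPow D (r i) (f i)) -
      ∑ j ∈ Finset.range J, t ^ j •
      ∑ r ∈ Finset.piAntidiag Finset.univ j, T (fun i => divPow D (r i) (f i)) ∈ fil σ M := by
    rw [h5, ← Finset.sum_filter_add_sum_filter_not (Fintype.piFinset fun _ : S => Finset.range J)
      (fun r => ∑ i, r i < J), add_sub_cancel_left]
    refine Submodule.sum_mem _ fun r hr => smul_mem_fil _ ?_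
    have hr := (Finset.mem_filter.mp hr).2
    obtain ⟨i, hi⟩ : ∃ i, M + D₀ ≤ r i := by
      by_contra! hlt
      have : ∑ i, r i ≤ _ := Finset.sum_le_card_nsmul Finset.univ r (M + D₀) fun i _ => (hlt i).le
      rw [Finset.card_univ, smul_eq_mul] at this
      omega
    exact hT M _ i (fil_anti hi (hf i (r i)))
  simp only [smul_sub, Finset.sum_sub_distrib]
  have h7 : α (T f) - ∑ j ∈ Finset.range J, t ^ j • divPow D j (T f) ∈ fil σ M :=
    fil_anti (by omega) h2
  rw [h4] at h3
  have := sub_mem (sub_mem h7 h3) h6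
  convert this using 1
  abel

end Leibniz

namespace SymplecticSpace

open MvPowerSeries

/-! ### Invariance under shears -/

theorem poisson_lin_lin_pow (V : SymplecticSpace.{u}) (lam : V.Vec) (k : ℕ) :
    V.poisson (lin lam) (lin lam ^ k) = 0 := by
  rw [poisson_comm]
  cases k with
  | zero => simpa using V.poisson_C_left _ 1
  | succ k => rw [poisson_lin_pow_left, poisson_lin, V.biv_isAlt lam]; simp

/-- On exponentials the Hamiltonian vector field of `λ^{d+1} / (d+1)` acts as multiplication by a
multiple of `λ^d`, because it kills `λ`. -/
theorem divPow_expo (V : SymplecticSpace.{u}) (lam ν : V.Vec) (d j : ℕ) :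
    divPow (V.poissonL (((d : ℂ) + 1)⁻¹ • lin lam ^ (d + 1))) j (expo ν) =
      (V.biv lam ν ^ j / j.factorial) • (lin lam ^ (d * j) * expo ν) := by
  have h3 : ∀ j : ℕ, ((j : ℂ) + 1) ≠ 0 := fun j => Nat.cast_add_one_ne_zero _
  induction j with
  | zero => simp [divPow_zero]
  | succ j ih =>
    apply smul_right_injective _ (h3 j)
    simp only
    rw [succ_smul_divPow_succ, ih, map_smul]
    change _ • V.poisson _ _ = _
    rw [poisson_smul_left, poisson_lin_pow_left, smul_smul ((d : ℂ) + 1)⁻¹, inv_mul_cancel₀ (h3 d),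
      one_smul, poisson_mul_right, poisson_lin_lin_pow, poisson_lin_expo, mul_zero, add_zero,
      mul_smul_comm, mul_smul_comm, smul_smul, smul_smul, ← mul_assoc, ← pow_add,
      Nat.factorial_succ, mul_add, mul_one, add_comm d]
    congr 1
    have h2 : (j.factorial : ℂ) ≠ 0 := Nat.cast_ne_zero.mpr (Nat.factorial_ne_zero _)
    have h4 := h3 j
    push_cast
    field_simp
    ring

theorem divPow_expo_mem_fil (V : SymplecticSpace.{u}) (lam ν : V.Vec) {d : ℕ} (hd : 1 ≤ d)
    (j : ℕ) (c : ℂ) :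
    divPow (V.poissonL (((d : ℂ) + 1)⁻¹ • lin lam ^ (d + 1))) j (c • expo ν) ∈ fil V.idx j := by
  rw [map_smul, divPow_expo]
  refine smul_mem_fil _ (smul_mem_fil _ (Ideal.mul_mem_right _ _ ?_))
  refine fil_anti ?_ (pow_mem_fil (lin_mem_fil lam) (d * j))
  rw [mul_one]
  exact Nat.le_mul_of_pos_left j hd

/-- A shear is the exponential of its Hamiltonian vector field. -/
theorem shear_expo_sub_mem_fil (V : SymplecticSpace.{u}) {lam : V.Vec} {d : ℕ} (hd : 1 ≤ d) {t : ℂ}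
    {α : V.Fun ≃ₐ[ℂ] V.Fun}
    (hα : ∀ ν, α (lin ν) = lin ν + (t * V.biv lam ν) • lin lam ^ d) (ν : V.Vec) (c : ℂ) (J : ℕ) :
    α (c • expo ν) - ∑ j ∈ Finset.range J, t ^ j •
      divPow (V.poissonL (((d : ℂ) + 1)⁻¹ • lin lam ^ (d + 1))) j (c • expo ν) ∈ fil V.idx J := by
  have h1 := map_expo_sub_mem_fil α.toAlgHom ν J
  have h2 := sum_pow_add_sub_mem_fil (lin_mem_fil ν) (g := (t * V.biv lam ν) • lin lam ^ d)
    (smul_mem_fil _ (fil_anti (by omega) (pow_mem_fil (lin_mem_fil lam) d))) J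
  have h3 := Ideal.mul_mem_right (∑ N ∈ Finset.range J, (N.factorial : ℂ)⁻¹ •
    ((t * V.biv lam ν) • lin lam ^ d) ^ N) _ (expo_sub_sum_mem_fil ν J)
  have h4 : expo ν * ∑ N ∈ Finset.range J, (N.factorial : ℂ)⁻¹ •
      ((t * V.biv lam ν) • lin lam ^ d) ^ N = ∑ j ∈ Finset.range J, t ^ j •
      divPow (V.poissonL (((d : ℂ) + 1)⁻¹ • lin lam ^ (d + 1))) j (expo ν) := by
    rw [Finset.mul_sum]
    refine Finset.sum_congr rfl fun j _ => ?_
    rw [divPow_expo, smul_pow, ← pow_mul, mul_smul_comm, mul_smul_comm, smul_smul, smul_smul,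
      mul_comm (expo ν), mul_pow]
    congr 1
    ring
  have h5 : α.toAlgHom (lin ν) = lin ν + (t * V.biv lam ν) • lin lam ^ d := hα ν
  rw [h5] at h1
  rw [sub_mul, h4] at h3
  have h6 := sub_mem (add_mem h1 h2) h3
  have h7 : α (c • expo ν) - ∑ j ∈ Finset.range J, t ^ j •
      divPow (V.poissonL (((d : ℂ) + 1)⁻¹ • lin lam ^ (d + 1))) j (c • expo ν) =
      c • (α (expo ν) - ∑ j ∈ Finset.range J, t ^ j •
      divPow (V.poissonL (((d : ℂ) + 1)⁻¹ • lin lam ^ (d + 1))) j (expo ν)) := by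
    rw [map_smul, smul_sub, Finset.smul_sum]
    simp only [map_smul, smul_comm c]
  rw [h7]
  refine smul_mem_fil _ ?_
  convert h6 using 1
  change α (expo ν) - _ = (α (expo ν) - _ + _) - _
  abel

/-- The operator with symbol `P` commutes with `α`. -/
def CommutesWith {V : SymplecticSpace.{u}} {n : ℕ} (P : V.Symb n) (α : V.Fun ≃ₐ[ℂ] V.Fun) : Prop :=
  ∀ f : Fin n → V.Fun, α (V.act n P f) = V.act n P (fun i => α (f i))

/-- Whether an isomorphism carries one operator to another has to be checked on exponentials
only. -/
theorem carries_of_expo {V W : SymplecticSpace.{u}} {n : ℕ} {P : V.Symb n} {Q : W.Symb n}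
    {α : V.Fun ≃ₐ[ℂ] W.Fun}
    (h : ∀ ν : Fin n → V.Vec, α (V.act n P fun i => expo (ν i)) =
      W.act n Q (fun i => α (expo (ν i)))) : Carries α P Q := by
  have h1 := multilinear_eq_zero_of_expo (T := α.toLinearMap.compMultilinearMap (V.actM n P) -
    (W.actM n Q).compLinearMap fun _ => α.toLinearMap) (fun M => by
      obtain ⟨K₁, hK₁⟩ := V.isAdicCont_actM n P M
      obtain ⟨K₂, hK₂⟩ := W.isAdicCont_actM n Q M
      refine ⟨K₁ + K₂, fun f i hf => ?_⟩
      rw [sub_apply]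
      refine sub_mem ?_ ?_
      · exact algHom_mem_fil α.toAlgHom (hK₁ f i (fil_anti (by omega) hf))
      · exact hK₂ _ i (algHom_mem_fil α.toAlgHom (fil_anti (by omega) hf))) (fun ν => by
      rw [sub_apply, sub_eq_zero]
      simp only [LinearMap.compMultilinearMap_apply, MultilinearMap.compLinearMap_apply, actM_apply,
        AlgEquiv.toLinearMap_apply]
      exact h ν)
  intro f
  have := h1 f
  rw [sub_apply, sub_eq_zero] at this
  simpa only [LinearMap.compMultilinearMap_apply, MultilinearMap.compLinearMap_apply, actM_apply,
    AlgEquiv.toLinearMap_apply] using this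

/-- If an operator commutes with the Hamiltonian vector field of `λ^{d+1}`, then it commutes with
the flow. -/
theorem commutesWith_shear {V : SymplecticSpace.{u}} {n : ℕ} {P : V.Symb n} {lam : V.Vec} {d : ℕ}
    (hd : 1 ≤ d) (hP : V.LieInv n P (lin lam ^ (d + 1))) {t : ℂ} {α : V.Fun ≃ₐ[ℂ] V.Fun}
    (hα : ∀ ν, α (lin ν) = lin ν + (t * V.biv lam ν) • lin lam ^ d) : CommutesWith P α := by
  refine carries_of_expo fun ν => eq_of_forall_sub_mem_fil fun M => ?_
  obtain ⟨D₀, hD₀⟩ := V.act_mem_fil n P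
  have hT : ∀ M f i, f i ∈ fil V.idx (M + D₀) → V.actM n P f ∈ fil V.idx M := fun M f i hf => by
    rw [actM_apply]
    exact hD₀ M f i hf
  obtain ⟨J, hJ⟩ := exp_multilinear_sub_mem_fil
    (D := V.poissonL (((d : ℂ) + 1)⁻¹ • lin lam ^ (d + 1))) hT (f := fun i => expo (ν i))
    (fun i j => by simpa using V.divPow_expo_mem_fil lam (ν i) hd j 1) M
  have h1 := hJ J le_rfl t α (fun i => by simpa using V.shear_expo_sub_mem_fil hd hα (ν i) 1 J)
    (by
      rw [actM_apply, act_expo]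
      exact V.shear_expo_sub_mem_fil hd hα _ _ J)
  have hL : ∀ f, V.poissonL (((d : ℂ) + 1)⁻¹ • lin lam ^ (d + 1)) (V.actM n P f) =
      ∑ i, V.actM n P (Function.update f i
        (V.poissonL (((d : ℂ) + 1)⁻¹ • lin lam ^ (d + 1)) (f i))) := by
    intro f
    change V.poisson _ _ = ∑ i, V.actM n P (Function.update f i (V.poisson _ _))
    simp only [poisson_smul_left, MultilinearMap.map_update_smul, actM_apply, ← Finset.smul_sum]
    rw [hP]
  simp only [divPow_multilinear hL, sub_self, smul_zero, Finset.sum_const_zero, sub_zero] at h1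
  rwa [actM_apply, actM_apply] at h1

/-- A polynomial in `t` with coefficients in the ring of power series that is close to zero for
all `t` has coefficients close to zero. -/
theorem mem_fil_of_forall_sum_mem_fil {σ : Type*} {M J : ℕ} {y : ℕ → MvPowerSeries σ ℂ}
    (h : ∀ t : ℂ, ∑ j ∈ Finset.range J, t ^ j • y j ∈ fil σ M) {j : ℕ} (hj : j < J) :
    y j ∈ fil σ M := by
  intro d hd
  have h0 : ∑ j ∈ Finset.range J, Polynomial.monomial j (coeff d (y j)) = 0 := by
    refine Polynomial.funext fun t => ?_
    have := h t d hd
    rw [map_sum] at this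
    rw [Polynomial.eval_finsetSum, Polynomial.eval_zero, ← this]
    refine Finset.sum_congr rfl fun j _ => ?_
    rw [Polynomial.eval_monomial, map_smul, smul_eq_mul, mul_comm]
  have := congrArg (fun p => Polynomial.coeff p j) h0
  simp only [Polynomial.finsetSum_coeff, Polynomial.coeff_monomial, Polynomial.coeff_zero] at this
  rw [Finset.sum_eq_single j] at this
  · simpa using this
  · intro k _ hk
    simp [hk]
  · intro h'
    exact absurd (Finset.mem_range.mpr hj) h'

/-- If an operator commutes with all shears in the direction `λ^♯` of degree `d`, then it
commutes with their infinitesimal generator. -/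
theorem lieInv_of_commutesWith_shear {V : SymplecticSpace.{u}} {n : ℕ} {P : V.Symb n}
    {lam : V.Vec} {d : ℕ} (hd : 1 ≤ d)
    (hP : ∀ (t : ℂ) (α : V.Fun ≃ₐ[ℂ] V.Fun), IsSymplectic α →
      (∀ ν, α (lin ν) = lin ν + (t * V.biv lam ν) • lin lam ^ d) → CommutesWith P α) :
    V.LieInv n P (lin lam ^ (d + 1)) := by
  rw [lieInv_iff_expo]
  intro ν
  set x := ((d : ℂ) + 1)⁻¹ • lin lam ^ (d + 1) with hx
  have hd1 : ((d : ℂ) + 1) ≠ 0 := Nat.cast_add_one_ne_zero _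
  have hx' : lin lam ^ (d + 1) = ((d : ℂ) + 1) • x := by
    rw [hx, smul_smul, mul_inv_cancel₀ hd1, one_smul]
  suffices hs : V.poissonL x (V.actM n P fun i => expo (ν i)) =
      ∑ i, V.actM n P (Function.update (fun i => expo (ν i)) i (V.poissonL x (expo (ν i)))) by
    change V.poisson _ _ = ∑ i, V.actM n P (Function.update _ i (V.poisson _ _)) at hs
    rw [hx']
    simp only [poisson_smul_left, ← actM_apply, MultilinearMap.map_update_smul, ← Finset.smul_sum]
    rw [hs]
  refine eq_of_forall_sub_mem_fil fun M => ?_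
  obtain ⟨D₀, hD₀⟩ := V.act_mem_fil n P
  have hT : ∀ M f i, f i ∈ fil V.idx (M + D₀) → V.actM n P f ∈ fil V.idx M := fun M f i hf => by
    rw [actM_apply]
    exact hD₀ M f i hf
  obtain ⟨J₀, hJ₀⟩ := exp_multilinear_sub_mem_fil (D := V.poissonL x) hT (f := fun i => expo (ν i))
    (fun i j => by simpa using V.divPow_expo_mem_fil lam (ν i) hd j 1) M
  have h1 : ∀ t : ℂ, ∑ j ∈ Finset.range (J₀ + 2), t ^ j • (divPow (V.poissonL x) j
      (V.actM n P fun i => expo (ν i)) - ∑ r ∈ Finset.piAntidiag Finset.univ j,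
        V.actM n P fun i => divPow (V.poissonL x) (r i) (expo (ν i))) ∈ fil V.idx M := by
    intro t
    obtain ⟨α, hα, hα', -⟩ := V.exists_shear lam hd t
    have h2 := hJ₀ (J₀ + 2) (by omega) t α
      (fun i => by simpa using V.shear_expo_sub_mem_fil hd hα' (ν i) 1 (J₀ + 2))
      (by
        rw [actM_apply, act_expo]
        exact V.shear_expo_sub_mem_fil hd hα' _ _ _)
    have h3 : α (V.actM n P fun i => expo (ν i)) = V.actM n P fun i => α (expo (ν i)) := by
      rw [actM_apply, actM_apply]
      exact hP t α hα hα' _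
    rw [h3, sub_self, zero_sub] at h2
    simpa using neg_mem h2
  -- the coefficient of `t` is the failure of the Leibniz rule for `D` itself
  have h2 := mem_fil_of_forall_sum_mem_fil h1 (j := 1) (by omega)
  have h3 := sum_piAntidiag_shift (S := Fin n)
    (fun r => V.actM n P fun i => divPow (V.poissonL x) (r i) (expo (ν i))) 0
  have h4 : ∀ f, divPow (V.poissonL x) 1 f = V.poissonL x f := fun f => by
    simp [divPow]
  rw [h4] at h2
  simp only [Nat.cast_zero, zero_add, one_smul, Finset.piAntidiag_zero, Finset.sum_singleton,
    Pi.zero_apply] at h3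
  rw [← h3] at h2
  convert h2 using 3 with i
  congr 1
  ext1 k
  by_cases hk : k = i
  · subst hk
    simp [h4]
  · simp [hk, divPow_zero]

end SymplecticSpace
namespace SymplecticSpace

open MvPowerSeries

/-! ### From the group of symplectic automorphisms to its Lie algebra -/

/-- The functions whose Hamiltonian vector fields commute with an operator form a subspace. -/
noncomputable def lieInvSubmodule (V : SymplecticSpace.{u}) (n : ℕ) (P : V.Symb n) :
    Submodule ℂ V.Fun where
  carrier := {x | V.LieInv n P x}
  add_mem' := by
    intro x y hx hy f
    rw [poisson_add_left, hx f, hy f]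
    simp only [poisson_add_left, ← actM_apply, MultilinearMap.map_update_add,
      Finset.sum_add_distrib]
  zero_mem' := by
    intro f
    have h : ∀ g : V.Fun, V.poisson 0 g = 0 := fun g => by simpa using V.poisson_C_left g 0
    simp only [h, ← actM_apply]
    rw [Finset.sum_eq_zero]
    exact fun i _ => MultilinearMap.map_update_zero _ _ _
  smul_mem' := by
    intro c x hx f
    rw [poisson_smul_left, hx f]
    simp only [poisson_smul_left, ← actM_apply, MultilinearMap.map_update_smul,
      Finset.smul_sum]

theorem mem_lieInvSubmodule {V : SymplecticSpace.{u}} {n : ℕ} {P : V.Symb n} {x : V.Fun} :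
    x ∈ V.lieInvSubmodule n P ↔ V.LieInv n P x := Iff.rfl

theorem poisson_mem_fil_left (V : SymplecticSpace.{u}) (g : V.Fun) {M : ℕ} {f : V.Fun}
    (hf : f ∈ fil V.idx (M + 1)) : V.poisson f g ∈ fil V.idx M := by
  rw [poisson_comm]
  exact neg_mem (V.poisson_mem_fil g hf)

theorem poisson_sub_left (V : SymplecticSpace.{u}) (f g h : V.Fun) :
    V.poisson (f - g) h = V.poisson f h - V.poisson g h := by
  rw [poisson_comm, poisson_sub_right, V.poisson_comm f, V.poisson_comm g]
  ring

theorem isAdicClosed_lieInvSubmodule (V : SymplecticSpace.{u}) (n : ℕ) (P : V.Symb n) :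
    IsAdicClosed (V.lieInvSubmodule n P) := by
  intro x hx f
  refine eq_of_forall_sub_mem_fil fun M => ?_
  obtain ⟨D, hD⟩ := V.act_mem_fil n P
  obtain ⟨y, hy, hxy⟩ := hx (M + D + 1)
  have h1 : V.poisson (x - y) (V.act n P f) ∈ fil V.idx M :=
    V.poisson_mem_fil_left _ (fil_anti (by omega) hxy)
  have h2 : ∑ i, V.act n P (Function.update f i (V.poisson (x - y) (f i))) ∈ fil V.idx M := by
    refine Submodule.sum_mem _ fun i _ => hD M _ i ?_
    rw [Function.update_self]
    exact V.poisson_mem_fil_left _ hxy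
  have h3 : ∑ i, V.act n P (Function.update f i (V.poisson (x - y) (f i))) =
      ∑ i, V.act n P (Function.update f i (V.poisson x (f i))) -
        ∑ i, V.act n P (Function.update f i (V.poisson y (f i))) := by
    simp only [poisson_sub_left, ← actM_apply, MultilinearMap.map_update_sub,
      Finset.sum_sub_distrib]
  rw [h3] at h2
  rw [poisson_sub_left, (mem_lieInvSubmodule.mp hy) f] at h1
  have := sub_mem h1 h2
  simpa using this

/-- Constant coefficient operators commute with translations. -/
theorem lieInv_lin (V : SymplecticSpace.{u}) (n : ℕ) (P : V.Symb n) (lam : V.Vec) :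
    V.LieInv n P (lin lam) := by
  rw [lieInv_iff_expo]
  intro ν
  simp only [poisson_lin_expo, ← actM_apply, MultilinearMap.map_update_smul,
    Function.update_eq_self]
  rw [actM_apply, act_expo, poisson_smul_right, poisson_lin_expo, ← Finset.sum_smul, map_sum,
    smul_comm]

/-- An operator is *infinitesimally `v`-invariant* if it commutes with the Hamiltonian vector
fields that kill `v^*`. Exponentials suffice as Hamiltonians. -/
def StabInv (V : SymplecticSpace.{u}) (n : ℕ) (v : V.Vec) (P : V.Symb n) : Prop :=
  ∀ lam, V.biv (V.codual v) lam = 0 → ∀ ν, symbVar V.biv P lam ν = 0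

/-- The shears along `lam` fix `v^*` if `lam` is orthogonal to `v^*`. So an operator invariant under
the stabilizer of `v^*` commutes with the Hamiltonian vector fields of all powers of `lam`, and
hence of `e^lam`. -/
theorem stabInv_of_mem_invFix {V : SymplecticSpace.{u}} {n : ℕ} {v : V.Vec} {P : V.Symb n}
    (hP : P ∈ V.invFix n v) : V.StabInv n v P := by
  intro lam hlam
  rw [← lieInv_expo_iff, ← mem_lieInvSubmodule]
  have hpow : ∀ N, lin lam ^ N ∈ V.lieInvSubmodule n P := by
    intro N
    match N with
    | 0 =>
      rw [mem_lieInvSubmodule, pow_zero]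
      intro f
      have h : ∀ g : V.Fun, V.poisson 1 g = 0 := fun g => by simpa using V.poisson_C_left g 1
      simp only [h, ← actM_apply]
      rw [Finset.sum_eq_zero]
      exact fun i _ => MultilinearMap.map_update_zero _ _ _
    | 1 =>
      rw [pow_one]
      exact V.lieInv_lin n P lam
    | d + 2 =>
      refine lieInv_of_commutesWith_shear (d := d + 1) (by omega) fun t α hα hα' => ?_
      refine hP α hα ?_
      rw [dual_eq_lin, hα', V.biv_neg, hlam]
      simp
  refine isAdicClosed_lieInvSubmodule V n P _ fun M => ⟨_, ?_, expo_sub_sum_mem_fil lam M⟩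
  exact Submodule.sum_mem _ fun N _ => Submodule.smul_mem _ _ (hpow N)

/-- The exponentials constant in the direction `v` are dense in the functions constant in the
direction `v`. -/
theorem StabInv.lieInv {V : SymplecticSpace.{u}} {n : ℕ} {v : V.Vec} {P : V.Symb n}
    (hP : V.StabInv n v P) {h : V.Fun} (hh : V.poisson (V.dual v) h = 0) : V.LieInv n P h := by
  rw [poisson_dual] at hh
  rw [← mem_lieInvSubmodule]
  refine isAdicClosed_lieInvSubmodule V n P _ fun M => ?_
  obtain ⟨g, hg, r, hr, rfl⟩ := Submodule.mem_sup.mp (mem_span_expo_sup_fil v hh M)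
  refine ⟨g, ?_, by simpa using hr⟩
  refine Submodule.span_le.mpr ?_ hg
  rintro _ ⟨ν, hν, rfl⟩
  rw [SetLike.mem_coe, mem_lieInvSubmodule, lieInv_expo_iff]
  exact hP ν (by rw [biv_codual, hν])

/-! ### Linear parts -/

theorem eq_zero_of_lin_mem_fil {σ : Type*} [Fintype σ] {ν : σ → ℂ} (h : lin ν ∈ fil σ 2) :
    ν = 0 := by
  ext a
  have := mem_fil_one.mp (pderiv_mem_fil a h)
  simpa [pderiv_lin] using this

theorem sub_lin_mem_fil {σ : Type*} [Fintype σ] [DecidableEq σ] {f : MvPowerSeries σ ℂ}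
    (hf : f ∈ fil σ 1) : f - lin (fun a => coeff (Finsupp.single a 1) f) ∈ fil σ 2 := by
  intro d hd
  rw [map_sub, lin, map_sum]
  simp only [map_smul, coeff_X, smul_eq_mul, mul_ite, mul_one, mul_zero]
  by_cases h0 : d.degree = 0
  · obtain rfl := (Finsupp.degree_eq_zero_iff d).mp h0
    rw [hf 0 (by simp), Finset.sum_eq_zero, sub_zero]
    intro a _
    rw [if_neg]
    intro h
    have := DFunLike.congr_fun h a
    simp at this
  · have h1 : d.degree = 1 := by omega
    obtain ⟨a, rfl⟩ : ∃ a, d = Finsupp.single a 1 := by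
      obtain ⟨a, ha⟩ : ∃ a, d a ≠ 0 := by
        by_contra! h2
        exact h0 ((Finsupp.degree_eq_zero_iff d).mpr (Finsupp.ext h2))
      have h2 : Finsupp.single a 1 ≤ d := Finsupp.single_le_iff.mpr (by omega)
      obtain ⟨e, rfl⟩ := exists_add_of_le h2
      rw [map_add, Finsupp.degree_single] at h1
      have h3 : e = 0 := (Finsupp.degree_eq_zero_iff e).mp (by omega)
      exact ⟨a, by rw [h3, add_zero]⟩
    rw [Finset.sum_eq_single a]
    · simp
    · intro b _ hb
      rw [if_neg]
      intro h
      exact hb (Finsupp.single_left_injective one_ne_zero h).symm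
    · simp

/-- The linear part of a symplectic isomorphism is a linear symplectic isomorphism. -/
theorem exists_linear_part {V W : SymplecticSpace.{u}} {α : V.Fun ≃ₐ[ℂ] W.Fun}
    (hα : IsSymplectic α) : ∃ A : V.Vec ≃ₗ[ℂ] W.Vec, (∀ μ ν, W.biv (A μ) (A ν) = V.biv μ ν) ∧
      ∀ ν, α (lin ν) - lin (A ν) ∈ fil W.idx 2 := by
  have hex : ∀ {V W : SymplecticSpace.{u}} (α : V.Fun ≃ₐ[ℂ] W.Fun), ∃ A : V.Vec →ₗ[ℂ] W.Vec,
      ∀ ν, α (lin ν) - lin (A ν) ∈ fil W.idx 2 := fun {V W} α =>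
    ⟨{ toFun := fun ν b => coeff (Finsupp.single b 1) (α (lin ν))
       map_add' := fun μ ν => by
        ext b
        simp [lin_add]
       map_smul' := fun c ν => by
        ext b
        simp [lin_smul] },
      fun ν => sub_lin_mem_fil (algHom_mem_fil α.toAlgHom (lin_mem_fil ν))⟩
  have hinv : ∀ {V W : SymplecticSpace.{u}} (α : V.Fun ≃ₐ[ℂ] W.Fun) (A : V.Vec →ₗ[ℂ] W.Vec)
      (A' : W.Vec →ₗ[ℂ] V.Vec), (∀ ν : V.Vec, α (lin ν) - lin (A ν) ∈ fil W.idx 2) →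
      (∀ ν : W.Vec, α.symm (lin ν) - lin (A' ν) ∈ fil V.idx 2) → A'.comp A = LinearMap.id := by
    intro V W α A A' hA hA'
    refine LinearMap.ext fun ν => ?_
    have h1 := algHom_mem_fil α.symm.toAlgHom (hA ν)
    have h2 : α.symm.toAlgHom (α (lin ν) - lin (A ν)) = lin ν - α.symm (lin (A ν)) := by
      rw [map_sub]
      congr 1
      exact α.symm_apply_apply _
    rw [h2] at h1
    have h3 := add_mem h1 (hA' (A ν))
    rw [sub_add_sub_cancel] at h3
    have h4 : lin (ν - A' (A ν)) = lin ν - lin (A' (A ν)) := by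
      rw [sub_eq_add_neg, lin_add, ← neg_one_smul ℂ, lin_smul]
      simp [sub_eq_add_neg]
    rw [← h4] at h3
    exact (sub_eq_zero.mp (eq_zero_of_lin_mem_fil h3)).symm
  obtain ⟨A, hA⟩ := hex α
  obtain ⟨A', hA'⟩ := hex α.symm
  refine ⟨LinearEquiv.ofLinearMap A A' (hinv α.symm A' A hA' hA) (hinv α A A' hA hA'), ?_, hA⟩
  intro μ ν
  have h1 := hα (lin μ) (lin ν)
  rw [poisson_lin] at h1
  have h2 : α (C (V.biv μ ν)) = C (V.biv μ ν) := α.commutes _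
  have h3 : ∀ ν, ∃ r ∈ fil W.idx 2, α (lin ν) = lin (A ν) + r := fun ν =>
    ⟨_, hA ν, by ring⟩
  obtain ⟨r, hr, hr'⟩ := h3 μ
  obtain ⟨s, hs, hs'⟩ := h3 ν
  rw [h2, hr', hs', poisson_add_left, poisson_add_right, poisson_lin] at h1
  have h5 := mem_fil_one.mp (add_mem (W.poisson_mem_fil (M := 1) (lin (A μ)) hs)
    (W.poisson_mem_fil_left (M := 1) (lin (A ν) + s) hr))
  have h6 := congrArg constantCoeff h1
  rw [add_assoc, map_add, h5, constantCoeff_C, constantCoeff_C, add_zero] at h6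
  exact h6.symm

/-! ### Unipotent symplectic automorphisms -/

/-- If an endomorphism agrees with the identity on coordinates up to order `d`, it changes a power
series of order `m + 1` only in order `d + m`. -/
theorem sub_mem_fil_of_X {σ : Type*} [Fintype σ] {β : MvPowerSeries σ ℂ →ₐ[ℂ] MvPowerSeries σ ℂ}
    {d : ℕ} (h : ∀ a, β (X a) - X a ∈ fil σ d) {m : ℕ} {f : MvPowerSeries σ ℂ}
    (hf : f ∈ fil σ (m + 1)) : β f - f ∈ fil σ (d + m) := by
  have h0 : ∀ f, β f - f ∈ fil σ d := by
    let S : Subalgebra ℂ (MvPowerSeries σ ℂ) :=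
      { carrier := {f | β f - f ∈ fil σ d}
        mul_mem' := fun {f g} hf hg => by
          have e : β (f * g) - f * g = (β f - f) * β g + f * (β g - g) := by
            rw [map_mul]
            ring
          change β (f * g) - f * g ∈ fil σ d
          rw [e]
          exact add_mem (Ideal.mul_mem_right _ _ hf) (Ideal.mul_mem_left _ _ hg)
        add_mem' := fun {f g} hf hg => by
          have e : β (f + g) - (f + g) = (β f - f) + (β g - g) := by
            rw [map_add]
            ring
          change β (f + g) - (f + g) ∈ fil σ d
          rw [e]
          exact add_mem hf hg
        algebraMap_mem' := fun c => by
          change β (algebraMap _ _ c) - algebraMap _ _ c ∈ fil σ d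
          rw [AlgHom.commutes, sub_self]
          exact zero_mem _ }
    have hS : S = ⊤ := by
      refine subalgebra_eq_top (fun f hf => ?_) h
      obtain ⟨g, hg, hfg⟩ := hf d
      have e : β f - f = β (f - g) - (f - g) + (β g - g) := by
        rw [map_sub]
        ring
      change β f - f ∈ fil σ d
      rw [e]
      exact add_mem (sub_mem (algHom_mem_fil β hfg) hfg) hg
    intro f
    have : f ∈ S := hS ▸ Algebra.mem_top
    exact this
  induction m generalizing f with
  | zero => exact h0 f
  | succ m ih =>
    obtain ⟨g, hg, rfl⟩ := exists_eq_sum_X_mul hf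
    rw [map_sum, ← Finset.sum_sub_distrib]
    refine Submodule.sum_mem _ fun a _ => ?_
    have e : β (X a * g a) - X a * g a = (β (X a) - X a) * β (g a) + X a * (β (g a) - g a) := by
      rw [map_mul]
      ring
    rw [e]
    refine add_mem (mul_mem_fil (h a) (algHom_mem_fil β (hg a))) ?_
    refine fil_anti (by omega) (mul_mem_fil (X_mem_fil a) (ih (hg a)))

/-- Euler's formula for the leading term of a power series. -/
theorem euler_sub_mem_fil {σ : Type*} [Fintype σ] {f : MvPowerSeries σ ℂ} {d : ℕ}
    (hf : f ∈ fil σ d) : (∑ a, X a * pderiv ℂ a f) - (d : ℂ) • f ∈ fil σ (d + 1) := by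
  classical
  intro e he
  rw [map_sub, map_smul, map_sum]
  have h1 : ∀ a, coeff e (X a * pderiv ℂ a f) = (e a : ℂ) * coeff e f := by
    intro a
    change coeff e (monomial (Finsupp.single a 1) 1 * _) = _
    rw [coeff_monomial_mul]
    split_ifs with h
    · rw [one_mul, coeff_pderiv, tsub_add_cancel_of_le h, Finsupp.tsub_apply,
        Finsupp.single_eq_same, mul_comm]
      congr 1
      have : 1 ≤ e a := by simpa using h a
      push_cast [this]
      ring
    · have : e a = 0 := by
        by_contra h0
        exact h (Finsupp.single_le_iff.mpr (by omega))
      simp [this]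
  rw [Finset.sum_congr rfl fun a _ => h1 a, ← Finset.sum_mul, ← Nat.cast_sum,
    ← Finsupp.degree_eq_sum]
  by_cases hlt : e.degree < d
  · simp [hf e hlt]
  · have : e.degree = d := by omega
    rw [this, smul_eq_mul, sub_self]

/-- The homogeneous functions of degree `N` that are constant in the direction `v` are spanned by
powers of linear functions with this property. -/
theorem homogeneousComponent_mem_span (V : SymplecticSpace.{u}) (v : V.Vec) {h : V.Fun}
    (hh : V.poisson (V.dual v) h = 0) (N : ℕ) : homogeneousComponent N h ∈
      Submodule.span ℂ {f | ∃ lam, V.biv (V.codual v) lam = 0 ∧ f = (lin lam : V.Fun) ^ N} := by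
  rw [poisson_dual] at hh
  obtain ⟨g, hg, r, hr, rfl⟩ := Submodule.mem_sup.mp (mem_span_expo_sup_fil v hh (N + 1))
  have h1 : homogeneousComponent N r = 0 := by
    ext d
    rw [coeff_homogeneousComponent]
    split_ifs with hd
    · rw [map_zero]
      exact hr d (by omega)
    · simp
  rw [map_add, h1, add_zero]
  have h2 := Submodule.mem_map_of_mem (f := homogeneousComponent N) hg
  rw [Submodule.map_span] at h2
  refine Submodule.span_le.mpr ?_ h2
  rintro _ ⟨_, ⟨ν, hν, rfl⟩, rfl⟩
  have h3 : homogeneousComponent N (expo ν) = (N.factorial : ℂ)⁻¹ • lin ν ^ N := by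
    ext d
    rw [coeff_homogeneousComponent, coeff_inv_factorial_smul_lin_pow]
  rw [h3]
  exact Submodule.smul_mem _ _ (Submodule.subset_span ⟨ν, by rw [biv_codual, hν], rfl⟩)

theorem poisson_codual_single (V : SymplecticSpace.{u}) (a : V.idx) (f : V.Fun) :
    V.poisson (lin (V.codual (Pi.single a 1))) f = pderiv ℂ a f := by
  rw [← dual_eq_lin, poisson_dual, Finset.sum_eq_single a]
  · simp
  · intro b _ hb
    simp [hb]
  · simp

theorem lin_codual_eq_sum (V : SymplecticSpace.{u}) (w : V.Vec) :
    lin (V.codual w) = ∑ a, w a • lin (V.codual (Pi.single a 1)) := by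
  have h : V.codual w = ∑ a, w a • V.codual (Pi.single a 1) := by
    ext b
    rw [codual_eq_vecMul, Finset.sum_apply]
    simp [codual_eq_vecMul, Matrix.vecMul, dotProduct]
  rw [h]
  induction (Finset.univ : Finset V.idx) using Finset.induction_on with
  | empty => simp [lin]
  | insert a s ha ih => rw [Finset.sum_insert ha, Finset.sum_insert ha, lin_add, lin_smul, ih]

/-- The leading term of a unipotent symplectic automorphism is Hamiltonian; this is the formal
Poincaré lemma. If the automorphism fixes `v^*`, the Hamiltonian is constant in the direction `v`,
so it is a combination of powers of linear functions with this property. -/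
theorem exists_hamiltonian {V : SymplecticSpace.{u}} {β : V.Fun ≃ₐ[ℂ] V.Fun} (hβ : IsSymplectic β)
    {d : ℕ} (hd : 2 ≤ d) (h : ∀ ν, β (lin ν) - lin ν ∈ fil V.idx d) {v : V.Vec}
    (hv : β (V.dual v) = V.dual v) :
    ∃ h ∈ Submodule.span ℂ {f | ∃ lam, V.biv (V.codual v) lam = 0 ∧
        f = (lin lam : V.Fun) ^ (d + 1)},
      ∀ ν, β (lin ν) - lin ν - V.poisson h (lin ν) ∈ fil V.idx (d + 1) := by
  obtain ⟨r, hr⟩ : ∃ r : V.Vec → V.Fun, ∀ ν, r ν = β (lin ν) - lin ν := ⟨_, fun _ => rfl⟩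
  have h : ∀ ν, r ν ∈ fil V.idx d := fun ν => hr ν ▸ h ν
  have hr' : ∀ ν, β (lin ν) = lin ν + r ν := fun ν => by rw [hr]; ring
  have hclosed : ∀ μ ν, V.poisson (lin μ) (r ν) - V.poisson (lin ν) (r μ) ∈ fil V.idx d := by
    intro μ ν
    have h1 := hβ (lin μ) (lin ν)
    have h2 : β (C (V.biv μ ν)) = C (V.biv μ ν) := β.commutes _
    rw [poisson_lin, h2, hr', hr', poisson_add_left, poisson_add_right, poisson_add_right,
      poisson_lin] at h1
    have h3 : V.poisson (lin μ) (r ν) - V.poisson (lin ν) (r μ) = -V.poisson (r μ) (r ν) := by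
      rw [V.poisson_comm (lin ν)]
      linear_combination -h1
    rw [h3]
    obtain ⟨e, rfl⟩ : ∃ e, d = e + 1 := ⟨d - 1, by omega⟩
    exact neg_mem (fil_anti (by omega) (V.poisson_mem_fil_add (h μ) (h ν)))
  -- `r ∘ q` is a closed `1`-form up to higher order, and `H` is its primitive by the radial homotopy
  set q : V.idx → V.Vec := fun a => V.codual (Pi.single a 1) with hq
  set H : V.Fun := -((d : ℂ) + 1)⁻¹ • ∑ a, X a * r (q a) with hH
  have hd1 : ((d : ℂ) + 1) ≠ 0 := Nat.cast_add_one_ne_zero _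
  have hHfil : H ∈ fil V.idx (d + 1) := by
    refine smul_mem_fil _ (Submodule.sum_mem _ fun a _ => ?_)
    rw [add_comm d]
    exact mul_mem_fil (X_mem_fil a) (h _)
  have hpd : ∀ c, pderiv ℂ c H + r (q c) ∈ fil V.idx (d + 1) := by
    intro c
    have h1 : pderiv ℂ c (∑ a, X a * r (q a)) = r (q c) + ∑ a, X a * pderiv ℂ c (r (q a)) := by
      rw [map_sum]
      simp only [Derivation.leibniz, pderiv_X, smul_eq_mul]
      rw [Finset.sum_add_distrib, add_comm]
      congr 1
      rw [Finset.sum_eq_single c]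
      · simp
      · intro b _ hb
        simp [hb.symm]
      · simp
    have h2 : ∑ a, X a * pderiv ℂ c (r (q a)) - ∑ a, X a * pderiv ℂ a (r (q c)) ∈
        fil V.idx (d + 1) := by
      rw [← Finset.sum_sub_distrib]
      refine Submodule.sum_mem _ fun a _ => ?_
      rw [← mul_sub, add_comm d, ← poisson_codual_single, ← poisson_codual_single]
      exact mul_mem_fil (X_mem_fil a) (hclosed _ _)
    have h3 := euler_sub_mem_fil (h (q c))
    have h4 : pderiv ℂ c H + r (q c) = -((d : ℂ) + 1)⁻¹ •
        ((∑ a, X a * pderiv ℂ c (r (q a)) - ∑ a, X a * pderiv ℂ a (r (q c))) +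
          (∑ a, X a * pderiv ℂ a (r (q c)) - (d : ℂ) • r (q c))) := by
      rw [hH, Derivation.map_smul, h1, sub_add_sub_cancel]
      have h5 : r (q c) = ((d : ℂ) + 1)⁻¹ • ((d : ℂ) • r (q c) + r (q c)) := by
        rw [show (d : ℂ) • r (q c) + r (q c) = ((d : ℂ) + 1) • r (q c) by module, smul_smul,
          inv_mul_cancel₀ hd1, one_smul]
      generalize ((d : ℂ) + 1)⁻¹ = t at h5
      linear_combination (norm := module) h5
    rw [h4]
    exact smul_mem_fil _ (add_mem h2 h3)
  have hHq : ∀ ν, r ν - V.poisson H (lin ν) ∈ fil V.idx (d + 1) := by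
    intro ν
    obtain ⟨w, rfl⟩ := V.exists_codual_eq ν
    have h1 : r (V.codual w) = ∑ a, w a • r (q a) := by
      simp only [hr]
      rw [lin_codual_eq_sum, map_sum, ← Finset.sum_sub_distrib]
      simp [smul_sub, hq]
    have h2 : V.poisson H (lin (V.codual w)) = -∑ a, w a • pderiv ℂ a H := by
      rw [poisson_comm, ← dual_eq_lin, poisson_dual]
    rw [h1, h2, sub_neg_eq_add, ← Finset.sum_add_distrib]
    refine Submodule.sum_mem _ fun a _ => ?_
    rw [← smul_add, add_comm (r _)]
    exact smul_mem_fil _ (hpd a)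
  -- only the component of degree `d + 1` matters
  set H' : V.Fun := homogeneousComponent (d + 1) H with hH'
  have hsub : H - H' ∈ fil V.idx (d + 2) := by
    intro e he
    rw [map_sub, hH', coeff_homogeneousComponent]
    split_ifs with h1
    · rw [sub_self]
    · rw [hHfil e (by omega), sub_zero]
  have hH'v : V.poisson (V.dual v) H' = 0 := by
    have h1 : V.poisson (V.dual v) H ∈ fil V.idx (d + 1) := by
      have h2 := hHq (V.codual v)
      have h3 : r (V.codual v) = 0 := by
        rw [hr, ← dual_eq_lin, hv, sub_self]
      rw [h3, zero_sub, ← dual_eq_lin, ← poisson_comm] at h2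
      exact h2
    have h2 := V.poisson_mem_fil (V.dual v) hsub
    rw [poisson_sub_right] at h2
    have h3 := sub_mem h1 h2
    rw [sub_sub_cancel] at h3
    ext e
    rw [map_zero]
    by_cases he : e.degree < d + 1
    · exact h3 e he
    · rw [poisson_dual, map_sum, Finset.sum_eq_zero]
      intro a _
      rw [map_smul, coeff_pderiv, hH', coeff_homogeneousComponent, if_neg, zero_mul, smul_zero]
      rw [map_add, Finsupp.degree_single]
      omega
  refine ⟨H', ?_, fun ν => ?_⟩
  · have := V.homogeneousComponent_mem_span v hH'v (d + 1)
    convert this using 1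
    ext e
    rw [coeff_homogeneousComponent, hH', coeff_homogeneousComponent]
    split_ifs with he
    · rw [coeff_homogeneousComponent, if_pos he]
    · rfl
  · rw [← hr]
    have h1 := V.poisson_mem_fil_left (lin ν) hsub
    rw [poisson_sub_left] at h1
    have := add_mem (hHq ν) h1
    rwa [sub_add_sub_cancel] at this

/-- The time one flow of a Hamiltonian `h` of degree `d + 1` that is constant in the direction `v` is,
up to higher order, a product of shears, and these commute with every infinitesimally `v`-invariant
operator. -/
theorem exists_commutesWith_approx {V : SymplecticSpace.{u}} {n : ℕ} {v : V.Vec} {P : V.Symb n}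
    (hP : V.StabInv n v P) {d : ℕ} (hd : 2 ≤ d) {h : V.Fun}
    (hh : h ∈ Submodule.span ℂ {f | ∃ lam, V.biv (V.codual v) lam = 0 ∧
        f = (lin lam : V.Fun) ^ (d + 1)}) :
    h ∈ fil V.idx (d + 1) ∧ ∃ γ : V.Fun ≃ₐ[ℂ] V.Fun, IsSymplectic γ ∧ CommutesWith P γ ∧
      γ (V.dual v) = V.dual v ∧
      ∀ ν, γ (lin ν) - lin ν - V.poisson h (lin ν) ∈ fil V.idx (d + 1) := by
  have hpow : ∀ lam : V.Vec, (lin lam : V.Fun) ^ (d + 1) ∈ fil V.idx (d + 1) := fun lam => by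
    simpa using pow_mem_fil (lin_mem_fil lam) (d + 1)
  induction hh using Submodule.closure_induction with
  | zero =>
    refine ⟨zero_mem _, AlgEquiv.refl, fun _ _ => rfl, fun _ => rfl, rfl, fun ν => ?_⟩
    have : V.poisson 0 (lin ν) = 0 := by simpa using V.poisson_C_left (lin ν) 0
    simp [this]
  | smul_mem c f hf =>
    obtain ⟨lam, hlam, rfl⟩ := hf
    obtain ⟨α, h1, h2, -⟩ := V.exists_shear lam (d := d) (by omega) (c * ((d : ℂ) + 1))
    refine ⟨smul_mem_fil _ (hpow lam), α, h1, ?_, ?_, fun ν => ?_⟩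
    · refine commutesWith_shear (by omega) (hP.lieInv ?_) h2
      rw [poisson_comm, poisson_lin_pow_left, dual_eq_lin, poisson_lin, V.biv_neg, hlam]
      simp
    · rw [dual_eq_lin, h2, V.biv_neg, hlam]
      simp
    · rw [h2, poisson_smul_left, poisson_lin_pow_left, poisson_lin, mul_comm _ (C _),
        ← smul_eq_C_mul, smul_smul, smul_smul, add_sub_cancel_left]
      simp [mul_assoc]
  | add x y _ _ hx hy =>
    obtain ⟨hx0, γ, h1, h2, h3, h4⟩ := hx
    obtain ⟨hy0, γ', h1', h2', h3', h4'⟩ := hy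
    refine ⟨add_mem hx0 hy0, γ'.trans γ, h1'.trans h1, fun f => ?_, ?_, fun ν => ?_⟩
    · rw [AlgEquiv.trans_apply, h2', h2]
      rfl
    · rw [AlgEquiv.trans_apply, h3', h3]
    · have h5 : ∀ f ∈ fil V.idx d, γ f - f ∈ fil V.idx (d + 1) := by
        intro f hf
        obtain ⟨e, rfl⟩ : ∃ e, d = e + 1 := ⟨d - 1, by omega⟩
        refine fil_anti (by omega) (sub_mem_fil_of_X (β := γ.toAlgHom) (d := e + 1)
          (fun a => ?_) hf)
        have h6 := add_mem (fil_anti (Nat.le_succ _) (h4 (Pi.single a 1)))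
          (V.poisson_mem_fil_left (lin (Pi.single a 1)) hx0)
        rw [sub_add_cancel, ← X_eq_lin] at h6
        exact h6
      have h6 := algHom_mem_fil γ.toAlgHom (h4' ν)
      have h7 := h5 _ (V.poisson_mem_fil_left (lin ν) hy0)
      have h8 := add_mem (add_mem h6 h7) (h4 ν)
      convert h8 using 1
      change γ (γ' (lin ν)) - _ - _ = γ (γ' (lin ν) - lin ν - V.poisson y (lin ν)) + _ + _
      rw [map_sub, map_sub, poisson_add_left]
      ring

/-- By induction on `k`, which bounds the number of leading terms of `β` still to be removed by
composition with products of shears. Once `β` is the identity to order `M + D`, it does not matter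
modulo `fil V.idx M`. -/
theorem act_sub_mem_fil_of_unipotent {V : SymplecticSpace.{u}} {n : ℕ} {v : V.Vec} {P : V.Symb n}
    (hP : V.StabInv n v P) {D : ℕ} (hD : ∀ (M : ℕ) (f : Fin n → V.Fun) (i : Fin n),
      f i ∈ fil V.idx (M + D) → V.act n P f ∈ fil V.idx M) (M k : ℕ) :
    ∀ β : V.Fun ≃ₐ[ℂ] V.Fun, IsSymplectic β →
      β (V.dual v) = V.dual v → ∀ d, 2 ≤ d → M + D ≤ d + k → (∀ ν, β (lin ν) - lin ν ∈ fil V.idx d) →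
      ∀ f : Fin n → V.Fun, β (V.act n P f) - V.act n P (fun i => β (f i)) ∈ fil V.idx M := by
  induction k with
  | zero =>
    intro β _ _ d hd hK hβ f
    have h1 : ∀ f, β f - f ∈ fil V.idx d := by
      intro f
      have h2 : β f - f = β (f - C (constantCoeff f)) - (f - C (constantCoeff f)) := by
        have : β (C (constantCoeff f)) = C (constantCoeff f) := β.commutes _
        rw [map_sub, this]
        ring
      rw [h2]
      refine sub_mem_fil_of_X (β := β.toAlgHom) (m := 0) (fun a => ?_) ?_
      · rw [X_eq_lin]
        exact hβ _
      · rw [mem_fil_one]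
        simp
    have h3 := multilinear_sub_mem_fil (T := V.actM n P) (K := M + D) (M := M)
      (fun f i hf => by rw [actM_apply]; exact hD M f i hf) (g := fun i => β (f i)) (h := f)
      (fun i => fil_anti (by omega) (h1 (f i)))
    have h4 := sub_mem (fil_anti (M := M) (by omega) (h1 (V.act n P f))) h3
    rw [actM_apply, actM_apply] at h4
    convert h4 using 1
    ring
  | succ k ih =>
    intro β hβs hβv d hd hK hβ f
    obtain ⟨h, hh, hβh⟩ := exists_hamiltonian hβs hd hβ hβv
    obtain ⟨-, γ, h1, h2, h3, h4⟩ := exists_commutesWith_approx hP hd hh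
    have h5 := ih (β.trans γ.symm) (hβs.trans h1.symm) (by
        rw [AlgEquiv.trans_apply, hβv]
        rw [AlgEquiv.symm_apply_eq, h3]) (d + 1) (by omega) (by omega) (fun ν => by
        have h6 := algHom_mem_fil γ.symm.toAlgHom (sub_mem (hβh ν) (h4 ν))
        convert h6 using 1
        change γ.symm (β (lin ν)) - lin ν = γ.symm _
        rw [eq_comm, AlgEquiv.symm_apply_eq, map_sub, AlgEquiv.apply_symm_apply]
        ring) f
    have h6 := algHom_mem_fil γ.toAlgHom h5
    convert h6 using 1
    change _ = γ (γ.symm (β _) - V.act n P fun i => γ.symm (β (f i)))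
    rw [map_sub, AlgEquiv.apply_symm_apply, h2]
    simp only [AlgEquiv.apply_symm_apply]

/-- Infinitesimal invariance implies invariance under the unipotent symplectic automorphisms that fix
`v^*`. -/
theorem commutesWith_of_unipotent {V : SymplecticSpace.{u}} {n : ℕ} {v : V.Vec} {P : V.Symb n}
    (hP : V.StabInv n v P) {β : V.Fun ≃ₐ[ℂ] V.Fun} (hβ : IsSymplectic β)
    (hv : β (V.dual v) = V.dual v) (h : ∀ ν, β (lin ν) - lin ν ∈ fil V.idx 2) :
    CommutesWith P β := by
  intro f
  refine eq_of_forall_sub_mem_fil fun M => ?_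
  obtain ⟨D, hD⟩ := V.act_mem_fil n P
  exact act_sub_mem_fil_of_unipotent hP hD M (M + D) β hβ hv 2 le_rfl (by omega) h f

end SymplecticSpace
namespace SymplecticSpace

open MvPowerSeries

/-! ### Invariance in terms of symbols -/

theorem lin_sub {σ : Type*} [Fintype σ] (μ ν : σ → ℂ) : lin (μ - ν) = lin μ - lin ν := by
  rw [sub_eq_add_neg, lin_add, ← neg_one_smul ℂ, lin_smul]
  simp [sub_eq_add_neg]

theorem carries_iff_of_map_lin {V W : SymplecticSpace.{u}} {n : ℕ} {P : V.Symb n} {Q : W.Symb n}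
    {α : V.Fun ≃ₐ[ℂ] W.Fun} {A : V.Vec ≃ₗ[ℂ] W.Vec} (hA : ∀ ν, α (lin ν) = lin (A ν)) :
    Carries α P Q ↔ ∀ ν : Fin n → V.Vec, symbEval Q (fun i => A (ν i)) = symbEval P ν := by
  have he : ∀ ν, α (expo ν) = expo (A ν) := fun ν => map_expo_of_map_lin α.toAlgHom (hA ν)
  have h1 : ∀ ν : Fin n → V.Vec, α (V.act n P fun i => expo (ν i)) =
      symbEval P ν • expo (∑ i, A (ν i)) := fun ν => by
    rw [act_expo, map_smul, he, map_sum]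
  have h2 : ∀ ν : Fin n → V.Vec, W.act n Q (fun i => α (expo (ν i))) =
      symbEval Q (fun i => A (ν i)) • expo (∑ i, A (ν i)) := fun ν => by
    simp only [he]
    rw [act_expo]
  constructor
  · intro h ν
    have := h fun i => expo (ν i)
    rw [h1, h2, smul_expo_inj] at this
    exact this.symm
  · intro h
    refine carries_of_expo fun ν => ?_
    rw [h1, h2, h]

/-- Whether a symplectic isomorphism carries one operator to another depends on its linear part
only, as soon as one of the operators commutes with enough Hamiltonian vector fields. -/
theorem carries_iff {V W : SymplecticSpace.{u}} {n : ℕ} {v : V.Vec} {P : V.Symb n} {Q : W.Symb n}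
    (hP : V.StabInv n v P) {α : V.Fun ≃ₐ[ℂ] W.Fun} (hα : IsSymplectic α) {A : V.Vec ≃ₗ[ℂ] W.Vec}
    (hA : ∀ μ ν, W.biv (A μ) (A ν) = V.biv μ ν) (hAα : ∀ ν, α (lin ν) - lin (A ν) ∈ fil W.idx 2)
    (hv : α (V.dual v) = lin (A (V.codual v))) :
    Carries α P Q ↔ ∀ ν : Fin n → V.Vec, symbEval Q (fun i => A (ν i)) = symbEval P ν := by
  obtain ⟨γ, h1, h2⟩ := exists_linear_isSymplectic A hA
  rw [← carries_iff_of_map_lin h2]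
  have hcomm : CommutesWith P (α.trans γ.symm) := by
    refine commutesWith_of_unipotent hP (hα.trans h1.symm) ?_ fun ν => ?_
    · rw [AlgEquiv.trans_apply, hv, AlgEquiv.symm_apply_eq, dual_eq_lin, h2]
    · have h3 := algHom_mem_fil γ.symm.toAlgHom (hAα ν)
      convert h3 using 1
      change γ.symm (α _) - _ = γ.symm _
      rw [eq_comm, AlgEquiv.symm_apply_eq, map_sub, AlgEquiv.apply_symm_apply, h2]
  have h3 : ∀ f, γ (γ.symm (α f)) = α f := fun f => γ.apply_symm_apply _
  constructor
  · intro h f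
    obtain ⟨g, hg⟩ : ∃ g : Fin n → V.Fun, ∀ i, α (g i) = γ (f i) :=
      ⟨fun i => α.symm (γ (f i)), fun i => α.apply_symm_apply _⟩
    have h4 : f = fun i => γ.symm (α (g i)) := by
      ext1 i
      rw [hg, γ.symm_apply_apply]
    simp only [← hg]
    rw [← h, ← h3, show γ.symm (α (V.act n P g)) = _ from hcomm g, h4]
    rfl
  · intro h f
    rw [← h3, show γ.symm (α (V.act n P f)) = _ from hcomm f, h]
    simp only [AlgEquiv.trans_apply, h3]

theorem exists_linear_part_of_dual {V W : SymplecticSpace.{u}} {α : V.Fun ≃ₐ[ℂ] W.Fun}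
    (hα : IsSymplectic α) {v : V.Vec} {μ : W.Vec} (hv : α (V.dual v) = lin μ) :
    ∃ A : V.Vec ≃ₗ[ℂ] W.Vec, (∀ μ ν, W.biv (A μ) (A ν) = V.biv μ ν) ∧
      (∀ ν, α (lin ν) - lin (A ν) ∈ fil W.idx 2) ∧ A (V.codual v) = μ := by
  obtain ⟨A, h1, h2⟩ := exists_linear_part hα
  refine ⟨A, h1, h2, ?_⟩
  have h3 := h2 (V.codual v)
  rw [← dual_eq_lin, hv, ← lin_sub] at h3
  exact (sub_eq_zero.mp (eq_zero_of_lin_mem_fil h3)).symm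

/-- Invariance under the stabilizer of `v^*`, in terms of the values of the symbol. -/
theorem mem_invFix_iff {V : SymplecticSpace.{u}} {n : ℕ} {v : V.Vec} {P : V.Symb n} :
    P ∈ V.invFix n v ↔ V.StabInv n v P ∧ ∀ A : V.Vec ≃ₗ[ℂ] V.Vec,
      (∀ μ ν, V.biv (A μ) (A ν) = V.biv μ ν) → A (V.codual v) = V.codual v →
      ∀ ν : Fin n → V.Vec, symbEval P (fun i => A (ν i)) = symbEval P ν := by
  constructor
  · intro h
    refine ⟨stabInv_of_mem_invFix h, fun A hA hv => ?_⟩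
    obtain ⟨γ, h1, h2⟩ := exists_linear_isSymplectic A hA
    rw [← carries_iff_of_map_lin h2]
    exact h γ h1 (by rw [dual_eq_lin, h2, hv])
  · rintro ⟨h, h'⟩ α hα hv
    obtain ⟨A, h1, h2, h3⟩ := exists_linear_part_of_dual (μ := V.codual v) hα hv
    exact (carries_iff h hα h1 h2 (by rw [h3, hv, dual_eq_lin])).mpr (h' A h1 h3)

/-- Membership in the weight `l` part, in terms of the values of the symbol. -/
theorem mem_invWeight_iff {V : SymplecticSpace.{u}} {k l : ℕ} {v : V.Vec} {P : V.Symb k} :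
    P ∈ V.invWeight k l v ↔ V.StabInv k v P ∧ ∀ A : V.Vec ≃ₗ[ℂ] V.Vec,
      (∀ μ ν, V.biv (A μ) (A ν) = V.biv μ ν) → ∀ c : ℂ, A (V.codual v) = c • V.codual v →
      ∀ ν : Fin k → V.Vec, c ^ l * symbEval P (fun i => A (ν i)) = symbEval P ν := by
  have key : ∀ (α : V.Fun ≃ₐ[ℂ] V.Fun) (c : ℂ),
      (∀ f, α (V.act k P (fun i => α.symm (f i))) = c ^ l • V.act k P f) ↔
        Carries α P (c ^ l • P) := by
    intro α c
    constructor
    · intro h f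
      rw [map_smul, Pi.smul_apply, ← h]
      simp only [AlgEquiv.symm_apply_apply]
    · intro h f
      rw [h, map_smul, Pi.smul_apply]
      simp only [AlgEquiv.apply_symm_apply]
  constructor
  · rintro ⟨h0, h⟩
    refine ⟨stabInv_of_mem_invFix h0, fun A hA c hc ν => ?_⟩
    obtain ⟨γ, h1, h2⟩ := exists_linear_isSymplectic A hA
    rw [← symbEval_smul]
    refine (carries_iff_of_map_lin h2).mp ((key γ c).mp (h γ h1 c ?_)) ν
    rw [dual_eq_lin, h2, hc, lin_smul]
  · rintro ⟨h, h'⟩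
    refine ⟨mem_invFix_iff.mpr ⟨h, fun A hA hv ν => ?_⟩, fun α hα c hc => (key α c).mpr ?_⟩
    · simpa using h' A hA 1 (by simpa using hv) ν
    · rw [dual_eq_lin, ← lin_smul, ← dual_eq_lin] at hc
      obtain ⟨A, h1, h2, h3⟩ := exists_linear_part_of_dual hα hc
      refine (carries_iff h hα h1 h2 (by rw [h3, hc])).mpr fun ν => ?_
      rw [symbEval_smul]
      exact h' A h1 c h3 ν

/-- Invariance under all symplectic automorphisms, in terms of the values of the symbol. -/
theorem mem_inv_iff {V : SymplecticSpace.{u}} {n : ℕ} {P : V.Symb n} :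
    P ∈ V.inv n ↔ (∀ lam ν, symbVar V.biv P lam ν = 0) ∧ ∀ A : V.Vec ≃ₗ[ℂ] V.Vec,
      (∀ μ ν, V.biv (A μ) (A ν) = V.biv μ ν) →
      ∀ ν : Fin n → V.Vec, symbEval P (fun i => A (ν i)) = symbEval P ν := by
  -- for `v = 0` the stabilizer of `v^* = 0` is the whole group
  have h0 : P ∈ V.inv n ↔ P ∈ V.invFix n 0 := by
    have h1 : ∀ α : V.Fun ≃ₐ[ℂ] V.Fun, α (V.dual 0) = V.dual 0 := fun α => by simp [dual]
    exact ⟨fun h α hα _ => h α hα, fun h α hα => h α hα (h1 α)⟩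
  rw [h0, mem_invFix_iff, StabInv, codual_zero]
  simp

end SymplecticSpace

/-! ### Bumping one covector -/

section Bump

variable {S I : Type*} [DecidableEq S]

/-- Add `lam` to the covector of the input `i`. -/
def bump (i : S) (lam : I → ℂ) (ν : S → I → ℂ) : S → I → ℂ := Function.update ν i (ν i + lam)

theorem bump_apply (i j : S) (lam : I → ℂ) (ν : S → I → ℂ) :
    bump i lam ν j = ν j + if j = i then lam else 0 := by
  by_cases h : j = i
  · subst h
    simp [bump]
  · simp [bump, h]

theorem bump_comm (i j : S) (lam mu : I → ℂ) (ν : S → I → ℂ) :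
    bump i lam (bump j mu ν) = bump j mu (bump i lam ν) := by
  ext1 x
  simp only [bump_apply]
  abel

theorem bump_bump (i : S) (lam mu : I → ℂ) (ν : S → I → ℂ) :
    bump i lam (bump i mu ν) = bump i (mu + lam) ν := by
  ext1 x
  simp only [bump_apply]
  split_ifs <;> abel

theorem bump_cons_zero {n : ℕ} (lam mu : I → ℂ) (ν : Fin n → I → ℂ) :
    bump 0 mu (Fin.cons lam ν : Fin (n + 1) → I → ℂ) = Fin.cons (lam + mu) ν := by
  simp [bump]

theorem bump_cons_succ {n : ℕ} (i : Fin n) (lam mu : I → ℂ) (ν : Fin n → I → ℂ) :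
    bump i.succ mu (Fin.cons lam ν : Fin (n + 1) → I → ℂ) = Fin.cons lam (bump i mu ν) := by
  simp [bump, Fin.cons_update]

variable [Fintype S]

/-- The sum over the inputs of the values after bumping one covector, minus the contribution of the
output. -/
theorem symbVar_eq (B : LinearMap.BilinForm ℂ (I → ℂ)) (P : MvPolynomial (S × I) ℂ)
    (lam : I → ℂ) (ν : S → I → ℂ) : symbVar B P lam ν =
      ∑ i, B lam (ν i) * symbEval P (bump i lam ν) - B lam (∑ i, ν i) * symbEval P ν := by
  rw [symbVar, map_sum, Finset.sum_mul, ← Finset.sum_sub_distrib]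
  simp only [mul_sub]
  rfl

end Bump

section Division

variable {I : Type*} [Fintype I] [DecidableEq I]

theorem bilin_eq_sum (B : LinearMap.BilinForm ℂ (I → ℂ)) (x y : I → ℂ) :
    B x y = ∑ a, ∑ b, x a * y b * B (Pi.single a 1) (Pi.single b 1) := by
  have h : ∀ x : I → ℂ, x = ∑ a, x a • (Pi.single a (1 : ℂ) : I → ℂ) := fun x => by
    ext c
    simp [Finset.sum_apply, Pi.single_apply]
  conv_lhs => rw [h x, h y]
  simp only [map_sum, LinearMap.sum_apply, map_smul, LinearMap.smul_apply, smul_eq_mul,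
    Finset.mul_sum]
  rw [Finset.sum_comm]
  refine Finset.sum_congr rfl fun a _ => Finset.sum_congr rfl fun b _ => ?_
  ring

/-- The symbol `ν ↦ P (A ν)`. -/
noncomputable def symbComp {S J : Type*} (A : (I → ℂ) →ₗ[ℂ] (J → ℂ)) (P : MvPolynomial (S × J) ℂ) :
    MvPolynomial (S × I) ℂ :=
  MvPolynomial.aeval (fun x : S × J => ∑ a, MvPolynomial.C (A (Pi.single a 1) x.2) *
    MvPolynomial.X (x.1, a)) P

theorem symbEval_symbComp {S J : Type*} (A : (I → ℂ) →ₗ[ℂ] (J → ℂ)) (P : MvPolynomial (S × J) ℂ)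
    (ν : S → I → ℂ) : symbEval (symbComp A P) ν = symbEval P (fun i => A (ν i)) := by
  rw [symbComp, symbEval_aeval]
  congr 1
  ext i b
  have h : ν i = ∑ a, ν i a • (Pi.single a (1 : ℂ) : I → ℂ) := by
    ext c
    simp [Finset.sum_apply, Pi.single_apply]
  conv_rhs => rw [h]
  simp only [symbEval_sum, symbEval_mul, symbEval_C, symbEval_X, map_sum, map_smul,
    Finset.sum_apply, Pi.smul_apply, smul_eq_mul]
  exact Finset.sum_congr rfl fun a _ => mul_comm _ _

/-- The variation of a symbol is a polynomial in all covectors, including the bumping one. -/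
theorem exists_symb_symbVar (B : LinearMap.BilinForm ℂ (I → ℂ)) {n : ℕ}
    (P : MvPolynomial (Fin n × I) ℂ) : ∃ F : MvPolynomial (Fin (n + 1) × I) ℂ,
      ∀ lam ν, symbEval F (Fin.cons lam ν) = symbVar B P lam ν := by
  let bil : Fin n → MvPolynomial (Fin (n + 1) × I) ℂ := fun i => ∑ a, ∑ b,
    MvPolynomial.X (0, a) * MvPolynomial.X (i.succ, b) *
      MvPolynomial.C (B (Pi.single a 1) (Pi.single b 1))
  let sh : Fin n → MvPolynomial (Fin (n + 1) × I) ℂ := fun i => MvPolynomial.aeval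
    (fun x : Fin n × I => MvPolynomial.X (x.1.succ, x.2) +
      if x.1 = i then MvPolynomial.X (0, x.2) else 0) P
  let st : MvPolynomial (Fin (n + 1) × I) ℂ := MvPolynomial.aeval
    (fun x : Fin n × I => MvPolynomial.X (x.1.succ, x.2)) P
  refine ⟨∑ i, bil i * (sh i - st), fun lam ν => ?_⟩
  rw [symbEval_sum, symbVar]
  refine Finset.sum_congr rfl fun i _ => ?_
  rw [symbEval_mul, symbEval_sub, bilin_eq_sum]
  congr 1
  · simp [bil, symbEval_sum]
  · rw [symbEval_aeval, symbEval_aeval]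
    congr 2
    · ext j a
      change _ = bump i lam ν j a
      rw [bump_apply]
      split_ifs <;> simp
    · ext j a
      simp

theorem exists_symb_symbVar_fixed (B : LinearMap.BilinForm ℂ (I → ℂ)) {n : ℕ}
    (P : MvPolynomial (Fin n × I) ℂ) (lam : I → ℂ) : ∃ F : MvPolynomial (Fin n × I) ℂ,
      ∀ ν, symbEval F ν = symbVar B P lam ν := by
  obtain ⟨F, hF⟩ := exists_symb_symbVar B P
  refine ⟨MvPolynomial.aeval (fun x : Fin (n + 1) × I => Fin.cases (MvPolynomial.C (lam x.2))
    (fun j => MvPolynomial.X (j, x.2)) x.1) F, fun ν => ?_⟩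
  rw [symbEval_aeval, ← hF]
  congr 1
  ext i a
  induction i using Fin.cases <;> simp

/-- Symbols can be cancelled against a nonzero linear form in the first covector. -/
theorem symb_eq_of_mul {n : ℕ} {L : (I → ℂ) →ₗ[ℂ] ℂ} (hL : L ≠ 0)
    {F G : MvPolynomial (Fin (n + 1) × I) ℂ}
    (h : ∀ lam ν, L lam * symbEval F (Fin.cons lam ν) = L lam * symbEval G (Fin.cons lam ν)) :
    F = G := by
  let ℓ : MvPolynomial (Fin (n + 1) × I) ℂ :=
    ∑ a, MvPolynomial.C (L (Pi.single a 1)) * MvPolynomial.X (0, a)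
  have hℓ : ∀ ν, symbEval ℓ ν = L (ν 0) := by
    intro ν
    have h : ν 0 = ∑ a, ν 0 a • (Pi.single a (1 : ℂ) : I → ℂ) := by
      ext c
      simp [Finset.sum_apply, Pi.single_apply]
    conv_rhs => rw [h]
    simp [ℓ, symbEval_sum, mul_comm]
  have h0 : ℓ ≠ 0 := by
    intro h0
    apply hL
    ext x
    have := hℓ (fun _ => Pi.single x 1)
    rw [h0, symbEval_zero] at this
    simpa using this.symm
  refine mul_left_cancel₀ h0 (symb_ext fun ν => ?_)
  rw [symbEval_mul, symbEval_mul, hℓ]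
  have := h (ν 0) (Fin.tail ν)
  rwa [Fin.cons_self_tail] at this

/-- A symbol that vanishes whenever its first covector is killed by a linear form is divisible by this
linear form. -/
theorem exists_div_linear {n : ℕ} {L : (I → ℂ) →ₗ[ℂ] ℂ} (hL : L ≠ 0)
    {F : MvPolynomial (Fin (n + 1) × I) ℂ}
    (h : ∀ lam ν, L lam = 0 → symbEval F (Fin.cons lam ν) = 0) :
    ∃ G : MvPolynomial (Fin (n + 1) × I) ℂ,
      ∀ lam ν, symbEval F (Fin.cons lam ν) = L lam * symbEval G (Fin.cons lam ν) := by
  let c : Fin (n + 1) × I → ℂ := fun x => if x.1 = 0 then L (Pi.single x.2 1) else 0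
  have hsum : ∀ x : Fin (n + 1) × I → ℂ, ∑ y, c y * x y = L fun a => x (0, a) := by
    intro x
    have h : (fun a => x (0, a)) = ∑ a, x (0, a) • (Pi.single a (1 : ℂ) : I → ℂ) := by
      ext c
      simp [Finset.sum_apply, Pi.single_apply]
    conv_rhs => rw [h]
    rw [Fintype.sum_prod_type, Fin.sum_univ_succ]
    simp [c, Fin.succ_ne_zero, mul_comm]
  have hc : c ≠ 0 := by
    intro h0
    apply hL
    ext a
    have := congrFun h0 (0, a)
    simpa [c] using this
  obtain ⟨G, hG⟩ := linearForm_dvd_of_eval_eq_zero hc (F := F) fun x hx => by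
    rw [hsum] at hx
    have := h (fun a => x (0, a)) (fun i a => x (i.succ, a)) hx
    rw [symbEval] at this
    convert this using 2
    refine congrArg _ (funext fun x => ?_)
    obtain ⟨i, a⟩ := x
    induction i using Fin.cases <;> simp
  refine ⟨G, fun lam ν => ?_⟩
  rw [hG, symbEval_mul]
  congr 1
  have := hsum fun y => (Fin.cons lam ν : Fin (n + 1) → I → ℂ) y.1 y.2
  simp only [Fin.cons_zero] at this
  rw [← this]
  simp [symbEval_sum]

end Division

/-! ### Adding an input -/

section AddInput

variable {I : Type*} [Fintype I] [DecidableEq I] {B : LinearMap.BilinForm ℂ (I → ℂ)} {p : I → ℂ}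
  {n : ℕ}

/-- The symbols whose variation vanishes for the covectors orthogonal to `p`. -/
def SymbStab (B : LinearMap.BilinForm ℂ (I → ℂ)) (p : I → ℂ) (P : MvPolynomial (Fin n × I) ℂ) :
    Prop := ∀ lam, B p lam = 0 → ∀ ν, symbVar B P lam ν = 0

/-- `P'` is obtained from `P` by adding an input in front. On exponentials `f = e^lam`, the defining
equation says that `P' ({p, f}, …) = ∑ P (…, {f, ·}, …) - {f, P (…)}`, where `{p, f} = B p lam • f`. -/
def IsNext (B : LinearMap.BilinForm ℂ (I → ℂ)) (p : I → ℂ) (P : MvPolynomial (Fin n × I) ℂ)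
    (P' : MvPolynomial (Fin (n + 1) × I) ℂ) : Prop :=
  ∀ lam ν, symbVar B P lam ν = B p lam * symbEval P' (Fin.cons lam ν)

/-- The variation of `P` vanishes on the hyperplane `B p lam = 0`, so it is divisible by this linear
form. -/
theorem exists_isNext (hp : B p ≠ 0) {P : MvPolynomial (Fin n × I) ℂ} (hP : SymbStab B p P) :
    ∃ P', IsNext B p P P' := by
  obtain ⟨F, hF⟩ := exists_symb_symbVar B P
  obtain ⟨G, hG⟩ := exists_div_linear hp (F := F) fun lam ν h => by rw [hF, hP lam h]
  exact ⟨G, fun lam ν => by rw [← hF, hG]⟩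

omit [Fintype I] [DecidableEq I] in
/-- The cocycle identity for the variation, along a direction under which `P` is invariant. It
expresses the Jacobi identity for the brackets with `e^lam` and `e^mu`. -/
theorem symbVar_cocycle (hB : B.IsAlt) {P : MvPolynomial (Fin n × I) ℂ} {mu : I → ℂ}
    (hP : ∀ ν, symbVar B P mu ν = 0) (lam : I → ℂ) (ν : Fin n → I → ℂ) :
    B mu lam * symbVar B P (lam + mu) ν + ∑ i, B mu (ν i) * symbVar B P lam (bump i mu ν) =
      B mu (lam + ∑ i, ν i) * symbVar B P lam ν := by
  have h1 : ∑ i, B mu (ν i) * symbEval P (bump i mu ν) = B mu (∑ i, ν i) * symbEval P ν := by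
    have := hP ν
    rw [symbVar_eq] at this
    linear_combination this
  have hsum : ∀ j (x : I → ℂ), ∑ i, bump j x ν i = ∑ i, ν i + x := by
    intro j x
    simp [bump_apply, Finset.sum_add_distrib]
  have h2 : ∀ j, ∑ i, B mu (ν i) * symbEval P (bump i mu (bump j lam ν)) =
      B mu (∑ i, ν i + lam) * symbEval P (bump j lam ν) -
        B mu lam * symbEval P (bump j (lam + mu) ν) := by
    intro j
    have := hP (bump j lam ν)
    rw [symbVar_eq, hsum] at this
    have e : ∀ i, B mu (bump j lam ν i) * symbEval P (bump i mu (bump j lam ν)) =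
        B mu (ν i) * symbEval P (bump i mu (bump j lam ν)) +
          if i = j then B mu lam * symbEval P (bump j (lam + mu) ν) else 0 := by
      intro i
      rw [bump_apply j i]
      split_ifs with h
      · subst h
        rw [bump_bump, map_add]
        ring
      · rw [add_zero, add_zero]
    simp only [e, Finset.sum_add_distrib, Finset.sum_ite_eq', Finset.mem_univ, if_true] at this
    linear_combination this
  have h3 : ∀ i, symbVar B P lam (bump i mu ν) =
      ∑ j, B lam (ν j) * symbEval P (bump i mu (bump j lam ν)) +
        B lam mu * symbEval P (bump i (lam + mu) ν) -
        (B lam (∑ j, ν j) + B lam mu) * symbEval P (bump i mu ν) := by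
    intro i
    rw [symbVar_eq, hsum, map_add]
    congr 1
    have e : ∀ j, B lam (bump i mu ν j) * symbEval P (bump j lam (bump i mu ν)) =
        B lam (ν j) * symbEval P (bump i mu (bump j lam ν)) +
          if j = i then B lam mu * symbEval P (bump i (lam + mu) ν) else 0 := by
      intro j
      rw [bump_apply i j, bump_comm j i]
      split_ifs with h
      · subst h
        rw [bump_bump, map_add]
        ring
      · rw [add_zero, add_zero]
    simp only [e, Finset.sum_add_distrib, Finset.sum_ite_eq', Finset.mem_univ, if_true]
  have h4 : ∑ i, B mu (ν i) * ∑ j, B lam (ν j) * symbEval P (bump i mu (bump j lam ν)) =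
      B mu (∑ i, ν i + lam) * ∑ j, B lam (ν j) * symbEval P (bump j lam ν) -
        B mu lam * ∑ j, B lam (ν j) * symbEval P (bump j (lam + mu) ν) := by
    simp only [Finset.mul_sum]
    rw [Finset.sum_comm, ← Finset.sum_sub_distrib]
    refine Finset.sum_congr rfl fun j _ => ?_
    have := h2 j
    have e : ∑ i, B mu (ν i) * (B lam (ν j) * symbEval P (bump i mu (bump j lam ν))) =
        B lam (ν j) * ∑ i, B mu (ν i) * symbEval P (bump i mu (bump j lam ν)) := by
      rw [Finset.mul_sum]
      exact Finset.sum_congr rfl fun i _ => by ring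
    rw [e, this]
    ring
  have h5 : ∑ i, B mu (ν i) * symbVar B P lam (bump i mu ν) =
      ∑ i, B mu (ν i) * ∑ j, B lam (ν j) * symbEval P (bump i mu (bump j lam ν)) +
        B lam mu * ∑ i, B mu (ν i) * symbEval P (bump i (lam + mu) ν) -
        (B lam (∑ j, ν j) + B lam mu) * ∑ i, B mu (ν i) * symbEval P (bump i mu ν) := by
    rw [Finset.mul_sum, Finset.mul_sum, ← Finset.sum_add_distrib, ← Finset.sum_sub_distrib]
    refine Finset.sum_congr rfl fun i _ => ?_
    rw [h3]
    ring
  have h6 : symbVar B P (lam + mu) ν = ∑ i, B lam (ν i) * symbEval P (bump i (lam + mu) ν) +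
      ∑ i, B mu (ν i) * symbEval P (bump i (lam + mu) ν) -
      (B lam (∑ i, ν i) + B mu (∑ i, ν i)) * symbEval P ν := by
    rw [symbVar_eq, ← Finset.sum_add_distrib]
    simp only [map_add, LinearMap.add_apply, add_mul]
  have h7 : B lam mu = -B mu lam := (hB.neg_eq mu lam).symm
  rw [h5, h4, h1, h6, symbVar_eq, map_add, map_add, h7]
  ring

/-- The Jacobi identity: adding an input preserves infinitesimal `p`-invariance. -/
theorem IsNext.symbStab (hB : B.IsAlt) (hp : B p ≠ 0) {P : MvPolynomial (Fin n × I) ℂ}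
    {P' : MvPolynomial (Fin (n + 1) × I) ℂ} (h : IsNext B p P P') (hP : SymbStab B p P) :
    SymbStab B p P' := by
  intro mu hmu
  obtain ⟨F, hF⟩ := exists_symb_symbVar_fixed B P' mu
  have hF0 : F = 0 := by
    refine symb_eq_of_mul hp fun lam ν => ?_
    rw [symbEval_zero, mul_zero, hF, symbVar_eq, Fin.sum_univ_succ, Fin.sum_univ_succ]
    simp only [Fin.cons_zero, Fin.cons_succ, bump_cons_zero, bump_cons_succ]
    have h1 := symbVar_cocycle hB (hP mu hmu) lam ν
    have h2 : ∑ i, B mu (ν i) * symbVar B P lam (bump i mu ν) =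
        B p lam * ∑ i, B mu (ν i) * symbEval P' (Fin.cons lam (bump i mu ν)) := by
      rw [Finset.mul_sum]
      refine Finset.sum_congr rfl fun i _ => ?_
      rw [h]
      ring
    rw [h2, h, h, map_add, hmu, add_zero] at h1
    linear_combination h1
  intro ν
  rw [← hF, hF0, symbEval_zero]

/-- Adding an input lowers the weight by one. -/
theorem IsNext.comp (hp : B p ≠ 0) {P : MvPolynomial (Fin n × I) ℂ}
    {P' : MvPolynomial (Fin (n + 1) × I) ℂ} (h : IsNext B p P P') {A : (I → ℂ) →ₗ[ℂ] (I → ℂ)}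
    (hA : ∀ x y, B (A x) (A y) = B x y) {c : ℂ} (hc : A p = c • p) {l j : ℕ}
    (hP : ∀ ν, c ^ l * symbEval P (fun i => A (ν i)) = c ^ j * symbEval P ν)
    (ν : Fin (n + 1) → I → ℂ) :
    c ^ l * symbEval P' (fun i => A (ν i)) = c ^ (j + 1) * symbEval P' ν := by
  have hcons : ∀ lam (ν : Fin n → I → ℂ), (fun i => A ((Fin.cons lam ν : Fin (n + 1) → I → ℂ) i)) =
      Fin.cons (A lam) (fun i => A (ν i)) := by
    intro lam ν
    ext1 i
    induction i using Fin.cases <;> simp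
  have key : c ^ l • symbComp A P' = c ^ (j + 1) • P' := by
    refine symb_eq_of_mul hp fun lam ν => ?_
    rw [symbEval_smul, symbEval_smul, symbEval_symbComp, hcons]
    have h1 := h (A lam) (fun i => A (ν i))
    have h2 : c * B p (A lam) = B p lam := by
      rw [← hA p lam, hc, map_smul, LinearMap.smul_apply, smul_eq_mul]
    have h3 : c ^ l * symbVar B P (A lam) (fun i => A (ν i)) = c ^ j * symbVar B P lam ν := by
      rw [symbVar_eq, symbVar_eq, mul_sub, mul_sub, Finset.mul_sum, Finset.mul_sum]
      congr 1
      · refine Finset.sum_congr rfl fun i _ => ?_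
        have h4 : bump i (A lam) (fun i => A (ν i)) = fun j => A (bump i lam ν j) := by
          ext1 j
          rw [bump_apply, bump_apply, map_add]
          split_ifs <;> simp
        rw [h4, hA]
        linear_combination B lam (ν i) * hP (bump i lam ν)
      · rw [← map_sum, hA]
        linear_combination B lam (∑ i, ν i) * hP ν
    rw [h1, h] at h3
    rw [← h2] at h3 ⊢
    linear_combination c * h3
  have := congrArg (fun F => symbEval F ν) key
  simpa only [symbEval_smul, symbEval_symbComp] using this

end AddInput

/-! ### Vanishing of negative weights -/

section NegativeWeight

variable {S I : Type*}

theorem exists_polynomial_line (P : MvPolynomial (S × I) ℂ) (x y : S → I → ℂ) :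
    ∃ F : Polynomial ℂ, ∀ t, F.eval t = symbEval P fun i => x i + t • y i := by
  refine ⟨MvPolynomial.aeval (fun z : S × I => Polynomial.C (x z.1 z.2) +
    Polynomial.X * Polynomial.C (y z.1 z.2)) P, fun t => ?_⟩
  rw [symbEval, ← Polynomial.coe_evalRingHom, MvPolynomial.aeval_def, MvPolynomial.eval,
    MvPolynomial.hom_eval₂]
  simp only [map_add, map_mul, Polynomial.coe_evalRingHom, Polynomial.eval_C, Polynomial.eval_X]
  congr 1
  ext z
  simp

/-- A polynomial `F` for which `t^d F(t)` is a polynomial in `t⁻¹` is zero. -/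
theorem Polynomial.eq_zero_of_eval_inv {F G : Polynomial ℂ} {d : ℕ} (hd : 0 < d)
    (h : ∀ t : ℂ, t ≠ 0 → t ^ d * F.eval t = G.eval t⁻¹) : F = 0 := by
  have h1 : Polynomial.X ^ (F.natDegree + d) * G = F.reverse := by
    refine Polynomial.eq_of_infinite_eval_eq _ _ (Set.Infinite.mono (s := {0}ᶜ) ?_
      (Set.finite_singleton _).infinite_compl)
    intro x (hx : x ≠ 0)
    have h2 := h x⁻¹ (inv_ne_zero hx)
    rw [inv_inv] at h2
    let : Invertible x⁻¹ := invertibleOfNonzero (inv_ne_zero hx)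
    have h3 := Polynomial.eval₂_reverse_mul_pow (RingHom.id ℂ) x⁻¹ F
    simp only [Polynomial.eval₂_id, invOf_eq_inv, inv_inv] at h3
    simp only [Set.mem_ofPred_eq, Polynomial.eval_mul, Polynomial.eval_pow, Polynomial.eval_X]
    rw [← h2, ← h3, pow_add, inv_pow, inv_pow]
    field_simp
  have h2 : G = 0 := by
    by_contra hG
    have h3 := congrArg Polynomial.natDegree h1
    rw [Polynomial.natDegree_X_pow_mul _ hG] at h3
    have := Polynomial.reverse_natDegree_le F
    omega
  rw [h2, mul_zero] at h1
  exact Polynomial.reverse_eq_zero.mp h1.symm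

variable {B : LinearMap.BilinForm ℂ (I → ℂ)} {p q : I → ℂ}

/-- The transvection `ν ↦ ν + t B(u, ν) u`. -/
noncomputable def transvect (B : LinearMap.BilinForm ℂ (I → ℂ)) (u : I → ℂ) (t : ℂ) :
    (I → ℂ) →ₗ[ℂ] (I → ℂ) := LinearMap.id + t • (B u).smulRight u

theorem transvect_apply (u : I → ℂ) (t : ℂ) (ν : I → ℂ) :
    transvect B u t ν = ν + (t * B u ν) • u := by
  simp [transvect, smul_smul]

theorem bilin_transvect (hB : B.IsAlt) (u : I → ℂ) (t : ℂ) (x y : I → ℂ) :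
    B (transvect B u t x) (transvect B u t y) = B x y := by
  have h1 : B x u = -B u x := (hB.neg_eq u x).symm
  have h2 : B u u = 0 := hB u
  simp only [transvect_apply, map_add, map_smul, LinearMap.add_apply, LinearMap.smul_apply,
    smul_eq_mul, h1, h2]
  ring

/-- The torus element that scales `p` by `c` and `q` by `c⁻¹` and fixes the orthogonal complement
of both. -/
noncomputable def torus (B : LinearMap.BilinForm ℂ (I → ℂ)) (p q : I → ℂ) (c : ℂ) :
    (I → ℂ) →ₗ[ℂ] (I → ℂ) :=
  LinearMap.id - (c - 1) • (B q).smulRight p + (c⁻¹ - 1) • (B p).smulRight q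

theorem torus_apply (c : ℂ) (ν : I → ℂ) :
    torus B p q c ν = ν - ((c - 1) * B q ν) • p + ((c⁻¹ - 1) * B p ν) • q := by
  simp [torus, smul_smul]

theorem bilin_torus (hB : B.IsAlt) (hpq : B p q = 1) {c : ℂ} (hc : c ≠ 0) (x y : I → ℂ) :
    B (torus B p q c x) (torus B p q c y) = B x y := by
  have h1 : B x p = -B p x := (hB.neg_eq p x).symm
  have h2 : B x q = -B q x := (hB.neg_eq q x).symm
  have h3 : B q p = -1 := by rw [← hB.neg_eq, hpq]
  have h4 : B p p = 0 := hB p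
  have h5 : B q q = 0 := hB q
  simp only [torus_apply, map_add, map_sub, map_smul, LinearMap.add_apply, LinearMap.sub_apply,
    LinearMap.smul_apply, smul_eq_mul, h1, h2, h3, h4, h5, hpq]
  field_simp
  ring

theorem torus_self (hB : B.IsAlt) (hpq : B p q = 1) (c : ℂ) : torus B p q c p = c • p := by
  have h3 : B q p = -1 := by rw [← hB.neg_eq, hpq]
  have h4 : B p p = 0 := hB p
  rw [torus_apply, h3, h4]
  module

/-- A Bruhat decomposition in `SL₂`. -/
theorem transvect_eq (hB : B.IsAlt) (hpq : B p q = 1) {t : ℂ} (ht : t ≠ 0) (ν : I → ℂ) :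
    transvect B p t⁻¹ (transvect B q t ν) = torus B p q t⁻¹ (transvect B p 1 (transvect B q 1
      (transvect B p 1 (transvect B p (-t⁻¹) ν)))) := by
  have h3 : B q p = -1 := by rw [← hB.neg_eq, hpq]
  have h4 : B p p = 0 := hB p
  have h5 : B q q = 0 := hB q
  simp only [transvect_apply, torus_apply, map_add, map_smul, h3, h4, h5, hpq]
  match_scalars
  · ring
  · field_simp
    ring
  · field_simp
    ring

/-- A symbol of negative weight `l - j` under the stabilizer of the line of `p` vanishes: along the
opposite unipotent subgroup it is a polynomial that tends to zero at infinity. -/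
theorem eq_zero_of_weight (hB : B.IsAlt) (hpq : B p q = 1) {P : MvPolynomial (S × I) ℂ} {l j : ℕ}
    (hlj : l < j) (hP : ∀ A : (I → ℂ) →ₗ[ℂ] (I → ℂ), (∀ x y, B (A x) (A y) = B x y) →
      ∀ c : ℂ, c ≠ 0 → A p = c • p → ∀ ν : S → I → ℂ,
      c ^ l * symbEval P (fun i => A (ν i)) = c ^ j * symbEval P ν) : P = 0 := by
  refine symb_ext fun ν => ?_
  rw [symbEval_zero]
  have hu : ∀ t (ν : S → I → ℂ), symbEval P (fun i => transvect B p t (ν i)) = symbEval P ν := by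
    intro t ν
    simpa using hP (transvect B p t) (bilin_transvect hB p t) 1 one_ne_zero
      (by rw [transvect_apply, hB p]; simp) ν
  -- the Weyl group element of the `SL₂` of `p` and `q`
  set s : (I → ℂ) →ₗ[ℂ] (I → ℂ) := transvect B p 1 ∘ₗ transvect B q 1 ∘ₗ transvect B p 1 with hs
  obtain ⟨F, hF⟩ := exists_polynomial_line P ν fun i => B q (ν i) • q
  obtain ⟨G, hG⟩ := exists_polynomial_line P (fun i => s (ν i)) fun i => s (-B p (ν i) • p)
  have hFG : F = 0 := by
    refine Polynomial.eq_zero_of_eval_inv (G := G) (d := j - l) (by omega) fun t ht => ?_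
    have h1 : F.eval t = symbEval P fun i => transvect B p t⁻¹ (transvect B q t (ν i)) := by
      rw [hF, hu]
      simp only [transvect_apply, smul_smul]
    have h2 : G.eval t⁻¹ = symbEval P fun i => s (transvect B p (-t⁻¹) (ν i)) := by
      rw [hG]
      congr 1
      ext1 i
      rw [← map_smul, ← map_add, transvect_apply]
      congr 2
      module
    have h3 := hP (torus B p q t⁻¹) (bilin_torus hB hpq (inv_ne_zero ht)) t⁻¹ (inv_ne_zero ht)
      (torus_self hB hpq _) fun i => s (transvect B p (-t⁻¹) (ν i))
    simp only [transvect_eq hB hpq ht] at h1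
    rw [h1, h2]
    obtain ⟨e, rfl⟩ := Nat.exists_eq_add_of_le hlj.le
    rw [Nat.add_sub_cancel_left]
    rw [pow_add, mul_assoc] at h3
    have h4 := mul_left_cancel₀ (pow_ne_zero l (inv_ne_zero ht)) h3
    rw [show (fun i => torus B p q t⁻¹ (transvect B p 1 (transvect B q 1 (transvect B p 1
      (transvect B p (-t⁻¹) (ν i)))))) = fun i => torus B p q t⁻¹ (s (transvect B p (-t⁻¹) (ν i)))
      from rfl, h4, ← mul_assoc, ← mul_pow, mul_inv_cancel₀ ht, one_pow, one_mul]
  have h := hF 0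
  rw [hFG, Polynomial.eval_zero] at h
  simpa using h.symm

end NegativeWeight

/-! ### The linear term in the added input -/

section LinearTerm

variable {S I : Type*} [Fintype I] [DecidableEq I]

/-- The derivative of a symbol in the covector of the input `i`. -/
noncomputable def symbGrad (P : MvPolynomial (S × I) ℂ) (ν : S → I → ℂ) (i : S) :
    (I → ℂ) →ₗ[ℂ] ℂ :=
  ∑ a, symbEval (MvPolynomial.pderiv (i, a) P) ν • LinearMap.proj a

omit [DecidableEq I] in
theorem symbGrad_apply (P : MvPolynomial (S × I) ℂ) (ν : S → I → ℂ) (i : S) (x : I → ℂ) :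
    symbGrad P ν i x = ∑ a, symbEval (MvPolynomial.pderiv (i, a) P) ν * x a := by
  simp [symbGrad]

omit [DecidableEq I] in
theorem hasDerivAt_symbEval [Fintype S] (P : MvPolynomial (S × I) ℂ) {c : ℂ → S → I → ℂ}
    {δ : S → I → ℂ} {t : ℂ} (hc : ∀ i a, HasDerivAt (fun t => c t i a) (δ i a) t) :
    HasDerivAt (fun t => symbEval P (c t)) (∑ i, symbGrad P (c t) i (δ i)) t := by
  classical
  simp only [symbGrad_apply]
  induction P using MvPolynomial.induction_on with
  | C z => simpa using hasDerivAt_const t z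
  | add P Q hP hQ =>
    simp only [map_add, symbEval_add, add_mul, Finset.sum_add_distrib]
    exact hP.add hQ
  | mul_X P x hP =>
    have h := hP.mul (hc x.1 x.2)
    simp only [symbEval_mul, symbEval_X]
    refine HasDerivAt.congr_deriv h ?_
    simp only [Derivation.leibniz, symbEval_add, smul_eq_mul, symbEval_mul, symbEval_X, add_mul,
      Finset.sum_add_distrib]
    rw [add_comm]
    congr 1
    · rw [Finset.sum_eq_single x.1, Finset.sum_eq_single x.2]
      · simp [symbEval]
      · intro a _ ha
        rw [MvPolynomial.pderiv_X_of_ne]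
        · simp
        · intro h
          exact ha (by rw [h])
      · simp
      · intro i _ hi
        refine Finset.sum_eq_zero fun a _ => ?_
        rw [MvPolynomial.pderiv_X_of_ne]
        · simp
        · intro h
          exact hi (by rw [h])
      · simp
    · rw [Finset.sum_mul]
      refine Finset.sum_congr rfl fun i _ => ?_
      rw [Finset.sum_mul]
      exact Finset.sum_congr rfl fun a _ => by ring

variable {B : LinearMap.BilinForm ℂ (I → ℂ)} {p q : I → ℂ} {n : ℕ}

omit [DecidableEq I] in
/-- The infinitesimal torus action on a symbol of weight `l - j`. -/
theorem sum_symbGrad (hB : B.IsAlt) (hpq : B p q = 1) {P : MvPolynomial (Fin n × I) ℂ} {l j : ℕ}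
    (hP : ∀ A : (I → ℂ) →ₗ[ℂ] (I → ℂ), (∀ x y, B (A x) (A y) = B x y) →
      ∀ c : ℂ, c ≠ 0 → A p = c • p → ∀ ν : Fin n → I → ℂ,
      c ^ l * symbEval P (fun i => A (ν i)) = c ^ j * symbEval P ν) (ν : Fin n → I → ℂ) :
    ∑ i, (B q (ν i) * symbGrad P ν i p + B p (ν i) * symbGrad P ν i q) =
      ((l : ℂ) - j) * symbEval P ν := by
  have h1 : HasDerivAt (fun c : ℂ => symbEval P fun i => torus B p q c (ν i))
      (∑ i, symbGrad P (fun i => torus B p q 1 (ν i)) i (-B q (ν i) • p - B p (ν i) • q)) 1 := by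
    refine hasDerivAt_symbEval P fun i a => ?_
    simp only [torus_apply, Pi.add_apply, Pi.sub_apply, Pi.smul_apply, smul_eq_mul]
    have h2 := ((((hasDerivAt_id (1 : ℂ)).sub_const 1).mul_const (B q (ν i))).mul_const (p a))
    have h3 := (((hasDerivAt_inv (one_ne_zero' ℂ)).sub_const 1).mul_const
      (B p (ν i))).mul_const (q a)
    have h4 := (h2.const_sub (ν i a)).add h3
    refine HasDerivAt.congr_deriv h4 ?_
    norm_num
    ring
  have h2 : (fun i => torus B p q 1 (ν i)) = ν := by
    ext1 i
    rw [torus_apply]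
    simp
  rw [h2] at h1
  have h3 := (hasDerivAt_pow l (1 : ℂ)).mul h1
  have h4 := (hasDerivAt_pow j (1 : ℂ)).mul_const (symbEval P ν)
  have h5 : (fun c : ℂ => c ^ l * symbEval P fun i => torus B p q c (ν i)) =ᶠ[nhds 1]
      fun c => c ^ j * symbEval P ν := by
    filter_upwards [isOpen_compl_singleton.mem_nhds (one_ne_zero' ℂ)] with c hc
    exact hP _ (bilin_torus hB hpq hc) c hc (torus_self hB hpq c) ν
  have h6 := (h3.congr_of_eventuallyEq h5.symm).unique h4
  simp only [one_pow, mul_one, one_mul, h2, map_sub, map_smul, smul_eq_mul,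
    Finset.sum_sub_distrib] at h6
  rw [Finset.sum_add_distrib]
  simp only [neg_mul, Finset.sum_neg_distrib] at h6
  linear_combination -h6

omit [DecidableEq I] in
/-- The defining equation of `P'` degenerates at `lam = s • p`, where `B p lam = 0`. Its derivative in
the direction `q` determines `P'` there. -/
theorem IsNext.eval_smul (hB : B.IsAlt) (hpq : B p q = 1) {P : MvPolynomial (Fin n × I) ℂ}
    {P' : MvPolynomial (Fin (n + 1) × I) ℂ} (h : IsNext B p P P') (s : ℂ) (ν : Fin n → I → ℂ) :
    symbEval P' (Fin.cons (s • p) ν) =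
      ∑ i, (B q (ν i) * (symbEval P (bump i (s • p) ν) - symbEval P ν) +
        s * B p (ν i) * symbGrad P (bump i (s • p) ν) i q) := by
  have hpp : B p p = 0 := hB p
  have hc : ∀ i a, HasDerivAt (fun ε : ℂ => bump i (s • p + ε • q) ν i a) (q a) 0 := by
    intro i a
    have h1 := ((hasDerivAt_id (0 : ℂ)).mul_const (q a)).const_add (ν i a + s * p a)
    simp only [bump_apply, if_true, Pi.add_apply, Pi.smul_apply, smul_eq_mul, ← add_assoc]
    simpa using h1
  have hc' : ∀ i j a, HasDerivAt (fun ε : ℂ => bump i (s • p + ε • q) ν j a)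
      ((if j = i then q else 0) a) 0 := by
    intro i j a
    by_cases hij : j = i
    · subst hij
      simpa using hc j a
    · simp only [bump_apply, if_neg hij, add_zero]
      simpa using hasDerivAt_const (0 : ℂ) (ν j a)
  have h1 : HasDerivAt (fun ε : ℂ => symbVar B P (s • p + ε • q) ν)
      (∑ i, (B q (ν i) * (symbEval P (bump i (s • p) ν) - symbEval P ν) +
        s * B p (ν i) * symbGrad P (bump i (s • p) ν) i q)) 0 := by
    refine HasDerivAt.fun_sum fun i _ => ?_
    have h2 := hasDerivAt_symbEval P (hc' i)
    have h3 : HasDerivAt (fun ε : ℂ => B (s • p + ε • q) (ν i)) (B q (ν i)) 0 := by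
      have := ((hasDerivAt_id (0 : ℂ)).mul_const (B q (ν i))).const_add (s * B p (ν i))
      simpa using this
    have h4 := h3.mul (h2.sub_const (symbEval P ν))
    refine h4.congr_deriv ?_
    have h5 : ∑ j, symbGrad P (bump i (s • p) ν) j (if j = i then q else 0) =
        symbGrad P (bump i (s • p) ν) i q := by
      rw [Finset.sum_eq_single i]
      · simp
      · intro j _ hj
        simp [hj]
      · simp
    simp only [zero_smul, add_zero, h5, map_smul, LinearMap.smul_apply, smul_eq_mul]
  have h2 : HasDerivAt (fun ε : ℂ => symbEval P' (Fin.cons (s • p + ε • q) ν))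
      (∑ j, symbGrad P' (Fin.cons (s • p + (0 : ℂ) • q) ν) j
        ((Fin.cons q 0 : Fin (n + 1) → I → ℂ) j)) 0 := by
    refine hasDerivAt_symbEval P' fun j a => ?_
    induction j using Fin.cases with
    | zero =>
      have := ((hasDerivAt_id (0 : ℂ)).mul_const (q a)).const_add (s * p a)
      simpa using this
    | succ j => simpa using hasDerivAt_const (0 : ℂ) (ν j a)
  have h3 := (hasDerivAt_id (0 : ℂ)).mul h2
  have h4 : (fun ε : ℂ => symbVar B P (s • p + ε • q) ν) =
      id * fun ε => symbEval P' (Fin.cons (s • p + ε • q) ν) := by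
    ext1 ε
    rw [h, Pi.mul_apply, map_add, map_smul, map_smul, hpp, hpq]
    simp
  rw [h4] at h1
  have h5 := h1.unique h3
  simpa using h5.symm

omit [DecidableEq I] in
/-- The linear term of `P'` in the added covector, along the line of `p`, is `P` times the weight. -/
theorem IsNext.hasDerivAt (hB : B.IsAlt) (hpq : B p q = 1) {P : MvPolynomial (Fin n × I) ℂ}
    {P' : MvPolynomial (Fin (n + 1) × I) ℂ} (h : IsNext B p P P') {l j : ℕ}
    (hP : ∀ A : (I → ℂ) →ₗ[ℂ] (I → ℂ), (∀ x y, B (A x) (A y) = B x y) →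
      ∀ c : ℂ, c ≠ 0 → A p = c • p → ∀ ν : Fin n → I → ℂ,
      c ^ l * symbEval P (fun i => A (ν i)) = c ^ j * symbEval P ν) (ν : Fin n → I → ℂ) :
    HasDerivAt (fun s : ℂ => symbEval P' (Fin.cons (s • p) ν)) (((l : ℂ) - j) * symbEval P ν)
      0 := by
  simp only [h.eval_smul hB hpq, ← sum_symbGrad hB hpq hP]
  have hc' : ∀ i j a, HasDerivAt (fun s : ℂ => bump i (s • p) ν j a)
      ((if j = i then p else 0) a) 0 := by
    intro i j a
    simp only [bump_apply]
    by_cases hij : j = i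
    · have := ((hasDerivAt_id (0 : ℂ)).mul_const (p a)).const_add (ν j a)
      simpa [hij] using this
    · simpa [hij] using hasDerivAt_const (0 : ℂ) (ν j a)
  refine HasDerivAt.fun_sum fun i _ => HasDerivAt.add ?_ ?_
  · have h1 := ((hasDerivAt_symbEval P (hc' i)).sub_const (symbEval P ν)).const_mul (B q (ν i))
    refine h1.congr_deriv ?_
    rw [Finset.sum_eq_single i]
    · simp [bump]
    · intro j _ hj
      simp [hj]
    · simp
  · have h1 : ∃ d, HasDerivAt (fun s : ℂ => symbGrad P (bump i (s • p) ν) i q) d 0 := by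
      simp only [symbGrad_apply]
      exact ⟨_, HasDerivAt.fun_sum fun a _ => (hasDerivAt_symbEval _ (hc' i)).mul_const (q a)⟩
    obtain ⟨d, hd⟩ := h1
    have h2 := ((hasDerivAt_id (0 : ℂ)).mul_const (B p (ν i))).mul hd
    refine h2.congr_deriv ?_
    simp [bump]

omit [DecidableEq I] in
theorem IsNext.eval_zero {P : MvPolynomial (Fin n × I) ℂ} (hB : B.IsAlt) (hpq : B p q = 1)
    {P' : MvPolynomial (Fin (n + 1) × I) ℂ} (h : IsNext B p P P') (ν : Fin n → I → ℂ) :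
    symbEval P' (Fin.cons 0 ν) = 0 := by
  have := h.eval_smul hB hpq 0 ν
  rw [zero_smul] at this
  rw [this]
  simp [bump]

end LinearTerm

/-! ### Values of symbols in algebras -/

section SymbAt

variable {S T I : Type*} {R R' : Type*} [CommRing R] [Algebra ℂ R] [CommRing R'] [Algebra ℂ R']

/-- The value of a symbol at a family of covectors with coefficients in a commutative algebra. -/
noncomputable def symbAt (x : S → I → R) : MvPolynomial (S × I) ℂ →ₐ[ℂ] R :=
  MvPolynomial.aeval fun y => x y.1 y.2

@[simp]
theorem symbAt_X (x : S → I → R) (y : S × I) : symbAt x (MvPolynomial.X y) = x y.1 y.2 := by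
  simp [symbAt]

theorem symbAt_complex (x : S → I → ℂ) (P : MvPolynomial (S × I) ℂ) :
    symbAt x P = symbEval P x := by
  rw [symbAt, symbEval, MvPolynomial.aeval_eq_eval]

theorem map_symbAt (φ : R →ₐ[ℂ] R') (x : S → I → R) (P : MvPolynomial (S × I) ℂ) :
    φ (symbAt x P) = symbAt (fun i a => φ (x i a)) P := by
  rw [← AlgHom.comp_apply]
  congr 1
  apply MvPolynomial.algHom_ext
  intro y
  simp

theorem symbAt_aeval {J : Type*} (x : T → I → R) (g : S × J → MvPolynomial (T × I) ℂ)
    (P : MvPolynomial (S × J) ℂ) :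
    symbAt x (MvPolynomial.aeval g P) = symbAt (fun i a => symbAt x (g (i, a))) P := by
  rw [← AlgHom.comp_apply]
  congr 1
  apply MvPolynomial.algHom_ext
  intro y
  simp

end SymbAt

/-! ### Iterated brackets -/

section Iterate

variable {I : Type*} [Fintype I] [DecidableEq I] {B : LinearMap.BilinForm ℂ (I → ℂ)}
  {p q : I → ℂ} {n : ℕ}

/-- The symbol `P` has weight `l - j` under the stabilizer of the line of `p`. -/
def SymbWeight {S : Type*} (B : LinearMap.BilinForm ℂ (I → ℂ)) (p : I → ℂ) (l j : ℕ)
    (P : MvPolynomial (S × I) ℂ) : Prop :=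
  ∀ A : (I → ℂ) →ₗ[ℂ] (I → ℂ), (∀ x y, B (A x) (A y) = B x y) →
    ∀ c : ℂ, c ≠ 0 → A p = c • p → ∀ ν : S → I → ℂ,
    c ^ l * symbEval P (fun i => A (ν i)) = c ^ j * symbEval P ν

omit [DecidableEq I] in
/-- The expansion of `P'` to first order in the parameter `t`, when the added covector is `t p`. -/
theorem IsNext.exists_expansion (hB : B.IsAlt) (hpq : B p q = 1) {P : MvPolynomial (Fin n × I) ℂ}
    {P' : MvPolynomial (Fin (n + 1) × I) ℂ} (h : IsNext B p P P') {l j : ℕ}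
    (hP : SymbWeight B p l j P) {R : Type*} [CommRing R] [Algebra ℂ R] {x : Fin (n + 1) → I → R}
    {t : R} (hx : ∀ a, x 0 a = t * algebraMap ℂ R (p a)) :
    ∃ r, symbAt x P' = ((l : ℂ) - j) • (t * symbAt (fun i => x i.succ) P) + t ^ 2 * r := by
  -- the generic case: the parameter and the other covectors are indeterminates
  let y : Fin (n + 1) → I → Polynomial (MvPolynomial (Fin n × I) ℂ) :=
    Fin.cons (fun a => Polynomial.X * Polynomial.C (MvPolynomial.C (p a)))
      fun i a => Polynomial.C (MvPolynomial.X (i, a))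
  have hev : ∀ (ν : Fin n → I → ℂ) (s : ℂ), ((symbAt y P').map
      (MvPolynomial.eval fun z => ν z.1 z.2)).eval s = symbEval P' (Fin.cons (s • p) ν) := by
    intro ν s
    let φ : Polynomial (MvPolynomial (Fin n × I) ℂ) →ₐ[ℂ] ℂ :=
      { toRingHom := (Polynomial.evalRingHom s).comp
          (Polynomial.mapRingHom (MvPolynomial.eval fun z => ν z.1 z.2))
        commutes' := fun c => by
          simp [Polynomial.algebraMap_apply, MvPolynomial.algebraMap_eq] }
    have h1 : ∀ F, φ F = (F.map (MvPolynomial.eval fun z => ν z.1 z.2)).eval s := fun F => rfl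
    rw [← h1, map_symbAt, symbAt_complex]
    congr 1
    ext i a
    rw [h1]
    induction i using Fin.cases with
    | zero => simpa [y] using mul_comm _ _
    | succ i => simp [y]
  have h0 : (symbAt y P').coeff 0 = 0 := by
    refine symb_ext fun ν => ?_
    have := hev ν 0
    rw [zero_smul, h.eval_zero hB hpq, ← Polynomial.coeff_zero_eq_eval_zero,
      Polynomial.coeff_map] at this
    rw [symbEval_zero]
    exact this
  have h1 : (symbAt y P').coeff 1 = ((l : ℂ) - j) • P := by
    refine symb_ext fun ν => ?_
    set F := (symbAt y P').map (MvPolynomial.eval fun z => ν z.1 z.2) with hF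
    have h2 := F.hasDerivAt 0
    simp only [hF, hev] at h2
    have h3 := h2.unique (h.hasDerivAt hB hpq hP ν)
    rw [← Polynomial.coeff_zero_eq_eval_zero, Polynomial.coeff_derivative, Polynomial.coeff_map]
      at h3
    rw [symbEval_smul]
    simp only [zero_add, Nat.cast_zero, mul_one] at h3
    exact h3
  have h2 : Polynomial.X ^ 2 ∣ symbAt y P' - Polynomial.X * Polynomial.C (((l : ℂ) - j) • P) := by
    rw [Polynomial.X_pow_dvd_iff]
    intro d hd
    interval_cases d <;> simp [h0, h1]
  obtain ⟨G, hG⟩ := h2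
  let ev : Polynomial (MvPolynomial (Fin n × I) ℂ) →ₐ[ℂ] R :=
    { toRingHom := Polynomial.eval₂RingHom (symbAt fun i : Fin n => x i.succ).toRingHom t
      commutes' := fun c => by
        simp [Polynomial.algebraMap_apply] }
  have h3 : ev (symbAt y P') = symbAt x P' := by
    rw [map_symbAt]
    congr 2
    ext i a
    change Polynomial.eval₂ (symbAt fun i : Fin n => x i.succ).toRingHom t _ = _
    induction i using Fin.cases with
    | zero => simpa [y, hx, ← MvPolynomial.algebraMap_eq] using mul_comm _ _
    | succ i => simp [y]
  refine ⟨ev G, ?_⟩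
  rw [← h3, sub_eq_iff_eq_add.mp hG, map_add, map_mul, add_comm]
  congr 1
  · change Polynomial.eval₂ (symbAt fun i : Fin n => x i.succ).toRingHom t _ = _
    simp [mul_comm t]
  · change Polynomial.eval₂ (symbAt fun i : Fin n => x i.succ).toRingHom t _ * _ = _
    simp

/-- Adding `j` inputs to an operator of weight `l`. The coefficient `d` of the original operator is
`l (l - 1) ⋯ (l - j + 1)`, so it does not vanish for `j ≤ l`. -/
theorem exists_iterate (hB : B.IsAlt) (hpq : B p q = 1) {k l : ℕ} {ψ : MvPolynomial (Fin k × I) ℂ}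
    (h1 : SymbStab B p ψ) (h2 : SymbWeight B p l 0 ψ) (j : ℕ) :
    ∃ P : MvPolynomial (Fin (k + j) × I) ℂ, SymbStab B p P ∧ SymbWeight B p l j P ∧
      ∃ d : ℂ, (j ≤ l → d ≠ 0) ∧ ∀ (R : Type w) [CommRing R] [Algebra ℂ R]
        (x : Fin (k + j) → I → R) (t : Fin j → R),
        (∀ i a, x ⟨i.1, by omega⟩ a = t i * algebraMap ℂ R (p a)) →
        symbAt x P - d • ((∏ i, t i) * symbAt (fun i : Fin k => x ⟨j + i.1, by omega⟩) ψ) ∈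
          Ideal.span (Set.range fun i => t i ^ 2) := by
  have hp : B p ≠ 0 := by
    intro h
    rw [h] at hpq
    simp at hpq
  induction j with
  | zero =>
    refine ⟨ψ, h1, h2, 1, fun _ => one_ne_zero, fun R _ _ x t hx => ?_⟩
    simp
  | succ j ih =>
    obtain ⟨P, hP1, hP2, d, hd, hP⟩ := ih
    obtain ⟨P', hP'⟩ := exists_isNext hp hP1
    refine ⟨P', hP'.symbStab hB hp hP1, fun A hA c _ hcp ν =>
      hP'.comp hp hA hcp (hP2 A hA c ‹_› hcp) ν, ((l : ℂ) - j) * d, fun hj => ?_,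
      fun R _ _ x t hx => ?_⟩
    · refine mul_ne_zero ?_ (hd (by omega))
      rw [sub_ne_zero]
      exact Nat.cast_injective.ne (by omega : l ≠ j)
    · obtain ⟨r, hr⟩ := hP'.exists_expansion hB hpq hP2 (x := x) (t := t 0) fun a => hx 0 a
      have h3 := hP R (fun i => x i.succ) (fun i => t i.succ) fun i a => hx i.succ a
      have h4 : Ideal.span (Set.range fun i : Fin j => t i.succ ^ 2) ≤
          Ideal.span (Set.range fun i => t i ^ 2) := by
        refine Ideal.span_mono ?_
        rintro _ ⟨i, rfl⟩
        exact ⟨i.succ, rfl⟩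
      have h5 : t 0 ^ 2 ∈ Ideal.span (Set.range fun i => t i ^ 2) :=
        Ideal.subset_span ⟨0, rfl⟩
      have h6 : (fun i : Fin k => x (Fin.succ (⟨j + i.1, by omega⟩ : Fin (k + j)))) =
          fun i : Fin k => x ⟨j + 1 + i.1, by omega⟩ := by
        ext1 i
        congr 1
        ext
        simp
        omega
      rw [h6] at h3
      rw [hr, Fin.prod_univ_succ]
      have h7 := add_mem (Ideal.mul_mem_left _ (algebraMap ℂ R ((l : ℂ) - j) * t 0) (h4 h3))
        (Ideal.mul_mem_right r _ h5)
      convert h7 using 1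
      simp only [Algebra.smul_def, map_mul]
      ring

/-- From an operator of weight `l` that is invariant under the stabilizer of `p` one obtains an
invariant operator by adding `l` inputs: the operator with one more input has weight `-1`, so it
vanishes, and it measures the variation of the previous one. Multiplying the covectors of the new inputs by the
parameters `t i` recovers the original operator from the coefficient of `∏ t i`. -/
theorem exists_invariant (hB : B.IsAlt) (hpq : B p q = 1) {k l : ℕ}
    {ψ : MvPolynomial (Fin k × I) ℂ} (h1 : SymbStab B p ψ) (h2 : SymbWeight B p l 0 ψ) :
    ∃ P : MvPolynomial (Fin (k + l) × I) ℂ, (∀ lam ν, symbVar B P lam ν = 0) ∧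
      (∀ A : (I → ℂ) →ₗ[ℂ] (I → ℂ), (∀ x y, B (A x) (A y) = B x y) → A p = p →
        ∀ ν : Fin (k + l) → I → ℂ, symbEval P (fun i => A (ν i)) = symbEval P ν) ∧
      ∀ (R : Type w) [CommRing R] [Algebra ℂ R] (x : Fin (k + l) → I → R) (t : Fin l → R),
        (∀ i a, x ⟨i.1, by omega⟩ a = t i * algebraMap ℂ R (p a)) →
        symbAt x P - (∏ i, t i) * symbAt (fun i : Fin k => x ⟨l + i.1, by omega⟩) ψ ∈
          Ideal.span (Set.range fun i => t i ^ 2) := by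
  have hp : B p ≠ 0 := by
    intro h
    rw [h] at hpq
    simp at hpq
  obtain ⟨P, hP1, hP2, d, hd, hP⟩ := exists_iterate.{w} hB hpq h1 h2 l
  obtain ⟨P', hP'⟩ := exists_isNext hp hP1
  have h0 : P' = 0 := eq_zero_of_weight hB hpq (Nat.lt_succ_self l) fun A hA c _ hcp ν =>
    hP'.comp hp hA hcp (hP2 A hA c ‹_› hcp) ν
  have hvar : ∀ lam ν, symbVar B P lam ν = 0 := fun lam ν => by
    rw [hP', h0, symbEval_zero, mul_zero]
  refine ⟨d⁻¹ • P, fun lam ν => ?_, fun A hA hAp ν => ?_, fun R _ _ x t hx => ?_⟩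
  · have := hvar lam ν
    rw [symbVar] at this ⊢
    simp only [symbEval_smul, ← mul_sub, mul_left_comm _ d⁻¹]
    rw [← Finset.mul_sum, this, mul_zero]
  · have := hP2 A hA 1 one_ne_zero (by rw [hAp, one_smul]) ν
    simp only [one_pow, one_mul] at this
    rw [symbEval_smul, symbEval_smul, this]
  · have h3 := Ideal.mul_mem_left _ (algebraMap ℂ R d⁻¹) (hP R x t hx)
    rw [← Algebra.smul_def, smul_sub, smul_smul, inv_mul_cancel₀ (hd le_rfl), one_smul] at h3
    rwa [map_smul]

end Iterate

/-! ### Square-free coefficients -/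

section SquareFree

variable {S : Type*} [DecidableEq S] {R : Type*} [CommRing R]

/-- The exponent of the square-free monomial `∏ i ∈ J, X i`. -/
noncomputable def sqfree (J : Finset S) : S →₀ ℕ := ∑ i ∈ J, Finsupp.single i 1

theorem sqfree_apply (J : Finset S) (i : S) : sqfree J i = if i ∈ J then 1 else 0 := by
  rw [sqfree, Finsupp.finsetSum_apply]
  simp [Finsupp.single_apply]

theorem sqfree_injective {J K : Finset S} (h : sqfree J = sqfree K) : J = K := by
  ext i
  have := DFunLike.congr_fun h i
  rw [sqfree_apply, sqfree_apply] at this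
  split_ifs at this <;> simp_all

omit [DecidableEq S] in
theorem degree_sqfree (J : Finset S) : (sqfree J).degree = J.card := by
  simp [sqfree, map_sum]

omit [DecidableEq S] in
theorem mapDomain_sqfree (σ : Equiv.Perm S) (J : Finset S) :
    Finsupp.mapDomain σ (sqfree J) = sqfree (J.map σ.toEmbedding) := by
  simp [sqfree, Finsupp.mapDomain_finsetSum, Finsupp.mapDomain_single]

theorem sqfree_sub_single (J : Finset S) (i : S) :
    sqfree J - Finsupp.single i 1 = sqfree (J.erase i) := by
  ext j
  rw [Finsupp.tsub_apply, sqfree_apply, sqfree_apply]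
  by_cases h : j = i
  · subst h
    simp
    split_ifs <;> rfl
  · simp [h, Finsupp.single_eq_of_ne h]

omit [DecidableEq S] in
theorem prod_X_eq (J : Finset S) : ∏ i ∈ J, (MvPolynomial.X i : MvPolynomial S R) =
    MvPolynomial.monomial (sqfree J) 1 := by
  classical
  rw [sqfree]
  induction J using Finset.induction_on with
  | empty => simp
  | insert i J hi ih =>
    rw [Finset.prod_insert hi, Finset.sum_insert hi, ih, MvPolynomial.X,
      MvPolynomial.monomial_mul, one_mul]

theorem coeff_sqfree_X_mul (J : Finset S) (i : S) (F : MvPolynomial S R) :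
    MvPolynomial.coeff (sqfree J) (MvPolynomial.X i * F) =
      if i ∈ J then MvPolynomial.coeff (sqfree (J.erase i)) F else 0 := by
  rw [MvPolynomial.coeff_X_mul', sqfree_sub_single]
  congr 1
  simp [sqfree_apply]

/-- The ideal generated by squares of variables has no square-free monomials. -/
theorem coeff_sqfree_eq_zero {ι : Type*} {v : ι → S} {F : MvPolynomial S R}
    (hF : F ∈ Ideal.span (Set.range fun i => (MvPolynomial.X (v i) : MvPolynomial S R) ^ 2))
    (J : Finset S) : MvPolynomial.coeff (sqfree J) F = 0 := by
  induction hF using Submodule.span_induction with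
  | mem x hx =>
    obtain ⟨i, rfl⟩ := hx
    change MvPolynomial.coeff (sqfree J) (MvPolynomial.X (v i) ^ 2) = 0
    rw [sq, coeff_sqfree_X_mul, ← mul_one (MvPolynomial.X (v i)), coeff_sqfree_X_mul]
    simp
  | zero => simp
  | add x y _ _ hx hy => rw [MvPolynomial.coeff_add, hx, hy, add_zero]
  | smul a x hx' hx =>
    clear hx
    rw [smul_eq_mul, mul_comm]
    induction hx' using Submodule.span_induction generalizing a with
    | mem x hx =>
      obtain ⟨i, rfl⟩ := hx
      simp only [sq, mul_assoc]
      rw [coeff_sqfree_X_mul, coeff_sqfree_X_mul]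
      simp
    | zero => simp
    | add x y _ _ hx hy => rw [add_mul, MvPolynomial.coeff_add, hx, hy, add_zero]
    | smul b x _ hx => rw [smul_eq_mul, mul_comm b, mul_assoc, hx]

omit [DecidableEq S] in
theorem coeff_scale (c : R) (F : MvPolynomial S R) (d : S →₀ ℕ) :
    MvPolynomial.coeff d (MvPolynomial.aeval
      (fun i => MvPolynomial.C c * (MvPolynomial.X i : MvPolynomial S R)) F) =
      c ^ d.degree * MvPolynomial.coeff d F := by
  classical
  induction F using MvPolynomial.induction_on' with
  | add F G hF hG => rw [map_add, MvPolynomial.coeff_add, MvPolynomial.coeff_add, hF, hG, mul_add]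
  | monomial e a =>
    have h : MvPolynomial.aeval (fun i => MvPolynomial.C c *
        (MvPolynomial.X i : MvPolynomial S R)) (MvPolynomial.monomial e a) =
        MvPolynomial.C (c ^ e.degree) * MvPolynomial.monomial e a := by
      rw [MvPolynomial.aeval_monomial, Finsupp.prod]
      simp only [mul_pow, Finset.prod_mul_distrib]
      rw [MvPolynomial.monomial_eq (s := e) (a := a), Finsupp.prod, MvPolynomial.algebraMap_eq,
        Finset.prod_pow_eq_pow_sum, map_pow]
      change _ = MvPolynomial.C c ^ (∑ i ∈ e.support, e i) * _
      ring
    rw [h, MvPolynomial.coeff_C_mul, MvPolynomial.coeff_monomial]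
    split_ifs with h
    · rw [h]
    · simp

end SquareFree

theorem symbAt_sub_mem {S I R : Type*} [CommRing R] [Algebra ℂ R] (𝔞 : Ideal R) {x y : S → I → R}
    (h : ∀ i a, x i a - y i a ∈ 𝔞) (P : MvPolynomial (S × I) ℂ) :
    symbAt x P - symbAt y P ∈ 𝔞 := by
  rw [← Ideal.Quotient.eq]
  have h1 := map_symbAt (Ideal.Quotient.mkₐ ℂ 𝔞) x P
  have h2 := map_symbAt (Ideal.Quotient.mkₐ ℂ 𝔞) y P
  rw [Ideal.Quotient.mkₐ_eq_mk] at h1 h2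
  rw [h1, h2]
  congr 2
  ext i a
  exact Ideal.Quotient.eq.mpr (h i a)

/-! ### Coefficients of a symbol along a fixed covector -/

section SymbCoeff

variable {S I : Type*} [DecidableEq S] {R R' : Type*} [CommRing R] [Algebra ℂ R] [CommRing R']
  [Algebra ℂ R'] {p : I → ℂ} {T : Finset S}

/-- The family of covectors `ν i + X i • p` for `i ∈ T`, and `ν i` for `i ∉ T`, with independent
parameters `X i`. -/
noncomputable def testPoint (p : I → ℂ) (T : Finset S) (ν : S → I → R) :
    S → I → MvPolynomial S R := fun i a => MvPolynomial.C (ν i a) +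
  if i ∈ T then MvPolynomial.X i * MvPolynomial.C (algebraMap ℂ R (p a)) else 0

/-- The coefficient of `∏ i ∈ J, X i` in the value of a symbol at `testPoint p T ν`. -/
noncomputable def symbCoeff (p : I → ℂ) (T J : Finset S) (ν : S → I → R) :
    MvPolynomial (S × I) ℂ →ₗ[ℂ] R :=
  (MvPolynomial.lcoeff R (sqfree J)).restrictScalars ℂ ∘ₗ (symbAt (testPoint p T ν)).toLinearMap

theorem symbCoeff_apply (p : I → ℂ) (T J : Finset S) (ν : S → I → R)
    (Q : MvPolynomial (S × I) ℂ) : symbCoeff p T J ν Q =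
      MvPolynomial.coeff (sqfree J) (symbAt (testPoint p T ν) Q) := rfl

theorem map_symbCoeff (φ : R →ₐ[ℂ] R') (J : Finset S) (ν : S → I → R)
    (Q : MvPolynomial (S × I) ℂ) :
    φ (symbCoeff p T J ν Q) = symbCoeff p T J (fun i a => φ (ν i a)) Q := by
  rw [symbCoeff_apply, symbCoeff_apply]
  have h : symbAt (testPoint p T fun i a => φ (ν i a)) Q =
      MvPolynomial.mapAlgHom φ (symbAt (testPoint p T ν) Q) := by
    rw [map_symbAt]
    congr 2
    ext1 i
    ext1 a
    simp only [testPoint, map_add, MvPolynomial.mapAlgHom_apply]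
    split_ifs <;> simp
  rw [h, MvPolynomial.mapAlgHom_apply, MvPolynomial.coeff_map]
  rfl

theorem eval_testPoint (ν : S → I → ℂ) (Q : MvPolynomial (S × I) ℂ) (t : S → ℂ) :
    MvPolynomial.eval t (symbAt (testPoint p T ν) Q) =
      symbEval Q fun i => ν i + if i ∈ T then t i • p else 0 := by
  have h := map_symbAt (MvPolynomial.aeval t : MvPolynomial S ℂ →ₐ[ℂ] ℂ) (testPoint p T ν) Q
  rw [symbAt_complex, MvPolynomial.aeval_eq_eval] at h
  rw [h]
  congr 1
  ext i a
  simp only [testPoint]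
  split_ifs <;> simp

/-- Linear maps that carry `p` to a multiple of `p'` scale the coefficients. -/
theorem symbCoeff_comp {I' : Type*} {p' : I' → ℂ} {Q : MvPolynomial (S × I') ℂ}
    {Q' : MvPolynomial (S × I) ℂ} {L : (I → ℂ) →ₗ[ℂ] (I' → ℂ)} {c e : ℂ} (hL : L p = c • p')
    (hQ : ∀ ν : S → I → ℂ, symbEval Q (fun i => L (ν i)) = e * symbEval Q' ν) (J : Finset S)
    (ν : S → I → ℂ) :
    c ^ J.card * symbCoeff p' T J (fun i => L (ν i)) Q = e * symbCoeff p T J ν Q' := by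
  have h : MvPolynomial.aeval (fun i => MvPolynomial.C c * (MvPolynomial.X i : MvPolynomial S ℂ))
      (symbAt (testPoint p' T fun i => L (ν i)) Q) =
      MvPolynomial.C e * symbAt (testPoint p T ν) Q' := by
    refine MvPolynomial.funext fun t => ?_
    rw [eval_aeval, eval_testPoint, map_mul, MvPolynomial.eval_C, eval_testPoint, ← hQ]
    congr 1
    ext1 i
    rw [map_add]
    congr 1
    split_ifs
    · rw [map_smul, hL, smul_smul]
      simp [mul_comm]
    · simp
  rw [symbCoeff_apply, symbCoeff_apply, ← degree_sqfree, ← coeff_scale, h, MvPolynomial.coeff_C_mul]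

/-- Permutations of the inputs permute the coefficients. -/
theorem symbCoeff_map {Q Q' : MvPolynomial (S × I) ℂ} {σ : Equiv.Perm S}
    (hσ : ∀ i, σ i ∈ T ↔ i ∈ T) (hQ : ∀ ν : S → I → ℂ, symbEval Q' (fun i => ν (σ i)) =
      symbEval Q ν) (J : Finset S) (ν : S → I → ℂ) :
    symbCoeff p T (J.map σ.toEmbedding) ν Q = symbCoeff p T J (fun i => ν (σ i)) Q' := by
  have h : symbAt (testPoint p T ν) Q =
      MvPolynomial.rename σ (symbAt (testPoint p T fun i => ν (σ i)) Q') := by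
    refine MvPolynomial.funext fun t => ?_
    rw [MvPolynomial.eval_rename, eval_testPoint, eval_testPoint, ← hQ]
    simp only [hσ, Function.comp_apply]
  rw [symbCoeff_apply, symbCoeff_apply, h, ← mapDomain_sqfree,
    MvPolynomial.coeff_rename_mapDomain _ σ.injective]

/-- Coefficients that do not involve `X s` are not affected by the parameter in the input `s`. -/
theorem symbCoeff_insert {s : S} {J : Finset S} (hs : s ∉ J) (ν : S → I → R)
    (Q : MvPolynomial (S × I) ℂ) :
    symbCoeff p (insert s T) J ν Q = symbCoeff p T J ν Q := by
  have h := symbAt_sub_mem (Ideal.span {(MvPolynomial.X s : MvPolynomial S R)})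
    (x := testPoint p (insert s T) ν) (y := testPoint p T ν) (fun i a => by
      by_cases hi : i = s
      · subst hi
        by_cases hT : i ∈ T
        · simp [testPoint, hT]
        · simp only [testPoint, Finset.mem_insert_self, if_true, hT, if_false]
          rw [add_sub_add_left_eq_sub, sub_zero]
          exact Ideal.mul_mem_right _ _ (Ideal.mem_span_singleton_self _)
      · simp [testPoint, hi]) Q
  obtain ⟨G, hG⟩ := Ideal.mem_span_singleton.mp h
  rw [symbCoeff_apply, symbCoeff_apply, ← sub_eq_zero, ← MvPolynomial.coeff_sub, hG,
    coeff_sqfree_X_mul, if_neg hs]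

theorem exists_polynomial_symbCoeff (p : I → ℂ) (T J : Finset S) (s : S) (q : I → ℂ)
    (ν : S → I → ℂ) (Q : MvPolynomial (S × I) ℂ) :
    ∃ H : Polynomial ℂ, ∀ z : ℂ, H.eval z = symbCoeff p T J (bump s (z • q) ν) Q := by
  refine ⟨symbCoeff p T J (fun i a => Polynomial.C (ν i a) +
    if i = s then Polynomial.X * Polynomial.C (q a) else 0) Q, fun z => ?_⟩
  have h := map_symbCoeff (p := p) (T := T) (Polynomial.aeval z : Polynomial ℂ →ₐ[ℂ] ℂ) J
    (fun i a => Polynomial.C (ν i a) +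
      if i = s then Polynomial.X * Polynomial.C (q a) else 0) Q
  rw [Polynomial.coe_aeval_eq_eval] at h
  rw [h]
  congr 2
  ext i a
  rw [bump_apply]
  split_ifs
  · simpa using mul_comm _ _
  · simp

variable [Fintype S] [Fintype I] {B : LinearMap.BilinForm ℂ (I → ℂ)} {q : I → ℂ}

omit [Fintype I] in
/-- The vanishing of the variation, at the monomial `∏ i ∈ J, X i`. -/
theorem sum_symbCoeff_bump {Q : MvPolynomial (S × I) ℂ} {lam : I → ℂ}
    (hQ : ∀ ν, symbVar B Q lam ν = 0) (J : Finset S) (ν : S → I → ℂ) :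
    ∑ i, (B lam (ν i) * (symbCoeff p T J (bump i lam ν) Q - symbCoeff p T J ν Q) +
      if i ∈ T ∧ i ∈ J then B lam p * (symbCoeff p T (J.erase i) (bump i lam ν) Q -
        symbCoeff p T (J.erase i) ν Q) else 0) = 0 := by
  have h : ∑ i, (MvPolynomial.C (B lam (ν i)) + if i ∈ T then
      MvPolynomial.X i * MvPolynomial.C (B lam p) else 0) *
      (symbAt (testPoint p T (bump i lam ν)) Q - symbAt (testPoint p T ν) Q) = 0 := by
    refine MvPolynomial.funext fun t => ?_
    rw [map_zero, ← hQ fun i => ν i + if i ∈ T then t i • p else 0, map_sum, symbVar]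
    refine Finset.sum_congr rfl fun i _ => ?_
    rw [map_mul, map_sub, eval_testPoint, eval_testPoint]
    congr 1
    · split_ifs <;> simp
    · congr 2
      ext1 j
      change _ = bump i lam _ j
      rw [bump_apply, bump_apply]
      abel
  have h1 := congrArg (MvPolynomial.coeff (sqfree J)) h
  rw [MvPolynomial.coeff_sum, MvPolynomial.coeff_zero] at h1
  refine Eq.trans ?_ h1
  refine Finset.sum_congr rfl fun i _ => ?_
  rw [add_mul, MvPolynomial.coeff_add, MvPolynomial.coeff_C_mul, MvPolynomial.coeff_sub]
  congr 1
  by_cases hi : i ∈ T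
  · rw [if_pos hi, mul_assoc, coeff_sqfree_X_mul]
    by_cases hJ : i ∈ J
    · rw [if_pos ⟨hi, hJ⟩, if_pos hJ, MvPolynomial.coeff_C_mul, MvPolynomial.coeff_sub]
      rfl
    · rw [if_neg (fun h => hJ h.2), if_neg hJ]
  · rw [if_neg (fun h => hi h.1), if_neg hi, zero_mul, MvPolynomial.coeff_zero]

omit [Fintype S] [Fintype I] in
/-- For a symmetric symbol it does not matter which of the parameters is replaced by a covector. -/
theorem symbCoeff_erase {Q : MvPolynomial (S × I) ℂ}
    (hsym : ∀ i ∈ T, ∀ j ∈ T, ∀ ν : S → I → ℂ,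
      symbEval Q (fun x => ν (Equiv.swap i j x)) = symbEval Q ν)
    {ν : S → I → ℂ} (hν : ∀ i ∈ T, ν i = 0) {i s : S} (hi : i ∈ T) (hs : s ∈ T) {J : Finset S}
    (hiJ : i ∈ J) (hsJ : s ∈ J) (lam : I → ℂ) :
    symbCoeff p T (J.erase i) (bump i lam ν) Q = symbCoeff p T (J.erase s) (bump s lam ν) Q := by
  have hmem : ∀ (K : Finset S), i ∈ K → s ∈ K → ∀ j, Equiv.swap s i j ∈ K ↔ j ∈ K := by
    intro K hiK hsK j
    rw [Equiv.swap_apply_def]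
    split_ifs with h1 h2
    · simp [h1, hiK, hsK]
    · simp [h2, hiK, hsK]
    · rfl
  have h3 := symbCoeff_map (p := p) (Q := Q) (Q' := Q) (σ := Equiv.swap s i) (hmem T hi hs)
    (hsym s hs i hi) (J.erase i) (bump s lam ν)
  have h4 : (J.erase i).map (Equiv.swap s i).toEmbedding = J.erase s := by
    ext j
    rw [Finset.mem_map_equiv, Equiv.symm_swap, Finset.mem_erase, Finset.mem_erase,
      hmem J hiJ hsJ, Ne, Ne, Equiv.swap_apply_eq_iff, Equiv.swap_apply_right]
  have h5 : (fun j => bump s lam ν (Equiv.swap s i j)) = bump i lam ν := by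
    ext1 j
    simp only [bump_apply, Equiv.swap_apply_eq_iff, Equiv.swap_apply_left]
    congr 1
    by_cases hj : j ∈ T
    · rw [hν j hj, hν _ ((hmem T hi hs j).mpr hj)]
    · rw [Equiv.swap_apply_of_ne_of_ne (by rintro rfl; exact hj hs) (by rintro rfl; exact hj hi)]
  rw [h4, h5] at h3
  exact h3.symm

omit [Fintype I] in
/-- If the square-free coefficients vanish when all covectors in `T` are zero, they vanish when one of
them is arbitrary: by symmetry the sum in `sum_symbCoeff_bump` consists of `#J` equal terms. -/
theorem mul_symbCoeff_eq_zero {Q : MvPolynomial (S × I) ℂ} {lam : I → ℂ}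
    (hQ : ∀ ν, symbVar B Q lam ν = 0)
    (hsym : ∀ i ∈ T, ∀ j ∈ T, ∀ ν : S → I → ℂ,
      symbEval Q (fun x => ν (Equiv.swap i j x)) = symbEval Q ν)
    (h0 : ∀ ν : S → I → ℂ, (∀ i ∈ T, ν i = 0) → ∀ J ⊆ T, symbCoeff p T J ν Q = 0)
    {ν : S → I → ℂ} (hν : ∀ i ∈ T, ν i = 0) {J : Finset S} (hJ : J ⊆ T) {s : S} (hs : s ∈ J) :
    B lam p * symbCoeff p T (J.erase s) (bump s lam ν) Q = 0 := by
  have h1 := sum_symbCoeff_bump (p := p) (T := T) hQ J ν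
  have h2 : ∀ i ∈ J, symbCoeff p T (J.erase i) (bump i lam ν) Q =
      symbCoeff p T (J.erase s) (bump s lam ν) Q := fun i hi =>
    symbCoeff_erase hsym hν (hJ hi) (hJ hs) hi hs lam
  obtain ⟨c, hc⟩ : ∃ c : Finset S → (S → I → ℂ) → ℂ, ∀ K ν, symbCoeff p T K ν Q = c K ν :=
    ⟨_, fun _ _ => rfl⟩
  simp only [hc] at h0 h1 h2 ⊢
  have h3 : ∀ i, (B lam (ν i) * (c J (bump i lam ν) - c J ν) + if i ∈ T ∧ i ∈ J then
      B lam p * (c (J.erase i) (bump i lam ν) - c (J.erase i) ν) else 0) =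
      if i ∈ J then B lam p * c (J.erase s) (bump s lam ν) else 0 := by
    intro i
    by_cases hiJ : i ∈ J
    · rw [if_pos ⟨hJ hiJ, hiJ⟩, if_pos hiJ, hν i (hJ hiJ), h2 i hiJ,
        h0 ν hν _ ((Finset.erase_subset _ _).trans hJ), map_zero]
      ring
    · rw [if_neg (fun h => hiJ h.2), if_neg hiJ, add_zero]
      by_cases hi : i ∈ T
      · rw [hν i hi, map_zero, zero_mul]
      · rw [h0 ν hν _ hJ, h0 (bump i lam ν) (fun j hj => ?_) _ hJ, sub_zero, mul_zero]
        rw [bump_apply, hν j hj, if_neg (by rintro rfl; exact hi hj), add_zero]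
  rw [Finset.sum_congr rfl fun i _ => h3 i, ← Finset.sum_filter, Finset.filter_mem_eq_inter,
    Finset.univ_inter, Finset.sum_const, nsmul_eq_mul] at h1
  exact (mul_eq_zero.mp h1).resolve_left (Nat.cast_ne_zero.mpr (Finset.card_ne_zero_of_mem hs))

omit [Fintype I] in
/-- An invariant symbol is determined by its square-free coefficients along `p`: bracketing with
exponentials turns one input after the other into an arbitrary covector. -/
theorem eq_zero_of_symbCoeff (hpq : B q p ≠ 0) {Q : MvPolynomial (S × I) ℂ}
    (hQ : ∀ lam ν, symbVar B Q lam ν = 0)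
    (hsym : ∀ i ∈ T, ∀ j ∈ T, ∀ ν : S → I → ℂ,
      symbEval Q (fun x => ν (Equiv.swap i j x)) = symbEval Q ν)
    (h0 : ∀ ν : S → I → ℂ, (∀ i ∈ T, ν i = 0) → ∀ J ⊆ T, symbCoeff p T J ν Q = 0) : Q = 0 := by
  induction T using Finset.induction_on with
  | empty =>
    refine symb_ext fun ν => ?_
    have h1 := h0 ν (by simp) ∅ le_rfl
    have h2 : testPoint p (∅ : Finset S) ν = fun i a => algebraMap ℂ (MvPolynomial S ℂ) (ν i a) := by
      ext1 i
      ext1 a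
      simp [testPoint, MvPolynomial.algebraMap_eq]
    have h3 := map_symbAt (Algebra.ofId ℂ (MvPolynomial S ℂ)) ν Q
    rw [symbCoeff_apply, h2] at h1
    change algebraMap ℂ _ _ = symbAt (fun i a => algebraMap ℂ _ _) Q at h3
    rw [← h3, symbAt_complex, MvPolynomial.algebraMap_eq, sqfree, Finset.sum_empty,
      MvPolynomial.coeff_zero_C] at h1
    rw [h1, symbEval_zero]
  | insert s T hs ih =>
    refine ih (fun i hi j hj => hsym i (Finset.mem_insert_of_mem hi) j
      (Finset.mem_insert_of_mem hj)) fun ν hν J hJ => ?_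
    have hsJ : s ∉ J := fun h => hs (hJ h)
    have key : ∀ ν : S → I → ℂ, (∀ i ∈ T, ν i = 0) → B (ν s) p * symbCoeff p T J ν Q = 0 := by
      intro ν hν
      set ν₀ : S → I → ℂ := Function.update ν s 0 with hν₀
      have hν₀' : ∀ i ∈ insert s T, ν₀ i = 0 := by
        intro i hi
        by_cases his : i = s
        · subst his
          simp [hν₀]
        · rw [hν₀, Function.update_of_ne his]
          exact hν i (Finset.mem_of_mem_insert_of_ne hi his)
      have hbump : bump s (ν s) ν₀ = ν := by
        simp [bump, hν₀]
      have h1 := mul_symbCoeff_eq_zero (hQ (ν s)) hsym h0 hν₀' (Finset.insert_subset_insert s hJ)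
        (Finset.mem_insert_self s J)
      rwa [hbump, Finset.erase_insert hsJ, symbCoeff_insert hsJ] at h1
    -- the factor `B (ν s) p` is removed by moving `ν s` along a line
    obtain ⟨H, hH⟩ := exists_polynomial_symbCoeff p T J s q ν Q
    have hpoly : H = 0 := by
      refine Polynomial.eq_zero_of_infinite_isRoot _ (Set.Infinite.mono
        (s := {-(B (ν s) p) / B q p}ᶜ) ?_ (Set.finite_singleton _).infinite_compl)
      intro z hz
      change Polynomial.eval z _ = 0
      rw [hH]
      have h1 := key (bump s (z • q) ν) fun i hi => by
        rw [bump_apply, hν i hi, if_neg (by rintro rfl; exact hs hi), add_zero]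
      refine (mul_eq_zero.mp h1).resolve_left fun h2 => hz ?_
      rw [bump_apply, if_pos rfl, map_add, map_smul, LinearMap.add_apply, LinearMap.smul_apply,
        smul_eq_mul] at h2
      rw [Set.mem_singleton_iff, eq_div_iff hpq]
      linear_combination h2
    have h3 := hH 0
    have h4 : bump s ((0 : ℂ) • q) ν = ν := by simp [bump]
    rw [hpoly, Polynomial.eval_zero, h4] at h3
    exact h3.symm

end SymbCoeff

/-! ### Operators with `n` inputs, the last `k` of them marked -/

section FrontTail

variable {I : Type u} {k n : ℕ}

/-- The first `n - k` inputs. -/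
def frontSlots (k n : ℕ) : Finset (Fin n) := Finset.univ.filter fun i => i.1 < n - k

theorem mem_frontSlots {i : Fin n} : i ∈ frontSlots k n ↔ i.1 < n - k := by
  simp [frontSlots]

/-- The last `k` inputs. -/
def tailSlot (h : k ≤ n) (i : Fin k) : Fin n := ⟨n - k + i.1, by omega⟩

/-- A family of covectors on the last `k` inputs, extended by zero. -/
def onTail {R : Type*} [Zero R] (μ : Fin k → I → R) : Fin n → I → R := fun i =>
  if hi : n - k ≤ i.1 then μ ⟨i.1 - (n - k), by omega⟩ else 0

theorem onTail_front {R : Type*} [Zero R] (μ : Fin k → I → R) {i : Fin n}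
    (hi : i ∈ frontSlots k n) : onTail μ i = 0 := by
  rw [mem_frontSlots] at hi
  rw [onTail, dif_neg (by omega)]

theorem onTail_tailSlot {R : Type*} [Zero R] (h : k ≤ n) (μ : Fin k → I → R) (i : Fin k) :
    onTail μ (tailSlot h i) = μ i := by
  rw [onTail, dif_pos (by simp [tailSlot])]
  congr 1
  ext
  simp [tailSlot]

theorem eq_tailSlot (h : k ≤ n) {i : Fin n} (hi : i ∉ frontSlots k n) :
    ∃ j, i = tailSlot h j := by
  rw [mem_frontSlots] at hi
  refine ⟨⟨i.1 - (n - k), by omega⟩, ?_⟩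
  ext
  simp only [tailSlot]
  omega

theorem tailSlot_notMem (h : k ≤ n) (i : Fin k) : tailSlot h i ∉ frontSlots k n := by
  rw [mem_frontSlots]
  simp [tailSlot]

theorem tailSlot_injective (h : k ≤ n) : Function.Injective (tailSlot h) := by
  intro i j hij
  have := congrArg Fin.val hij
  ext
  simpa [tailSlot] using this

theorem eq_onTail (h : k ≤ n) {R : Type*} [Zero R] {ν : Fin n → I → R}
    (hν : ∀ i ∈ frontSlots k n, ν i = 0) : ν = onTail fun i => ν (tailSlot h i) := by
  ext1 i
  by_cases hi : i ∈ frontSlots k n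
  · rw [hν i hi, onTail_front _ hi]
  · obtain ⟨j, rfl⟩ := eq_tailSlot h hi
    rw [onTail_tailSlot]

theorem sum_front_tail (h : k ≤ n) {E : Type*} [AddCommMonoid E] (F : Fin n → E) :
    ∑ i, F i = ∑ i ∈ frontSlots k n, F i + ∑ i, F (tailSlot h i) := by
  rw [← Finset.sum_filter_add_sum_filter_not Finset.univ (· ∈ frontSlots k n),
    Finset.filter_mem_eq_inter, Finset.univ_inter]
  congr 1
  refine (Finset.sum_nbij (tailSlot h) ?_ (tailSlot_injective h).injOn ?_ fun _ _ => rfl).symm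
  · intro i _
    simp [tailSlot_notMem]
  · intro i hi
    obtain ⟨j, rfl⟩ := eq_tailSlot h (Finset.mem_filter.mp hi).2
    exact ⟨j, by simp, rfl⟩

/-- The permutations of the inputs that fix the last `k` ones. -/
def FrontPerm (k : ℕ) (σ : Equiv.Perm (Fin n)) : Prop := ∀ i ∉ frontSlots k n, σ i = i

theorem FrontPerm.mem_iff {σ : Equiv.Perm (Fin n)} (h : FrontPerm k σ) (i : Fin n) :
    σ i ∈ frontSlots k n ↔ i ∈ frontSlots k n := by
  constructor
  · intro h1
    by_contra h2
    rw [h i h2] at h1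
    exact h2 h1
  · intro h1
    by_contra h2
    exact h2 ((σ.injective (h _ h2)).symm ▸ h1)

theorem FrontPerm.inv {σ : Equiv.Perm (Fin n)} (h : FrontPerm k σ) : FrontPerm k σ⁻¹ := by
  intro i hi
  rw [Equiv.Perm.inv_eq_iff_eq, h i hi]

theorem FrontPerm.mul {σ τ : Equiv.Perm (Fin n)} (h : FrontPerm k σ) (h' : FrontPerm k τ) :
    FrontPerm k (σ * τ) := by
  intro i hi
  rw [Equiv.Perm.mul_apply, h' i hi, h i hi]

theorem FrontPerm.onTail {R : Type*} [Zero R] {σ : Equiv.Perm (Fin n)} (h : FrontPerm k σ)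
    (μ : Fin k → I → R) : (fun i => onTail μ (σ i)) = onTail μ := by
  ext1 i
  by_cases hi : i ∈ frontSlots k n
  · rw [onTail_front _ hi, onTail_front _ ((h.mem_iff i).mpr hi)]
  · rw [h i hi]

theorem frontPerm_swap {i j : Fin n} (hi : i ∈ frontSlots k n) (hj : j ∈ frontSlots k n) :
    FrontPerm k (Equiv.swap i j) := by
  intro x hx
  exact Equiv.swap_apply_of_ne_of_ne (by rintro rfl; exact hx hi) (by rintro rfl; exact hx hj)

theorem exists_frontPerm {J K : Finset (Fin n)} (hJ : J ⊆ frontSlots k n)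
    (hK : K ⊆ frontSlots k n) (h : J.card = K.card) :
    ∃ σ : Equiv.Perm (Fin n), FrontPerm k σ ∧ J.map σ.toEmbedding = K := by
  classical
  let e : {x : {i // i ∈ frontSlots k n} // x.1 ∈ J} ≃ {x : {i // i ∈ frontSlots k n} // x.1 ∈ K} :=
    Fintype.equivOfCardEq (by
      rw [Fintype.card_subtype, Fintype.card_subtype]
      have : ∀ J ⊆ frontSlots k n, (Finset.univ.filter fun x : {i // i ∈ frontSlots k n} =>
          x.1 ∈ J).card = J.card := by
        intro J hJ
        rw [← Finset.card_map (Function.Embedding.subtype _)]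
        congr 1
        ext i
        simp only [Finset.mem_map, Finset.mem_filter, Finset.mem_univ, true_and,
          Function.Embedding.coe_subtype, Subtype.exists, exists_and_left, exists_prop,
          exists_eq_right_right, and_iff_left_iff_imp]
        exact fun hi => hJ hi
      rw [this J hJ, this K hK, h])
  refine ⟨Equiv.Perm.ofSubtype e.extendSubtype, fun i hi =>
    Equiv.Perm.ofSubtype_apply_of_not_mem _ hi, ?_⟩
  refine Finset.eq_of_subset_of_card_le (fun i hi => ?_) (by rw [Finset.card_map, h])
  obtain ⟨j, hj, rfl⟩ := Finset.mem_map.mp hi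
  rw [Equiv.coe_toEmbedding, Equiv.Perm.ofSubtype_apply_of_mem _ (hJ hj)]
  exact e.extendSubtype_mem ⟨j, hJ hj⟩ hj

/-- Symbols that are symmetric in the first `n - k` inputs. -/
def FrontSymm (k : ℕ) (Q : MvPolynomial (Fin n × I) ℂ) : Prop :=
  ∀ σ : Equiv.Perm (Fin n), FrontPerm k σ → ∀ ν : Fin n → I → ℂ,
    symbEval Q (fun i => ν (σ i)) = symbEval Q ν

variable [Fintype I] {p q : I → ℂ} {B : LinearMap.BilinForm ℂ (I → ℂ)}

/-- The coefficient of `∏ i ∈ J, X i` of a symbol, when the covectors `X i • p` are put in the first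
`n - k` inputs. It is a symbol in the last `k` inputs. -/
noncomputable def symbRestr (p : I → ℂ) (J : Finset (Fin n)) :
    MvPolynomial (Fin n × I) ℂ →ₗ[ℂ] MvPolynomial (Fin k × I) ℂ :=
  symbCoeff p (frontSlots k n) J (onTail fun i a => MvPolynomial.X (i, a))

omit [Fintype I] in
theorem symbEval_symbRestr (J : Finset (Fin n)) (Q : MvPolynomial (Fin n × I) ℂ)
    (μ : Fin k → I → ℂ) : symbEval (symbRestr p J Q) μ =
      symbCoeff p (frontSlots k n) J (onTail μ) Q := by
  have h := map_symbCoeff (p := p) (T := frontSlots k n)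
    (MvPolynomial.aeval fun x : Fin k × I => μ x.1 x.2) J
    (onTail fun i a => MvPolynomial.X (i, a)) Q
  rw [MvPolynomial.aeval_eq_eval] at h
  refine Eq.trans h ?_
  congr 2
  ext i a
  rw [onTail, onTail]
  split_ifs <;> simp

omit [Fintype I] in
/-- Uniqueness of front-symmetric invariant operators with given coefficients. -/
theorem eq_zero_of_symbRestr (h : k ≤ n) (hpq : B q p ≠ 0) {Q : MvPolynomial (Fin n × I) ℂ}
    (hQ : ∀ lam ν, symbVar B Q lam ν = 0) (hsym : FrontSymm k Q)
    (h0 : ∀ J ⊆ frontSlots k n, (symbRestr p J Q : MvPolynomial (Fin k × I) ℂ) = 0) : Q = 0 := by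
  refine eq_zero_of_symbCoeff hpq hQ (T := frontSlots k n) (fun i hi j hj ν =>
    hsym _ (frontPerm_swap hi hj) ν) fun ν hν J hJ => ?_
  rw [eq_onTail h hν, ← symbEval_symbRestr, h0 J hJ, symbEval_zero]

omit [Fintype I] in
theorem FrontSymm.symbRestr_eq {Q : MvPolynomial (Fin n × I) ℂ} (hQ : FrontSymm k Q)
    {J K : Finset (Fin n)} (hJ : J ⊆ frontSlots k n) (hK : K ⊆ frontSlots k n)
    (h : J.card = K.card) :
    (symbRestr p J Q : MvPolynomial (Fin k × I) ℂ) = symbRestr p K Q := by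
  obtain ⟨σ, hσ, rfl⟩ := exists_frontPerm hJ hK h
  refine symb_ext fun μ => ?_
  rw [symbEval_symbRestr, symbEval_symbRestr, symbCoeff_map hσ.mem_iff (hQ σ hσ), hσ.onTail]

omit [Fintype I] in
theorem symbRestr_comp {I' : Type u} {p' : I' → ℂ} {Q : MvPolynomial (Fin n × I') ℂ}
    {Q' : MvPolynomial (Fin n × I) ℂ} {L : (I → ℂ) →ₗ[ℂ] (I' → ℂ)} {c e : ℂ} (hL : L p = c • p')
    (hQ : ∀ ν : Fin n → I → ℂ, symbEval Q (fun i => L (ν i)) = e * symbEval Q' ν)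
    (J : Finset (Fin n)) (μ : Fin k → I → ℂ) :
    c ^ J.card * symbEval (symbRestr p' J Q) (fun i => L (μ i)) =
      e * symbEval (symbRestr p J Q') μ := by
  have e : onTail (n := n) (fun i => L (μ i)) = fun i => L (onTail μ i) := by
    ext1 i
    rw [onTail, onTail]
    split_ifs <;> simp
  rw [symbEval_symbRestr, symbEval_symbRestr, ← symbCoeff_comp hL hQ, e]

omit [Fintype I] in
/-- Restrictions of invariant operators are infinitesimally `p`-invariant. -/
theorem symbStab_symbRestr (h : k ≤ n) (hB : B.IsAlt) {Q : MvPolynomial (Fin n × I) ℂ}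
    (hQ : ∀ lam ν, symbVar B Q lam ν = 0) (J : Finset (Fin n)) :
    SymbStab B p (symbRestr p J Q : MvPolynomial (Fin k × I) ℂ) := by
  intro lam hlam μ
  have h1 := sum_symbCoeff_bump (p := p) (T := frontSlots k n) (hQ lam) J (onTail μ)
  have h2 : B lam p = 0 := by rw [← hB.neg_eq, hlam, neg_zero]
  simp only [h2, zero_mul, ite_self, add_zero] at h1
  rw [sum_front_tail h, Finset.sum_eq_zero (fun i hi => by rw [onTail_front μ hi, map_zero,
    zero_mul]), zero_add] at h1
  have e : ∀ i, bump (tailSlot h i) lam (onTail μ) = onTail (bump i lam μ) := by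
    intro i
    ext1 j
    rw [bump_apply]
    by_cases hj : j ∈ frontSlots k n
    · rw [onTail_front _ hj, onTail_front _ hj,
        if_neg (by rintro rfl; exact tailSlot_notMem h i hj), add_zero]
    · obtain ⟨j, rfl⟩ := eq_tailSlot h hj
      rw [onTail_tailSlot, onTail_tailSlot, bump_apply]
      simp only [(tailSlot_injective h).eq_iff]
  refine Eq.trans ?_ h1
  refine Finset.sum_congr rfl fun i _ => ?_
  rw [onTail_tailSlot, e, ← symbEval_symbRestr, ← symbEval_symbRestr]
  rfl

/-! ### Existence of invariant operators with given coefficients -/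

omit [Fintype I] in
theorem symbEval_rename {S S' : Type*} (f : S → S') (P : MvPolynomial (S × I) ℂ) (ν : S' → I → ℂ) :
    symbEval (MvPolynomial.rename (Prod.map f id) P) ν = symbEval P fun i => ν (f i) := by
  rw [symbEval, MvPolynomial.eval_rename]
  rfl

omit [Fintype I] in
theorem symbAt_rename {S S' R : Type*} [CommRing R] [Algebra ℂ R] (f : S → S')
    (P : MvPolynomial (S × I) ℂ) (x : S' → I → R) :
    symbAt x (MvPolynomial.rename (Prod.map f id) P) = symbAt (fun i => x (f i)) P := by
  rw [symbAt, MvPolynomial.aeval_rename]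
  rfl

omit [Fintype I] in
theorem symbVar_smul {S : Type*} [Fintype S] [DecidableEq S] (c : ℂ) (P : MvPolynomial (S × I) ℂ)
    (lam : I → ℂ) (ν : S → I → ℂ) : symbVar B (c • P) lam ν = c * symbVar B P lam ν := by
  rw [symbVar, symbVar, Finset.mul_sum]
  refine Finset.sum_congr rfl fun i _ => ?_
  rw [symbEval_smul, symbEval_smul]
  ring

omit [Fintype I] in
theorem symbVar_sum {S J : Type*} [Fintype S] [DecidableEq S] (s : Finset J)
    (P : J → MvPolynomial (S × I) ℂ) (lam : I → ℂ) (ν : S → I → ℂ) :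
    symbVar B (∑ j ∈ s, P j) lam ν = ∑ j ∈ s, symbVar B (P j) lam ν := by
  simp only [symbVar]
  rw [Finset.sum_comm]
  refine Finset.sum_congr rfl fun i _ => ?_
  rw [symbEval_sum, symbEval_sum, ← Finset.sum_sub_distrib, Finset.mul_sum]

omit [Fintype I] in
theorem symbVar_rename {S S' : Type*} [Fintype S] [Fintype S'] [DecidableEq S] [DecidableEq S']
    {f : S → S'} (hf : Function.Injective f) (P : MvPolynomial (S × I) ℂ) (lam : I → ℂ)
    (ν : S' → I → ℂ) : symbVar B (MvPolynomial.rename (Prod.map f id) P) lam ν =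
      symbVar B P lam fun i => ν (f i) := by
  rw [symbVar, symbVar]
  refine (Finset.sum_of_injOn f hf.injOn (fun _ _ => Finset.mem_univ _) (fun i _ hi => ?_)
    fun i _ => ?_).symm
  · rw [symbEval_rename, symbEval_rename]
    have : (fun j => Function.update ν i (ν i + lam) (f j)) = fun j => ν (f j) := by
      ext1 j
      rw [Function.update_of_ne]
      rintro rfl
      exact hi (by simp)
    rw [this, sub_self, mul_zero]
  · rw [symbEval_rename, symbEval_rename]
    congr 3
    ext1 j
    by_cases hj : j = i
    · subst hj
      simp
    · rw [Function.update_of_ne hj, Function.update_of_ne (hf.ne hj)]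

/-- Existence of front-symmetric invariant operators with given coefficients. The invariant operator obtained by adding `l` inputs to `ψ` is viewed as an operator with `n`
inputs that does not differentiate the remaining ones, and is symmetrized over the first `n - k`
inputs. -/
theorem exists_symbRestr_eq [DecidableEq I] (h : k ≤ n) (hB : B.IsAlt) (hpq : B p q = 1) {l : ℕ}
    (hl : l ≤ n - k) {ψ : MvPolynomial (Fin k × I) ℂ} (h1 : SymbStab B p ψ)
    (h2 : SymbWeight B p l 0 ψ) : ∃ Q : MvPolynomial (Fin n × I) ℂ,
      (∀ lam ν, symbVar B Q lam ν = 0) ∧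
      (∀ A : (I → ℂ) →ₗ[ℂ] (I → ℂ), (∀ x y, B (A x) (A y) = B x y) → A p = p →
        ∀ ν : Fin n → I → ℂ, symbEval Q (fun i => A (ν i)) = symbEval Q ν) ∧
      FrontSymm k Q ∧
      ∀ J ⊆ frontSlots k n, symbRestr p J Q = if J.card = l then ψ else 0 := by
  classical
  obtain ⟨P, hP1, hP2, hP3⟩ := exists_invariant.{u} hB hpq h1 h2
  let f : Fin (k + l) → Fin n := fun i =>
    if hi : i.1 < l then ⟨i.1, by omega⟩ else ⟨n - k + (i.1 - l), by omega⟩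
  have hf : Function.Injective f := by
    intro i j hij
    have := congrArg Fin.val hij
    ext
    simp only [f] at this
    split_ifs at this <;> simp only at this <;> omega
  let Q₀ : MvPolynomial (Fin n × I) ℂ := MvPolynomial.rename (Prod.map f id) P
  let v : Fin l → Fin n := fun i => ⟨i.1, by omega⟩
  have hv : Function.Injective v := by
    intro i j hij
    have := congrArg Fin.val hij
    ext
    exact this
  let L : Finset (Fin n) := Finset.univ.map ⟨v, hv⟩
  have hL : L ⊆ frontSlots k n := by
    intro i hi
    obtain ⟨j, -, rfl⟩ := Finset.mem_map.mp hi
    rw [mem_frontSlots]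
    exact lt_of_lt_of_le j.2 hl
  have hLcard : L.card = l := by simp [L]
  have hQ₀ : ∀ J, symbRestr p J Q₀ = if J = L then ψ else 0 := by
    intro J
    have h3 := hP3 (MvPolynomial (Fin n) (MvPolynomial (Fin k × I) ℂ))
      (fun i => testPoint p (frontSlots k n) (onTail fun i a => MvPolynomial.X (i, a)) (f i))
      (fun i => MvPolynomial.X (v i)) (fun i a => by
        have hi : f ⟨i.1, by omega⟩ = v i := by
          simp [f, v]
        have hi' : v i ∈ frontSlots k n := hL (Finset.mem_map_of_mem _ (Finset.mem_univ i))
        rw [hi, testPoint, onTail_front _ hi', if_pos hi']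
        simp [MvPolynomial.algebraMap_eq, MvPolynomial.algebraMap_apply])
    have h4 : symbAt (fun i : Fin k => testPoint p (frontSlots k n)
        (onTail fun i a => MvPolynomial.X (i, a)) (f ⟨l + i.1, by omega⟩)) ψ =
        MvPolynomial.C ψ := by
      have h5 : ∀ i : Fin k, f ⟨l + i.1, by omega⟩ = tailSlot h i := by
        intro i
        simp [f, tailSlot]
      have h6 : symbAt (fun (i : Fin k) (a : I) => (MvPolynomial.X (i, a) :
          MvPolynomial (Fin k × I) ℂ)) ψ = ψ := MvPolynomial.aeval_X_left_apply ψ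
      have h7 := map_symbAt (IsScalarTower.toAlgHom ℂ (MvPolynomial (Fin k × I) ℂ)
        (MvPolynomial (Fin n) (MvPolynomial (Fin k × I) ℂ))) (fun (i : Fin k) (a : I) =>
          (MvPolynomial.X (i, a) : MvPolynomial (Fin k × I) ℂ)) ψ
      rw [h6] at h7
      refine Eq.trans ?_ h7.symm
      congr 2
      ext1 i
      ext1 a
      rw [h5, testPoint, onTail_tailSlot, if_neg (tailSlot_notMem h i), add_zero]
      rfl
    have h5 := coeff_sqfree_eq_zero h3 J
    have h6 : ∏ i, (MvPolynomial.X (v i) : MvPolynomial (Fin n) (MvPolynomial (Fin k × I) ℂ)) =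
        MvPolynomial.monomial (sqfree L) 1 := by
      rw [← prod_X_eq, Finset.prod_map]
      rfl
    rw [h4, MvPolynomial.coeff_sub, h6, mul_comm, MvPolynomial.coeff_C_mul, MvPolynomial.coeff_monomial,
      sub_eq_zero] at h5
    rw [symbRestr, symbCoeff_apply, symbAt_rename, h5]
    by_cases hJ : J = L
    · rw [if_pos hJ, if_pos (by rw [hJ]), mul_one]
    · rw [if_neg hJ, if_neg (fun h => hJ (sqfree_injective h).symm), mul_zero]
  let G : Finset (Equiv.Perm (Fin n)) := Finset.univ.filter fun σ => FrontPerm k σ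
  have hG : ∀ σ, σ ∈ G ↔ FrontPerm k σ := fun σ => by simp [G]
  -- each set `J` of cardinality `l` is hit by `N` of the permutations of the front inputs
  let N : ℕ := (G.filter fun σ => L.map σ.toEmbedding = L).card
  have hN : (N : ℂ) ≠ 0 := by
    refine Nat.cast_ne_zero.mpr (Finset.card_ne_zero_of_mem (a := 1) ?_)
    rw [Finset.mem_filter, hG]
    exact ⟨fun _ _ => rfl, Finset.map_refl⟩
  let Q : MvPolynomial (Fin n × I) ℂ :=
    (N : ℂ)⁻¹ • ∑ σ ∈ G, MvPolynomial.rename (Prod.map σ id) Q₀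
  have hQev : ∀ ν, symbEval Q ν = (N : ℂ)⁻¹ * ∑ σ ∈ G, symbEval Q₀ fun i => ν (σ i) := by
    intro ν
    simp only [Q, symbEval_smul, symbEval_sum, symbEval_rename]
  have hsym : FrontSymm k Q := by
    intro τ hτ ν
    rw [hQev, hQev]
    congr 1
    refine Finset.sum_equiv (Equiv.mulLeft τ) (fun σ => ?_) fun σ _ => rfl
    rw [hG, hG]
    refine ⟨fun hσ => hτ.mul hσ, fun hσ => ?_⟩
    have := hτ.inv.mul hσ
    simpa using this
  refine ⟨Q, fun lam ν => ?_, fun A hA hAp ν => ?_, hsym, fun J hJ => ?_⟩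
  · have h3 : ∀ σ : Equiv.Perm (Fin n), symbVar B (MvPolynomial.rename (Prod.map σ id) Q₀) lam ν =
        0 := fun σ => by
      rw [symbVar_rename σ.injective, symbVar_rename hf, hP1]
    have h4 : symbVar B Q lam ν = (N : ℂ)⁻¹ * ∑ σ ∈ G,
        symbVar B (MvPolynomial.rename (Prod.map σ id) Q₀) lam ν := by
      rw [symbVar_smul, symbVar_sum]
    rw [h4, Finset.sum_eq_zero fun σ _ => h3 σ, mul_zero]
  · rw [hQev, hQev]
    congr 1
    refine Finset.sum_congr rfl fun σ _ => ?_
    rw [symbEval_rename, symbEval_rename]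
    exact hP2 A hA hAp _
  · have h3 : ∀ J, symbRestr p J Q = (N : ℂ)⁻¹ • ∑ σ ∈ G,
        if J = L.map σ.toEmbedding then ψ else 0 := by
      intro J
      simp only [Q, map_smul, map_sum]
      congr 1
      refine Finset.sum_congr rfl fun σ hσ => ?_
      obtain ⟨K, rfl⟩ : ∃ K : Finset (Fin n), J = K.map σ.toEmbedding :=
        ⟨J.map σ.symm.toEmbedding, by ext; simp [Finset.mem_map_equiv]⟩
      have h4 : (symbRestr p (K.map σ.toEmbedding) (MvPolynomial.rename (Prod.map σ id) Q₀) :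
          MvPolynomial (Fin k × I) ℂ) = symbRestr p K Q₀ := by
        refine symb_ext fun μ => ?_
        have hσ' := (hG σ).mp hσ
        rw [symbEval_symbRestr, symbEval_symbRestr, symbCoeff_map hσ'.mem_iff (Q' := Q₀)
          (fun ν => (symbEval_rename _ _ _).symm), hσ'.onTail]
      rw [h4, hQ₀]
      simp only [Finset.map_inj]
    by_cases hJl : J.card = l
    · rw [if_pos hJl, hsym.symbRestr_eq hJ hL (by rw [hJl, hLcard]), h3, ← Finset.sum_filter,
        Finset.sum_const, ← Nat.cast_smul_eq_nsmul ℂ, smul_smul]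
      have h4 : (G.filter fun σ => L = L.map σ.toEmbedding).card = N := by
        congr 1
        ext σ
        simp only [Finset.mem_filter, eq_comm]
      rw [h4, inv_mul_cancel₀ hN, one_smul]
    · rw [if_neg hJl, h3, Finset.sum_eq_zero, smul_zero]
      intro σ _
      rw [if_neg]
      rintro rfl
      exact hJl (by rw [Finset.card_map, hLcard])

end FrontTail
namespace SymplecticSpace

variable {V : SymplecticSpace.{u}} {k n : ℕ}

/-! ### The symmetric extension of an operator of given weight -/

theorem exists_biv_eq_one {p : V.Vec} (hp : p ≠ 0) : ∃ q, V.biv p q = 1 := by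
  obtain ⟨q, hq⟩ := V.exists_biv_ne_zero hp
  exact ⟨(V.biv p q)⁻¹ • q, by rw [map_smul, smul_eq_mul, inv_mul_cancel₀ hq]⟩

/-- A linear map that preserves the bivector is an automorphism. -/
theorem exists_equiv_of_biv (A : V.Vec →ₗ[ℂ] V.Vec) (hA : ∀ μ ν, V.biv (A μ) (A ν) = V.biv μ ν) :
    ∃ E : V.Vec ≃ₗ[ℂ] V.Vec, ∀ ν, E ν = A ν := by
  refine ⟨LinearEquiv.ofInjectiveEndo A ?_, fun ν => rfl⟩
  rw [injective_iff_map_eq_zero]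
  intro μ hμ
  by_contra hne
  obtain ⟨ν, hν⟩ := V.exists_biv_ne_zero hne
  rw [← hA, hμ, map_zero] at hν
  exact hν rfl

theorem symbEval_transvect {P : V.Symb n} (hP : ∀ lam ν, symbVar V.biv P lam ν = 0) (u : V.Vec)
    (t : ℂ) (ν : Fin n → V.Vec) : symbEval P (fun i => transvect V.biv u t (ν i)) = symbEval P ν := by
  obtain ⟨E, hE⟩ := exists_equiv_of_biv _ (bilin_transvect V.biv_isAlt u t)
  obtain ⟨α, -, h2, -⟩ := V.exists_shear u le_rfl t
  have h3 : V.StabInv n 0 P := fun lam _ ν => hP lam ν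
  have h4 : CommutesWith P α := commutesWith_shear le_rfl (h3.lieInv (by simp [poisson_dual])) h2
  have h5 : ∀ ν, α (lin ν) = lin (E ν) := fun ν => by
    rw [h2, hE, transvect_apply, lin_add, lin_smul, pow_one]
  have h6 := (carries_iff_of_map_lin h5).mp (show Carries α P P from h4) ν
  simpa only [hE] using h6

theorem exists_biv_ne_zero_of_ne_zero {p p' : V.Vec} (hp : p ≠ 0) (hp' : p' ≠ 0) :
    ∃ x, V.biv p x ≠ 0 ∧ V.biv p' x ≠ 0 := by
  obtain ⟨x, hx⟩ := V.exists_biv_ne_zero hp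
  obtain ⟨y, hy⟩ := V.exists_biv_ne_zero hp'
  by_cases hx' : V.biv p' x = 0
  · by_cases hy' : V.biv p y = 0
    · exact ⟨x + y, by rwa [map_add, hy', add_zero], by rwa [map_add, hx', zero_add]⟩
    · exact ⟨y, hy', hy⟩
  · exact ⟨x, hx, hx'⟩

theorem exists_transvect_eq {p p' : V.Vec} (h : V.biv p p' ≠ 0) :
    ∃ u t, transvect V.biv u t p = p' := by
  refine ⟨p' - p, (V.biv p' p)⁻¹, ?_⟩
  have h1 : V.biv p' p ≠ 0 := by rwa [V.biv_neg, neg_ne_zero]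
  rw [transvect_apply, map_sub, LinearMap.sub_apply, V.biv_isAlt p, sub_zero, inv_mul_cancel₀ h1,
    one_smul, add_sub_cancel]

/-- Transvections move any nonzero covector to any other, so an operator that commutes with all
Hamiltonian vector fields is invariant as soon as it is invariant under the linear symplectic maps
fixing one covector. -/
theorem mem_inv_of_stabilizer {p : V.Vec} (hp : p ≠ 0) {P : V.Symb n}
    (hP : ∀ lam ν, symbVar V.biv P lam ν = 0)
    (hA : ∀ A : V.Vec →ₗ[ℂ] V.Vec, (∀ x y, V.biv (A x) (A y) = V.biv x y) → A p = p →
        ∀ ν : Fin n → V.Vec, symbEval P (fun i => A (ν i)) = symbEval P ν) : P ∈ V.inv n := by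
  refine mem_inv_iff.mpr ⟨hP, fun A h ν => ?_⟩
  have hp' : A p ≠ 0 := fun h0 => hp (A.map_eq_zero_iff.mp h0)
  obtain ⟨x, hx, hx'⟩ := exists_biv_ne_zero_of_ne_zero hp' hp
  obtain ⟨u₁, t₁, h₁⟩ := exists_transvect_eq hx
  obtain ⟨u₂, t₂, h₂⟩ := exists_transvect_eq (p := x) (p' := p) (by rwa [V.biv_neg, neg_ne_zero])
  have h3 := hA (transvect V.biv u₂ t₂ ∘ₗ transvect V.biv u₁ t₁ ∘ₗ A.toLinearMap) (fun μ ν => by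
    simp only [LinearMap.comp_apply, LinearEquiv.coe_coe, bilin_transvect V.biv_isAlt, h]) (by
    simp only [LinearMap.comp_apply, LinearEquiv.coe_coe, h₁, h₂]) ν
  simp only [LinearMap.comp_apply, LinearEquiv.coe_coe] at h3
  rw [← h3, symbEval_transvect hP u₂ t₂ fun i => transvect V.biv u₁ t₁ (A (ν i)),
    symbEval_transvect hP]

/-- `Q` is invariant under the permutations of the first `n - k` inputs, and if `j` of these are
specialized to `v^*` and the others to `1`, the part that is free of `v^*` is `ψ` for `j = l` and
zero otherwise. -/
structure IsSymmExt (V : SymplecticSpace.{u}) {k n : ℕ} (l : ℕ) (v : V.Vec) (ψ : V.Symb k)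
    (Q : V.Symb n) : Prop where
  mem_inv : Q ∈ V.inv n
  symm : FrontSymm k Q
  restr : ∀ J ⊆ frontSlots k n, symbRestr (V.codual v) J Q = if J.card = l then ψ else 0

theorem symbWeight_of_mem_invWeight {l : ℕ} {v : V.Vec} {ψ : V.Symb k}
    (h : ψ ∈ V.invWeight k l v) : SymbWeight V.biv (V.codual v) l 0 ψ := by
  intro A hA c _ hc ν
  obtain ⟨E, hE⟩ := exists_equiv_of_biv A hA
  have := (mem_invWeight_iff.mp h).2 E (by simpa only [hE] using hA) c (by rw [hE, hc]) ν
  simpa only [hE, pow_zero, one_mul] using this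

theorem exists_isSymmExt (h : k ≤ n) {l : ℕ} (hl : k + l ≤ n) {v : V.Vec} (hv : v ≠ 0)
    {ψ : V.Symb k} (hψ : ψ ∈ V.invWeight k l v) : ∃ Q : V.Symb n, V.IsSymmExt l v ψ Q := by
  obtain ⟨q, hq⟩ := exists_biv_eq_one (V.codual_ne_zero hv)
  obtain ⟨Q, h1, h2, h3, h4⟩ := exists_symbRestr_eq h V.biv_isAlt hq (by omega)
    (mem_invWeight_iff.mp hψ).1 (symbWeight_of_mem_invWeight hψ)
  exact ⟨Q, mem_inv_of_stabilizer (V.codual_ne_zero hv) h1 h2, h3, h4⟩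

theorem _root_.FrontSymm.sub {I : Type*} {P Q : MvPolynomial (Fin n × I) ℂ} (hP : FrontSymm k P)
    (hQ : FrontSymm k Q) : FrontSymm k (P - Q) := fun σ hσ ν => by
  rw [symbEval_sub, symbEval_sub, hP σ hσ, hQ σ hσ]

/-- An invariant operator that is symmetric in the first `n - k` inputs is determined by its
restrictions. -/
theorem eq_of_symbRestr (h : k ≤ n) {v : V.Vec} (hv : v ≠ 0) {P Q : V.Symb n} (hP : P ∈ V.inv n)
    (hQ : Q ∈ V.inv n) (hPs : FrontSymm k P) (hQs : FrontSymm k Q)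
    (hr : ∀ J ⊆ frontSlots k n, (symbRestr (V.codual v) J P : V.Symb k) =
      symbRestr (V.codual v) J Q) : P = Q := by
  obtain ⟨q, hq⟩ := exists_biv_eq_one (V.codual_ne_zero hv)
  rw [← sub_eq_zero]
  refine eq_zero_of_symbRestr h (B := V.biv) (p := V.codual v) (q := q) ?_
    (mem_inv_iff.mp (sub_mem hP hQ)).1 (hPs.sub hQs) fun J hJ => ?_
  · rw [V.biv_neg, hq]
    norm_num
  · rw [map_sub, hr J hJ, sub_self]

theorem IsSymmExt.unique (h : k ≤ n) {l : ℕ} {v : V.Vec} (hv : v ≠ 0) {ψ : V.Symb k}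
    {P Q : V.Symb n} (hP : V.IsSymmExt l v ψ P) (hQ : V.IsSymmExt l v ψ Q) : P = Q :=
  eq_of_symbRestr h hv hP.mem_inv hQ.mem_inv hP.symm hQ.symm fun J hJ => by
    rw [hP.restr J hJ, hQ.restr J hJ]

theorem IsSymmExt.add {l : ℕ} {v : V.Vec} {ψ φ : V.Symb k} {P Q : V.Symb n}
    (hP : V.IsSymmExt l v ψ P) (hQ : V.IsSymmExt l v φ Q) : V.IsSymmExt l v (ψ + φ) (P + Q) where
  mem_inv := add_mem hP.mem_inv hQ.mem_inv
  symm σ hσ ν := by rw [symbEval_add, symbEval_add, hP.symm σ hσ, hQ.symm σ hσ]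
  restr J hJ := by
    rw [map_add, hP.restr J hJ, hQ.restr J hJ]
    split_ifs
    · rfl
    · exact add_zero 0

theorem IsSymmExt.smul {l : ℕ} {v : V.Vec} {ψ : V.Symb k} {P : V.Symb n} (c : ℂ)
    (hP : V.IsSymmExt l v ψ P) : V.IsSymmExt l v (c • ψ) (c • P) where
  mem_inv := Submodule.smul_mem _ c hP.mem_inv
  symm σ hσ ν := by rw [symbEval_smul, symbEval_smul, hP.symm σ hσ]
  restr J hJ := by
    rw [map_smul, hP.restr J hJ]
    split_ifs
    · rfl
    · exact smul_zero c

/-- A conformally symplectic linear isomorphism carries symmetric extensions to symmetric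
extensions. -/
theorem IsSymmExt.comp {V W : SymplecticSpace.{u}} {l : ℕ} {v : V.Vec} {w : W.Vec}
    {ψ : V.Symb k} {φ : W.Symb k} {P : V.Symb n} {Q : W.Symb n} (h : k ≤ n) (hv : v ≠ 0)
    (A : V.Vec ≃ₗ[ℂ] W.Vec) {c e : ℂ} (he : e ≠ 0)
    (hA : ∀ μ ν, W.biv (A μ) (A ν) = e * V.biv μ ν) (hAv : A (V.codual v) = c • W.codual w)
    (hφ : ∀ ν : Fin k → V.Vec, c ^ l * symbEval φ (fun i => A (ν i)) = symbEval ψ ν)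
    (hP : V.IsSymmExt l v ψ P) (hQ : W.IsSymmExt l w φ Q) (ν : Fin n → V.Vec) :
    symbEval Q (fun i => A (ν i)) = symbEval P ν := by
  rw [← LinearEquiv.coe_coe, ← symbEval_symbComp]
  congr 1
  refine IsSymmExt.unique h hv ⟨?_, ?_, fun J hJ => symb_ext fun μ => ?_⟩ hP
  · obtain ⟨h1, h2⟩ := mem_inv_iff.mp hQ.mem_inv
    refine mem_inv_iff.mpr ⟨fun lam ν => ?_, fun E hE ν => ?_⟩
    · have h3 := h1 (A lam) (fun i => A (ν i))
      refine (mul_eq_zero.mp ?_).resolve_left he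
      rw [symbVar] at h3 ⊢
      rw [← h3, Finset.mul_sum]
      refine Finset.sum_congr rfl fun i _ => ?_
      rw [hA, symbEval_symbComp, symbEval_symbComp, mul_assoc]
      congr 4
      ext1 j
      by_cases hj : j = i
      · subst hj
        simp
      · simp [hj]
    · have h3 := h2 (A.symm.trans (E.trans A)) (fun μ ν => by
        simp only [LinearEquiv.trans_apply, hA, hE]
        rw [← hA, A.apply_symm_apply, A.apply_symm_apply]) (fun i => A (ν i))
      simp only [LinearEquiv.trans_apply, A.symm_apply_apply] at h3
      simpa only [symbEval_symbComp, LinearEquiv.coe_coe] using h3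
  · intro σ hσ ν
    rw [symbEval_symbComp, symbEval_symbComp]
    exact hQ.symm σ hσ fun i => A (ν i)
  · have h1 := symbRestr_comp (c := c) (e := 1) (L := A.toLinearMap) (p := V.codual v)
      (p' := W.codual w) hAv (fun ν => by
        rw [one_mul, symbEval_symbComp]) J μ (Q := Q) (Q' := symbComp A.toLinearMap Q)
    rw [one_mul] at h1
    rw [← h1, hQ.restr J hJ]
    split_ifs with hJl
    · rw [hJl]
      exact hφ μ
    · simp

end SymplecticSpace
namespace SymplecticSpace

/-! ### Orders and weights of restrictions and extensions -/

section Homogeneous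

variable {S I : Type*}

theorem coeff_of_scale {P Q : MvPolynomial (S × I) ℂ} {c e : ℂ}
    (h : ∀ ν : S → I → ℂ, symbEval P (fun i => c • ν i) = e * symbEval Q ν) (d : S × I →₀ ℕ) :
    c ^ d.degree * MvPolynomial.coeff d P = e * MvPolynomial.coeff d Q := by
  rw [← coeff_scale, ← MvPolynomial.coeff_C_mul]
  congr 1
  refine symb_ext fun ν => ?_
  rw [symbEval_mul, symbEval_C, ← h, symbEval_aeval]
  congr 1
  ext i a
  simp

/-- A scaling property under the homothety of ratio `2` determines the degrees of the monomials, since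
the powers of `2` are distinct. -/
theorem degree_eq_of_scale_two {P : MvPolynomial (S × I) ℂ} {j N : ℕ}
    (h : ∀ ν : S → I → ℂ, 2 ^ j * symbEval P (fun i => (2 : ℂ) • ν i) = 2 ^ N * symbEval P ν)
    {d : S × I →₀ ℕ} (hd : MvPolynomial.coeff d P ≠ 0) : d.degree + j = N := by
  have h1 := coeff_of_scale (P := (2 ^ j : ℂ) • P) (fun ν => (symbEval_smul _ _ _).trans (h ν)) d
  rw [MvPolynomial.coeff_smul, smul_eq_mul, ← mul_assoc, ← pow_add] at h1
  have h2 := mul_right_cancel₀ hd h1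
  have h3 : (2 : ℕ) ^ (d.degree + j) = 2 ^ N := by exact_mod_cast h2
  exact Nat.pow_right_injective le_rfl h3

theorem isHomogeneous_iff_degree {T : Type*} {P : MvPolynomial T ℂ} {N : ℕ} :
    P.IsHomogeneous N ↔ ∀ d, MvPolynomial.coeff d P ≠ 0 → d.degree = N := by
  have h1 : ∀ d : T →₀ ℕ, Finsupp.weight 1 d = d.degree := fun d => by
    rw [Finsupp.degree_eq_weight_one]
    rfl
  refine ⟨fun h d hd => ?_, fun h d hd => ?_⟩
  · rw [← h1]
    exact h hd
  · rw [h1]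
    exact h d hd

theorem isHomogeneous_iff_scale_two {P : MvPolynomial (S × I) ℂ} {N : ℕ} :
    P.IsHomogeneous N ↔
      ∀ ν : S → I → ℂ, symbEval P (fun i => (2 : ℂ) • ν i) = 2 ^ N * symbEval P ν := by
  constructor
  · intro h ν
    have h1 : MvPolynomial.aeval (fun y => MvPolynomial.C (2 : ℂ) *
        (MvPolynomial.X y : MvPolynomial (S × I) ℂ)) P = MvPolynomial.C (2 ^ N) * P := by
      ext d
      rw [coeff_scale, MvPolynomial.coeff_C_mul]
      by_cases hd : MvPolynomial.coeff d P = 0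
      · rw [hd, mul_zero, mul_zero]
      · rw [isHomogeneous_iff_degree.mp h d hd]
    have h2 := congrArg (fun F => symbEval F ν) h1
    simp only [symbEval_mul, symbEval_C, symbEval_aeval, symbEval_X] at h2
    exact h2
  · intro h
    refine isHomogeneous_iff_degree.mpr fun d hd => ?_
    exact degree_eq_of_scale_two (j := 0) (fun ν => by rw [h, pow_zero, one_mul]) hd

end Homogeneous

variable {V : SymplecticSpace.{u}} {k n : ℕ}

theorem symbRestr_mem_invWeight (h : k ≤ n) {Q : V.Symb n} (hQ : Q ∈ V.inv n) (v : V.Vec)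
    (J : Finset (Fin n)) : symbRestr (V.codual v) J Q ∈ V.invWeight k J.card v := by
  obtain ⟨h1, h2⟩ := mem_inv_iff.mp hQ
  refine mem_invWeight_iff.mpr ⟨symbStab_symbRestr h V.biv_isAlt h1 J, fun A hA c hc μ => ?_⟩
  rw [← one_mul (symbEval _ μ)]
  exact symbRestr_comp (L := A.toLinearMap) hc (fun ν => by rw [one_mul]; exact h2 A hA ν) J μ

theorem symbRestr_scale {N : ℕ} {Q : V.Symb n} (hQ : Q ∈ V.ofOrder n N) (v : V.Vec)
    (J : Finset (Fin n)) (μ : Fin k → V.Vec) :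
    2 ^ J.card * symbEval (symbRestr (V.codual v) J Q) (fun i => (2 : ℂ) • μ i) =
      2 ^ N * symbEval (symbRestr (V.codual v) J Q) μ := by
  have h1 := symbRestr_comp (k := k) (L := (2 : ℂ) • LinearMap.id) (c := 2) (e := 2 ^ N)
    (p := V.codual v) (p' := V.codual v) (Q := Q) (Q' := Q) (by simp) (fun ν => by
      simpa only [LinearMap.smul_apply, LinearMap.id_apply] using
        isHomogeneous_iff_scale_two.mp ((MvPolynomial.mem_homogeneousSubmodule _ _).mp hQ) ν) J μ
  simpa only [LinearMap.smul_apply, LinearMap.id_apply] using h1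

theorem symbRestr_mem_ofOrder {r : ℕ} {Q : V.Symb n} {J : Finset (Fin n)}
    (hQ : Q ∈ V.ofOrder n (r + J.card)) (v : V.Vec) :
    (symbRestr (V.codual v) J Q : V.Symb k) ∈ V.ofOrder k r := by
  refine isHomogeneous_iff_degree.mpr fun d hd => ?_
  have := degree_eq_of_scale_two (symbRestr_scale hQ v J) hd
  omega

theorem symbRestr_eq_zero {N : ℕ} {Q : V.Symb n} {J : Finset (Fin n)} (hQ : Q ∈ V.ofOrder n N)
    (hJ : N < J.card) (v : V.Vec) : (symbRestr (V.codual v) J Q : V.Symb k) = 0 := by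
  ext d
  by_contra hd
  have := degree_eq_of_scale_two (symbRestr_scale hQ v J) hd
  omega

/-- By uniqueness, extensions are compatible with homotheties, which are conformally symplectic. -/
theorem IsSymmExt.mem_ofOrder (h : k ≤ n) {l r : ℕ} {v : V.Vec} (hv : v ≠ 0) {ψ : V.Symb k}
    {Q : V.Symb n} (hQ : V.IsSymmExt l v ψ Q) (hψ : ψ ∈ V.ofOrder k r) :
    Q ∈ V.ofOrder n (r + l) := by
  refine isHomogeneous_iff_scale_two.mpr fun ν => ?_
  rw [← symbEval_smul]
  refine IsSymmExt.comp h hv (LinearEquiv.smulOfNeZero ℂ V.Vec (2 : ℂ) two_ne_zero) (c := 2)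
    (e := 4) (by norm_num) (fun μ ν => ?_) rfl (fun μ => ?_) (hQ.smul _) hQ ν
  · simp only [LinearEquiv.smulOfNeZero_apply, map_smul, LinearMap.smul_apply, smul_eq_mul]
    ring
  · simp only [LinearEquiv.smulOfNeZero_apply]
    rw [isHomogeneous_iff_scale_two.mp hψ, symbEval_smul]
    ring

open Classical in
/-- The symmetric extension of the operators of weight `l`. It is linear by uniqueness. For `v = 0` or
`k + l > n`, where extensions need not exist, it is zero by convention. -/
noncomputable def symmExt (V : SymplecticSpace.{u}) {k n : ℕ} (h : k ≤ n) (l : ℕ) (v : V.Vec) :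
    V.invWeight k l v →ₗ[ℂ] V.Symb n :=
  if hv : v ≠ 0 ∧ k + l ≤ n then
    { toFun := fun ψ => (exists_isSymmExt h hv.2 hv.1 ψ.2).choose
      map_add' := fun ψ φ => IsSymmExt.unique h hv.1
        (exists_isSymmExt h hv.2 hv.1 (ψ + φ).2).choose_spec
        ((exists_isSymmExt h hv.2 hv.1 ψ.2).choose_spec.add
          (exists_isSymmExt h hv.2 hv.1 φ.2).choose_spec)
      map_smul' := fun c ψ => IsSymmExt.unique h hv.1
        (exists_isSymmExt h hv.2 hv.1 (c • ψ).2).choose_spec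
        ((exists_isSymmExt h hv.2 hv.1 ψ.2).choose_spec.smul c) }
  else 0

theorem isSymmExt_symmExt (h : k ≤ n) {l : ℕ} (hl : k + l ≤ n) {v : V.Vec} (hv : v ≠ 0)
    (ψ : V.invWeight k l v) : V.IsSymmExt l v (ψ : V.Symb k) (V.symmExt h l v ψ) := by
  rw [symmExt, dif_pos ⟨hv, hl⟩]
  exact (exists_isSymmExt h hl hv ψ.2).choose_spec

theorem symmExt_eq_zero (h : k ≤ n) {l : ℕ} {v : V.Vec} (hv : ¬(v ≠ 0 ∧ k + l ≤ n)) :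
    V.symmExt h l v = 0 := dif_neg hv

end SymplecticSpace

/-! ### The action of `S_{n+1}` on symbols -/

/-- Completes a family of covectors by minus their sum, the covector of the output. -/
def withOutput {I R : Type*} [CommRing R] {n : ℕ} (x : Fin n → I → R) : Fin (n + 1) → I → R :=
  Fin.snoc (α := fun _ => I → R) x (-∑ i, x i)

section WithOutput

variable {I R : Type*} [CommRing R] {n : ℕ}

@[simp]
theorem withOutput_castSucc (x : Fin n → I → R) (i : Fin n) : withOutput x i.castSucc = x i := by
  simp [withOutput]

@[simp]
theorem withOutput_last (x : Fin n → I → R) : withOutput x (Fin.last n) = -∑ i, x i := by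
  simp [withOutput]

theorem withOutput_of_sum_eq_zero {y : Fin (n + 1) → I → R} (h : ∑ i, y i = 0) :
    withOutput (fun i => y i.castSucc) = y := by
  ext1 j
  induction j using Fin.lastCases with
  | cast i => simp
  | last =>
    rw [Fin.sum_univ_castSucc] at h
    rw [withOutput_last, neg_eq_of_add_eq_zero_right h]

end WithOutput

namespace SymplecticSpace

variable {V : SymplecticSpace.{u}} {k n : ℕ}

theorem symbAt_perm {R : Type*} [CommRing R] [Algebra ℂ R] (s : Equiv.Perm (Fin (n + 1)))
    (Q : V.Symb n) (x : Fin n → V.idx → R) :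
    symbAt x (V.perm n s Q) = symbAt (fun i => withOutput x (s i.castSucc)) Q := by
  have h : ∀ j a, symbAt x (V.slot n j a) = withOutput x j a := by
    intro j a
    induction j using Fin.lastCases with
    | cast i => simp [slot]
    | last => simp [slot, Finset.sum_apply]
  change symbAt x (V.permHom n s Q) = _
  rw [permHom, symbAt_aeval]
  simp only [h]

theorem symbEval_perm (s : Equiv.Perm (Fin (n + 1))) (Q : V.Symb n) (ν : Fin n → V.Vec) :
    symbEval (V.perm n s Q) ν = symbEval Q fun i => withOutput ν (s i.castSucc) := by
  rw [← symbAt_complex, symbAt_perm, symbAt_complex]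

theorem symbEval_perm_of_sum_eq_zero (s : Equiv.Perm (Fin (n + 1))) (Q : V.Symb n)
    {y : Fin (n + 1) → V.Vec} (h : ∑ i, y i = 0) :
    symbEval (V.perm n s Q) (fun i => y i.castSucc) = symbEval Q fun i => y (s i.castSucc) := by
  rw [symbEval_perm, withOutput_of_sum_eq_zero h]

/-- The variation of a symbol, in a form in which the inputs and the output play the same role. -/
theorem symbVar_eq_sum (Q : V.Symb n) {lam : V.Vec} {y : Fin (n + 1) → V.Vec}
    (h : ∑ j, y j = -lam) : symbVar V.biv Q lam (fun i => y i.castSucc) =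
      ∑ j, V.biv lam (y j) *
        symbEval Q (fun i => (y + Pi.single j lam : Fin (n + 1) → V.Vec) i.castSucc) := by
  rw [Fin.sum_univ_castSucc] at h
  have h1 : y (Fin.last n) = -lam - ∑ i : Fin n, y i.castSucc := by rw [← h]; abel
  have h2 : V.biv lam (y (Fin.last n)) = -∑ i : Fin n, V.biv lam (y i.castSucc) := by
    rw [h1, map_sub, map_neg, V.biv_isAlt lam, map_sum]
    ring
  have h3 : ∀ i : Fin n, (fun j : Fin n => (y + Pi.single i.castSucc lam : Fin (n + 1) → V.Vec)
      j.castSucc) = Function.update (fun j : Fin n => y j.castSucc) i (y i.castSucc + lam) := by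
    intro i
    ext1 j
    by_cases hj : j = i
    · subst hj
      simp
    · simp [hj]
  have h4 : (fun j : Fin n => (y + Pi.single (Fin.last n) lam : Fin (n + 1) → V.Vec)
      j.castSucc) = fun j : Fin n => y j.castSucc := by
    ext1 j
    simp [Fin.castSucc_ne_last]
  rw [Fin.sum_univ_castSucc, symbVar, h4, h2, neg_mul, Finset.sum_mul, ← sub_eq_add_neg,
    ← Finset.sum_sub_distrib]
  refine Finset.sum_congr rfl fun i _ => ?_
  rw [h3, mul_sub]

theorem symbVar_perm (s : Equiv.Perm (Fin (n + 1))) {Q : V.Symb n} {lam : V.Vec}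
    (hQ : ∀ ν, symbVar V.biv Q lam ν = 0) (ν : Fin n → V.Vec) :
    symbVar V.biv (V.perm n s Q) lam ν = 0 := by
  let y : Fin (n + 1) → V.Vec := Fin.snoc (α := fun _ => V.Vec) ν (-lam - ∑ i, ν i)
  have hy : ∑ j, y j = -lam := by simp [y, Fin.sum_univ_castSucc]
  have hν : ν = fun i => y i.castSucc := by simp [y]
  have hy' : ∑ j, y (s j) = -lam := by rw [Equiv.sum_comp s y, hy]
  have h3 := hQ (fun i => y (s i.castSucc))
  rw [symbVar_eq_sum Q (y := fun j => y (s j)) hy'] at h3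
  rw [hν, symbVar_eq_sum _ hy, ← Equiv.sum_comp s, ← h3]
  refine Finset.sum_congr rfl fun j _ => ?_
  rw [symbEval_perm_of_sum_eq_zero s Q (by simp [Finset.sum_add_distrib, hy])]
  congr 2
  ext1 i
  simp [Pi.single_apply]

theorem symbEval_perm_comp {W : SymplecticSpace.{u}} (s : Equiv.Perm (Fin (n + 1))) {Q : V.Symb n}
    {Q' : W.Symb n} {A : V.Vec →ₗ[ℂ] W.Vec} {c e : ℂ}
    (hQ : ∀ ν : Fin n → V.Vec, c * symbEval Q' (fun i => A (ν i)) = e * symbEval Q ν)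
    (ν : Fin n → V.Vec) : c * symbEval (W.perm n s Q') (fun i => A (ν i)) =
      e * symbEval (V.perm n s Q) ν := by
  rw [symbEval_perm, symbEval_perm, ← hQ fun i => withOutput ν (s i.castSucc)]
  congr 2
  ext1 i
  generalize s i.castSucc = j
  induction j using Fin.lastCases with
  | cast i => simp
  | last => simp

theorem symbEval_perm_equiv {W : SymplecticSpace.{u}} (s : Equiv.Perm (Fin (n + 1)))
    {Q : V.Symb n} {Q' : W.Symb n} {A : V.Vec ≃ₗ[ℂ] W.Vec}
    (hQ : ∀ ν : Fin n → V.Vec, symbEval Q' (fun i => A (ν i)) = symbEval Q ν) (ν : Fin n → V.Vec) :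
    symbEval (W.perm n s Q') (fun i => A (ν i)) = symbEval (V.perm n s Q) ν := by
  have h := symbEval_perm_comp (A := A.toLinearMap) (c := 1) (e := 1) s (fun ν => by
    rw [one_mul, one_mul]
    exact hQ ν) ν
  rw [one_mul, one_mul] at h
  exact h

theorem perm_mem_inv (s : Equiv.Perm (Fin (n + 1))) {Q : V.Symb n} (hQ : Q ∈ V.inv n) :
    V.perm n s Q ∈ V.inv n := by
  obtain ⟨h1, h2⟩ := mem_inv_iff.mp hQ
  exact mem_inv_iff.mpr ⟨fun lam ν => symbVar_perm s (h1 lam) ν, fun A hA ν =>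
    symbEval_perm_equiv s (h2 A hA) ν⟩

theorem perm_mem_invWeight (s : Equiv.Perm (Fin (n + 1))) {l : ℕ} {v : V.Vec} {Q : V.Symb n}
    (hQ : Q ∈ V.invWeight n l v) : V.perm n s Q ∈ V.invWeight n l v := by
  obtain ⟨h1, h2⟩ := mem_invWeight_iff.mp hQ
  refine mem_invWeight_iff.mpr ⟨fun lam hlam ν => symbVar_perm s (h1 lam hlam) ν,
    fun A hA c hc ν => ?_⟩
  have h3 := symbEval_perm_comp (A := A.toLinearMap) (c := c ^ l) (e := 1) s (fun ν => by
    rw [one_mul]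
    exact h2 A hA c hc ν) ν
  rw [one_mul] at h3
  exact h3

theorem perm_mem_ofOrder (s : Equiv.Perm (Fin (n + 1))) {N : ℕ} {Q : V.Symb n}
    (hQ : Q ∈ V.ofOrder n N) : V.perm n s Q ∈ V.ofOrder n N := by
  refine isHomogeneous_iff_scale_two.mpr fun ν => ?_
  have h := symbEval_perm_comp (A := (2 : ℂ) • LinearMap.id) (c := 1) (e := 2 ^ N) s (fun ν => by
    simpa using isHomogeneous_iff_scale_two.mp hQ ν) ν
  simpa using h

/-- The permutations of the first `n - k` of `n + 1` functions. -/
def IsFront (k : ℕ) (s : Equiv.Perm (Fin (n + 1))) : Prop := ∀ i, n - k ≤ i.1 → s i = i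

/-- Symmetry in the first inputs, as invariance under a subgroup of `S_{n+1}`. -/
theorem frontSymm_iff {Q : V.Symb n} :
    FrontSymm k Q ↔ ∀ s : Equiv.Perm (Fin (n + 1)), IsFront k s → V.perm n s Q = Q := by
  constructor
  · intro h s hs
    have hlast : s (Fin.last n) = Fin.last n := hs _ (by simp)
    have hne : ∀ i : Fin n, (s i.castSucc).1 < n := fun i => by
      have h1 : s i.castSucc ≠ Fin.last n := fun h1 => by
        rw [← hlast, s.injective.eq_iff] at h1
        exact Fin.castSucc_ne_last i h1
      have := (s i.castSucc).2
      have h2 : (s i.castSucc).1 ≠ n := fun h2 => h1 (Fin.ext h2)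
      omega
    have hinj : Function.Injective fun i : Fin n => (⟨(s i.castSucc).1, hne i⟩ : Fin n) := by
      intro i j hij
      have h1 : s i.castSucc = s j.castSucc := Fin.ext (by simpa [Fin.ext_iff] using hij)
      exact Fin.castSucc_injective _ (s.injective h1)
    let σ : Equiv.Perm (Fin n) := Equiv.ofBijective _ (Finite.injective_iff_bijective.mp hinj)
    have hσ : ∀ i, (σ i).castSucc = s i.castSucc := fun i => rfl
    have hf : FrontPerm k σ := by
      intro i hi
      rw [mem_frontSlots, not_lt] at hi
      apply Fin.castSucc_injective
      rw [hσ, hs _ (by simpa using hi)]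
    refine symb_ext fun ν => ?_
    rw [symbEval_perm, ← h σ hf ν]
    simp only [← hσ, withOutput_castSucc]
  · intro h σ hσ ν
    let s : Equiv.Perm (Fin (n + 1)) := σ.viaFintypeEmbedding Fin.castSuccEmb
    have hs : ∀ i : Fin n, s i.castSucc = (σ i).castSucc := fun i =>
      Equiv.Perm.viaFintypeEmbedding_apply_image σ Fin.castSuccEmb i
    have hlast : s (Fin.last n) = Fin.last n :=
      Equiv.Perm.viaFintypeEmbedding_apply_notMem_range σ Fin.castSuccEmb (by simp)
    have h1 := congrArg (fun P => symbEval P ν) (h s fun i hi => by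
      induction i using Fin.lastCases with
      | last => exact hlast
      | cast i => rw [hs, hσ i (by rw [mem_frontSlots, not_lt]; simpa using hi)])
    simp only [symbEval_perm, hs, withOutput_castSucc] at h1
    exact h1

theorem tailEmb_val (h : k ≤ n) (j : Fin (k + 1)) : (tailEmb h j).1 = n - k + j.1 := rfl

theorem tailPerm_tailEmb (h : k ≤ n) (s : Equiv.Perm (Fin (k + 1))) (j : Fin (k + 1)) :
    tailPerm h s (tailEmb h j) = tailEmb h (s j) :=
  Equiv.Perm.viaFintypeEmbedding_apply_image s (tailEmb h) j

theorem tailPerm_of_lt (h : k ≤ n) (s : Equiv.Perm (Fin (k + 1))) {i : Fin (n + 1)}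
    (hi : i.1 < n - k) : tailPerm h s i = i := by
  refine Equiv.Perm.viaFintypeEmbedding_apply_notMem_range s (tailEmb h) ?_
  rintro ⟨j, rfl⟩
  rw [tailEmb_val] at hi
  omega

theorem exists_tailEmb_eq (h : k ≤ n) {i : Fin (n + 1)} (hi : n - k ≤ i.1) :
    ∃ j, i = tailEmb h j := by
  refine ⟨⟨i.1 - (n - k), by have := i.2; omega⟩, Fin.ext ?_⟩
  rw [tailEmb_val]
  dsimp only
  omega

theorem tailPerm_mul (h : k ≤ n) (s t : Equiv.Perm (Fin (k + 1))) :
    tailPerm h (s * t) = tailPerm h s * tailPerm h t := by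
  ext1 i
  rw [Equiv.Perm.mul_apply]
  obtain hi | hi := lt_or_ge i.1 (n - k)
  · rw [tailPerm_of_lt h _ hi, tailPerm_of_lt h _ hi, tailPerm_of_lt h _ hi]
  · obtain ⟨j, rfl⟩ := exists_tailEmb_eq h hi
    rw [tailPerm_tailEmb, tailPerm_tailEmb, tailPerm_tailEmb, Equiv.Perm.mul_apply]

theorem IsFront.commute (h : k ≤ n) {f : Equiv.Perm (Fin (n + 1))} (hf : IsFront k f)
    (s : Equiv.Perm (Fin (k + 1))) : f * tailPerm h s = tailPerm h s * f := by
  have hd : Equiv.Perm.Disjoint f (tailPerm h s) := fun i => by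
    obtain hi | hi := lt_or_ge i.1 (n - k)
    · exact Or.inr (tailPerm_of_lt h _ hi)
    · exact Or.inl (hf i hi)
  exact hd.commute

theorem frontSymm_tailPerm (h : k ≤ n) (s : Equiv.Perm (Fin (k + 1))) {Q : V.Symb n}
    (hQ : FrontSymm k Q) : FrontSymm k (V.perm n (tailPerm h s) Q) := by
  rw [frontSymm_iff] at hQ ⊢
  intro f hf
  rw [← Module.End.mul_apply, ← map_mul, hf.commute h, map_mul, Module.End.mul_apply, hQ f hf]

end SymplecticSpace

/-! ### Restrictions of permuted operators -/

section Perturbation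

variable {S R R' : Type*} [CommRing R] [Algebra ℂ R] [CommRing R'] [Algebra ℂ R'] [DecidableEq S]

theorem exists_sqfree_of_le {d : S →₀ ℕ} {J : Finset S} (h : d ≤ sqfree J) :
    ∃ K ⊆ J, d = sqfree K := by
  have h1 : ∀ i, d i ≤ if i ∈ J then 1 else 0 := fun i => by
    rw [← sqfree_apply]
    exact h i
  refine ⟨d.support, fun i hi => ?_, ?_⟩
  · by_contra hJ
    have h2 := h1 i
    rw [if_neg hJ] at h2
    exact Finsupp.mem_support_iff.mp hi (by omega)
  · ext i
    rw [sqfree_apply]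
    have h2 := h1 i
    split_ifs with hi
    · rw [Finsupp.mem_support_iff] at hi
      split_ifs at h2 <;> omega
    · exact Finsupp.notMem_support_iff.mp hi

/-- If the coefficients of `F` at the proper divisors of a square free monomial vanish, then a
change of the coefficients of `F` that depends on the variables is invisible at this monomial. -/
theorem coeff_sqfree_aevalTower (φ : R →ₐ[ℂ] MvPolynomial S R') (F : MvPolynomial S R)
    (J : Finset S) (h : ∀ K ⊂ J, MvPolynomial.coeff (sqfree K) F = 0) :
    MvPolynomial.coeff (sqfree J) (MvPolynomial.aevalTower φ MvPolynomial.X F) =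
      MvPolynomial.constantCoeff (φ (MvPolynomial.coeff (sqfree J) F)) := by
  have h1 : MvPolynomial.aevalTower φ MvPolynomial.X F =
      ∑ d ∈ F.support, φ (MvPolynomial.coeff d F) * MvPolynomial.monomial d 1 := by
    conv_lhs => rw [F.as_sum, map_sum]
    refine Finset.sum_congr rfl fun d _ => ?_
    rw [MvPolynomial.monomial_eq, map_mul, MvPolynomial.aevalTower_C, Finsupp.prod, map_prod,
      MvPolynomial.monomial_eq, Finsupp.prod, map_one, one_mul]
    simp only [map_pow, MvPolynomial.aevalTower_X]
  rw [h1, MvPolynomial.coeff_sum]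
  simp only [MvPolynomial.coeff_mul_monomial', mul_one]
  rw [Finset.sum_eq_single (sqfree J)]
  · rw [if_pos le_rfl, tsub_self, MvPolynomial.constantCoeff_eq]
  · intro d _ hd
    split_ifs with hle
    · obtain ⟨K, hK, rfl⟩ := exists_sqfree_of_le hle
      rw [h K (hK.ssubset_of_ne fun hKJ => hd (by rw [hKJ])), map_zero, MvPolynomial.coeff_zero]
    · rfl
  · intro hJ
    rw [MvPolynomial.notMem_support_iff.mp hJ, map_zero, if_pos le_rfl, MvPolynomial.coeff_zero]

end Perturbation

namespace SymplecticSpace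

variable {V : SymplecticSpace.{u}} {k n : ℕ}

/-- The covector of the output is minus the sum of the covectors of the inputs. -/
theorem withOutput_generic (j : Fin (k + 1)) (a : V.idx) :
    withOutput (fun i a => (MvPolynomial.X (i, a) : V.Symb k)) j a = V.slot k j a := by
  induction j using Fin.lastCases with
  | cast i => simp [slot]
  | last => simp [slot, Finset.sum_apply]

theorem tailEmb_castSucc (h : k ≤ n) (j : Fin k) :
    tailEmb h j.castSucc = (tailSlot h j).castSucc := Fin.ext rfl

theorem tailEmb_last (h : k ≤ n) : tailEmb h (Fin.last k) = Fin.last n :=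
  Fin.ext (by rw [tailEmb_val]; simp; omega)

/-- Permutations of the last `k` inputs and the output commute with the restriction to the lowest
nonvanishing power of `v^*`. -/
theorem symbRestr_tailPerm (h : k ≤ n) (p : V.Vec) (s : Equiv.Perm (Fin (k + 1))) (Q : V.Symb n)
    {J : Finset (Fin n)} (h0 : ∀ K ⊂ J, (symbRestr p K Q : V.Symb k) = 0) :
    (symbRestr p J (V.perm n (tailPerm h s) Q) : V.Symb k) = V.perm k s (symbRestr p J Q) := by
  let x : Fin n → V.idx → MvPolynomial (Fin n) (V.Symb k) := testPoint p (frontSlots k n)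
    (onTail fun i a => MvPolynomial.X (i, a))
  have hfront : ∀ i ∈ frontSlots k n, ∀ a, x i a =
      MvPolynomial.X i * MvPolynomial.C (algebraMap ℂ (V.Symb k) (p a)) := fun i hi a => by
    simp only [x, testPoint, onTail_front _ hi, if_pos hi, Pi.zero_apply, map_zero, zero_add]
  have htail : ∀ i a, x (tailSlot h i) a =
      MvPolynomial.C (MvPolynomial.X (i, a) : V.Symb k) := fun i a => by
    simp only [x, testPoint, onTail_tailSlot, if_neg (tailSlot_notMem h i), add_zero]
  -- the output covector of `Q` involves the parameters of the front inputs, but only in terms that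
  -- are invisible at the lowest monomial
  let φ : V.Symb k →ₐ[ℂ] MvPolynomial (Fin n) (V.Symb k) :=
    symbAt fun j a => withOutput x (tailEmb h (s j.castSucc)) a
  have hφ : ∀ P, MvPolynomial.constantCoeff (φ P) = V.perm k s P := by
    have h1 : (MvPolynomial.constantCoeff.comp φ.toRingHom : V.Symb k →+* V.Symb k) =
        (V.permHom k s).toRingHom := by
      refine MvPolynomial.ringHom_ext (fun c => ?_) fun y => ?_
      · change MvPolynomial.constantCoeff (φ (algebraMap ℂ _ c)) = V.permHom k s (algebraMap ℂ _ c)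
        rw [AlgHom.commutes, AlgHom.commutes, IsScalarTower.algebraMap_apply ℂ (V.Symb k)
          (MvPolynomial (Fin n) (V.Symb k)), MvPolynomial.algebraMap_eq,
          MvPolynomial.constantCoeff_C]
      · change MvPolynomial.constantCoeff (φ (MvPolynomial.X y)) = V.permHom k s (MvPolynomial.X y)
        simp only [φ, symbAt_X, permHom, MvPolynomial.aeval_X]
        generalize s y.1.castSucc = j
        rw [← withOutput_generic]
        induction j using Fin.lastCases with
        | cast i => rw [tailEmb_castSucc, withOutput_castSucc, withOutput_castSucc, htail,
            MvPolynomial.constantCoeff_C]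
        | last =>
          rw [tailEmb_last, withOutput_last, withOutput_last, sum_front_tail h]
          simp only [Pi.neg_apply, Pi.add_apply, Finset.sum_apply, map_neg, map_add, map_sum,
            htail, MvPolynomial.constantCoeff_C]
          rw [Finset.sum_eq_zero, zero_add]
          intro i hi
          rw [hfront i hi, map_mul, MvPolynomial.constantCoeff_X, zero_mul]
    intro P
    exact DFunLike.congr_fun h1 P
  have key : symbAt x (V.perm n (tailPerm h s) Q) =
      MvPolynomial.aevalTower φ MvPolynomial.X (symbAt x Q) := by
    rw [symbAt_perm, map_symbAt]
    congr 2
    ext1 i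
    ext1 a
    by_cases hi : i ∈ frontSlots k n
    · have h2 : tailPerm h s i.castSucc = i.castSucc :=
        tailPerm_of_lt h s (by simpa using mem_frontSlots.mp hi)
      rw [h2, withOutput_castSucc, hfront i hi, map_mul, MvPolynomial.aevalTower_X,
        MvPolynomial.aevalTower_C, AlgHom.commutes, IsScalarTower.algebraMap_apply ℂ (V.Symb k)
          (MvPolynomial (Fin n) (V.Symb k)), MvPolynomial.algebraMap_eq, MvPolynomial.algebraMap_eq]
    · obtain ⟨j, rfl⟩ := eq_tailSlot h hi
      rw [← tailEmb_castSucc, tailPerm_tailEmb, htail, MvPolynomial.aevalTower_C]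
      simp only [φ, symbAt_X]
  have h3 : ∀ K Q, (symbRestr p K Q : V.Symb k) = MvPolynomial.coeff (sqfree K) (symbAt x Q) :=
    fun K Q => rfl
  rw [h3, key, coeff_sqfree_aevalTower _ _ _ fun K hK => by rw [← h3, h0 K hK], hφ, ← h3]

/-! ### Restricting to powers of `v^*` -/

theorem iterDeriv_pderiv (m : V.idx →₀ ℕ) (a : V.idx) (f : V.Fun) :
    V.iterDeriv m (MvPowerSeries.pderiv ℂ a f) = MvPowerSeries.pderiv ℂ a (V.iterDeriv m f) := by
  let D : V.Fun →ₗ[ℂ] V.Fun := (MvPowerSeries.pderiv ℂ a).toLinearMap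
  let T : V.Fun →ₗ[ℂ] V.Fun := V.iterDerivL m ∘ₗ D - D ∘ₗ V.iterDerivL m
  have hT : LinearMap.ker T = ⊤ := by
    refine eq_top_of_expo_mem (isAdicClosed_ker T fun M => ⟨M + m.degree + 1, fun f hf => ?_⟩)
      fun ν => ?_
    · refine sub_mem (V.iterDeriv_mem_fil m (pderiv_mem_fil a hf)) ?_
      exact pderiv_mem_fil (M := M + 1) a (V.iterDeriv_mem_fil m (fil_anti (by omega) hf))
    · rw [LinearMap.mem_ker]
      change V.iterDeriv m (MvPowerSeries.pderiv ℂ a (expo ν)) -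
        MvPowerSeries.pderiv ℂ a (V.iterDeriv m (expo ν)) = 0
      have h1 : V.iterDeriv m (ν a • expo ν) = ν a • V.iterDeriv m (expo ν) :=
        (V.iterDerivL m).map_smul _ _
      rw [pderiv_expo, h1, iterDeriv_expo, Derivation.map_smul, pderiv_expo, smul_comm, sub_self]
  have h2 : f ∈ LinearMap.ker T := hT ▸ Submodule.mem_top
  exact sub_eq_zero.mp (LinearMap.mem_ker.mp h2)

theorem act_mul_X (P : V.Symb n) (i : Fin n) (a : V.idx) (f : Fin n → V.Fun) :
    V.act n (P * MvPolynomial.X (i, a)) f =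
      V.act n P (Function.update f i (MvPowerSeries.pderiv ℂ a (f i))) := by
  induction P using act_induction with
  | add P Q hP hQ => simp only [add_mul, map_add, Pi.add_apply, hP, hQ]
  | smul c P hP => simp only [smul_mul_assoc, map_smul, Pi.smul_apply, hP]
  | monomial m =>
    rw [MvPolynomial.X, MvPolynomial.monomial_mul, one_mul, act_monomial, act_monomial]
    refine Finset.prod_congr rfl fun j _ => ?_
    by_cases hj : j = i
    · subst hj
      have h1 : (m + Finsupp.single (j, a) 1).curry j = m.curry j + Finsupp.single a 1 := by
        ext b
        simp [Finsupp.curry_apply, Finsupp.single_apply, Prod.ext_iff]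
      rw [h1, iterDeriv_add_single, Function.update_self, iterDeriv_pderiv]
    · have h1 : (m + Finsupp.single (i, a) 1).curry j = m.curry j := by
        ext b
        simp [Finsupp.curry_apply, Prod.ext_iff, Ne.symm hj]
      rw [h1, Function.update_of_ne hj]

/-- The inputs `x` at the positions in `K`, `1` at the other ones of the first `n - k`, and `g` at
the last `k`. -/
noncomputable def plugAt (x : V.Fun) (K : Finset (Fin n)) (g : Fin k → V.Fun) : Fin n → V.Fun :=
  fun i => if i ∈ K then x else if hi : n - k ≤ i.1 then g ⟨i.1 - (n - k), by omega⟩ else 1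

theorem plugAt_tailSlot (h : k ≤ n) (x : V.Fun) {K : Finset (Fin n)} (hK : K ⊆ frontSlots k n)
    (g : Fin k → V.Fun) (i : Fin k) : plugAt x K g (tailSlot h i) = g i := by
  rw [plugAt, if_neg fun hi => tailSlot_notMem h i (hK hi), dif_pos (by simp [tailSlot])]
  congr 1
  ext
  simp [tailSlot]

theorem plugAt_front (x : V.Fun) (K : Finset (Fin n)) (g : Fin k → V.Fun) {i : Fin n}
    (hi : i ∈ frontSlots k n) : plugAt x K g i = if i ∈ K then x else 1 := by
  rw [mem_frontSlots] at hi
  rw [plugAt]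
  split_ifs with h1 h2
  · rfl
  · omega
  · rfl

theorem prod_plugAt (h : k ≤ n) (x : V.Fun) {K : Finset (Fin n)} (hK : K ⊆ frontSlots k n)
    (g : Fin k → V.Fun) : ∏ i, plugAt x K g i = x ^ K.card * ∏ i, g i := by
  have h1 := sum_front_tail h (E := Additive V.Fun) fun i => Additive.ofMul (plugAt x K g i)
  have h2 : ∏ i, plugAt x K g i = (∏ i ∈ frontSlots k n, plugAt x K g i) *
      ∏ i, plugAt x K g (tailSlot h i) := h1
  rw [h2, Finset.prod_congr rfl fun i hi => plugAt_front x K g hi, Finset.prod_ite_mem,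
    Finset.inter_eq_right.mpr hK, Finset.prod_const]
  simp only [plugAt_tailSlot h x hK]

theorem act_C (c : ℂ) (f : Fin n → V.Fun) : V.act n (MvPolynomial.C c) f = c • ∏ i, f i := by
  have h1 : (MvPolynomial.C c : V.Symb n) = c • MvPolynomial.monomial 0 1 := by
    rw [MvPolynomial.smul_monomial, smul_eq_mul, mul_one, MvPolynomial.C_apply]
  rw [h1, map_smul, Pi.smul_apply, act_monomial]
  congr 1
  refine Finset.prod_congr rfl fun i _ => ?_
  have h2 : (0 : Fin n × V.idx →₀ ℕ).curry i = 0 := by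
    ext b
    simp [Finsupp.curry_apply]
  rw [h2, iterDeriv_zero]

theorem symbRestr_C (p : V.Vec) (J : Finset (Fin n)) (c : ℂ) :
    (symbRestr p J (MvPolynomial.C c : V.Symb n) : V.Symb k) =
      if J = ∅ then MvPolynomial.C c else 0 := by
  rw [symbRestr, symbCoeff_apply, ← MvPolynomial.algebraMap_eq, AlgHom.commutes,
    IsScalarTower.algebraMap_apply ℂ (V.Symb k) (MvPolynomial (Fin n) (V.Symb k)),
    MvPolynomial.algebraMap_eq, MvPolynomial.algebraMap_eq, MvPolynomial.coeff_C]
  have h1 : (0 : Fin n →₀ ℕ) = sqfree J ↔ J = ∅ := by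
    refine ⟨fun h => ?_, fun h => by simp [h, sqfree]⟩
    exact sqfree_injective (h.symm.trans (by simp [sqfree]))
  simp only [h1]

theorem symbRestr_mul_X_front (p : V.Vec) (J : Finset (Fin n)) (P : V.Symb n) {i : Fin n}
    (hi : i ∈ frontSlots k n) (a : V.idx) :
    (symbRestr p J (P * MvPolynomial.X (i, a)) : V.Symb k) =
      if i ∈ J then p a • symbRestr p (J.erase i) P else 0 := by
  rw [symbRestr, symbRestr, symbCoeff_apply, symbCoeff_apply, map_mul, symbAt_X]
  have h1 : testPoint p (frontSlots k n) (onTail fun i a => (MvPolynomial.X (i, a) : V.Symb k))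
      i a = MvPolynomial.X i * MvPolynomial.C (algebraMap ℂ (V.Symb k) (p a)) := by
    simp only [testPoint, onTail_front _ hi, if_pos hi, Pi.zero_apply, map_zero, zero_add]
  rw [h1, ← mul_assoc, mul_comm _ (MvPolynomial.C _), MvPolynomial.coeff_C_mul,
    mul_comm _ (MvPolynomial.X i), coeff_sqfree_X_mul]
  split_ifs
  · rw [Algebra.smul_def]
  · rw [mul_zero]

theorem symbRestr_mul_X_tail (h : k ≤ n) (p : V.Vec) (J : Finset (Fin n)) (P : V.Symb n)
    (i : Fin k) (a : V.idx) : (symbRestr p J (P * MvPolynomial.X (tailSlot h i, a)) : V.Symb k) =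
      symbRestr p J P * MvPolynomial.X (i, a) := by
  rw [symbRestr, symbCoeff_apply, symbCoeff_apply, map_mul, symbAt_X]
  have h1 : testPoint p (frontSlots k n) (onTail fun i a => (MvPolynomial.X (i, a) : V.Symb k))
      (tailSlot h i) a = MvPolynomial.C (MvPolynomial.X (i, a) : V.Symb k) := by
    simp only [testPoint, onTail_tailSlot, if_neg (tailSlot_notMem h i), add_zero]
  rw [h1, mul_comm, MvPolynomial.coeff_C_mul, mul_comm]

/-- An operator applied to powers of a linear function in the first inputs, expanded in terms of its
restrictions. -/
theorem act_plugAt (h : k ≤ n) (p : V.Vec) (Q : V.Symb n) {K : Finset (Fin n)}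
    (hK : K ⊆ frontSlots k n) (g : Fin k → V.Fun) :
    V.act n Q (plugAt (lin p) K g) =
      ∑ J ∈ K.powerset, lin p ^ (K.card - J.card) * V.act k (symbRestr p J Q) g := by
  induction Q using MvPolynomial.induction_on generalizing K g with
  | C c =>
    rw [act_C, prod_plugAt h _ hK, Finset.sum_eq_single ∅]
    · rw [symbRestr_C, if_pos rfl, act_C, Finset.card_empty, tsub_zero, mul_smul_comm]
    · intro J _ hJ
      rw [symbRestr_C, if_neg hJ, map_zero, Pi.zero_apply, mul_zero]
    · simp
  | add P Q hP hQ =>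
    simp only [map_add, Pi.add_apply, hP hK, hQ hK, mul_add, Finset.sum_add_distrib]
  | mul_X P y hP =>
    obtain ⟨i, a⟩ := y
    rw [act_mul_X]
    by_cases hi : i ∈ frontSlots k n
    · simp only [symbRestr_mul_X_front p _ P hi]
      by_cases hiK : i ∈ K
      · have h1 : Function.update (plugAt (lin p) K g) i
            (MvPowerSeries.pderiv ℂ a (plugAt (lin p) K g i)) =
            Function.update (plugAt (lin p) (K.erase i) g) i
              (p a • plugAt (lin p) (K.erase i) g i) := by
          ext1 j
          by_cases hj : j = i
          · subst hj
            rw [Function.update_self, Function.update_self, plugAt_front _ _ _ hi,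
              plugAt_front _ _ _ hi, if_pos hiK, if_neg (by simp), pderiv_lin,
              MvPowerSeries.smul_eq_C_mul, mul_one]
          · rw [Function.update_of_ne hj, Function.update_of_ne hj, plugAt, plugAt]
            simp [hj]
        rw [h1, ← actM_apply, MultilinearMap.map_update_smul, Function.update_eq_self, actM_apply,
          hP ((Finset.erase_subset i K).trans hK), ← Finset.insert_erase hiK,
          Finset.sum_powerset_insert (by simp), Finset.insert_erase hiK, Finset.smul_sum]
        refine Eq.symm ((congrArg₂ (· + ·) (Finset.sum_eq_zero fun J hJ => ?_)
          (Finset.sum_congr rfl fun J hJ => ?_)).trans (zero_add _))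
        · have hiJ : i ∉ J := fun hiJ => by simpa using Finset.mem_powerset.mp hJ hiJ
          rw [if_neg hiJ, map_zero, Pi.zero_apply, mul_zero]
        · have hiJ : i ∉ J := fun hiJ => by simpa using Finset.mem_powerset.mp hJ hiJ
          rw [if_pos (Finset.mem_insert_self i J), Finset.erase_insert hiJ,
            Finset.card_insert_of_notMem hiJ, Finset.card_erase_of_mem hiK, map_smul,
            Pi.smul_apply, mul_smul_comm, Nat.sub_sub, add_comm 1]
      · rw [plugAt_front _ _ _ hi, if_neg hiK, Derivation.map_one_eq_zero, ← actM_apply,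
          MultilinearMap.map_update_zero]
        refine (Finset.sum_eq_zero fun J hJ => ?_).symm
        rw [if_neg fun hiJ => hiK (Finset.mem_powerset.mp hJ hiJ), map_zero, Pi.zero_apply,
          mul_zero]
    · obtain ⟨j, rfl⟩ := eq_tailSlot h hi
      simp only [symbRestr_mul_X_tail, act_mul_X]
      rw [plugAt_tailSlot h _ hK, ← hP hK]
      refine congrArg (V.act n P) (funext fun x => ?_)
      by_cases hx : x ∈ frontSlots k n
      · rw [Function.update_of_ne (fun hxj => hi (by rwa [← hxj])), plugAt_front _ _ _ hx,
          plugAt_front _ _ _ hx]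
      · obtain ⟨y, rfl⟩ := eq_tailSlot h hx
        rw [plugAt_tailSlot h _ hK]
        by_cases hy : y = j
        · subst hy
          rw [Function.update_self, Function.update_self]
        · rw [Function.update_of_ne hy, Function.update_of_ne ((tailSlot_injective h).ne hy),
            plugAt_tailSlot h _ hK]

/-- The first `l` inputs. -/
def firstSlots (n l : ℕ) : Finset (Fin n) := Finset.univ.filter fun i => i.1 < l

theorem card_firstSlots {l : ℕ} (h : l ≤ n) : (firstSlots n l).card = l := by
  rw [firstSlots, Fin.card_filter_val_lt, min_eq_right h]

theorem firstSlots_subset {l : ℕ} (h : k + l ≤ n) : firstSlots n l ⊆ frontSlots k n := by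
  intro i hi
  rw [mem_frontSlots]
  have := (Finset.mem_filter.mp hi).2
  omega

/-- The value of an operator at a tuple with the lowest power of `v^*` for which it does not
vanish. -/
theorem act_plug {l : ℕ} (h : k ≤ n) (hl : k + l ≤ n) (v : V.Vec) {ψ : V.Symb k} {Q : V.Symb n}
    (h0 : ∀ J ⊆ frontSlots k n, J.card < l → (symbRestr (V.codual v) J Q : V.Symb k) = 0)
    (h1 : symbRestr (V.codual v) (firstSlots n l) Q = ψ) (g : Fin k → V.Fun) :
    V.act n Q (V.plug h l v g) = V.act k ψ g := by
  have h2 : V.plug h l v g = plugAt (lin (V.codual v)) (firstSlots n l) g := by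
    ext1 i
    rw [plug, plugAt, dual_eq_lin]
    simp only [firstSlots, Finset.mem_filter, Finset.mem_univ, true_and]
    split_ifs <;> first | rfl | omega
  have h3 := firstSlots_subset hl
  rw [h2, act_plugAt h _ _ h3, Finset.sum_eq_single (firstSlots n l)]
  · rw [h1, tsub_self, pow_zero, one_mul]
  · intro J hJ hne
    have h4 := Finset.card_lt_card ((Finset.mem_powerset.mp hJ).ssubset_of_ne hne)
    rw [card_firstSlots (by omega)] at h4
    rw [h0 J ((Finset.mem_powerset.mp hJ).trans h3) h4, map_zero, Pi.zero_apply, mul_zero]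
  · simp

end SymplecticSpace
namespace SymplecticSpace

variable {V : SymplecticSpace.{u}} {k n : ℕ}

/-! ### The equivariant extension -/

/-- The action of `S_{k+1}` on operators of given weight. -/
noncomputable def permWeight (V : SymplecticSpace.{u}) (k l : ℕ) (v : V.Vec)
    (s : Equiv.Perm (Fin (k + 1))) : V.invWeight k l v →ₗ[ℂ] V.invWeight k l v :=
  (V.perm k s).restrict fun _ h => perm_mem_invWeight s h

theorem coe_permWeight {l : ℕ} {v : V.Vec} (s : Equiv.Perm (Fin (k + 1)))
    (ψ : V.invWeight k l v) : (V.permWeight k l v s ψ : V.Symb k) = V.perm k s ψ := rfl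

theorem permWeight_mul {l : ℕ} {v : V.Vec} (s t : Equiv.Perm (Fin (k + 1)))
    (ψ : V.invWeight k l v) :
    V.permWeight k l v (s * t) ψ = V.permWeight k l v s (V.permWeight k l v t ψ) :=
  Subtype.ext (by rw [coe_permWeight, coe_permWeight, coe_permWeight, map_mul]; rfl)

/-- The average of the symmetric extension over `S_{k+1}`. -/
noncomputable def equivExt (V : SymplecticSpace.{u}) {k n : ℕ} (h : k ≤ n) (l : ℕ) (v : V.Vec) :
    V.invWeight k l v →ₗ[ℂ] V.Symb n :=
  ((k + 1).factorial : ℂ)⁻¹ • ∑ s : Equiv.Perm (Fin (k + 1)),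
    V.perm n (tailPerm h s⁻¹) ∘ₗ V.symmExt h l v ∘ₗ V.permWeight k l v s

theorem equivExt_apply (h : k ≤ n) {l : ℕ} {v : V.Vec} (ψ : V.invWeight k l v) :
    V.equivExt h l v ψ = ((k + 1).factorial : ℂ)⁻¹ • ∑ s : Equiv.Perm (Fin (k + 1)),
      V.perm n (tailPerm h s⁻¹) (V.symmExt h l v (V.permWeight k l v s ψ)) := by
  simp [equivExt]

theorem equivExt_eq_zero (h : k ≤ n) {l : ℕ} {v : V.Vec} (hv : ¬(v ≠ 0 ∧ k + l ≤ n))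
    (ψ : V.invWeight k l v) : V.equivExt h l v ψ = 0 := by
  simp [equivExt_apply, symmExt_eq_zero h hv]

theorem equivExt_mem_inv (h : k ≤ n) {l : ℕ} {v : V.Vec} (ψ : V.invWeight k l v) :
    V.equivExt h l v ψ ∈ V.inv n := by
  by_cases hv : v ≠ 0 ∧ k + l ≤ n
  · rw [equivExt_apply]
    exact Submodule.smul_mem _ _ (Submodule.sum_mem _ fun s _ =>
      perm_mem_inv _ (isSymmExt_symmExt h hv.2 hv.1 _).mem_inv)
  · rw [equivExt_eq_zero h hv]
    exact zero_mem _

theorem equivExt_permWeight (h : k ≤ n) {l : ℕ} {v : V.Vec} (t : Equiv.Perm (Fin (k + 1)))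
    (ψ : V.invWeight k l v) : V.equivExt h l v (V.permWeight k l v t ψ) =
      V.perm n (tailPerm h t) (V.equivExt h l v ψ) := by
  obtain ⟨F, hF⟩ : ∃ F : Equiv.Perm (Fin (k + 1)) → V.Symb n,
      ∀ s, F s = V.symmExt h l v (V.permWeight k l v s ψ) := ⟨_, fun _ => rfl⟩
  simp only [equivExt_apply, ← permWeight_mul, ← hF, map_smul, map_sum]
  rw [← Equiv.sum_comp (Equiv.mulRight t) fun s =>
    V.perm n (tailPerm h t) (V.perm n (tailPerm h s⁻¹) (F s))]
  refine congrArg (((k + 1).factorial : ℂ)⁻¹ • ·) (Finset.sum_congr rfl fun s _ => ?_)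
  rw [Equiv.coe_mulRight, ← Module.End.mul_apply, ← map_mul, ← tailPerm_mul,
    mul_inv_rev, mul_inv_cancel_left]

theorem frontSymm_equivExt (h : k ≤ n) {l : ℕ} (hl : k + l ≤ n) {v : V.Vec} (hv : v ≠ 0)
    (ψ : V.invWeight k l v) : FrontSymm k (V.equivExt h l v ψ) := by
  intro σ hσ ν
  rw [equivExt_apply, symbEval_smul, symbEval_smul, symbEval_sum, symbEval_sum]
  congr 1
  exact Finset.sum_congr rfl fun s _ =>
    frontSymm_tailPerm h s⁻¹ (isSymmExt_symmExt h hl hv _).symm σ hσ ν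

/-- Averaging does not change the restrictions of order `≤ l` in `v^*`, but it may change those of
higher order. -/
theorem symbRestr_equivExt (h : k ≤ n) {l : ℕ} (hl : k + l ≤ n) {v : V.Vec} (hv : v ≠ 0)
    (ψ : V.invWeight k l v) {J : Finset (Fin n)} (hJ : J ⊆ frontSlots k n) (hJl : J.card ≤ l) :
    (symbRestr (V.codual v) J (V.equivExt h l v ψ) : V.Symb k) =
      if J.card = l then (ψ : V.Symb k) else 0 := by
  have h1 : ∀ s : Equiv.Perm (Fin (k + 1)), (symbRestr (V.codual v) J (V.perm n (tailPerm h s⁻¹)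
      (V.symmExt h l v (V.permWeight k l v s ψ))) : V.Symb k) =
        if J.card = l then (ψ : V.Symb k) else 0 := by
    intro s
    have h2 := (isSymmExt_symmExt h hl hv (V.permWeight k l v s ψ)).restr
    rw [symbRestr_tailPerm h, h2 J hJ]
    · split_ifs
      · rw [coe_permWeight, ← Module.End.mul_apply, ← map_mul, inv_mul_cancel, map_one,
          Module.End.one_apply]
      · rw [map_zero]
    · intro K hK
      rw [h2 K (hK.subset.trans hJ), if_neg]
      have := Finset.card_lt_card hK
      omega
  rw [equivExt_apply, map_smul, map_sum, Finset.sum_congr rfl fun s _ => h1 s, Finset.sum_const,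
    Finset.card_univ, Fintype.card_perm, Fintype.card_fin, ← Nat.cast_smul_eq_nsmul ℂ, smul_smul,
    inv_mul_cancel₀ (Nat.cast_ne_zero.mpr (Nat.factorial_ne_zero _)), one_smul]

theorem act_equivExt (h : k ≤ n) {l : ℕ} (hl : k + l ≤ n) {v : V.Vec} (hv : v ≠ 0)
    (ψ : V.invWeight k l v) (g : Fin k → V.Fun) :
    V.act n (V.equivExt h l v ψ) (V.plug h l v g) = V.act k (ψ : V.Symb k) g := by
  refine act_plug h hl v (fun J hJ hJl => ?_) ?_ g
  · rw [symbRestr_equivExt h hl hv ψ hJ hJl.le, if_neg hJl.ne]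
  · rw [symbRestr_equivExt h hl hv ψ (firstSlots_subset hl)
      (card_firstSlots (by omega)).le, if_pos (card_firstSlots (by omega))]

theorem equivExt_injective (h : k ≤ n) {l : ℕ} (hl : k + l ≤ n) {v : V.Vec} (hv : v ≠ 0) :
    Function.Injective (V.equivExt h l v) := by
  rw [injective_iff_map_eq_zero]
  intro ψ hψ
  have h1 := symbRestr_equivExt h hl hv ψ (firstSlots_subset hl) (card_firstSlots (by omega)).le
  rw [if_pos (card_firstSlots (by omega)), hψ, map_zero] at h1
  exact Subtype.ext h1.symm

theorem equivExt_mem_ofOrder (h : k ≤ n) {l r : ℕ} (hl : k + l ≤ n) {v : V.Vec} (hv : v ≠ 0)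
    {ψ : V.invWeight k l v} (hψ : (ψ : V.Symb k) ∈ V.ofOrder k r) :
    V.equivExt h l v ψ ∈ V.ofOrder n (r + l) := by
  rw [equivExt_apply]
  exact Submodule.smul_mem _ _ (Submodule.sum_mem _ fun s _ => perm_mem_ofOrder _
    ((isSymmExt_symmExt h hl hv _).mem_ofOrder h hv (perm_mem_ofOrder s hψ)))

theorem stabInv_of_mem_inv {Q : V.Symb n} (hQ : Q ∈ V.inv n) (v : V.Vec) : V.StabInv n v Q :=
  fun lam _ ν => (mem_inv_iff.mp hQ).1 lam ν

/-- Naturality: by uniqueness, extensions are carried to extensions by linear symplectic maps, and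
invariant operators only see linear parts. -/
theorem carries_equivExt (h : k ≤ n) {V' : SymplecticSpace.{u}} {l : ℕ} (hl : k + l ≤ n)
    {v : V.Vec} {v' : V'.Vec} (hv : v ≠ 0) {α : V.Fun ≃ₐ[ℂ] V'.Fun} (hα : IsSymplectic α)
    (hαv : α (V.dual v) = V'.dual v') {ψ : V.invWeight k l v} {ψ' : V'.invWeight k l v'}
    (hψ : Carries α (ψ : V.Symb k) (ψ' : V'.Symb k)) :
    Carries α (V.equivExt h l v ψ) (V'.equivExt h l v' ψ') := by
  rw [dual_eq_lin V'] at hαv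
  obtain ⟨A, h1, h2, h3⟩ := exists_linear_part_of_dual hα hαv
  rw [← h3] at hαv
  have hv' : v' ≠ 0 := by
    rintro rfl
    rw [codual_zero] at h3
    exact V.codual_ne_zero hv (A.map_eq_zero_iff.mp h3)
  rw [carries_iff (mem_invWeight_iff.mp ψ.2).1 hα h1 h2 hαv] at hψ
  rw [carries_iff (stabInv_of_mem_inv (equivExt_mem_inv h ψ) v) hα h1 h2 hαv]
  intro ν
  rw [equivExt_apply, equivExt_apply, symbEval_smul, symbEval_smul, symbEval_sum, symbEval_sum]
  congr 1
  refine Finset.sum_congr rfl fun s _ => ?_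
  have h4 : ∀ ν : Fin k → V.Vec, symbEval (V'.permWeight k l v' s ψ' : V'.Symb k)
      (fun i => A (ν i)) = symbEval (V.permWeight k l v s ψ : V.Symb k) ν :=
    symbEval_perm_equiv s hψ
  have h5 := IsSymmExt.comp h hv A (c := 1) (e := 1) one_ne_zero (fun μ ν => by rw [one_mul, h1])
    (by rw [one_smul, h3]) (fun ν => by rw [one_pow, one_mul]; exact h4 ν)
    (isSymmExt_symmExt h hl hv (V.permWeight k l v s ψ))
    (isSymmExt_symmExt h hl hv' (V'.permWeight k l v' s ψ'))
  exact symbEval_perm_equiv _ h5 ν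

/-! ### The span of the equivariant extensions -/

/-- Invariant operators that are symmetric in the first `n - k` inputs are sums of equivariant
extensions: subtract the extension of the lowest nonvanishing restriction, and repeat. -/
theorem mem_span_equivExt (h : k ≤ n) {v : V.Vec} (hv : v ≠ 0) {N : ℕ} (d : ℕ) {l : ℕ}
    (hd : k + l + d = n + 1) {x : V.Symb n} (hx : x ∈ V.inv n) (hxN : x ∈ V.ofOrder n N)
    (hxs : FrontSymm k x)
    (hr : ∀ J ⊆ frontSlots k n, J.card < l → (symbRestr (V.codual v) J x : V.Symb k) = 0) :
    x ∈ Submodule.span ℂ {φ : V.Symb n | ∃ (l r : ℕ) (ψ : V.invWeight k l v), k + l ≤ n ∧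
      r + l = N ∧ (ψ : V.Symb k) ∈ V.ofOrder k r ∧ φ = V.equivExt h l v ψ} := by
  -- `d` counts the restrictions not yet known to vanish
  induction d generalizing l x with
  | zero =>
    have h1 : x = 0 := by
      refine eq_of_symbRestr h hv hx (zero_mem _) hxs (fun σ _ ν => by simp) fun J hJ => ?_
      rw [map_zero, hr J hJ]
      have h2 := Finset.card_le_card hJ
      have h3 : (frontSlots k n).card = n - k := card_firstSlots (Nat.sub_le n k)
      omega
    rw [h1]
    exact zero_mem _
  | succ d ih =>
    have hl : k + l ≤ n := by omega
    have hcard : (firstSlots n l).card = l := card_firstSlots (by omega)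
    have hψ := symbRestr_mem_invWeight h hx v (firstSlots n l)
    rw [hcard] at hψ
    obtain ⟨ψ, h1⟩ : ∃ ψ : V.invWeight k l v, (ψ : V.Symb k) =
      symbRestr (V.codual v) (firstSlots n l) x := ⟨⟨_, hψ⟩, rfl⟩
    have h2 : V.equivExt h l v ψ ∈ V.ofOrder n N ∧ V.equivExt h l v ψ ∈ Submodule.span ℂ
        {φ : V.Symb n | ∃ (l r : ℕ) (ψ : V.invWeight k l v), k + l ≤ n ∧
          r + l = N ∧ (ψ : V.Symb k) ∈ V.ofOrder k r ∧ φ = V.equivExt h l v ψ} := by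
      obtain hlN | hlN := le_or_gt l N
      · have h3 : (ψ : V.Symb k) ∈ V.ofOrder k (N - l) := by
          rw [h1]
          refine symbRestr_mem_ofOrder ?_ v
          rwa [hcard, Nat.sub_add_cancel hlN]
        refine ⟨?_, Submodule.subset_span ⟨l, N - l, ψ, hl, by omega, h3, rfl⟩⟩
        have h4 := equivExt_mem_ofOrder h hl hv h3
        rwa [Nat.sub_add_cancel hlN] at h4
      · have h3 : ψ = 0 := Subtype.ext (h1.trans (symbRestr_eq_zero hxN (by rwa [hcard]) v))
        rw [h3, map_zero]
        exact ⟨zero_mem _, zero_mem _⟩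
    rw [← sub_add_cancel x (V.equivExt h l v ψ)]
    refine add_mem (ih (l := l + 1) (by omega) (sub_mem hx (equivExt_mem_inv h ψ))
      (sub_mem hxN h2.1) (fun σ hσ ν => ?_) fun J hJ hJl => ?_) h2.2
    · rw [symbEval_sub, symbEval_sub, hxs σ hσ, frontSymm_equivExt h hl hv ψ σ hσ]
    · rw [map_sub, symbRestr_equivExt h hl hv ψ hJ (by omega)]
      split_ifs with hJl'
      · rw [h1, hxs.symbRestr_eq hJ (firstSlots_subset hl) (hJl'.trans hcard.symm), sub_self]
      · rw [hr J hJ (by omega), sub_zero]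

/-- The `S_{n+1}`-span of the equivariant extensions is generated by the invariants of `S_{n-k}`. -/
theorem groupSpan_equivExt (h : k ≤ n) {v : V.Vec} (hv : v ≠ 0) (N : ℕ) :
    groupSpan (V.perm n) {φ : V.Symb n | ∃ (l r : ℕ) (ψ : V.invWeight k l v), k + l ≤ n ∧
      r + l = N ∧ (ψ : V.Symb k) ∈ V.ofOrder k r ∧ φ = V.equivExt h l v ψ} =
    groupSpan (V.perm n) {x | x ∈ V.inv n ⊓ V.ofOrder n N ∧
      ∀ s : Equiv.Perm (Fin (n + 1)), (∀ i, n - k ≤ i.1 → s i = i) → V.perm n s x = x} := by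
  apply le_antisymm
  · refine Submodule.span_mono ?_
    rintro _ ⟨s, _, ⟨l, r, ψ, hl, rfl, hψ, rfl⟩, rfl⟩
    exact ⟨s, _, ⟨⟨equivExt_mem_inv h ψ, equivExt_mem_ofOrder h hl hv hψ⟩,
      frontSymm_iff.mp (frontSymm_equivExt h hl hv ψ)⟩, rfl⟩
  · refine Submodule.span_le.mpr ?_
    rintro _ ⟨s, x, ⟨⟨hx, hxN⟩, hxs⟩, rfl⟩
    have h1 := mem_span_equivExt h hv (n + 1 - k) (l := 0) (by omega) hx hxN
      (frontSymm_iff.mpr hxs) fun J _ hJ => absurd hJ (Nat.not_lt_zero _)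
    have h2 := Submodule.mem_map_of_mem (f := V.perm n s) h1
    rw [Submodule.map_span] at h2
    refine Submodule.span_mono ?_ h2
    rintro _ ⟨x, hx, rfl⟩
    exact ⟨s, x, hx, rfl⟩

end SymplecticSpace

/-! ### Row symmetrizers and column antisymmetrizers -/

section Symmetrizers

open Equiv MonoidAlgebra

variable {α : Type*} [Fintype α] [DecidableEq α]

/-- The permutations that preserve a colouring. -/
def colourPerms (r : α → ℕ) : Finset (Perm α) := Finset.univ.filter fun p => ∀ x, r (p x) = r x

theorem mem_colourPerms {r : α → ℕ} {p : Perm α} : p ∈ colourPerms r ↔ ∀ x, r (p x) = r x := by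
  simp [colourPerms]

/-- The sum of the permutations that preserve a colouring. -/
noncomputable def symmetrizer (r : α → ℕ) : MonoidAlgebra ℂ (Perm α) :=
  ∑ p ∈ colourPerms r, single p 1

/-- The alternating sum of the permutations that preserve a colouring. -/
noncomputable def antisymmetrizer (c : α → ℕ) : MonoidAlgebra ℂ (Perm α) :=
  ∑ q ∈ colourPerms c, single q ((Perm.sign q : ℤ) : ℂ)

theorem mul_mem_colourPerms {r : α → ℕ} {p q : Perm α} (hp : p ∈ colourPerms r) :
    p * q ∈ colourPerms r ↔ q ∈ colourPerms r := by
  rw [mem_colourPerms] at *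
  rw [mem_colourPerms]
  simp only [Perm.mul_apply, hp]

theorem inv_mem_colourPerms {r : α → ℕ} {p : Perm α} (hp : p ∈ colourPerms r) :
    p⁻¹ ∈ colourPerms r := by
  rw [← mul_mem_colourPerms hp, mul_inv_cancel, mem_colourPerms]
  simp

theorem mul_mem_colourPerms' {r : α → ℕ} {p q : Perm α} (hp : p ∈ colourPerms r) :
    q * p ∈ colourPerms r ↔ q ∈ colourPerms r := by
  rw [mem_colourPerms] at *
  rw [mem_colourPerms]
  simp only [Perm.mul_apply]
  refine ⟨fun h x => ?_, fun h x => by rw [h, hp]⟩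
  have h1 := h (p.symm x)
  rw [p.apply_symm_apply] at h1
  rw [h1, ← hp (p.symm x), p.apply_symm_apply]

theorem swap_mem_colourPerms {r : α → ℕ} {x y : α} (h : r x = r y) :
    swap x y ∈ colourPerms r := by
  rw [mem_colourPerms]
  intro z
  rw [swap_apply_def]
  split_ifs with h1 h2
  · rw [h1, h]
  · rw [h2, h]
  · rfl

theorem single_mul_symmetrizer {r : α → ℕ} {p : Perm α} (hp : p ∈ colourPerms r) :
    single p 1 * symmetrizer r = symmetrizer r := by
  rw [symmetrizer, Finset.mul_sum]
  refine Finset.sum_bijective (p * ·) (Group.mulLeft_bijective p)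
    (fun q => (mul_mem_colourPerms hp).symm) fun q _ => ?_
  rw [single_mul_single, one_mul]

theorem symmetrizer_mul_single {r : α → ℕ} {p : Perm α} (hp : p ∈ colourPerms r) :
    symmetrizer r * single p 1 = symmetrizer r := by
  rw [symmetrizer, Finset.sum_mul]
  refine Finset.sum_bijective (· * p) (Group.mulRight_bijective p)
    (fun q => (mul_mem_colourPerms' hp).symm) fun q _ => ?_
  rw [single_mul_single, one_mul]

theorem permSign_mul_self (p : Perm α) : ((Perm.sign p : ℤ) : ℂ) * ((Perm.sign p : ℤ) : ℂ) = 1 := by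
  rw [← Int.cast_mul, ← Units.val_mul, Int.units_mul_self, Units.val_one, Int.cast_one]

theorem single_mul_antisymmetrizer {c : α → ℕ} {p : Perm α} (hp : p ∈ colourPerms c) :
    single p 1 * antisymmetrizer c = ((Perm.sign p : ℤ) : ℂ) • antisymmetrizer c := by
  rw [antisymmetrizer, Finset.mul_sum, Finset.smul_sum]
  refine Finset.sum_bijective (p * ·) (Group.mulLeft_bijective p)
    (fun q => (mul_mem_colourPerms hp).symm) fun q _ => ?_
  rw [single_mul_single, one_mul, smul_single, Perm.sign_mul, Units.val_mul, Int.cast_mul,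
    smul_eq_mul, ← mul_assoc, permSign_mul_self, one_mul]

theorem antisymmetrizer_mul_single {c : α → ℕ} {p : Perm α} (hp : p ∈ colourPerms c) :
    antisymmetrizer c * single p 1 = ((Perm.sign p : ℤ) : ℂ) • antisymmetrizer c := by
  rw [antisymmetrizer, Finset.sum_mul, Finset.smul_sum]
  refine Finset.sum_bijective (· * p) (Group.mulRight_bijective p)
    (fun q => (mul_mem_colourPerms' hp).symm) fun q _ => ?_
  rw [single_mul_single, mul_one, smul_single, Perm.sign_mul, Units.val_mul, Int.cast_mul,
    smul_eq_mul, mul_comm, mul_assoc, permSign_mul_self, mul_one]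

theorem single_mul_antisymmetrizer_swap {c : α → ℕ} {x y : α} (hxy : x ≠ y) (h : c x = c y) :
    single (swap x y) 1 * antisymmetrizer c = -antisymmetrizer c := by
  rw [single_mul_antisymmetrizer (swap_mem_colourPerms h), Perm.sign_swap hxy]
  simp

theorem antisymmetrizer_mul_single_swap {c : α → ℕ} {x y : α} (hxy : x ≠ y) (h : c x = c y) :
    antisymmetrizer c * single (swap x y) 1 = -antisymmetrizer c := by
  rw [antisymmetrizer_mul_single (swap_mem_colourPerms h), Perm.sign_swap hxy]
  simp

omit [Fintype α] in
theorem single_mul_swap (g : Perm α) (x y : α) : (single g 1 * single (swap x y) 1 :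
    MonoidAlgebra ℂ (Perm α)) = single (swap (g x) (g y)) 1 * single g 1 := by
  rw [single_mul_single, single_mul_single, mul_swap_eq_swap_mul]

/-- If two points have the same colour for both colourings, the product vanishes: the transposition of
the two points can be absorbed on the left, and on the right at the cost of a sign. -/
theorem symmetrizer_mul_single_mul_antisymmetrizer {r c : α → ℕ} {g : Perm α} {x y : α}
    (hxy : x ≠ y) (hr : r (g x) = r (g y)) (hc : c x = c y) :
    symmetrizer r * single g 1 * antisymmetrizer c = 0 := by
  have h1 : symmetrizer r * single g 1 * antisymmetrizer c =
      -(symmetrizer r * single g 1 * antisymmetrizer c) := by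
    conv_lhs => rw [← symmetrizer_mul_single (swap_mem_colourPerms hr), mul_assoc (symmetrizer r),
      ← single_mul_swap, ← mul_assoc, mul_assoc _ _ (antisymmetrizer c),
      single_mul_antisymmetrizer_swap hxy hc, mul_neg]
  have h2 : (2 : ℂ) • (symmetrizer r * single g 1 * antisymmetrizer c) = 0 := by
    rw [two_smul]
    nth_rewrite 2 [h1]
    exact add_neg_cancel _
  exact (smul_eq_zero.mp h2).resolve_left two_ne_zero

/-! ### Ideals of the group algebra -/

theorem mem_span_single {G : Type*} (y : MonoidAlgebra ℂ G) :
    y ∈ Submodule.span ℂ (Set.range fun g : G => (single g 1 : MonoidAlgebra ℂ G)) := by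
  induction y using MonoidAlgebra.induction_linear with
  | zero => exact zero_mem _
  | add y z hy hz => exact add_mem hy hz
  | single g a =>
    rw [← mul_one a, ← smul_eq_mul, ← smul_single]
    exact Submodule.smul_mem _ _ (Submodule.subset_span ⟨g, rfl⟩)

/-- By Maschke's theorem, a left ideal of square zero is zero. -/
theorem eq_zero_of_mul_eq_zero {G : Type*} [Group G] [Fintype G]
    (K : Submodule (MonoidAlgebra ℂ G) (MonoidAlgebra ℂ G))
    (h : ∀ x ∈ K, ∀ y ∈ K, x * y = 0) {x : MonoidAlgebra ℂ G} (hx : x ∈ K) : x = 0 := by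
  have : NeZero (Nat.card G : ℂ) := ⟨Nat.cast_ne_zero.mpr Nat.card_pos.ne'⟩
  obtain ⟨K', hK⟩ := MonoidAlgebra.Submodule.exists_isCompl K
  have h1 : (1 : MonoidAlgebra ℂ G) ∈ K ⊔ K' := hK.sup_eq_top ▸ Submodule.mem_top
  obtain ⟨e, he, e', he', h2⟩ := Submodule.mem_sup.mp h1
  have h3 : x * e' = x := by
    rw [← add_zero (x * e'), ← h x hx e he, ← mul_add, add_comm, h2, mul_one]
  have h4 : x ∈ K' := h3 ▸ K'.smul_mem x he'
  have h5 : x ∈ K ⊓ K' := ⟨hx, h4⟩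
  rwa [hK.inf_eq_bot, Submodule.mem_bot] at h5

end Symmetrizers

/-! ### Tableaux -/

section Tableaux

open Equiv MonoidAlgebra

theorem Finset.sum_range_card_le (s : Finset ℕ) : ∑ i ∈ Finset.range s.card, i ≤ ∑ i ∈ s, i := by
  induction s using Finset.induction_on_max with
  | empty => simp
  | insert a s ha ih =>
    have h1 : a ∉ s := fun h => (ha a h).false
    have h2 : s.card ≤ a := by
      rw [← Finset.card_range a]
      exact Finset.card_le_card fun x hx => Finset.mem_range.mpr (ha x hx)
    rw [Finset.card_insert_of_notMem h1, Finset.sum_range_succ, Finset.sum_insert h1]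
    omega

variable {α : Type*} [Fintype α] {μ : YoungDiagram}

/-- The row of an entry of a tableau. -/
def rowOf (T : ↥μ.cells ≃ α) (x : α) : ℕ := (T.symm x).1.1

/-- The column of an entry of a tableau. -/
def colOf (T : ↥μ.cells ≃ α) (x : α) : ℕ := (T.symm x).1.2

omit [Fintype α] in
theorem rowOf_colOf_mem (T : ↥μ.cells ≃ α) (x : α) : (rowOf T x, colOf T x) ∈ μ :=
  (T.symm x).2

omit [Fintype α] in
theorem eq_of_rowOf_colOf (T : ↥μ.cells ≃ α) {x y : α} (h : rowOf T x = rowOf T y)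
    (h' : colOf T x = colOf T y) : x = y :=
  T.symm.injective (Subtype.ext (Prod.ext h h'))

omit [Fintype α] in
theorem exists_rowOf_colOf (T : ↥μ.cells ≃ α) {i j : ℕ} (h : (i, j) ∈ μ) :
    ∃ x, rowOf T x = i ∧ colOf T x = j :=
  ⟨T ⟨(i, j), h⟩, by simp [rowOf], by simp [colOf]⟩

theorem sum_column_rowOf (T : ↥μ.cells ≃ α) [DecidableEq α] (j : ℕ) :
    ∑ x with colOf T x = j, rowOf T x = ∑ i ∈ Finset.range (μ.colLen j), i ∧
      (Finset.univ.filter fun x => colOf T x = j).card = μ.colLen j := by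
  have h1 : Set.InjOn (rowOf T) (Finset.univ.filter fun x => colOf T x = j) := by
    intro x hx y hy hxy
    simp only [Finset.coe_filter, Finset.mem_univ, true_and, Set.mem_ofPred_eq] at hx hy
    exact eq_of_rowOf_colOf T hxy (hx.trans hy.symm)
  have h2 : (Finset.univ.filter fun x => colOf T x = j).image (rowOf T) =
      Finset.range (μ.colLen j) := by
    ext i
    rw [Finset.mem_range, ← YoungDiagram.mem_iff_lt_colLen, Finset.mem_image]
    constructor
    · rintro ⟨x, hx, rfl⟩
      rw [← (Finset.mem_filter.mp hx).2]
      exact rowOf_colOf_mem T x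
    · intro h
      obtain ⟨x, hx, hx'⟩ := exists_rowOf_colOf T h
      exact ⟨x, by simp [hx'], hx⟩
  rw [← h2, Finset.sum_image h1, ← Finset.card_image_of_injOn h1, h2, Finset.card_range]
  exact ⟨rfl, rfl⟩

/-- The version of `sum_rowOf_le` for a single column: distinct natural numbers have at least the sum
`0 + 1 + ⋯`, with equality only for an initial segment. -/
theorem le_sum_column (T : ↥μ.cells ≃ α) [DecidableEq α] {f : α → ℕ}
    (hf : ∀ x y, f x = f y → colOf T x = colOf T y → x = y) (j : ℕ) :
    ∑ x with colOf T x = j, rowOf T x ≤ ∑ x with colOf T x = j, f x ∧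
      (∑ x with colOf T x = j, rowOf T x = ∑ x with colOf T x = j, f x →
        ∀ x, colOf T x = j → f x < μ.colLen j) := by
  obtain ⟨h1, h2⟩ := sum_column_rowOf T j
  have h3 : Set.InjOn f (Finset.univ.filter fun x => colOf T x = j) := by
    intro x hx y hy hxy
    simp only [Finset.coe_filter, Finset.mem_univ, true_and, Set.mem_ofPred_eq] at hx hy
    exact hf x y hxy (hx.trans hy.symm)
  have h4 := Finset.card_image_of_injOn h3
  rw [h2] at h4
  have h5 : ∑ x with colOf T x = j, f x =
      ∑ i ∈ (Finset.univ.filter fun x => colOf T x = j).image f, i := 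
    (Finset.sum_image (f := fun i => i) h3).symm
  rw [h1, h5]
  obtain ⟨s, hs⟩ : ∃ s, s = (Finset.univ.filter fun x => colOf T x = j).image f := ⟨_, rfl⟩
  rw [← hs] at h4 ⊢
  rw [← h4]
  refine ⟨s.sum_range_card_le, fun h x hx => ?_⟩
  have hxs : f x ∈ s := by
    rw [hs]
    exact Finset.mem_image_of_mem f (by simp [hx])
  by_contra hlt
  rw [not_lt] at hlt
  -- replacing `f x` by the largest element of the complement of the other elements lowers the sum
  have h6 := (s.erase (f x)).sum_range_card_le
  have h7 := Finset.add_sum_erase s (fun i => i) hxs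
  rw [Finset.card_erase_of_mem hxs] at h6
  have h8 : 0 < s.card := Finset.card_pos.mpr ⟨_, hxs⟩
  have h9 := Finset.sum_range_succ (fun i => i) (s.card - 1)
  rw [Nat.sub_add_cancel h8] at h9
  omega

/-- A colouring that separates the entries of each column has at least the sum of the row
colouring, with equality only if it takes the values of the row colouring in each column. -/
theorem sum_rowOf_le (T : ↥μ.cells ≃ α) {f : α → ℕ}
    (hf : ∀ x y, f x = f y → colOf T x = colOf T y → x = y) :
    ∑ x, rowOf T x ≤ ∑ x, f x ∧
      (∑ x, rowOf T x = ∑ x, f x → ∀ x, (f x, colOf T x) ∈ μ) := by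
  classical
  have h1 : ∀ g : α → ℕ, ∑ x, g x = ∑ j ∈ Finset.univ.image (colOf T),
      ∑ x with colOf T x = j, g x := fun g =>
    (Finset.sum_fiberwise_of_maps_to (fun x _ => Finset.mem_image_of_mem _ (Finset.mem_univ x))
      g).symm
  have h2 : ∀ j ∈ Finset.univ.image (colOf T), ∑ x with colOf T x = j, rowOf T x ≤
      ∑ x with colOf T x = j, f x := fun j _ => (le_sum_column T hf j).1
  rw [h1, h1 f]
  refine ⟨Finset.sum_le_sum h2, fun h x => ?_⟩
  rw [YoungDiagram.mem_iff_lt_colLen]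
  exact (le_sum_column T hf _).2 ((Finset.sum_eq_sum_iff_of_le h2).mp h _
    (Finset.mem_image_of_mem _ (Finset.mem_univ x))) x rfl

variable [DecidableEq α]

/-- A permutation that separates rows from columns is the product of a permutation preserving the
rows and one preserving the columns. -/
theorem exists_eq_mul (T : ↥μ.cells ≃ α) {g : Perm α}
    (hg : ∀ x y, rowOf T (g x) = rowOf T (g y) → colOf T x = colOf T y → x = y) :
    ∃ p ∈ colourPerms (rowOf T), ∃ q ∈ colourPerms (colOf T), g = p * q := by
  have h1 := (sum_rowOf_le T hg).2 (Equiv.sum_comp g (rowOf T)).symm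
  choose q hq hq' using fun x => exists_rowOf_colOf T (h1 x)
  have hinj : Function.Injective q := fun x y hxy => by
    refine hg x y ?_ ?_
    · rw [← hq, hxy, hq]
    · rw [← hq', hxy, hq']
  let σ : Perm α := Equiv.ofBijective q (Finite.injective_iff_bijective.mp hinj)
  refine ⟨σ.symm.trans g, mem_colourPerms.mpr fun x => ?_, σ, mem_colourPerms.mpr hq', ?_⟩
  · have h2 : rowOf T (σ (σ.symm x)) = rowOf T (g (σ.symm x)) := hq _
    rw [σ.apply_symm_apply] at h2
    exact h2.symm
  · ext x
    simp

theorem YoungDiagram.eq_of_rowLen {μ ν : YoungDiagram} (h : ∀ i, μ.rowLen i = ν.rowLen i) :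
    μ = ν := by
  refine YoungDiagram.ext (Finset.ext fun c => ?_)
  rw [YoungDiagram.mem_cells, YoungDiagram.mem_cells, ← Prod.mk.eta (p := c),
    YoungDiagram.mem_iff_lt_rowLen, YoungDiagram.mem_iff_lt_rowLen, h]

omit [DecidableEq α] in
theorem card_rowOf_eq (T : ↥μ.cells ≃ α) (i : ℕ) :
    (Finset.univ.filter fun x => rowOf T x = i).card = μ.rowLen i := by
  rw [← Finset.card_range (μ.rowLen i)]
  refine Finset.card_nbij (colOf T) (fun x hx => ?_) (fun x hx y hy hxy => ?_) fun j hj => ?_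
  · rw [Finset.mem_coe, Finset.mem_range, ← YoungDiagram.mem_iff_lt_rowLen,
      ← (Finset.mem_filter.mp hx).2]
    exact rowOf_colOf_mem T x
  · exact eq_of_rowOf_colOf T ((Finset.mem_filter.mp hx).2.trans (Finset.mem_filter.mp hy).2.symm)
      hxy
  · rw [Finset.mem_coe, Finset.mem_range, ← YoungDiagram.mem_iff_lt_rowLen] at hj
    obtain ⟨x, hx, hx'⟩ := exists_rowOf_colOf T hj
    exact ⟨x, by simp [hx], hx'⟩

/-- Tableaux of different shapes: some two entries lie in one row of the first and in one column of
the second. -/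
theorem exists_rowOf_eq_colOf_eq {lam : YoungDiagram} (T' : ↥lam.cells ≃ α) (T : ↥μ.cells ≃ α)
    (hne : lam ≠ μ) (hle : ∑ x, rowOf T' x ≤ ∑ x, rowOf T x) (g : Perm α) :
    ∃ x y, x ≠ y ∧ rowOf T' (g x) = rowOf T' (g y) ∧ colOf T x = colOf T y := by
  by_contra hcon
  push Not at hcon
  have hg : ∀ x y, rowOf T' (g x) = rowOf T' (g y) → colOf T x = colOf T y → x = y :=
    fun x y h1 h2 => by_contra fun h3 => hcon x y h3 h1 h2
  have h0 : ∑ x, rowOf T' (g x) = ∑ x, rowOf T' x := Equiv.sum_comp g (rowOf T')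
  have h1 := sum_rowOf_le T hg
  have h2 := h1.2 (le_antisymm h1.1 (h0.trans_le hle))
  refine hne (YoungDiagram.eq_of_rowLen fun i => ?_)
  choose q hq hq' using fun x => exists_rowOf_colOf T (h2 x)
  have hinj : Function.Injective q := fun x y hxy => by
    refine hg x y ?_ ?_
    · rw [← hq, hxy, hq]
    · rw [← hq', hxy, hq']
  let σ : Perm α := Equiv.ofBijective q (Finite.injective_iff_bijective.mp hinj)
  rw [← card_rowOf_eq T' i, ← card_rowOf_eq T i]
  refine Finset.card_bijective (g.symm.trans σ) (g.symm.trans σ).bijective fun x => ?_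
  have h3 : rowOf T (σ (g.symm x)) = rowOf T' (g (g.symm x)) := hq _
  rw [g.apply_symm_apply] at h3
  simp [h3]

/-- The tableau form of the Young symmetrizer. -/
theorem youngSymmetrizer_eq {N : ℕ} (T : ↥μ.cells ≃ Fin N) :
    youngSymmetrizer T = symmetrizer (rowOf T) * antisymmetrizer (colOf T) := by
  rw [youngSymmetrizer, symmetrizer, antisymmetrizer, Finset.sum_mul_sum]
  refine Finset.sum_congr ?_ fun p _ => Finset.sum_congr ?_ fun q _ => ?_
  · ext p
    rw [mem_colourPerms]
    exact Finset.mem_filter.trans ⟨fun h => h.2, fun h => ⟨Finset.mem_univ _, h⟩⟩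
  · ext p
    rw [mem_colourPerms]
    exact Finset.mem_filter.trans ⟨fun h => h.2, fun h => ⟨Finset.mem_univ _, h⟩⟩
  · rw [single_mul_single, one_mul]

end Tableaux

/-! ### Young symmetrizers generate the group algebra -/

section YoungSymmetrizers

open Equiv MonoidAlgebra

variable {N : ℕ}

theorem YoungDiagram.card_cellsOfRowLens (w : List ℕ) :
    (YoungDiagram.cellsOfRowLens w).card = w.sum := by
  induction w with
  | nil => rfl
  | cons a w ih =>
    rw [YoungDiagram.cellsOfRowLens, Finset.card_union_of_disjoint, Finset.card_map, ih,
      Finset.card_product, Finset.card_singleton, Finset.card_range, one_mul, List.sum_cons]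
    rw [Finset.disjoint_left]
    rintro ⟨i, j⟩ h1 h2
    simp only [Finset.mem_product, Finset.mem_singleton] at h1
    simp only [Finset.mem_map, Function.Embedding.prodMap, Function.Embedding.coeFn_mk,
      Prod.map_apply', Prod.mk.injEq] at h2
    obtain ⟨c, -, h2⟩ := h2
    exact Nat.succ_ne_zero _ (h2.1.trans h1.1)

/-- The Young diagram whose row lengths are the parts of a partition. -/
def Nat.Partition.diagram (P : N.Partition) : YoungDiagram :=
  YoungDiagram.ofRowLens (P.parts.sort (· ≥ ·)) (P.parts.pairwise_sort (· ≥ ·)).sortedGE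

theorem Nat.Partition.card_diagram (P : N.Partition) : P.diagram.cells.card = N := by
  refine (YoungDiagram.card_cellsOfRowLens _).trans ?_
  rw [← Multiset.sum_coe, Multiset.sort_eq, P.parts_sum]

theorem Nat.Partition.diagram_injective :
    Function.Injective (Nat.Partition.diagram : N.Partition → YoungDiagram) := by
  intro P Q h
  have h1 : ∀ P : N.Partition, P.diagram.rowLens = P.parts.sort (· ≥ ·) := fun P =>
    YoungDiagram.rowLens_ofRowLens_eq_self fun x hx => P.parts_pos (by simpa using hx)
  have h2 := h1 P
  rw [h, h1 Q] at h2
  refine Nat.Partition.ext ?_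
  rw [← Multiset.sort_eq P.parts (· ≥ ·), ← h2, Multiset.sort_eq]

/-- A tableau for each partition. -/
noncomputable def Nat.Partition.tableau (P : N.Partition) : ↥P.diagram.cells ≃ Fin N :=
  Finset.equivFinOfCardEq P.card_diagram

variable {lam μ : YoungDiagram}

/-- The identity is a product of a row and a column permutation in only one way. -/
theorem coeff_youngSymmetrizer_one (T : ↥μ.cells ≃ Fin N) : (youngSymmetrizer T).coeff 1 = 1 := by
  rw [youngSymmetrizer_eq, symmetrizer, antisymmetrizer, Finset.sum_mul_sum, coeff_sum,
    Finset.sum_apply', Finset.sum_eq_single 1]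
  · rw [coeff_sum, Finset.sum_apply', Finset.sum_eq_single 1]
    · simp
    · intro q _ hq
      rw [single_mul_single, coeff_single, Finsupp.single_apply, if_neg (by simpa using hq)]
    · intro h
      exact absurd (mem_colourPerms.mpr fun _ => rfl) h
  · intro p hp hne
    rw [coeff_sum, Finset.sum_apply', Finset.sum_eq_zero]
    intro q hq
    rw [single_mul_single, coeff_single, Finsupp.single_apply, if_neg]
    intro hpq
    rw [mul_eq_one_iff_eq_inv] at hpq
    have hp' := inv_mem_colourPerms hq
    rw [← hpq, mem_colourPerms] at hp'
    refine hne (Equiv.ext fun x => ?_)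
    exact eq_of_rowOf_colOf T (mem_colourPerms.mp hp x) (hp' x)
  · intro h
    exact absurd (mem_colourPerms.mpr fun _ => rfl) h

/-- The main property of Young symmetrizers: a permutation either is a product of a row and a column
permutation, or it puts two entries of one column into one row. -/
theorem exists_symmetrizer_mul_mul_eq (T : ↥μ.cells ≃ Fin N) (y : MonoidAlgebra ℂ (Perm (Fin N))) :
    ∃ a : ℂ, symmetrizer (rowOf T) * y * antisymmetrizer (colOf T) = a • youngSymmetrizer T := by
  have hy := mem_span_single y
  induction hy using Submodule.span_induction with
  | mem y hy =>
    obtain ⟨g, rfl⟩ := hy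
    by_cases hg : ∀ x y, rowOf T (g x) = rowOf T (g y) → colOf T x = colOf T y → x = y
    · obtain ⟨p, hp, q, hq, rfl⟩ := exists_eq_mul T hg
      refine ⟨((Perm.sign q : ℤ) : ℂ), ?_⟩
      have h1 : (single (p * q) 1 : MonoidAlgebra ℂ (Perm (Fin N))) = single p 1 * single q 1 := by
        rw [single_mul_single, one_mul]
      dsimp only
      rw [h1, ← mul_assoc, symmetrizer_mul_single hp, mul_assoc, single_mul_antisymmetrizer hq,
        mul_smul_comm, youngSymmetrizer_eq]
    · push Not at hg
      obtain ⟨x, y, h1, h2, h3⟩ := hg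
      refine ⟨0, ?_⟩
      rw [zero_smul]
      exact symmetrizer_mul_single_mul_antisymmetrizer h3 h1 h2
  | zero => exact ⟨0, by simp⟩
  | add y z _ _ hy hz =>
    obtain ⟨a, ha⟩ := hy
    obtain ⟨b, hb⟩ := hz
    exact ⟨a + b, by rw [mul_add, add_mul, ha, hb, add_smul]⟩
  | smul c y _ hy =>
    obtain ⟨a, ha⟩ := hy
    exact ⟨c * a, by rw [mul_smul_comm, smul_mul_assoc, ha, smul_smul]⟩

theorem exists_youngSymmetrizer_mul_mul_eq (T : ↥μ.cells ≃ Fin N)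
    (y : MonoidAlgebra ℂ (Perm (Fin N))) :
    ∃ a : ℂ, youngSymmetrizer T * y * youngSymmetrizer T = a • youngSymmetrizer T := by
  obtain ⟨a, ha⟩ := exists_symmetrizer_mul_mul_eq T
    (antisymmetrizer (colOf T) * y * symmetrizer (rowOf T))
  refine ⟨a, ?_⟩
  rw [← ha, youngSymmetrizer_eq]
  simp only [mul_assoc]

/-- Young symmetrizers of different shapes are orthogonal, in one of the two orders. Comparing the row
sums `∑ x, rowOf T x` plays the role of comparing the shapes. -/
theorem youngSymmetrizer_mul_mul_eq_zero (T' : ↥lam.cells ≃ Fin N) (T : ↥μ.cells ≃ Fin N)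
    (hne : lam ≠ μ) (hle : ∑ x, rowOf T' x ≤ ∑ x, rowOf T x) (y : MonoidAlgebra ℂ (Perm (Fin N))) :
    youngSymmetrizer T' * y * youngSymmetrizer T = 0 := by
  have key : ∀ y : MonoidAlgebra ℂ (Perm (Fin N)),
      symmetrizer (rowOf T') * y * antisymmetrizer (colOf T) = 0 := by
    intro y
    have hy := mem_span_single y
    induction hy using Submodule.span_induction with
    | mem y hy =>
      obtain ⟨g, rfl⟩ := hy
      obtain ⟨x, y, h1, h2, h3⟩ := exists_rowOf_eq_colOf_eq T' T hne hle g
      exact symmetrizer_mul_single_mul_antisymmetrizer h1 h2 h3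
    | zero => simp
    | add y z _ _ hy hz => rw [mul_add, add_mul, hy, hz, add_zero]
    | smul c y _ hy => rw [mul_smul_comm, smul_mul_assoc, hy, smul_zero]
  have h1 := key (antisymmetrizer (colOf T') * y * symmetrizer (rowOf T))
  rw [youngSymmetrizer_eq, youngSymmetrizer_eq, ← h1]
  simp only [mul_assoc]

/-- The left ideals generated by the Young symmetrizers are simple. -/
theorem youngSymmetrizer_mem_of_ne_zero (T : ↥μ.cells ≃ Fin N)
    {K : Submodule (MonoidAlgebra ℂ (Perm (Fin N))) (MonoidAlgebra ℂ (Perm (Fin N)))}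
    (hK : K ≤ spechtModule T) {x : MonoidAlgebra ℂ (Perm (Fin N))} (hx : x ∈ K) (h0 : x ≠ 0) :
    youngSymmetrizer T ∈ K := by
  by_contra hc
  refine h0 (eq_zero_of_mul_eq_zero K (fun y hy z hz => ?_) hx)
  obtain ⟨a, rfl⟩ := Submodule.mem_span_singleton.mp (hK hy)
  obtain ⟨b, rfl⟩ := Submodule.mem_span_singleton.mp (hK hz)
  obtain ⟨e, he⟩ := exists_youngSymmetrizer_mul_mul_eq T b
  have h1 : e • youngSymmetrizer T ∈ K := by
    rw [← he, mul_assoc]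
    exact K.smul_mem _ hz
  have he0 : e = 0 := by
    by_contra he0
    refine hc ?_
    have h2 := K.smul_mem (algebraMap ℂ _ e⁻¹) h1
    rwa [algebraMap_smul, smul_smul, inv_mul_cancel₀ he0, one_smul] at h2
  rw [smul_eq_mul, smul_eq_mul, mul_assoc, ← mul_assoc (youngSymmetrizer T), he, he0, zero_smul,
    mul_zero]

/-! ### The center of the group algebra -/

/-- The sum of the conjugates of an element of a group algebra. -/
noncomputable def conjSum {G : Type*} [Group G] [Fintype G] (y : MonoidAlgebra ℂ G) :
    MonoidAlgebra ℂ G := ∑ g : G, single g 1 * y * single g⁻¹ 1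

theorem single_mul_conjSum {G : Type*} [Group G] [Fintype G] (y : MonoidAlgebra ℂ G) (h : G) :
    single h 1 * conjSum y = conjSum y * single h 1 := by
  rw [conjSum, Finset.mul_sum, Finset.sum_mul]
  refine Finset.sum_bijective (h * ·) (Group.mulLeft_bijective h) (by simp) fun g _ => ?_
  rw [mul_assoc _ _ (single h 1), single_mul_single, ← mul_assoc, ← mul_assoc, single_mul_single]
  simp

theorem conjSum_commute {G : Type*} [Group G] [Fintype G] (y z : MonoidAlgebra ℂ G) :
    z * conjSum y = conjSum y * z := by
  have hz := mem_span_single z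
  induction hz using Submodule.span_induction with
  | mem z hz =>
    obtain ⟨g, rfl⟩ := hz
    exact single_mul_conjSum y g
  | zero => simp
  | add z w _ _ hz hw => rw [add_mul, mul_add, hz, hw]
  | smul c z _ hz => rw [smul_mul_assoc, mul_smul_comm, hz]

theorem coeff_conjSum_one {G : Type*} [Group G] [Fintype G] (y : MonoidAlgebra ℂ G) :
    (conjSum y).coeff 1 = Fintype.card G * y.coeff 1 := by
  rw [conjSum, coeff_sum, Finset.sum_apply', Finset.sum_congr rfl fun g _ => ?_, Finset.sum_const,
    Finset.card_univ, nsmul_eq_mul]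
  rw [coeff_mul_single_apply, coeff_single_mul_apply]
  simp

/-- The central elements made from Young symmetrizers of different shapes are orthogonal in both
orders, since they commute. -/
theorem conjSum_mul_conjSum_eq_zero (T' : ↥lam.cells ≃ Fin N) (T : ↥μ.cells ≃ Fin N)
    (hne : lam ≠ μ) : conjSum (youngSymmetrizer T') * conjSum (youngSymmetrizer T) = 0 := by
  wlog hle : ∑ x, rowOf T' x ≤ ∑ x, rowOf T x generalizing lam μ
  · rw [conjSum_commute]
    exact this T T' hne.symm (le_of_not_ge hle)
  rw [conjSum, conjSum, Finset.sum_mul_sum]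
  refine Finset.sum_eq_zero fun g _ => Finset.sum_eq_zero fun h _ => ?_
  have h1 := youngSymmetrizer_mul_mul_eq_zero T' T hne hle (single g⁻¹ 1 * single h 1)
  have h2 : single g 1 * youngSymmetrizer T' * single g⁻¹ 1 *
      (single h 1 * youngSymmetrizer T * single h⁻¹ 1) = single g 1 *
      (youngSymmetrizer T' * (single g⁻¹ 1 * single h 1) * youngSymmetrizer T) * single h⁻¹ 1 := by
    simp only [mul_assoc]
  rw [h2, h1, mul_zero, zero_mul]

/-- A central element of square zero generates an ideal of square zero, so it is zero; but the
coefficient of the identity in the central element does not vanish. -/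
theorem conjSum_mul_self_ne_zero (T : ↥μ.cells ≃ Fin N) :
    conjSum (youngSymmetrizer T) * conjSum (youngSymmetrizer T) ≠ 0 := by
  intro h
  have h1 : conjSum (youngSymmetrizer T) = 0 := by
    refine eq_zero_of_mul_eq_zero (Submodule.span _ {conjSum (youngSymmetrizer T)})
      (fun y hy z hz => ?_) (Submodule.mem_span_singleton_self _)
    obtain ⟨a, rfl⟩ := Submodule.mem_span_singleton.mp hy
    obtain ⟨b, rfl⟩ := Submodule.mem_span_singleton.mp hz
    rw [smul_eq_mul, smul_eq_mul, mul_assoc, ← mul_assoc _ b, ← conjSum_commute, mul_assoc, h,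
      mul_zero, mul_zero]
  have h2 := coeff_conjSum_one (youngSymmetrizer T)
  rw [h1, coeff_youngSymmetrizer_one, mul_one] at h2
  exact Nat.cast_ne_zero.mpr Fintype.card_ne_zero h2.symm

/-- The elements of a group algebra that commute with the group. -/
noncomputable def groupCenter (G : Type*) [Group G] : Submodule ℂ (MonoidAlgebra ℂ G) where
  carrier := {y | ∀ h : G, single h 1 * y = y * single h 1}
  add_mem' hy hz h := by rw [mul_add, add_mul, hy, hz]
  zero_mem' h := by rw [mul_zero, zero_mul]
  smul_mem' c y hy h := by rw [mul_smul_comm, smul_mul_assoc, hy]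

/-- Central elements are determined by one coefficient for each conjugacy class. -/
noncomputable def classCoeff (N : ℕ) : groupCenter (Perm (Fin N)) →ₗ[ℂ]
    ((Fintype.card (Fin N)).Partition → ℂ) where
  toFun y P := y.1.coeff (Function.invFun Perm.partition P)
  map_add' _ _ := rfl
  map_smul' _ _ := rfl

theorem coeff_conj {G : Type*} [Group G] {y : MonoidAlgebra ℂ G} (hy : y ∈ groupCenter G)
    {g h : G} (hgh : IsConj g h) : y.coeff g = y.coeff h := by
  obtain ⟨c, hc⟩ := isConj_iff.mp hgh
  have h1 := congrArg (fun z => z.coeff (c * g)) (hy c)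
  simp only [coeff_mul_single_apply, coeff_single_mul_apply] at h1
  rw [hc, inv_mul_cancel_left, one_mul, mul_one] at h1
  exact h1

theorem classCoeff_injective (N : ℕ) : Function.Injective (classCoeff N) := by
  rw [injective_iff_map_eq_zero]
  intro y hy
  refine Subtype.ext (coeff_injective (Finsupp.ext fun g => ?_))
  have h1 : IsConj g (Function.invFun Perm.partition g.partition) := by
    rw [Perm.partition_eq_of_isConj]
    exact (Function.invFun_eq ⟨g, rfl⟩).symm
  rw [coeff_conj y.2 h1]
  exact congrFun hy g.partition

/-- The central elements made from the Young symmetrizers are linearly independent, and there are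
as many of them as conjugacy classes; so they span the center. -/
theorem one_mem_span_youngSymmetrizer (N : ℕ) : (1 : MonoidAlgebra ℂ (Perm (Fin N))) ∈
    Submodule.span ℂ {y | ∃ (μ : YoungDiagram) (T : ↥μ.cells ≃ Fin N) (g h : Perm (Fin N)),
      y = single g 1 * youngSymmetrizer T * single h 1} := by
  have T : ∀ P : (Fintype.card (Fin N)).Partition, ↥P.diagram.cells ≃ Fin N := fun P =>
    P.tableau.trans (finCongr (Fintype.card_fin N))
  let z : (Fintype.card (Fin N)).Partition → groupCenter (Perm (Fin N)) := fun P =>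
    ⟨conjSum (youngSymmetrizer (T P)), single_mul_conjSum _⟩
  have hz : LinearIndependent ℂ z := by
    rw [Fintype.linearIndependent_iff]
    intro a ha P
    have h1 := congrArg (fun y => y.1 * conjSum (youngSymmetrizer (T P))) ha
    rw [AddSubmonoidClass.coe_finsetSum, Finset.sum_mul, Finset.sum_eq_single P] at h1
    · simp only [z, Submodule.coe_smul, Submodule.coe_zero, zero_mul, smul_mul_assoc] at h1
      exact (smul_eq_zero.mp h1).resolve_right (conjSum_mul_self_ne_zero _)
    · intro Q _ hQ
      rw [Submodule.coe_smul, smul_mul_assoc, conjSum_mul_conjSum_eq_zero _ _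
        fun h => hQ (Nat.Partition.diagram_injective h), smul_zero]
    · simp
  -- the dimension of the target is the number of partitions, which is the size of the family
  have h1 := (hz.map' (classCoeff N)
    (LinearMap.ker_eq_bot.mpr (classCoeff_injective N))).span_eq_top_of_card_eq_finrank'
      (by rw [Module.finrank_fintype_fun_eq_card])
  have h2 : (1 : MonoidAlgebra ℂ (Perm (Fin N))) ∈ groupCenter (Perm (Fin N)) := fun h => by simp
  have h3 : classCoeff N ⟨1, h2⟩ ∈ Submodule.map (classCoeff N) (Submodule.span ℂ (Set.range z)) := by
    rw [Submodule.map_span, ← Set.range_comp, h1]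
    exact Submodule.mem_top
  obtain ⟨y, hy, hy1⟩ := h3
  rw [classCoeff_injective N hy1] at hy
  have h4 := Submodule.mem_map_of_mem (f := (groupCenter (Perm (Fin N))).subtype) hy
  rw [Submodule.map_span] at h4
  refine Submodule.span_le.mpr ?_ h4
  rintro _ ⟨_, ⟨P, rfl⟩, rfl⟩
  exact Submodule.sum_mem _ fun g _ => Submodule.subset_span ⟨_, T P, g, g⁻¹, rfl⟩

end YoungSymmetrizers

/-! ### Invariants of Young subgroups and the height filtration -/

section Height

open Equiv MonoidAlgebra

variable {N : ℕ} {μ : YoungDiagram}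

theorem rowLen_zero_add_height (T : ↥μ.cells ≃ Fin N) : μ.rowLen 0 + μ.height = N := by
  have h1 : μ.height = (Finset.univ.filter fun x => ¬rowOf T x = 0).card := by
    rw [YoungDiagram.height]
    refine (Finset.card_bij (fun x _ => (T.symm x).1) (fun x hx => ?_) (fun x _ y _ hxy => ?_)
      fun c hc => ?_).symm
    · rw [Finset.mem_filter]
      exact ⟨(T.symm x).2, Nat.pos_of_ne_zero (Finset.mem_filter.mp hx).2⟩
    · exact T.symm.injective (Subtype.ext hxy)
    · rw [Finset.mem_filter] at hc
      exact ⟨T ⟨c, hc.1⟩, Finset.mem_filter.mpr ⟨Finset.mem_univ _, by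
        simpa [rowOf] using hc.2.ne'⟩, by simp⟩
  rw [h1, ← card_rowOf_eq T 0, Finset.card_filter_add_card_filter_not, Finset.card_univ,
    Fintype.card_fin]

theorem colOf_lt_rowLen (T : ↥μ.cells ≃ Fin N) (x : Fin N) : colOf T x < μ.rowLen 0 := by
  rw [← YoungDiagram.mem_iff_lt_rowLen]
  exact μ.up_left_mem (Nat.zero_le _) le_rfl (rowOf_colOf_mem T x)

theorem exists_perm_front {m : ℕ} (hmN : m ≤ N) {S : Finset (Fin N)} (hS : m ≤ S.card) :
    ∃ g : Perm (Fin N), ∀ x, (g x).1 < m → x ∈ S := by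
  obtain ⟨S', hS', hcard⟩ := Finset.exists_subset_card_eq hS
  have e : {x // x ∈ S'} ≃ {x : Fin N // x.1 < m} := Fintype.equivOfCardEq (by
    rw [Fintype.card_coe, hcard, Fintype.card_subtype, Fin.card_filter_val_lt, min_eq_right hmN])
  refine ⟨e.extendSubtype, fun x hx => ?_⟩
  by_contra hxS
  exact e.extendSubtype_not_mem x (fun h => hxS (hS' h)) hx

variable {E : Type w} [AddCommGroup E] [Module ℂ E]
  (ρ : Representation ℂ (Perm (Fin N)) E) {M : Submodule ℂ E}

theorem asAlgebraHom_mem (hM : ∀ s, ∀ x ∈ M, ρ s x ∈ M) (y : MonoidAlgebra ℂ (Perm (Fin N)))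
    {x : E} (hx : x ∈ M) : ρ.asAlgebraHom y x ∈ M := by
  have hy := mem_span_single y
  induction hy using Submodule.span_induction with
  | mem y hy =>
    obtain ⟨g, rfl⟩ := hy
    dsimp only
    rw [Representation.asAlgebraHom_single, one_smul]
    exact hM g x hx
  | zero => simp
  | add y z _ _ hy hz =>
    rw [map_add]
    exact add_mem hy hz
  | smul c y _ hy =>
    rw [map_smul]
    exact M.smul_mem c hy

theorem asAlgebraHom_single_apply (g : Perm (Fin N)) (x : E) :
    ρ.asAlgebraHom (single g 1) x = ρ g x := by
  rw [Representation.asAlgebraHom_single, one_smul]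

theorem asAlgebraHom_mul_apply (y z : MonoidAlgebra ℂ (Perm (Fin N))) (x : E) :
    ρ.asAlgebraHom (y * z) x = ρ.asAlgebraHom y (ρ.asAlgebraHom z x) := by
  rw [map_mul, Module.End.mul_apply]

/-- A vector that is not killed by a Young symmetrizer generates an irreducible subrepresentation
of the given shape. -/
theorem exists_isSubrepOfShape (hM : ∀ s, ∀ x ∈ M, ρ s x ∈ M) (T : ↥μ.cells ≃ Fin N) {x : E}
    (hx : x ∈ M) (hne : ρ.asAlgebraHom (youngSymmetrizer T) x ≠ 0) :
    ∃ W ≤ M, IsSubrepOfShape ρ W μ ∧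
      ∀ g, ρ.asAlgebraHom (single g 1 * youngSymmetrizer T) x ∈ W := by
  -- the orbit map of `x`; it is injective because the Specht module is simple
  let φ : ↥((spechtModule T).restrictScalars ℂ) →ₗ[ℂ] E :=
    ((LinearMap.applyₗ x : (E →ₗ[ℂ] E) →ₗ[ℂ] E) ∘ₗ ρ.asAlgebraHom.toLinearMap) ∘ₗ
      ((spechtModule T).restrictScalars ℂ).subtype
  have hφ : ∀ y, φ y = ρ.asAlgebraHom (y : MonoidAlgebra ℂ (Perm (Fin N))) x := fun y => rfl
  have hinj : Function.Injective φ := by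
    rw [injective_iff_map_eq_zero]
    intro y hy
    by_contra hy0
    let K : Submodule (MonoidAlgebra ℂ (Perm (Fin N))) (MonoidAlgebra ℂ (Perm (Fin N))) :=
      { carrier := {z | z ∈ spechtModule T ∧ ρ.asAlgebraHom z x = 0}
        add_mem' := fun ha hb => ⟨add_mem ha.1 hb.1, by
          rw [map_add, LinearMap.add_apply, ha.2, hb.2, add_zero]⟩
        zero_mem' := ⟨zero_mem _, by simp⟩
        smul_mem' := fun c z hz => ⟨Submodule.smul_mem _ c hz.1, by
          rw [smul_eq_mul, asAlgebraHom_mul_apply, hz.2, map_zero]⟩ }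
    have h1 : youngSymmetrizer T ∈ K := youngSymmetrizer_mem_of_ne_zero T (fun z hz => hz.1)
      (show (y : MonoidAlgebra ℂ (Perm (Fin N))) ∈ K from ⟨y.2, hy⟩) fun h => hy0 (Subtype.ext h)
    exact hne h1.2
  have hW : ∀ s, ∀ z ∈ LinearMap.range φ, ρ s z ∈ LinearMap.range φ := by
    rintro s _ ⟨y, rfl⟩
    refine ⟨⟨single s 1 * (y : MonoidAlgebra ℂ (Perm (Fin N))),
      (spechtModule T).smul_mem (single s 1) y.2⟩, ?_⟩
    rw [hφ, hφ, asAlgebraHom_mul_apply, asAlgebraHom_single_apply]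
  let e := LinearEquiv.ofInjective φ hinj
  refine ⟨LinearMap.range φ, ?_, ⟨hW, T, e.symm, fun s z => ?_⟩, fun g => ?_⟩
  · rintro _ ⟨y, rfl⟩
    exact asAlgebraHom_mem ρ hM _ hx
  · obtain ⟨y, rfl⟩ := e.surjective z
    have h1 : (⟨ρ s (e y), hW s _ (e y).2⟩ : LinearMap.range φ) =
        e ⟨single s 1 * (y : MonoidAlgebra ℂ (Perm (Fin N))),
          (spechtModule T).smul_mem (single s 1) y.2⟩ := by
      refine Subtype.ext ?_
      change ρ s (φ y) = φ _
      rw [hφ, hφ, asAlgebraHom_mul_apply, asAlgebraHom_single_apply]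
    rw [h1, e.symm_apply_apply, e.symm_apply_apply]
  · exact ⟨⟨single g 1 * youngSymmetrizer T, (spechtModule T).smul_mem _
      (Submodule.mem_span_singleton_self _)⟩, rfl⟩

/-- Column antisymmetrizers with few columns kill the vectors invariant under many permutations. -/
theorem antisymmetrizer_apply_eq_zero (T : ↥μ.cells ≃ Fin N) {m : ℕ} (hm : μ.rowLen 0 < m)
    (hmN : m ≤ N) {x : E} (hx : ∀ s : Perm (Fin N), (∀ i, m ≤ i.1 → s i = i) → ρ s x = x)
    (g : Perm (Fin N)) : ρ.asAlgebraHom (antisymmetrizer (colOf T)) (ρ g x) = 0 := by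
  obtain ⟨i, hi, j, hj, hij, hcol⟩ := Finset.exists_ne_map_eq_of_card_lt_of_maps_to
    (s := Finset.univ.filter fun i : Fin N => i.1 < m) (t := Finset.range (μ.rowLen 0))
    (f := fun i => colOf T (g i)) (by
      rw [Finset.card_range, Fin.card_filter_val_lt, min_eq_right hmN]
      exact hm) fun i _ => Finset.mem_coe.mpr (Finset.mem_range.mpr (colOf_lt_rowLen T _))
  rw [Finset.mem_filter] at hi hj
  have h1 : ρ (swap i j) x = x := hx _ fun y hy => swap_apply_of_ne_of_ne
    (fun h => by rw [h] at hy; omega) (fun h => by rw [h] at hy; omega)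
  have h2 : ρ.asAlgebraHom (antisymmetrizer (colOf T)) (ρ g x) =
      -ρ.asAlgebraHom (antisymmetrizer (colOf T)) (ρ g x) := by
    conv_lhs => rw [← h1, ← asAlgebraHom_single_apply, ← asAlgebraHom_single_apply ρ (swap i j),
      ← asAlgebraHom_mul_apply, ← asAlgebraHom_mul_apply, mul_assoc, single_mul_swap, ← mul_assoc,
      antisymmetrizer_mul_single_swap (g.injective.ne hij) hcol, neg_mul, map_neg,
      LinearMap.neg_apply, asAlgebraHom_mul_apply, asAlgebraHom_single_apply]
  have h3 : (2 : ℂ) • ρ.asAlgebraHom (antisymmetrizer (colOf T)) (ρ g x) = 0 := by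
    rw [two_smul]
    nth_rewrite 2 [h2]
    exact add_neg_cancel _
  exact (smul_eq_zero.mp h3).resolve_left two_ne_zero

/-- The height `≤ h` part of a representation of `S_{m+h}` is generated by the vectors that are
invariant under `S_m`. A diagram has height `≤ h` if and only if its first row has at least `m`
cells. In this case the generator of the Specht module is invariant under the permutations of the
first row; otherwise the column antisymmetrizers kill all `S_m`-invariants, two of the `m` entries
lying in one column. -/
theorem heightPart_eq_groupSpan {m h : ℕ} (hmh : m + h = N) (hM : ∀ s, ∀ x ∈ M, ρ s x ∈ M) :
    heightPart ρ M h = groupSpan ρ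
      {x | x ∈ M ∧ ∀ s : Perm (Fin N), (∀ i, m ≤ i.1 → s i = i) → ρ s x = x} := by
  apply le_antisymm
  · refine sSup_le ?_
    rintro W ⟨hWM, μ, hμ, hW, T, e, he⟩
    -- `w` corresponds to the Young symmetrizer, and `g` will carry entries of the first row to the
    -- first `m` places
    let w : W := e.symm ⟨youngSymmetrizer T, Submodule.mem_span_singleton_self _⟩
    have hw : (e w : MonoidAlgebra ℂ (Perm (Fin N))) = youngSymmetrizer T := by simp [w]
    have hrow : m ≤ (Finset.univ.filter fun x => rowOf T x = 0).card := by
      have := rowLen_zero_add_height T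
      rw [card_rowOf_eq]
      omega
    obtain ⟨g, hg⟩ := exists_perm_front (by omega) hrow
    have hinv : ∀ p ∈ colourPerms (rowOf T), ρ p w = w := by
      intro p hp
      have h1 : (⟨ρ p w, hW p w w.2⟩ : W) = w := by
        refine e.injective (Subtype.ext ?_)
        rw [he, hw, youngSymmetrizer_eq, ← mul_assoc, single_mul_symmetrizer hp]
      exact congrArg Subtype.val h1
    have hgw : ∀ s : Perm (Fin N), (∀ i, m ≤ i.1 → s i = i) → ρ s (ρ g w) = ρ g w := by
      intro s hs
      have h1 : g⁻¹ * s * g ∈ colourPerms (rowOf T) := by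
        rw [mem_colourPerms]
        intro x
        by_cases hx : s (g x) = g x
        · simp [hx]
        · have h2 : ∀ y, s y ≠ y → y.1 < m := fun y hy => by
            by_contra hlt
            exact hy (hs y (not_lt.mp hlt))
          have h3 := (Finset.mem_filter.mp (hg x (h2 _ hx))).2
          have h4 := (Finset.mem_filter.mp (hg (g⁻¹ (s (g x))) (by
            have h5 := h2 (s (g x)) fun h => hx (s.injective h)
            simpa using h5))).2
          rw [h3, Perm.mul_apply, Perm.mul_apply, h4]
      rw [← Module.End.mul_apply, ← map_mul, show s * g = g * (g⁻¹ * s * g) by group, map_mul,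
        Module.End.mul_apply, hinv _ h1]
    intro x hx
    obtain ⟨b, hb⟩ := Submodule.mem_span_singleton.mp (e ⟨x, hx⟩).2
    have key : ∀ b : MonoidAlgebra ℂ (Perm (Fin N)), ρ.asAlgebraHom b w ∈ groupSpan ρ
        {x | x ∈ M ∧ ∀ s : Perm (Fin N), (∀ i, m ≤ i.1 → s i = i) → ρ s x = x} ∧
        ∃ h : ρ.asAlgebraHom b w ∈ W, (e ⟨_, h⟩ : MonoidAlgebra ℂ (Perm (Fin N))) =
          b * youngSymmetrizer T := by
      intro b
      have hb := mem_span_single b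
      induction hb using Submodule.span_induction with
      | mem b hb =>
        obtain ⟨s, rfl⟩ := hb
        dsimp only
        rw [asAlgebraHom_single_apply]
        refine ⟨Submodule.subset_span ⟨s * g⁻¹, ρ g w, ⟨hM g _ (hWM w.2), hgw⟩, ?_⟩,
          hW s w w.2, ?_⟩
        · rw [← Module.End.mul_apply, ← map_mul, inv_mul_cancel_right]
        · rw [he, hw]
      | zero => exact ⟨by simp, by simp, by simp⟩
      | add y z _ _ hy hz =>
        obtain ⟨hy1, hy2, hy3⟩ := hy
        obtain ⟨hz1, hz2, hz3⟩ := hz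
        rw [map_add, LinearMap.add_apply]
        refine ⟨add_mem hy1 hz1, add_mem hy2 hz2, ?_⟩
        rw [add_mul, ← hy3, ← hz3, ← Submodule.coe_add, ← map_add]
        rfl
      | smul c y _ hy =>
        obtain ⟨hy1, hy2, hy3⟩ := hy
        rw [map_smul, LinearMap.smul_apply]
        refine ⟨Submodule.smul_mem _ c hy1, Submodule.smul_mem _ c hy2, ?_⟩
        rw [smul_mul_assoc, ← hy3]
        exact congrArg Subtype.val (e.map_smul c ⟨_, hy2⟩)
    obtain ⟨h1, h2, h3⟩ := key b
    have h4 : (⟨x, hx⟩ : W) = ⟨_, h2⟩ := e.injective (Subtype.ext (by rw [h3, ← hb, smul_eq_mul]))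
    rw [show x = ρ.asAlgebraHom b w from congrArg Subtype.val h4]
    exact h1
  · refine Submodule.span_le.mpr ?_
    rintro _ ⟨s, x, ⟨hx, hinv⟩, rfl⟩
    -- write the identity as a combination of translates of Young symmetrizers; those with short first
    -- row kill `x`, the others map it into irreducible subrepresentations of small height
    have key : ∀ y ∈ Submodule.span ℂ {y | ∃ (μ : YoungDiagram) (T : ↥μ.cells ≃ Fin N)
        (g h : Perm (Fin N)), y = single g 1 * youngSymmetrizer T * single h 1},
        ρ s (ρ.asAlgebraHom y x) ∈ heightPart ρ M h := by
      intro y hy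
      induction hy using Submodule.span_induction with
      | mem y hy =>
        obtain ⟨μ, T, g, t, rfl⟩ := hy
        rw [← asAlgebraHom_single_apply, ← asAlgebraHom_mul_apply, ← mul_assoc, ← mul_assoc,
          single_mul_single, one_mul, asAlgebraHom_mul_apply, asAlgebraHom_single_apply]
        by_cases h0 : ρ.asAlgebraHom (youngSymmetrizer T) (ρ t x) = 0
        · rw [asAlgebraHom_mul_apply, h0, map_zero]
          exact zero_mem _
        · have hμ : μ.height ≤ h := by
            by_contra hlt
            refine h0 ?_
            have := rowLen_zero_add_height T
            rw [youngSymmetrizer_eq, asAlgebraHom_mul_apply,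
              antisymmetrizer_apply_eq_zero ρ T (by omega) (by omega) hinv, map_zero]
          obtain ⟨W, hWM, hW, hmem⟩ := exists_isSubrepOfShape ρ hM T (hM t x hx) h0
          have hle : W ≤ heightPart ρ M h := le_sSup ⟨hWM, μ, hμ, hW⟩
          exact hle (hmem _)
      | zero => simp
      | add y z _ _ hy hz =>
        rw [map_add, LinearMap.add_apply, map_add]
        exact add_mem hy hz
      | smul c y _ hy =>
        rw [map_smul, LinearMap.smul_apply, map_smul]
        exact Submodule.smul_mem _ c hy
    have h1 := key 1 (one_mem_span_youngSymmetrizer N)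
    rwa [map_one, Module.End.one_apply] at h1

end Height
theorem mainTheorem4 (k n : ℕ) (hkn : k ≤ n) :
    ∃ ι : ∀ (V : SymplecticSpace.{u}) (l : ℕ) (v : V.Vec), V.invWeight k l v →ₗ[ℂ] V.inv n,
      -- for every `ℓ` with `k + ℓ ≤ n`: an injection, `S_{k+1}`-linear, with the stated left inverse
      (∀ (V : SymplecticSpace.{u}) (l : ℕ) (v : V.Vec), v ≠ 0 → k + l ≤ n →
        Function.Injective (ι V l v) ∧
        (∀ (s : Equiv.Perm (Fin (k + 1))) (ψ : V.invWeight k l v),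
          ∃ hψ : V.perm k s (ψ : V.Symb k) ∈ V.invWeight k l v,
            (ι V l v ⟨V.perm k s (ψ : V.Symb k), hψ⟩ : V.Symb n) =
              V.perm n (SymplecticSpace.tailPerm hkn s) (ι V l v ψ : V.Symb n)) ∧
        (∀ (ψ : V.invWeight k l v) (g : Fin k → V.Fun),
          V.act n (ι V l v ψ : V.Symb n) (V.plug hkn l v g) = V.act k (ψ : V.Symb k) g)) ∧
      -- naturality with respect to symplectic isomorphisms `(V, v) ≃ (V', v')`
      (∀ (V V' : SymplecticSpace.{u}) (l : ℕ) (v : V.Vec) (v' : V'.Vec), v ≠ 0 → k + l ≤ n →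
        ∀ α : V.Fun ≃ₐ[ℂ] V'.Fun, SymplecticSpace.IsSymplectic α → α (V.dual v) = V'.dual v' →
          ∀ (ψ : V.invWeight k l v) (ψ' : V'.invWeight k l v'),
            SymplecticSpace.Carries α (ψ : V.Symb k) (ψ' : V'.Symb k) →
              SymplecticSpace.Carries α (ι V l v ψ : V.Symb n) (ι V' l v' ψ' : V'.Symb n)) ∧
      -- the `S_{n+1}`-span of the images of the order `r` parts, over all `r + ℓ = N`
      (∀ (V : SymplecticSpace.{u}) (v : V.Vec), v ≠ 0 → ∀ N : ℕ,
        groupSpan (V.perm n)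
            {φ : V.Symb n | ∃ (l r : ℕ) (ψ : V.invWeight k l v), k + l ≤ n ∧ r + l = N ∧
              (ψ : V.Symb k) ∈ V.ofOrder k r ∧ φ = (ι V l v ψ : V.Symb n)} =
          heightPart (V.perm n) (V.inv n ⊓ V.ofOrder n N) (k + 1)) := by
  refine ⟨fun V l v => (V.equivExt hkn l v).codRestrict (V.inv n)
    (SymplecticSpace.equivExt_mem_inv hkn), fun V l v hv hl => ⟨fun ψ φ h => ?_, fun s ψ => ?_,
    fun ψ g => ?_⟩, fun V V' l v v' hv hl α hα hαv ψ ψ' hψ => ?_, fun V v hv N => ?_⟩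
  · exact SymplecticSpace.equivExt_injective hkn hl hv (congrArg Subtype.val h)
  · exact ⟨SymplecticSpace.perm_mem_invWeight s ψ.2, SymplecticSpace.equivExt_permWeight hkn s ψ⟩
  · exact SymplecticSpace.act_equivExt hkn hl hv ψ g
  · exact SymplecticSpace.carries_equivExt hkn hl hv hα hαv hψ
  · rw [heightPart_eq_groupSpan (V.perm n) (M := V.inv n ⊓ V.ofOrder n N)
      (m := n - k) (h := k + 1) (by omega) fun s x hx =>
      ⟨SymplecticSpace.perm_mem_inv s hx.1, SymplecticSpace.perm_mem_ofOrder s hx.2⟩]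
    exact SymplecticSpace.groupSpan_equivExt hkn hv N
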